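/- Let $p\ge 2$ and $N\ge 2$ be integers, $\mathfrak q=e^{i\pi/p}$, $[n]=\frac{\mathfrak q^n-\mathfrak q^{-n}}{\mathfrak q-\mathfrak q^{-1}}$. **Quantum group.** $U=U_{\mathfrak q}s\ell(2)$ is the complex algebra generated by $E,F,K^{\pm1},e,f,h$ with the relations $KEK^{-1}=\mathfrak q^2E$, $KFK^{-1}=\mathfrak q^{-2}F$, $[E,F]=\frac{K-K^{-1}}{\mathfrak q-\mathfrak q^{-1}}$, $E^p=F^p=0$, $K^{2p}=1$; $[h,e]=e$, $[h,f]=-f$, $[e,f]=2h$; $[K,e]=[K,f]=[E,e]=[F,f]=0$, $[F,e]=\frac{1}{[p-1]!}K^p\frac{\mathfrak qK-\mathfrak q^{-1}K^{-1}}{\mathfrak q-\mathfrak q^{-1}}E^{p-1}$, $[E,f]=\frac{(-1)^{p+1}}{[p-1]!}F^{p-1}\frac{\mathfrak qK-\mathfrak q^{-1}K^{-1}}{\mathfrak q-\mathfrak q^{-1}}$ (here $e=K^pE^p/[p]!$ and $f=(-1)^pF^p/[p]!$ as limits from generic values of the parameter). Its modules are: * $\mathcal X_{s,r}$ ($1\le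 s\le p$, $r\ge1$), irreducible, with basis $v_{n,m}$, $0\le n<s$, $0\le m<r$, and (vectors with an index out of range being $0$) $Kv_{n,m}=(-1)^{r-1}\mathfrak q^{s-1-2n}v_{n,m}$, $Ev_{n,m}=(-1)^{r-1}[n][s-n]v_{n-1,m}$, $Fv_{n,m}=v_{n+1,m}$, $hv_{n,m}=\frac12(r-1-2m)v_{n,m}$, $ev_{n,m}=m(r-m)v_{n,m-1}$, $fv_{n,m}=v_{n,m+1}$; * the Weyl module $\mathcal N_{s,r}$ ($1\le s\le p-1$, $r\ge1$) of dimension $p(r+1)-s$, i.e. the limit from generic values of the parameter of the irreducible module of that dimension in the basis $F^kv_0/[k]!$; and its contragredient $\overline{\mathcal N}_{s,r}$, the dual space with $(a\varphi)(v)=\varphi(a^{t}v)$ for the transposition $t$ of $U$ (the anti-automorphism with $K^t=K$, $E^t=F$, $F^t=E$, $h^t=h$, $e^t=(-1)^pK^pf$, $f^t=(-1)^pK^pe$); * $\mathcal P_{s,r}$, the projective cover of $\mathcal X_{s,r}$ among finite-dimensional $U$-modules. **Temperley–Lieb algebra.** $TL_{\mathfrak q}(N)$ has generators $e_1,\dots,e_{N-1}$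 with $e_i^2=(\mathfrak q+\mathfrak q^{-1})e_i$, $e_ie_{i\pm1}e_i=e_i$, $e_ie_j=e_je_i$ for $|i-j|\ge2$; let $a\mapsto a^\dagger$ be its anti-involution $e_i\mapsto e_{N-i}$. For $j\in\frac12\mathbb Z_{\ge0}$: * $\mathrm{St}_j$ is the standard module: it has as basis the link states on $N$ sites with $2j$ through-lines (non-crossing partial matchings of the sites with no unmatched site below an arc), $e_i$ acts by stacking diagrams, closed loops have weight $\mathfrak q+\mathfrak q^{-1}$, and contracting two through-lines gives $0$. It is $0$ for $j>N/2$; * $\mathrm{St}_j^*$ is its contragredient (costandard) module: the dual space with $(a\varphi)(v)=\varphi(a^\dagger v)$; * $\mathrm{Irr}_j$ is the quotient of $\mathrm{St}_j$ by its maximal proper submodule (so $0$ for $j>N/2$), except that $\mathrm{Irr}_0=0$ if $p=2$; * a zig-zag module $\mathcal K_{\frac{s-1}{2},1}$ ($1\le s\le p-1$) is a module with subquotient diagram $\mathrm{Irr}_{\frac{s-1}2}\to\mathrm{Irr}_{\frac{2p-s-1}2}\leftarrow\mathrm{Irr}_{\frac{2p+s-1}2}$: it has a submodule isomorphic to $S=\mathrm{Irr}_{\frac{2p-s-1}2}$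 with quotient $A\oplus B$, $A=\mathrm{Irr}_{\frac{s-1}2}$, $B=\mathrm{Irr}_{\frac{2p+s-1}2}$, and the preimages of $A$ and of $B$ are non-split extensions by $S$ (a condition that is dropped when $S$ or the quotient concerned is $0$); * $\mathrm{P}_j$ is the projective cover of $\mathrm{Irr}_j$ among finite-dimensional modules. **The functor.** Let $\mathcal H_N=\mathcal X_{2,1}^{\otimes N}$ with basis the words of length $N$ in $+,-$, and with the $U$-action given by the coproduct $\Delta K=K\otimes K$, $\Delta E=E\otimes1+K\otimes E$, $\Delta F=F\otimes K^{-1}+1\otimes F$ (and the resulting formulas for $E^p/[p]!$ and $F^p/[p]!$). $TL_{\mathfrak q}(N)$ acts on it, commuting with $U$, by the XXZ representation: $e_i$ acts on the sites $i,i+1$ by $++\mapsto0$, $--\mapsto0$, $+-\mapsto\mathfrak q^{-1}(+-)-(-+)$, $-+\mapsto-(+-)+\mathfrak q(-+)$. For a finite-dimensional $U$-module $M$ put $\mathscr H(M)=\mathrm{Hom}_U(\mathcal H_N,M)$, a left $TL_{\mathfrak q}(N)$-module by $(a\varphi)(v)=\varphi(a^\dagger v)$. **Proposition.** For $s$, $r$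 with $(r+1)p+s+N$ odd, there are isomorphisms of $TL_{\mathfrak q}(N)$-modules: 1. $\mathscr H(\mathcal X_{s,1})\cong\mathrm{St}_{\frac{s-1}2}$ for $1\le s\le p$; 2. $\mathscr H(\mathcal X_{s,r})\cong\mathrm{Irr}_{\frac{(r+1)p-s-1}2}$ for $1\le s\le p$, $r>1$; 3. $\mathscr H(\overline{\mathcal N}_{s,r})\cong\mathrm{St}_{\frac{(r+1)p-s-1}2}$ for $1\le s\le p-1$, $r\ge1$; 4. $\mathscr H(\mathcal N_{s,1})$ is a zig-zag module $\mathcal K_{\frac{s-1}2,1}$ for $1\le s\le p-1$; 5. $\mathscr H(\mathcal N_{s,r})\cong\mathrm{St}^*_{\frac{(r+1)p-s-1}2}$ for $1\le s\le p-1$, $r>1$; 6. for $1\le s\le p$, $r\ge1$ with $(r+1)p-s-1\le N$, the projective cover $\mathcal P_{s,r}$ exists and $\mathscr H(\mathcal P_{s,r})\cong\mathrm P_{\frac{(r+1)p-s-1}2}$. -/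

import Mathlib

namespace XXZ

noncomputable section

/-! ### The root of unity and quantum integers -/

/-- `q = exp(iπ/p)`. -/
def q (p : ℕ) : ℂ := Complex.exp (Real.pi * Complex.I / p)

/-- The `q`-integer `[n] = (q^n - q^{-n}) / (q - q^{-1})`. -/
def qInt (p : ℕ) (n : ℤ) : ℂ := (q p ^ n - q p ^ (-n)) / (q p - (q p)⁻¹)

/-- The `q`-factorial `[n]! = [1][2]⋯[n]`. -/
def qFact (p n : ℕ) : ℂ := ∏ i ∈ Finset.range n, qInt p ((i : ℤ) + 1)

lemma q_ne (p : ℕ) : q p ≠ 0 := Complex.exp_ne_zero _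

lemma q_zpow (p : ℕ) (n : ℤ) : q p ^ n = Complex.exp (n * (Real.pi * Complex.I / p)) := by
  rw [q, Complex.exp_int_mul]

lemma q_pow_p {p : ℕ} (hp : 2 ≤ p) : q p ^ (p : ℤ) = -1 := by
  rw [q_zpow, ← Complex.exp_pi_mul_I]
  congr 1
  have : (p : ℂ) ≠ 0 := by exact_mod_cast (by omega : p ≠ 0)
  push_cast
  field_simp

lemma q_shift {p : ℕ} (hp : 2 ≤ p) (a n : ℤ) : q p ^ (n + a * p) = (-1) ^ a * q p ^ n := by
  rw [zpow_add₀ (q_ne p), mul_comm a, zpow_mul, q_pow_p hp, mul_comm]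

lemma q_zpow_eq_iff {p : ℕ} (hp : 2 ≤ p) (n : ℤ) : q p ^ n = q p ^ (-n) ↔ (p : ℤ) ∣ n := by
  have hp0 : (p : ℂ) ≠ 0 := by exact_mod_cast (by omega : p ≠ 0)
  have hpi : (Real.pi : ℂ) ≠ 0 := by exact_mod_cast Real.pi_ne_zero
  rw [q_zpow, q_zpow, Complex.exp_eq_exp_iff_exists_int]
  constructor
  · rintro ⟨k, hk⟩
    refine ⟨k, ?_⟩
    have hI := Complex.I_ne_zero
    field_simp at hk
    push_cast at hk
    have h2 : (n : ℂ) = p * k := by linear_combination hk / 2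
    exact_mod_cast h2
  · rintro ⟨k, rfl⟩
    refine ⟨k, ?_⟩
    push_cast
    field_simp
    ring

lemma q_sub_ne {p : ℕ} (hp : 2 ≤ p) : q p - (q p)⁻¹ ≠ 0 := by
  intro h
  have := (q_zpow_eq_iff hp 1).1 (by simpa [sub_eq_zero] using h)
  have := Int.le_of_dvd one_pos this
  omega

lemma qInt_eq_zero_iff {p : ℕ} (hp : 2 ≤ p) (n : ℤ) : qInt p n = 0 ↔ (p : ℤ) ∣ n := by
  rw [qInt, div_eq_zero_iff, or_iff_left (q_sub_ne hp), sub_eq_zero, q_zpow_eq_iff hp]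

lemma qInt_zero (p : ℕ) : qInt p 0 = 0 := by simp [qInt]

lemma qInt_one {p : ℕ} (hp : 2 ≤ p) : qInt p 1 = 1 := by
  simp [qInt, div_self (q_sub_ne hp)]

lemma qInt_neg (p : ℕ) (n : ℤ) : qInt p (-n) = - qInt p n := by
  simp only [qInt, neg_neg]; ring

lemma qInt_shift {p : ℕ} (hp : 2 ≤ p) (a n : ℤ) :
    qInt p (n + a * p) = (-1) ^ a * qInt p n := by
  have h : -(n + a * p) = -n + (-a) * p := by ring
  have h1 : ((-1 : ℂ)) ^ (-a) = (-1) ^ a := by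
    rw [zpow_neg, ← inv_zpow]; norm_num
  rw [qInt, h, q_shift hp, q_shift hp, qInt, h1]; ring

lemma qInt_shift_one {p : ℕ} (hp : 2 ≤ p) (n : ℤ) : qInt p (n + p) = - qInt p n := by
  simpa using qInt_shift hp 1 n

lemma qFact_ne {p : ℕ} (hp : 2 ≤ p) {n : ℕ} (hn : n < p) : qFact p n ≠ 0 := by
  rw [qFact, Finset.prod_ne_zero_iff]
  intro i hi h
  rw [Finset.mem_range] at hi
  have := Int.le_of_dvd (by omega) ((qInt_eq_zero_iff hp _).1 h)
  omega

lemma qFact_succ (p n : ℕ) : qFact p (n + 1) = qFact p n * qInt p ((n : ℤ) + 1) := by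
  rw [qFact, Finset.prod_range_succ]; rfl

lemma qFact_p {p : ℕ} (hp : 2 ≤ p) : qFact p p = 0 := by
  obtain ⟨k, rfl⟩ : ∃ k, p = k + 1 := ⟨p - 1, by omega⟩
  rw [qFact_succ, (qInt_eq_zero_iff hp _).2 (by push_cast; exact dvd_refl _), mul_zero]

/-! ### The quantum group -/

/-- Generators: `E, F, K^{±1}` of the restricted quantum group and `e, f, h` of `U sl(2)`. -/
inductive Gen
  | E | F | K | Kinv | e | f | h

/-- The generators as elements of the free algebra. -/
abbrev w (x : Gen) : FreeAlgebra ℂ Gen := FreeAlgebra.ι ℂ x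

/-- `[K; 1] = (q K - q⁻¹ K⁻¹) / (q - q⁻¹)`. -/
def kBr (p : ℕ) {A : Type*} [Ring A] [Algebra ℂ A] (K Kinv : A) : A :=
  (q p - (q p)⁻¹)⁻¹ • (q p • K - (q p)⁻¹ • Kinv)

/-- The defining relations of the quantum group `U_q sl(2)` with divided powers at
`q = exp(iπ/p)`: those of the restricted quantum group `⟨E, F, K^{±1}⟩`, those of `sl(2)`, and the
commutators of the normalised divided powers `e = K^p E^p/[p]!`, `f = (-1)^p F^p/[p]!` (limits from
generic values of the deformation parameter) with `E`, `F` and `K`.  The commutators of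
`h = (e f - f e) / 2` with `E`, `F`, `K` follow from these by the Jacobi identity. -/
inductive UqRel (p : ℕ) : FreeAlgebra ℂ Gen → FreeAlgebra ℂ Gen → Prop
  | K_Kinv : UqRel p (w .K * w .Kinv) 1
  | Kinv_K : UqRel p (w .Kinv * w .K) 1
  | K_E : UqRel p (w .K * w .E) (q p ^ 2 • (w .E * w .K))
  | K_F : UqRel p (w .K * w .F) ((q p)⁻¹ ^ 2 • (w .F * w .K))
  | E_F : UqRel p (w .E * w .F - w .F * w .E) ((q p - (q p)⁻¹)⁻¹ • (w .K - w .Kinv))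
  | E_pow : UqRel p (w .E ^ p) 0
  | F_pow : UqRel p (w .F ^ p) 0
  | K_pow : UqRel p (w .K ^ (2 * p)) 1
  | h_e : UqRel p (w .h * w .e - w .e * w .h) (w .e)
  | h_f : UqRel p (w .h * w .f - w .f * w .h) (-w .f)
  | e_f : UqRel p (w .e * w .f - w .f * w .e) ((2 : ℂ) • w .h)
  | K_e : UqRel p (w .K * w .e) (w .e * w .K)
  | K_f : UqRel p (w .K * w .f) (w .f * w .K)
  | E_e : UqRel p (w .E * w .e) (w .e * w .E)
  | F_f : UqRel p (w .F * w .f) (w .f * w .F)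
  | F_e : UqRel p (w .F * w .e - w .e * w .F)
      ((qFact p (p - 1))⁻¹ • (w .K ^ p * kBr p (w .K) (w .Kinv) * w .E ^ (p - 1)))
  | E_f : UqRel p (w .E * w .f - w .f * w .E)
      (((-1) ^ (p + 1) * (qFact p (p - 1))⁻¹) • (w .F ^ (p - 1) * kBr p (w .K) (w .Kinv)))

/-- The quantum group `U_q sl(2)` at `q = exp(iπ/p)`. -/
def U (p : ℕ) : Type := RingQuot (UqRel p)

instance (p : ℕ) : Ring (U p) := inferInstanceAs (Ring (RingQuot (UqRel p)))

instance (p : ℕ) : Algebra ℂ (U p) := inferInstanceAs (Algebra ℂ (RingQuot (UqRel p)))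

/-- The quotient map. -/
def U.mk (p : ℕ) : FreeAlgebra ℂ Gen →ₐ[ℂ] U p := RingQuot.mkAlgHom ℂ (UqRel p)

/-- The generators of `U_q sl(2)`. -/
def U.gen (p : ℕ) (x : Gen) : U p := U.mk p (w x)

/-- The same relations for a family of elements of an arbitrary algebra. -/
structure IsUq (p : ℕ) {A : Type*} [Ring A] [Algebra ℂ A] (g : Gen → A) : Prop where
  K_Kinv : g .K * g .Kinv = 1
  Kinv_K : g .Kinv * g .K = 1
  K_E : g .K * g .E = q p ^ 2 • (g .E * g .K)
  K_F : g .K * g .F = (q p)⁻¹ ^ 2 • (g .F * g .K)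
  E_F : g .E * g .F - g .F * g .E = (q p - (q p)⁻¹)⁻¹ • (g .K - g .Kinv)
  E_pow : g .E ^ p = 0
  F_pow : g .F ^ p = 0
  K_pow : g .K ^ (2 * p) = 1
  h_e : g .h * g .e - g .e * g .h = g .e
  h_f : g .h * g .f - g .f * g .h = - g .f
  e_f : g .e * g .f - g .f * g .e = (2 : ℂ) • g .h
  K_e : g .K * g .e = g .e * g .K
  K_f : g .K * g .f = g .f * g .K
  E_e : g .E * g .e = g .e * g .E
  F_f : g .F * g .f = g .f * g .F
  F_e : g .F * g .e - g .e * g .F =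
    (qFact p (p - 1))⁻¹ • (g .K ^ p * kBr p (g .K) (g .Kinv) * g .E ^ (p - 1))
  E_f : g .E * g .f - g .f * g .E =
    ((-1) ^ (p + 1) * (qFact p (p - 1))⁻¹) • (g .F ^ (p - 1) * kBr p (g .K) (g .Kinv))

lemma U.isUq (p : ℕ) : IsUq p (U.gen p) := by
  have key : ∀ {x y}, UqRel p x y → U.mk p x = U.mk p y :=
    fun h => RingQuot.mkAlgHom_rel ℂ h
  constructor
  · simpa [U.gen] using key .K_Kinv
  · simpa [U.gen] using key .Kinv_K
  · simpa [U.gen] using key .K_E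
  · simpa [U.gen] using key .K_F
  · simpa [U.gen] using key .E_F
  · simpa [U.gen] using key .E_pow
  · simpa [U.gen] using key .F_pow
  · simpa [U.gen] using key .K_pow
  · simpa [U.gen] using key .h_e
  · simpa [U.gen] using key .h_f
  · simpa [U.gen] using key .e_f
  · simpa [U.gen] using key .K_e
  · simpa [U.gen] using key .K_f
  · simpa [U.gen] using key .E_e
  · simpa [U.gen] using key .F_f
  · simpa [kBr, U.gen] using key .F_e
  · simpa [kBr, U.gen] using key .E_f

/-- The universal property of `U_q sl(2)`. -/
def U.lift {p : ℕ} {A : Type*} [Ring A] [Algebra ℂ A] (g : Gen → A) (hg : IsUq p g) :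
    U p →ₐ[ℂ] A :=
  RingQuot.liftAlgHom ℂ ⟨FreeAlgebra.lift ℂ g, by
    intro x y h
    cases h
    · simpa using hg.K_Kinv
    · simpa using hg.Kinv_K
    · simpa using hg.K_E
    · simpa using hg.K_F
    · simpa using hg.E_F
    · simpa using hg.E_pow
    · simpa using hg.F_pow
    · simpa using hg.K_pow
    · simpa using hg.h_e
    · simpa using hg.h_f
    · simpa using hg.e_f
    · simpa using hg.K_e
    · simpa using hg.K_f
    · simpa using hg.E_e
    · simpa using hg.F_f
    · simpa [kBr] using hg.F_e
    · simpa [kBr] using hg.E_f⟩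

lemma U.lift_gen {p : ℕ} {A : Type*} [Ring A] [Algebra ℂ A] (g : Gen → A) (hg : IsUq p g)
    (x : Gen) : U.lift g hg (U.gen p x) = g x := by
  exact (RingQuot.liftAlgHom_mkAlgHom_apply ℂ _ _ _).trans (FreeAlgebra.lift_ι_apply g x)

/-! ### Representations -/

/-- The module over `A` afforded by a representation `ρ` of `A` on `V`. -/
@[nolint unusedArguments]
def RepSpace {A V : Type} [Ring A] [Algebra ℂ A] [AddCommGroup V] [Module ℂ V]
    (_ρ : A →ₐ[ℂ] Module.End ℂ V) : Type := V

section RepSpace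

variable {A V : Type} [Ring A] [Algebra ℂ A] [AddCommGroup V] [Module ℂ V]
  (ρ : A →ₐ[ℂ] Module.End ℂ V)

instance : AddCommGroup (RepSpace ρ) := inferInstanceAs (AddCommGroup V)

instance : Module ℂ (RepSpace ρ) := inferInstanceAs (Module ℂ V)

instance : Module A (RepSpace ρ) := Module.compHom V ρ.toRingHom

lemma RepSpace.smul_def (a : A) (v : RepSpace ρ) : a • v = (ρ a : V →ₗ[ℂ] V) v := rfl

instance : IsScalarTower ℂ A (RepSpace ρ) where
  smul_assoc c a v := by
    change (ρ (c • a) : V →ₗ[ℂ] V) v = c • (ρ a : V →ₗ[ℂ] V) v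
    rw [map_smul]; rfl

/-- The representation contragredient to `ρ` with respect to an anti-homomorphism `σ`:
`a` acts on linear functionals by `(a • φ)(v) = φ(σ(a) v)`. -/
def contraRep (σ : A →ₐ[ℂ] Aᵐᵒᵖ) : A →ₐ[ℂ] Module.End ℂ (Module.Dual ℂ V) :=
  AlgHom.ofLinearMap
    ((Module.Dual.transpose (R := ℂ) (M := V) (M' := V)) ∘ₗ ρ.toLinearMap ∘ₗ
      (MulOpposite.opLinearEquiv ℂ).symm.toLinearMap ∘ₗ σ.toLinearMap)
    (by ext; simp; rfl)
    (by intro a b; ext; simp; rfl)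

lemma contraRep_apply (σ : A →ₐ[ℂ] Aᵐᵒᵖ) (a : A) (φ : Module.Dual ℂ V) (v : V) :
    (contraRep ρ σ a : Module.Dual ℂ V →ₗ[ℂ] Module.Dual ℂ V) φ v =
      φ ((ρ (σ a).unop : V →ₗ[ℂ] V) v) := rfl

end RepSpace

/-! ### Irreducible modules and Weyl modules -/

/-- The basis vector `v_{n,m}` of `ℂ^s ⊗ ℂ^r`, and `0` when an index is out of range. -/
def vec {s r : ℕ} (n m : ℤ) : Fin s × Fin r → ℂ :=
  fun j => if (j.1 : ℤ) = n ∧ (j.2 : ℤ) = m then 1 else 0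

/-- The linear map that sends each basis vector `v_{n,m}` to the prescribed vector. -/
def onBasis {s r : ℕ} (img : ℤ → ℤ → Fin s × Fin r → ℂ) : Module.End ℂ (Fin s × Fin r → ℂ) :=
  Fintype.linearCombination ℂ fun j : Fin s × Fin r => img j.1 j.2

lemma vec_zero {s r : ℕ} {n m : ℤ} (h : ¬ ((0 ≤ n ∧ n < s) ∧ (0 ≤ m ∧ m < r))) :
    (vec n m : Fin s × Fin r → ℂ) = 0 := by
  funext j
  have h1 := j.1.2
  have h2 := j.2.2
  simp only [vec, Pi.zero_apply, ite_eq_right_iff, one_ne_zero, imp_false]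
  omega

lemma onBasis_vec {s r : ℕ} (img : ℤ → ℤ → Fin s × Fin r → ℂ) {n m : ℤ}
    (h : (0 ≤ n ∧ n < s) ∧ (0 ≤ m ∧ m < r)) : onBasis img (vec n m) = img n m := by
  obtain ⟨⟨h1, h2⟩, h3, h4⟩ := h
  lift n to ℕ using h1
  lift m to ℕ using h3
  have : (vec n m : Fin s × Fin r → ℂ) =
      Pi.single ((⟨n, by omega⟩, ⟨m, by omega⟩) : Fin s × Fin r) 1 := by
    funext j
    simp only [vec, Pi.single_apply, Prod.ext_iff, Fin.ext_iff, Nat.cast_inj]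
  rw [this, onBasis, Fintype.linearCombination_apply_single]
  simp

lemma end_ext {s r : ℕ} {S T : Module.End ℂ (Fin s × Fin r → ℂ)}
    (h : ∀ n m : ℤ, 0 ≤ n → n < s → 0 ≤ m → m < r → S (vec n m) = T (vec n m)) : S = T := by
  refine (Pi.basisFun ℂ (Fin s × Fin r)).ext fun j => ?_
  have := h j.1 j.2 (by omega) (by have := j.1.2; omega) (by omega) (by have := j.2.2; omega)
  convert this using 2 <;>
  · funext i
    simp only [vec, Pi.basisFun_apply, Pi.single_apply, Prod.ext_iff, Fin.ext_iff, Nat.cast_inj]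

/-- The action of the generators on the irreducible module `X_{s,r}`, with highest-weight vector
`v_{0,0}`. -/
def simpleGen (p s r : ℕ) : Gen → Module.End ℂ (Fin s × Fin r → ℂ)
  | .K => onBasis fun n m => ((-1) ^ (r - 1) * q p ^ ((s : ℤ) - 1 - 2 * n)) • vec n m
  | .Kinv => onBasis fun n m => ((-1) ^ (r - 1) * q p ^ (-((s : ℤ) - 1 - 2 * n))) • vec n m
  | .E => onBasis fun n m => ((-1) ^ (r - 1) * qInt p n * qInt p (s - n)) • vec (n - 1) m
  | .F => onBasis fun n m => vec (n + 1) m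
  | .h => onBasis fun n m => (((r : ℂ) - 1 - 2 * m) / 2) • vec n m
  | .e => onBasis fun n m => ((m : ℂ) * (r - m)) • vec n (m - 1)
  | .f => onBasis fun n m => vec n (m + 1)

section simple

variable {p s r : ℕ}

lemma sK (n m : ℤ) : simpleGen p s r .K (vec n m) =
    ((-1) ^ (r - 1) * q p ^ ((s : ℤ) - 1 - 2 * n)) • vec n m := by
  by_cases h : (0 ≤ n ∧ n < s) ∧ (0 ≤ m ∧ m < r)
  · rw [simpleGen, onBasis_vec _ h]
  · rw [vec_zero h]; simp

lemma sKinv (n m : ℤ) : simpleGen p s r .Kinv (vec n m) =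
    ((-1) ^ (r - 1) * q p ^ (-((s : ℤ) - 1 - 2 * n))) • vec n m := by
  by_cases h : (0 ≤ n ∧ n < s) ∧ (0 ≤ m ∧ m < r)
  · rw [simpleGen, onBasis_vec _ h]
  · rw [vec_zero h]; simp

lemma sh (n m : ℤ) : simpleGen p s r .h (vec n m) = (((r : ℂ) - 1 - 2 * m) / 2) • vec n m := by
  by_cases h : (0 ≤ n ∧ n < s) ∧ (0 ≤ m ∧ m < r)
  · rw [simpleGen, onBasis_vec _ h]
  · rw [vec_zero h]; simp

lemma sE (n m : ℤ) : simpleGen p s r .E (vec n m) =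
    ((-1) ^ (r - 1) * qInt p n * qInt p (s - n)) • vec (n - 1) m := by
  by_cases h : (0 ≤ n ∧ n < s) ∧ (0 ≤ m ∧ m < r)
  · rw [simpleGen, onBasis_vec _ h]
  · rw [vec_zero h, map_zero]
    by_cases h' : n = s
    · subst h'; simp [qInt_zero]
    · rw [vec_zero (by omega), smul_zero]

lemma se (n m : ℤ) : simpleGen p s r .e (vec n m) = ((m : ℂ) * (r - m)) • vec n (m - 1) := by
  by_cases h : (0 ≤ n ∧ n < s) ∧ (0 ≤ m ∧ m < r)
  · rw [simpleGen, onBasis_vec _ h]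
  · rw [vec_zero h, map_zero]
    by_cases h' : m = r
    · subst h'; simp
    · rw [vec_zero (by omega), smul_zero]

lemma sF {n m : ℤ} (hn : n ≠ -1) : simpleGen p s r .F (vec n m) = vec (n + 1) m := by
  by_cases h : (0 ≤ n ∧ n < s) ∧ (0 ≤ m ∧ m < r)
  · rw [simpleGen, onBasis_vec _ h]
  · rw [vec_zero h, map_zero, vec_zero (by omega)]

lemma sf {n m : ℤ} (hm : m ≠ -1) : simpleGen p s r .f (vec n m) = vec n (m + 1) := by
  by_cases h : (0 ≤ n ∧ n < s) ∧ (0 ≤ m ∧ m < r)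
  · rw [simpleGen, onBasis_vec _ h]
  · rw [vec_zero h, map_zero, vec_zero (by omega)]

lemma sE_pow (k : ℕ) (n m : ℤ) : ∃ c : ℂ, (simpleGen p s r .E ^ k) (vec n m) =
    c • vec (n - k) m := by
  induction k with
  | zero => exact ⟨1, by simp⟩
  | succ k ih =>
    obtain ⟨c, hc⟩ := ih
    refine ⟨c * ((-1) ^ (r - 1) * qInt p (n - k) * qInt p (s - (n - k))), ?_⟩
    rw [pow_succ', Module.End.mul_apply, hc, map_smul, sE, smul_smul]
    congr 2
    push_cast; ring

lemma sF_pow (k : ℕ) {n m : ℤ} (hn : 0 ≤ n) : (simpleGen p s r .F ^ k) (vec n m) =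
    vec (n + k) m := by
  induction k with
  | zero => simp
  | succ k ih =>
    rw [pow_succ', Module.End.mul_apply, ih, sF (by omega)]
    congr 1
    push_cast; ring

lemma sK_pow (k : ℕ) (n m : ℤ) : (simpleGen p s r .K ^ k) (vec n m) =
    ((-1) ^ (r - 1) * q p ^ ((s : ℤ) - 1 - 2 * n)) ^ k • vec n m := by
  induction k with
  | zero => simp
  | succ k ih => rw [pow_succ', Module.End.mul_apply, ih, map_smul, sK, smul_smul, pow_succ]

lemma sign_sq (k : ℕ) : ((-1 : ℂ) ^ k) * (-1) ^ k = 1 := by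
  rw [← mul_pow]; norm_num

lemma simple_isUq (hp : 2 ≤ p) (hs : s ≤ p) : IsUq p (simpleGen p s r) := by
  have hq := q_ne p
  have hq' := q_sub_ne hp
  set ε : ℂ := (-1) ^ (r - 1) with hε
  have hεε : ε * ε = 1 := sign_sq _
  constructor
  · refine end_ext fun n m _ _ _ _ => ?_
    simp only [Module.End.mul_apply, sKinv, sK, map_smul, smul_smul, Module.End.one_apply]
    rw [zpow_neg, ← hε]
    convert one_smul ℂ _
    have := zpow_ne_zero ((s : ℤ) - 1 - 2 * n) hq
    field_simp
    linear_combination hεε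
  · refine end_ext fun n m _ _ _ _ => ?_
    simp only [Module.End.mul_apply, sKinv, sK, map_smul, smul_smul, Module.End.one_apply]
    rw [zpow_neg, ← hε]
    convert one_smul ℂ _
    have := zpow_ne_zero ((s : ℤ) - 1 - 2 * n) hq
    field_simp
    linear_combination hεε
  · refine end_ext fun n m _ _ _ _ => ?_
    simp only [Module.End.mul_apply, LinearMap.smul_apply, sE, sK, map_smul, smul_smul]
    congr 1
    have : (s : ℤ) - 1 - 2 * (n - 1) = ((s : ℤ) - 1 - 2 * n) + 2 := by ring
    rw [this, zpow_add₀ hq]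
    norm_cast
    ring
  · refine end_ext fun n m hn _ _ _ => ?_
    rw [Module.End.mul_apply, LinearMap.smul_apply, Module.End.mul_apply, sF (by omega), sK, sK,
      map_smul, sF (by omega), smul_smul]
    congr 1
    have : (s : ℤ) - 1 - 2 * (n + 1) = ((s : ℤ) - 1 - 2 * n) - 2 := by ring
    rw [this, zpow_sub₀ hq]
    norm_cast
    field_simp
  · refine end_ext fun n m hn hns _ _ => ?_
    have h1 : simpleGen p s r .F (simpleGen p s r .E (vec n m)) =
        (ε * qInt p n * qInt p (s - n)) • vec n m := by
      rw [sE, map_smul]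
      by_cases h0 : n = 0
      · subst h0; simp [qInt_zero]
      · rw [sF (by omega), sub_add_cancel]
    rw [LinearMap.sub_apply, Module.End.mul_apply, Module.End.mul_apply, h1, sF (by omega), sE,
      LinearMap.smul_apply, LinearMap.sub_apply, sK, sKinv, add_sub_cancel_right, ← sub_smul,
      ← sub_smul, smul_smul]
    congr 1
    simp only [qInt]
    have e1 : (s : ℤ) - (n + 1) = s - n - 1 := by ring
    have e2 : (s : ℤ) - 1 - 2 * n = s - n - n - 1 := by ring
    rw [e1, e2]
    simp only [zpow_add₀ hq, zpow_sub₀ hq, zpow_neg, zpow_one, zpow_natCast, ← hε]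
    have := zpow_ne_zero n hq
    have := pow_ne_zero s hq
    have hq2 : q p ^ 2 - 1 ≠ 0 := fun h => hq' (by field_simp; linear_combination h)
    field_simp
    ring
  · refine end_ext fun n m hn hns _ _ => ?_
    obtain ⟨c, hc⟩ := sE_pow (p := p) (s := s) (r := r) p n m
    rw [hc, vec_zero (by omega)]; simp
  · refine end_ext fun n m hn hns _ _ => ?_
    rw [sF_pow p hn, vec_zero (by omega)]; simp
  · refine end_ext fun n m hn hns _ _ => ?_
    rw [sK_pow, Module.End.one_apply]
    convert one_smul ℂ _
    rw [mul_pow, pow_mul, pow_two, hεε, one_pow, one_mul, ← zpow_natCast, ← zpow_mul]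
    have := q_shift hp (2 * ((s : ℤ) - 1 - 2 * n)) 0
    rw [zpow_zero, mul_one, zero_add, zpow_mul (-1 : ℂ)] at this
    norm_num at this
    rw [← this]; congr 1; push_cast; ring
  · refine end_ext fun n m hn hns _ _ => ?_
    simp only [LinearMap.sub_apply, Module.End.mul_apply, se, sh, map_smul, smul_smul, ← sub_smul]
    congr 1
    push_cast; ring
  · refine end_ext fun n m hn hns _ _ => ?_
    rw [LinearMap.sub_apply, Module.End.mul_apply, Module.End.mul_apply, LinearMap.neg_apply,
      sf (by omega), sh, sh, map_smul, sf (by omega), ← sub_smul, ← neg_one_smul ℂ (vec n (m + 1))]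
    congr 1
    push_cast; ring
  · refine end_ext fun n m hn hns hm _ => ?_
    have h1 : simpleGen p s r .f (simpleGen p s r .e (vec n m)) =
        ((m : ℂ) * (r - m)) • vec n m := by
      rw [se, map_smul]
      by_cases h0 : m = 0
      · subst h0; simp
      · rw [sf (by omega), sub_add_cancel]
    rw [LinearMap.sub_apply, Module.End.mul_apply, Module.End.mul_apply, h1, sf (by omega), se,
      LinearMap.smul_apply, sh, add_sub_cancel_right, ← sub_smul, smul_smul]
    congr 1
    push_cast; ring
  · refine end_ext fun n m hn hns hm _ => ?_
    simp only [Module.End.mul_apply, se, sK, map_smul, smul_smul, mul_comm]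
  · refine end_ext fun n m hn hns hm _ => ?_
    rw [Module.End.mul_apply, Module.End.mul_apply, sf (by omega), sK, sK, map_smul, sf (by omega)]
  · refine end_ext fun n m hn hns hm _ => ?_
    simp only [Module.End.mul_apply, se, sE, map_smul, smul_smul, mul_comm]
  · refine end_ext fun n m hn hns hm _ => ?_
    rw [Module.End.mul_apply, Module.End.mul_apply, sf (by omega), sF (by omega), sF (by omega),
      sf (by omega)]
  · refine end_ext fun n m hn hns hm _ => ?_
    have h1 : simpleGen p s r .F (simpleGen p s r .e (vec n m)) =
        simpleGen p s r .e (simpleGen p s r .F (vec n m)) := by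
      rw [se, map_smul, sF (by omega), sF (by omega), se]
    rw [LinearMap.sub_apply, Module.End.mul_apply, Module.End.mul_apply, h1, sub_self]
    obtain ⟨c, hc⟩ := sE_pow (p := p) (s := s) (r := r) (p - 1) n m
    rw [LinearMap.smul_apply, Module.End.mul_apply, hc, map_smul, Module.End.mul_apply]
    by_cases hh : n = p - 1
    · obtain rfl : s = p := by omega
      have : n - ((s - 1 : ℕ) : ℤ) = 0 := by omega
      rw [this]
      have : kBr s (simpleGen s s r .K) (simpleGen s s r .Kinv) (vec 0 m) = 0 := by
        simp only [kBr, LinearMap.smul_apply, LinearMap.sub_apply, sK, sKinv, smul_smul,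
          ← sub_smul]
        convert zero_smul ℂ _
        have h2 := q_pow_p hp
        rw [mul_zero, sub_zero, zpow_neg, zpow_sub_one₀ hq, h2]
        field_simp
        ring
      rw [this]; simp
    · rw [vec_zero (by omega)]; simp
  · refine end_ext fun n m hn hns hm _ => ?_
    have h1 : simpleGen p s r .E (simpleGen p s r .f (vec n m)) =
        simpleGen p s r .f (simpleGen p s r .E (vec n m)) := by
      rw [sf (by omega), sE, sE, map_smul, sf (by omega)]
    rw [LinearMap.sub_apply, Module.End.mul_apply, Module.End.mul_apply, h1, sub_self,
      LinearMap.smul_apply, Module.End.mul_apply]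
    by_cases hh : n = 0 ∧ s = p
    · obtain ⟨rfl, rfl⟩ := hh
      have : kBr s (simpleGen s s r .K) (simpleGen s s r .Kinv) (vec 0 m) = 0 := by
        simp only [kBr, LinearMap.smul_apply, LinearMap.sub_apply, sK, sKinv, smul_smul,
          ← sub_smul]
        convert zero_smul ℂ _
        have h2 := q_pow_p hp
        rw [mul_zero, sub_zero, zpow_neg, zpow_sub_one₀ hq, h2]
        field_simp
        ring
      rw [this]; simp
    · have : ∃ c : ℂ, kBr p (simpleGen p s r .K) (simpleGen p s r .Kinv) (vec n m) =
          c • vec n m := by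
        simp only [kBr, LinearMap.smul_apply, LinearMap.sub_apply, sK, sKinv, smul_smul,
          ← sub_smul]
        exact ⟨_, rfl⟩
      obtain ⟨c, hc⟩ := this
      rw [hc, map_smul, sF_pow _ hn, vec_zero (by omega)]; simp

end simple

/-- The irreducible `sr`-dimensional module `X_{s,r}`, for `1 ≤ s ≤ p` and `r ≥ 1`. -/
def simpleRep {p s r : ℕ} (hp : 2 ≤ p) (hs : s ≤ p) :
    U p →ₐ[ℂ] Module.End ℂ (Fin s × Fin r → ℂ) :=
  U.lift (simpleGen p s r) (simple_isUq hp hs)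

/-- The basis vector `v_k` of `ℂ^{n+1}`, and `0` when `k` is out of range. -/
def wvec {n : ℕ} (k : ℤ) : Fin (n + 1) → ℂ := fun j => if (j : ℤ) = k then 1 else 0

/-- The linear map that sends each basis vector `v_k` to the prescribed vector. -/
def onWeyl {n : ℕ} (img : ℤ → Fin (n + 1) → ℂ) : Module.End ℂ (Fin (n + 1) → ℂ) :=
  Fintype.linearCombination ℂ fun j : Fin (n + 1) => img j

lemma wvec_zero {n : ℕ} {k : ℤ} (h : ¬ (0 ≤ k ∧ k ≤ n)) :
    (wvec k : Fin (n + 1) → ℂ) = 0 := by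
  funext j
  have h1 := j.2
  simp only [wvec, Pi.zero_apply, ite_eq_right_iff, one_ne_zero, imp_false]
  omega

lemma onWeyl_vec {n : ℕ} (img : ℤ → Fin (n + 1) → ℂ) {k : ℤ}
    (h : 0 ≤ k ∧ k ≤ n) : onWeyl img (wvec k) = img k := by
  obtain ⟨h1, h2⟩ := h
  lift k to ℕ using h1
  have : (wvec k : Fin (n + 1) → ℂ) = Pi.single (⟨k, by omega⟩ : Fin (n + 1)) 1 := by
    funext j
    simp only [wvec, Pi.single_apply, Fin.ext_iff, Nat.cast_inj]
  rw [this, onWeyl, Fintype.linearCombination_apply_single]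
  simp

lemma wend_ext {n : ℕ} {S T : Module.End ℂ (Fin (n + 1) → ℂ)}
    (h : ∀ k : ℤ, 0 ≤ k → k ≤ n → S (wvec k) = T (wvec k)) : S = T := by
  refine (Pi.basisFun ℂ (Fin (n + 1))).ext fun j => ?_
  have := h j (by omega) (by have := j.2; omega)
  convert this using 2 <;>
  · funext i
    simp only [wvec, Pi.basisFun_apply, Pi.single_apply, Fin.ext_iff, Nat.cast_inj]

/-- The action of the generators on the Weyl module of dimension `n + 1` and highest-weight vector
`v_0`, the limit from generic values of the deformation parameter of the irreducible module with
basis `v_k = F^k v_0 / [k]!`.  Divided powers act there by `E^p/[p]! v_k = [n-k+p choose p] v_{k-p}`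
and `F^p/[p]! v_k = [k+p choose p] v_{k+p}`, where the `q`-binomial coefficient `[a choose p]` takes
the value `(-1)^{a+p} ⌊a/p⌋` at `q = exp(iπ/p)`. -/
def weylGen (p n : ℕ) : Gen → Module.End ℂ (Fin (n + 1) → ℂ)
  | .K => onWeyl fun k => q p ^ ((n : ℤ) - 2 * k) • wvec k
  | .Kinv => onWeyl fun k => q p ^ (-((n : ℤ) - 2 * k)) • wvec k
  | .E => onWeyl fun k => qInt p (n - k + 1) • wvec (k - 1)
  | .F => onWeyl fun k => qInt p (k + 1) • wvec (k + 1)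
  | .e => onWeyl fun k => ((-1) ^ k * ((((n : ℤ) - k) / p + 1 : ℤ) : ℂ)) • wvec (k - p)
  | .f => onWeyl fun k => ((-1) ^ (k + p) * ((k / p + 1 : ℤ) : ℂ)) • wvec (k + p)
  | .h => onWeyl fun k => (((((n : ℤ) - k) / p - k / p : ℤ) : ℂ) / 2) • wvec k

section weyl

variable {p n : ℕ}

lemma wK (k : ℤ) : weylGen p n .K (wvec k) = q p ^ ((n : ℤ) - 2 * k) • wvec k := by
  by_cases h : 0 ≤ k ∧ k ≤ n
  · rw [weylGen, onWeyl_vec _ h]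
  · rw [wvec_zero h]; simp

lemma wKinv (k : ℤ) : weylGen p n .Kinv (wvec k) = q p ^ (-((n : ℤ) - 2 * k)) • wvec k := by
  by_cases h : 0 ≤ k ∧ k ≤ n
  · rw [weylGen, onWeyl_vec _ h]
  · rw [wvec_zero h]; simp

lemma wh (k : ℤ) : weylGen p n .h (wvec k) =
    (((((n : ℤ) - k) / p - k / p : ℤ) : ℂ) / 2) • wvec k := by
  by_cases h : 0 ≤ k ∧ k ≤ n
  · rw [weylGen, onWeyl_vec _ h]
  · rw [wvec_zero h]; simp

lemma wE (k : ℤ) : weylGen p n .E (wvec k) = qInt p (n - k + 1) • wvec (k - 1) := by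
  by_cases h : 0 ≤ k ∧ k ≤ n
  · rw [weylGen, onWeyl_vec _ h]
  · rw [wvec_zero h, map_zero]
    by_cases h' : k = n + 1
    · subst h'; simp [qInt_zero]
    · rw [wvec_zero (by omega), smul_zero]

lemma wF (k : ℤ) : weylGen p n .F (wvec k) = qInt p (k + 1) • wvec (k + 1) := by
  by_cases h : 0 ≤ k ∧ k ≤ n
  · rw [weylGen, onWeyl_vec _ h]
  · rw [wvec_zero h, map_zero]
    by_cases h' : k = -1
    · subst h'; simp [qInt_zero]
    · rw [wvec_zero (by omega), smul_zero]

lemma ediv_neg_one {p : ℕ} {a : ℤ} (h1 : a < 0) (h2 : -p ≤ a) : a / p = -1 := by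
  have : a / p = (a + p) / p - 1 := by
    rw [Int.add_ediv_of_dvd_right (dvd_refl _), Int.ediv_self (by omega)]; ring
  rw [this, Int.ediv_eq_zero_of_lt (by omega) (by omega)]; rfl

lemma we (k : ℤ) : weylGen p n .e (wvec k) =
    ((-1) ^ k * ((((n : ℤ) - k) / p + 1 : ℤ) : ℂ)) • wvec (k - p) := by
  by_cases h : 0 ≤ k ∧ k ≤ n
  · rw [weylGen, onWeyl_vec _ h]
  · rw [wvec_zero h, map_zero]
    by_cases h' : n < k ∧ k ≤ n + p
    · rw [ediv_neg_one (by omega) (by omega)]; simp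
    · rw [wvec_zero (by omega), smul_zero]

lemma wf (k : ℤ) : weylGen p n .f (wvec k) =
    ((-1) ^ (k + p) * ((k / p + 1 : ℤ) : ℂ)) • wvec (k + p) := by
  by_cases h : 0 ≤ k ∧ k ≤ n
  · rw [weylGen, onWeyl_vec _ h]
  · rw [wvec_zero h, map_zero]
    by_cases h' : k < 0 ∧ -p ≤ k
    · rw [ediv_neg_one (by omega) (by omega)]; simp
    · rw [wvec_zero (by omega), smul_zero]

lemma wE_pow (j : ℕ) (k : ℤ) : (weylGen p n .E ^ j) (wvec k) =
    (∏ i ∈ Finset.range j, qInt p (n - k + (i + 1))) • wvec (k - j) := by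
  induction j with
  | zero => simp
  | succ j ih =>
    rw [pow_succ', Module.End.mul_apply, ih, map_smul, wE, smul_smul, Finset.prod_range_succ]
    congr 2
    · congr 1; ring
    · push_cast; ring

lemma wF_pow (j : ℕ) (k : ℤ) : (weylGen p n .F ^ j) (wvec k) =
    (∏ i ∈ Finset.range j, qInt p (k + (i + 1))) • wvec (k + j) := by
  induction j with
  | zero => simp
  | succ j ih =>
    rw [pow_succ', Module.End.mul_apply, ih, map_smul, wF, smul_smul, Finset.prod_range_succ]
    congr 2
    · congr 1; ring
    · push_cast; ring

lemma wK_pow (j : ℕ) (k : ℤ) : (weylGen p n .K ^ j) (wvec k) =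
    (q p ^ ((n : ℤ) - 2 * k)) ^ j • wvec k := by
  induction j with
  | zero => simp
  | succ j ih => rw [pow_succ', Module.End.mul_apply, ih, map_smul, wK, smul_smul, pow_succ]

/-- A product of `p` consecutive quantum integers vanishes. -/
lemma prod_qInt_p (hp : 2 ≤ p) (a : ℤ) : ∏ i ∈ Finset.range p, qInt p (a + (i + 1)) = 0 := by
  have h1 := Int.emod_nonneg (-(a + 1)) (by omega : (p : ℤ) ≠ 0)
  have h2 := Int.emod_lt_of_pos (-(a + 1)) (by omega : (0 : ℤ) < p)
  have h3 := Int.mul_ediv_add_emod (-(a + 1)) p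
  refine Finset.prod_eq_zero (i := ((-(a + 1)) % p).toNat)
      (by rw [Finset.mem_range]; omega) ?_
  rw [qInt_eq_zero_iff hp, Int.toNat_of_nonneg h1]
  exact ⟨-(-(a + 1) / p), by linear_combination h3⟩

/-- A product of `p - 1` consecutive quantum integers. -/
lemma prod_qInt_pred (hp : 2 ≤ p) (a : ℤ) :
    ∏ i ∈ Finset.range (p - 1), qInt p (a + (i + 1)) =
      if (p : ℤ) ∣ a then (-1) ^ (a + a / p) * qFact p (p - 1) else 0 := by
  split_ifs with h
  · obtain ⟨b, rfl⟩ := h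
    rw [Int.mul_ediv_cancel_left _ (by omega : (p : ℤ) ≠ 0)]
    have : ∀ i ∈ Finset.range (p - 1), qInt p (p * b + (i + 1)) =
        (-1) ^ b * qInt p ((i : ℤ) + 1) := fun i _ => by
      rw [← qInt_shift hp]; congr 1; ring
    rw [Finset.prod_congr rfl this, Finset.prod_mul_distrib, Finset.prod_const,
      Finset.card_range, qFact]
    congr 1
    rw [← zpow_natCast, ← zpow_mul, Nat.cast_sub (by omega)]
    have : (p : ℤ) * b + b = b * (p - (1 : ℕ)) + 2 * b := by push_cast; ring
    rw [this, zpow_add₀ (by norm_num), zpow_mul _ 2]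
    norm_num
  · have h1 := Int.emod_nonneg (-(a + 1)) (by omega : (p : ℤ) ≠ 0)
    have h2 := Int.emod_lt_of_pos (-(a + 1)) (by omega : (0 : ℤ) < p)
    have h3 := Int.mul_ediv_add_emod (-(a + 1)) p
    have h4 : (-(a + 1)) % p ≠ p - 1 := fun h4 => h ⟨-(-(a + 1) / p) - 1, by
      rw [h4] at h3; linear_combination h3⟩
    refine Finset.prod_eq_zero (i := ((-(a + 1)) % p).toNat)
      (by rw [Finset.mem_range]; omega) ?_
    rw [qInt_eq_zero_iff hp, Int.toNat_of_nonneg h1]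
    exact ⟨-(-(a + 1) / p), by linear_combination h3⟩

lemma ediv_sub_one (hp : 2 ≤ p) (a : ℤ) :
    (a - 1) / p = a / p - if (p : ℤ) ∣ a then 1 else 0 := by
  have hp' : (0 : ℤ) < p := by omega
  split_ifs with h
  · obtain ⟨b, rfl⟩ := h
    rw [Int.mul_ediv_cancel_left _ hp'.ne', Int.ediv_eq_iff_of_pos hp']
    constructor <;> nlinarith
  · rw [Int.ediv_eq_iff_of_pos hp']
    have h1 := Int.emod_nonneg a (by omega : (p : ℤ) ≠ 0)
    have h2 := Int.emod_lt_of_pos a hp'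
    have h3 := Int.mul_ediv_add_emod a p
    have h4 : a % p ≠ 0 := fun h4 => h (Int.dvd_of_emod_eq_zero h4)
    have h5 : 1 ≤ a % p := by omega
    constructor <;> nlinarith

lemma kBr_weyl (k : ℤ) : kBr p (weylGen p n .K) (weylGen p n .Kinv) (wvec k) =
    qInt p (n - 2 * k + 1) • wvec k := by
  have hq := q_ne p
  simp only [kBr, LinearMap.smul_apply, LinearMap.sub_apply, wK, wKinv, smul_smul, ← sub_smul]
  congr 1
  rw [qInt, zpow_add_one₀ hq, neg_add, zpow_add₀ hq, zpow_neg_one]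
  ring

lemma neg_one_zpow_congr {a b c : ℤ} (h : a = b + 2 * c) : (-1 : ℂ) ^ a = (-1) ^ b := by
  rw [h, zpow_add₀ (by norm_num), zpow_mul]; norm_num

lemma weyl_isUq (hp : 2 ≤ p) : IsUq p (weylGen p n) := by
  have hq := q_ne p
  have hq' := q_sub_ne hp
  have hp' : (0 : ℤ) < p := by omega
  have hadd (a : ℤ) : (a + p) / p = a / p + 1 := by
    rw [Int.add_ediv_of_dvd_right (dvd_refl _), Int.ediv_self (by omega)]
  have hsub (a : ℤ) : (a - p) / p = a / p - 1 := by
    have := hadd (a - p)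
    rw [sub_add_cancel] at this; omega
  constructor
  · refine wend_ext fun k _ _ => ?_
    simp only [Module.End.mul_apply, wKinv, wK, map_smul, smul_smul, Module.End.one_apply]
    rw [← zpow_add₀ hq]; simp
  · refine wend_ext fun k _ _ => ?_
    simp only [Module.End.mul_apply, wKinv, wK, map_smul, smul_smul, Module.End.one_apply]
    rw [← zpow_add₀ hq]; simp
  · refine wend_ext fun k _ _ => ?_
    simp only [Module.End.mul_apply, LinearMap.smul_apply, wE, wK, map_smul, smul_smul]
    congr 1
    have : (n : ℤ) - 2 * (k - 1) = ((n : ℤ) - 2 * k) + 2 := by ring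
    rw [this, zpow_add₀ hq]
    norm_cast
    ring
  · refine wend_ext fun k _ _ => ?_
    simp only [Module.End.mul_apply, LinearMap.smul_apply, wF, wK, map_smul, smul_smul]
    congr 1
    have : (n : ℤ) - 2 * (k + 1) = ((n : ℤ) - 2 * k) - 2 := by ring
    rw [this, zpow_sub₀ hq]
    norm_cast
    field_simp
  · refine wend_ext fun k _ _ => ?_
    simp only [Module.End.mul_apply, LinearMap.sub_apply, LinearMap.smul_apply, wE, wF, wK, wKinv,
      map_smul, smul_smul, add_sub_cancel_right, sub_add_cancel, ← sub_smul]
    congr 1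
    simp only [qInt]
    have e1 : (n : ℤ) - (k + 1) + 1 = n - k := by ring
    have e2 : (n : ℤ) - 2 * k = n - k - k := by ring
    rw [e1, e2]
    simp only [zpow_add₀ hq, zpow_sub₀ hq, zpow_neg, zpow_one, zpow_natCast]
    have := zpow_ne_zero k hq
    have := pow_ne_zero n hq
    have hq2 : q p ^ 2 - 1 ≠ 0 := fun h => hq' (by field_simp; linear_combination h)
    field_simp
    ring
  · refine wend_ext fun k _ _ => ?_
    rw [wE_pow, prod_qInt_p hp]; simp
  · refine wend_ext fun k _ _ => ?_
    rw [wF_pow, prod_qInt_p hp]; simp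
  · refine wend_ext fun k _ _ => ?_
    rw [wK_pow, Module.End.one_apply]
    convert one_smul ℂ _
    rw [← zpow_natCast, ← zpow_mul]
    have := q_shift hp (2 * ((n : ℤ) - 2 * k)) 0
    rw [zpow_zero, mul_one, zero_add, zpow_mul (-1 : ℂ)] at this
    norm_num at this
    rw [← this]; congr 1; push_cast; ring
  · refine wend_ext fun k _ _ => ?_
    simp only [LinearMap.sub_apply, Module.End.mul_apply, we, wh, map_smul, smul_smul, ← sub_smul]
    congr 1
    have e1 : (n : ℤ) - (k - p) = n - k + p := by ring
    rw [e1, hadd, hsub]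
    push_cast; ring
  · refine wend_ext fun k _ _ => ?_
    simp only [LinearMap.sub_apply, LinearMap.neg_apply, Module.End.mul_apply, wf, wh, map_smul,
      smul_smul, ← sub_smul, ← neg_smul]
    congr 1
    have e1 : (n : ℤ) - (k + p) = n - k - p := by ring
    rw [e1, hadd, hsub]
    push_cast; ring
  · refine wend_ext fun k _ _ => ?_
    simp only [LinearMap.sub_apply, LinearMap.smul_apply, Module.End.mul_apply, we, wf, wh,
      map_smul, smul_smul, add_sub_cancel_right, sub_add_cancel, ← sub_smul]
    congr 1
    have e1 : (n : ℤ) - (k + p) = n - k - p := by ring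
    have h1 : ((-1 : ℂ) ^ (k + p)) * (-1) ^ (k + p) = 1 := by
      rw [← mul_zpow]; norm_num
    have h2 : ((-1 : ℂ) ^ k) * (-1) ^ k = 1 := by
      rw [← mul_zpow]; norm_num
    rw [e1, hsub, hsub]
    push_cast
    linear_combination (((k / p : ℤ) : ℂ) + 1) * ((((n : ℤ) - k) / p : ℤ) : ℂ) * h1 -
      (((k / p : ℤ) : ℂ)) * (((((n : ℤ) - k) / p : ℤ) : ℂ) + 1) * h2
  · refine wend_ext fun k _ _ => ?_
    simp only [Module.End.mul_apply, we, wK, map_smul, smul_smul]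
    congr 1
    have e1 : (n : ℤ) - 2 * (k - p) = (n - 2 * k) + 2 * p := by ring
    rw [e1, q_shift hp]; norm_num; ring
  · refine wend_ext fun k _ _ => ?_
    simp only [Module.End.mul_apply, wf, wK, map_smul, smul_smul]
    congr 1
    have e1 : (n : ℤ) - 2 * (k + p) = (n - 2 * k) + (-2) * p := by ring
    rw [e1, q_shift hp]; norm_num; ring
  · refine wend_ext fun k _ _ => ?_
    simp only [Module.End.mul_apply, we, wE, map_smul, smul_smul]
    have e1 : (n : ℤ) - (k - p) + 1 = (n - k + 1) + p := by ring
    have e2 : k - 1 - (p : ℤ) = k - p - 1 := by ring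
    have e3 := ediv_sub_one hp ((n : ℤ) - (k - 1))
    have e4 : (n : ℤ) - (k - 1) - 1 = n - k := by ring
    rw [e4] at e3
    rw [e1, e2, qInt_shift_one hp, e3, zpow_sub_one₀ (by norm_num)]
    congr 1
    split_ifs with h
    · rw [(qInt_eq_zero_iff hp _).2 (by convert h using 1; ring)]; simp
    · push_cast; ring
  · refine wend_ext fun k _ _ => ?_
    simp only [Module.End.mul_apply, wf, wF, map_smul, smul_smul]
    have e1 : k + (p : ℤ) + 1 = (k + 1) + p := by ring
    have e3 := ediv_sub_one hp (k + 1)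
    rw [add_sub_cancel_right] at e3
    rw [e1, qInt_shift_one hp, e3, add_right_comm, zpow_add_one₀ (by norm_num)]
    congr 1
    split_ifs with h
    · rw [(qInt_eq_zero_iff hp _).2 h]; simp
    · push_cast; ring
  · refine wend_ext fun k _ _ => ?_
    simp only [LinearMap.sub_apply, LinearMap.smul_apply, Module.End.mul_apply, we, wF, map_smul,
      smul_smul, wE_pow, kBr_weyl, wK_pow, prod_qInt_pred hp]
    have e1 : k + 1 - (p : ℤ) = k - p + 1 := by ring
    have e2 : k - ((p - 1 : ℕ) : ℤ) = k - p + 1 := by omega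
    have e3 := ediv_sub_one hp ((n : ℤ) - k)
    have e4 : (n : ℤ) - k - 1 = n - (k + 1) := by ring
    have e5 : k - (p : ℤ) + 1 = (k + 1) + (-1) * p := by ring
    rw [e4] at e3
    rw [e1, e2, ← sub_smul, e3, e5, qInt_shift hp, zpow_add_one₀ (by norm_num)]
    congr 1
    split_ifs with h
    · have e6 : (n : ℤ) - 2 * (k + 1 + -1 * p) + 1 =
          -(k + 1) + (((n : ℤ) - k) / p + 2) * p := by
        have := Int.ediv_mul_cancel h
        linear_combination -this
      have e7 : (q p ^ ((n : ℤ) - 2 * (k + 1 + -1 * p))) ^ p = (-1) ^ (n : ℤ) := by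
        have := q_shift hp ((n : ℤ) - 2 * (k + 1 + -1 * p)) 0
        rw [zpow_zero, mul_one, zero_add] at this
        rw [← zpow_natCast, ← zpow_mul, this]
        exact neg_one_zpow_congr (c := p - (k + 1)) (by ring)
      have h2 : (-1 : ℂ) ^ (((n : ℤ) - k) / p) * (-1) ^ (((n : ℤ) - k) / p) = 1 := by
        rw [← mul_zpow]; norm_num
      have h3 : (-1 : ℂ) ^ (n : ℤ) * (-1) ^ (n : ℤ) = 1 := by
        rw [← mul_zpow]; norm_num
      have h4 : (-1 : ℂ) ^ ((n : ℤ) - k) = (-1) ^ (n : ℤ) * (-1) ^ k := by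
        rw [← zpow_add₀ (by norm_num)]
        exact neg_one_zpow_congr (c := -k) (by ring)
      rw [e6, e7, qInt_shift hp, qInt_neg, zpow_add₀ (by norm_num), zpow_add₀ (by norm_num), h4]
      have := qFact_ne hp (n := p - 1) (by omega)
      have hF := inv_mul_cancel₀ this
      push_cast
      generalize (qFact p (p-1))⁻¹ = G at *
      have m1 : (-1 : ℂ) ^ (-1 : ℤ) = -1 := by norm_num
      have m2 : (-1 : ℂ) ^ (2 : ℤ) = 1 := by norm_num
      rw [m1, m2]
      generalize (-1 : ℂ) ^ (n : ℤ) = N at *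
      generalize (-1 : ℂ) ^ (((n : ℤ) - k) / p) = B at *
      generalize (-1 : ℂ) ^ k = A at *
      linear_combination A * qInt p (k + 1) * (h3 * (B * B * (G * qFact p (p - 1))) +
        h2 * (G * qFact p (p - 1)) + hF)
    · norm_num
      ring
  · refine wend_ext fun k _ _ => ?_
    simp only [LinearMap.sub_apply, LinearMap.smul_apply, Module.End.mul_apply, wf, wE, map_smul,
      smul_smul, wF_pow, kBr_weyl, prod_qInt_pred hp]
    have e1 : k - 1 + (p : ℤ) = k + p - 1 := by ring
    have e2 : k + ((p - 1 : ℕ) : ℤ) = k + p - 1 := by omega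
    have e3 := ediv_sub_one hp k
    have e5 : (n : ℤ) - (k + p) + 1 = (n - k + 1) + (-1) * p := by ring
    rw [e1, e2, ← sub_smul, e3, e5, qInt_shift hp, zpow_sub_one₀ (by norm_num)]
    congr 1
    split_ifs with h
    · have e6 : (n : ℤ) - 2 * k + 1 = (n - k + 1) + (-(k / p)) * p := by
        have := Int.ediv_mul_cancel h
        linear_combination this
      have h2 : (-1 : ℂ) ^ (k / p) * (-1) ^ (-(k / p)) = 1 := by
        rw [← zpow_add₀ (by norm_num)]; simp
      rw [e6, qInt_shift hp, zpow_add₀ (by norm_num), zpow_add₀ (by norm_num)]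
      have := qFact_ne hp (n := p - 1) (by omega)
      have hF := inv_mul_cancel₀ this
      push_cast
      generalize (qFact p (p-1))⁻¹ = G at *
      have m1 : (-1 : ℂ) ^ (-1 : ℤ) = -1 := by norm_num
      have m2 : (-1 : ℂ)⁻¹ = -1 := by norm_num
      rw [m1, m2, zpow_natCast, pow_succ]
      linear_combination (-1 : ℂ) ^ k * (-1) ^ p * qInt p (n - k + 1) *
        (h2 * (G * qFact p (p - 1)) + hF)
    · norm_num
      ring

end weyl

/-- The Weyl module of dimension `n + 1`. -/
def weylRep {p : ℕ} (hp : 2 ≤ p) (n : ℕ) : U p →ₐ[ℂ] Module.End ℂ (Fin (n + 1) → ℂ) :=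
  U.lift (weylGen p n) (weyl_isUq hp)

/-! ### Contragredient modules of the quantum group -/

section anti

variable {p : ℕ} {A : Type*} [Ring A] [Algebra ℂ A] {g : Gen → A}

lemma IsUq.Kpow_E (hg : IsUq p g) (hp : 2 ≤ p) : g .K ^ p * g .E = g .E * g .K ^ p := by
  have : ∀ j : ℕ, g .K ^ j * g .E = (q p ^ 2) ^ j • (g .E * g .K ^ j) := by
    intro j
    induction j with
    | zero => simp
    | succ j ih =>
      rw [pow_succ', mul_assoc, ih, mul_smul_comm, ← mul_assoc, hg.K_E, smul_mul_assoc, smul_smul,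
        mul_assoc, ← pow_succ', pow_succ (q p ^ 2)]
  have h2 := q_pow_p hp
  rw [zpow_natCast] at h2
  rw [this, ← pow_mul, mul_comm, pow_mul, h2]
  norm_num

lemma IsUq.Kpow_F (hg : IsUq p g) (hp : 2 ≤ p) : g .K ^ p * g .F = g .F * g .K ^ p := by
  have : ∀ j : ℕ, g .K ^ j * g .F = ((q p)⁻¹ ^ 2) ^ j • (g .F * g .K ^ j) := by
    intro j
    induction j with
    | zero => simp
    | succ j ih =>
      rw [pow_succ', mul_assoc, ih, mul_smul_comm, ← mul_assoc, hg.K_F, smul_mul_assoc, smul_smul,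
        mul_assoc, ← pow_succ', pow_succ ((q p)⁻¹ ^ 2)]
  have h2 := q_pow_p hp
  rw [zpow_natCast] at h2
  rw [this, ← pow_mul, mul_comm, pow_mul, inv_pow, h2]
  norm_num

lemma IsUq.Kpow_e (hg : IsUq p g) : Commute (g .K ^ p) (g .e) :=
  Commute.pow_left hg.K_e p

lemma IsUq.Kpow_f (hg : IsUq p g) : Commute (g .K ^ p) (g .f) :=
  Commute.pow_left hg.K_f p

lemma IsUq.Kpow_h (hg : IsUq p g) : Commute (g .K ^ p) (g .h) := by
  have h : g .h = (2 : ℂ)⁻¹ • (g .e * g .f - g .f * g .e) := by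
    rw [hg.e_f, smul_smul]; norm_num
  rw [h]
  exact ((hg.Kpow_e.mul_right hg.Kpow_f).sub_right (hg.Kpow_f.mul_right hg.Kpow_e)).smul_right _

lemma IsUq.Kpow_kBr (hg : IsUq p g) : Commute (g .K ^ p) (kBr p (g .K) (g .Kinv)) := by
  have h1 : Commute (g .K) (g .Kinv) := by
    rw [Commute, SemiconjBy, hg.K_Kinv, hg.Kinv_K]
  refine Commute.pow_left ?_ p
  exact (((Commute.refl _).smul_right _).sub_right (h1.smul_right _)).smul_right _

lemma IsUq.Kpow_sq (hg : IsUq p g) : g .K ^ p * g .K ^ p = 1 := by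
  rw [← pow_add, ← two_mul, hg.K_pow]

/-- The images of the generators under the transposition of `U_q sl(2)`, which exchanges the
divided powers of `E` and `F` and fixes `K`. -/
def antiGen (p : ℕ) : Gen → (U p)ᵐᵒᵖ
  | .E => .op (U.gen p .F)
  | .F => .op (U.gen p .E)
  | .K => .op (U.gen p .K)
  | .Kinv => .op (U.gen p .Kinv)
  | .e => .op ((-1 : ℂ) ^ p • (U.gen p .K ^ p * U.gen p .f))
  | .f => .op ((-1 : ℂ) ^ p • (U.gen p .K ^ p * U.gen p .e))
  | .h => .op (U.gen p .h)

lemma antiGen_isUq (hp : 2 ≤ p) : IsUq p (antiGen p) := by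
  have H := U.isUq p
  have ke := H.Kpow_e.eq
  have kf := H.Kpow_f.eq
  have kh := H.Kpow_h.eq
  have kE := H.Kpow_E hp
  have kF := H.Kpow_F hp
  have kb := H.Kpow_kBr.eq
  have kk := H.Kpow_sq
  have hq := q_ne p
  have s2 : ((-1 : ℂ) ^ p) * (-1) ^ p = 1 := sign_sq p
  have kFp : U.gen p .K ^ p * U.gen p .F ^ (p - 1) = U.gen p .F ^ (p - 1) * U.gen p .K ^ p :=
    (Commute.pow_right kF (p - 1)).eq
  have hb : kBr p (MulOpposite.op (U.gen p .K)) (MulOpposite.op (U.gen p .Kinv)) =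
      MulOpposite.op (kBr p (U.gen p .K) (U.gen p .Kinv)) := rfl
  have Kκ : U.gen p .K * U.gen p .K ^ p = U.gen p .K ^ p * U.gen p .K := by
    rw [← pow_succ, ← pow_succ']
  constructor <;> apply MulOpposite.unop_injective <;>
    simp only [antiGen, hb, MulOpposite.unop_mul, MulOpposite.unop_op, MulOpposite.unop_sub,
      MulOpposite.unop_smul, MulOpposite.unop_one, MulOpposite.unop_pow, MulOpposite.unop_zero,
      MulOpposite.unop_neg]
  · exact H.Kinv_K
  · exact H.K_Kinv
  · rw [H.K_F, smul_smul]; field_simp; rw [one_smul]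
  · rw [H.K_E, smul_smul]; field_simp; rw [one_smul]
  · exact H.E_F
  · exact H.F_pow
  · exact H.E_pow
  · exact H.K_pow
  · rw [mul_smul_comm, smul_mul_assoc, ← smul_sub, ← mul_assoc, ← kh, mul_assoc, mul_assoc,
      ← mul_sub, ← neg_sub, H.h_f, neg_neg]
  · rw [mul_smul_comm, smul_mul_assoc, ← smul_sub, ← mul_assoc, ← kh, mul_assoc, mul_assoc,
      ← mul_sub, ← neg_sub, H.h_e, mul_neg, smul_neg]
  · have h1 : U.gen p .K ^ p * U.gen p .e * (U.gen p .K ^ p * U.gen p .f) =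
        U.gen p .e * U.gen p .f := by
      rw [ke, mul_assoc, ← mul_assoc (U.gen p .K ^ p), kk, one_mul]
    have h2 : U.gen p .K ^ p * U.gen p .f * (U.gen p .K ^ p * U.gen p .e) =
        U.gen p .f * U.gen p .e := by
      rw [kf, mul_assoc, ← mul_assoc (U.gen p .K ^ p), kk, one_mul]
    simp only [smul_mul_assoc, mul_smul_comm, smul_smul, s2, one_smul, h1, h2]
    exact H.e_f
  · rw [smul_mul_assoc, mul_smul_comm, mul_assoc, ← H.K_f, ← mul_assoc, ← mul_assoc, Kκ]
  · rw [smul_mul_assoc, mul_smul_comm, mul_assoc, ← H.K_e, ← mul_assoc, ← mul_assoc, Kκ]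
  · rw [smul_mul_assoc, mul_smul_comm, mul_assoc, ← H.F_f, ← mul_assoc, ← mul_assoc, kF]
  · rw [smul_mul_assoc, mul_smul_comm, mul_assoc, ← H.E_e, ← mul_assoc, ← mul_assoc, kE]
  · rw [smul_mul_assoc, mul_smul_comm, ← smul_sub, ← mul_assoc, ← kE, mul_assoc, mul_assoc,
      ← mul_sub, ← neg_sub, H.E_f, mul_neg, mul_smul_comm, smul_neg, smul_smul, ← neg_smul]
    congr 1
    · linear_combination (qFact p (p - 1))⁻¹ * s2
    · rw [← mul_assoc, kFp, mul_assoc, kb]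
  · rw [smul_mul_assoc, mul_smul_comm, ← smul_sub, ← mul_assoc, ← kF, mul_assoc, mul_assoc,
      ← mul_sub, ← neg_sub, H.F_e, mul_neg, mul_smul_comm, smul_neg, smul_smul, ← neg_smul]
    congr 1
    · ring
    · rw [← mul_assoc, ← mul_assoc, kk, one_mul]

end anti

/-- The transposition of `U_q sl(2)`, an anti-automorphism. -/
def uAnti {p : ℕ} (hp : 2 ≤ p) : U p →ₐ[ℂ] (U p)ᵐᵒᵖ :=
  U.lift (antiGen p) (antiGen_isUq hp)

/-! ### The spin chain as a module over the quantum group -/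

/-- The spin chain `H_N = (ℂ²)^{⊗N}`: `H_{n+1} = ℂ² ⊗ H_n` is written as the space of pairs
`(u, d)`, standing for `v_+ ⊗ u + v_- ⊗ d`. -/
def Chain : ℕ → Type
  | 0 => ℂ
  | n + 1 => Chain n × Chain n

instance instChainGroup : ∀ n, AddCommGroup (Chain n)
  | 0 => inferInstanceAs (AddCommGroup ℂ)
  | n + 1 => @Prod.instAddCommGroup _ _ (instChainGroup n) (instChainGroup n)

instance instChainModule : ∀ n, Module ℂ (Chain n)
  | 0 => inferInstanceAs (Module ℂ ℂ)
  | n + 1 => @Prod.instModule ℂ _ _ _ _ _ (instChainModule n) (instChainModule n)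

/-- The operator on `H_{n+1} = ℂ² ⊗ H_n` with the block matrix `[[a, b], [c, d]]`. -/
def blk {n : ℕ} (a b c d : Module.End ℂ (Chain n)) : Module.End ℂ (Chain (n + 1)) :=
  LinearMap.prod (LinearMap.coprod a b) (LinearMap.coprod c d)

section blk

variable {n : ℕ} (a b c d a' b' c' d' : Module.End ℂ (Chain n))

lemma blk_apply (x : Chain (n + 1)) : blk a b c d x = (a x.1 + b x.2, c x.1 + d x.2) := rfl

lemma blk_mul : blk a b c d * blk a' b' c' d' =
    blk (a * a' + b * c') (a * b' + b * d') (c * a' + d * c') (c * b' + d * d') := by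
  refine LinearMap.ext fun x => Prod.ext ?_ ?_
  · change a (a' x.1 + b' x.2) + b (c' x.1 + d' x.2) =
      (a (a' x.1) + b (c' x.1)) + (a (b' x.2) + b (d' x.2))
    rw [map_add, map_add]; abel
  · change c (a' x.1 + b' x.2) + d (c' x.1 + d' x.2) =
      (c (a' x.1) + d (c' x.1)) + (c (b' x.2) + d (d' x.2))
    rw [map_add, map_add]; abel

lemma blk_add : blk a b c d + blk a' b' c' d' = blk (a + a') (b + b') (c + c') (d + d') := by
  refine LinearMap.ext fun x => ?_
  refine Prod.ext ?_ ?_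
  · change (a x.1 + b x.2) + (a' x.1 + b' x.2) = (a + a') x.1 + (b + b') x.2
    simp only [LinearMap.add_apply]; abel
  · change (c x.1 + d x.2) + (c' x.1 + d' x.2) = (c + c') x.1 + (d + d') x.2
    simp only [LinearMap.add_apply]; abel

lemma blk_smul (z : ℂ) : z • blk a b c d = blk (z • a) (z • b) (z • c) (z • d) := by
  refine LinearMap.ext fun x => ?_
  refine Prod.ext ?_ ?_
  · change z • (a x.1 + b x.2) = z • a x.1 + z • b x.2
    rw [smul_add]
  · change z • (c x.1 + d x.2) = z • c x.1 + z • d x.2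
    rw [smul_add]

lemma blk_one : blk (1 : Module.End ℂ (Chain n)) 0 0 1 = 1 := by
  refine LinearMap.ext fun x => ?_
  simp [blk_apply]; rfl

lemma blk_zero : blk (0 : Module.End ℂ (Chain n)) 0 0 0 = 0 := by
  refine LinearMap.ext fun x => ?_
  simp [blk_apply]; rfl

lemma blk_sum {κ : Type*} (s : Finset κ) (f₁ f₂ f₃ f₄ : κ → Module.End ℂ (Chain n)) :
    ∑ i ∈ s, blk (f₁ i) (f₂ i) (f₃ i) (f₄ i) =
      blk (∑ i ∈ s, f₁ i) (∑ i ∈ s, f₂ i) (∑ i ∈ s, f₃ i) (∑ i ∈ s, f₄ i) := by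
  classical
  induction s using Finset.induction_on with
  | empty => simp [blk_zero]
  | insert i s hi ih => simp only [Finset.sum_insert hi, ih, blk_add]

end blk

/-- The diagonal operator that multiplies a product of basis vectors of total weight `w` (the
number of `v_+` minus the number of `v_-`) by `φ w`. -/
def chainDiag : (n : ℕ) → (ℤ → ℂ) → Module.End ℂ (Chain n)
  | 0, φ => φ 0 • (1 : Module.End ℂ (Chain 0))
  | n + 1, φ => blk (chainDiag n fun x => φ (x + 1)) 0 0 (chainDiag n fun x => φ (x - 1))

/-- The divided power `E^a/[a]!` on the spin chain, for the coproduct `ΔE = E ⊗ 1 + K ⊗ E`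
(it is zero for negative `a`). -/
def chainE (p : ℕ) : (n : ℕ) → ℤ → Module.End ℂ (Chain n)
  | 0, a => (if a = 0 then 1 else 0 : Module.End ℂ (Chain 0))
  | n + 1, a => blk (q p ^ a • chainE p n a) (chainE p n (a - 1)) 0 (q p ^ (-a) • chainE p n a)

/-- The divided power `F^a/[a]!` on the spin chain, for the coproduct `ΔF = F ⊗ K⁻¹ + 1 ⊗ F`
(it is zero for negative `a`). -/
def chainF (p : ℕ) : (n : ℕ) → ℤ → Module.End ℂ (Chain n)
  | 0, a => (if a = 0 then 1 else 0 : Module.End ℂ (Chain 0))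
  | n + 1, a => blk (chainF p n a) 0
      (q p ^ (a - 1) • (chainF p n (a - 1) * chainDiag n fun x => q p ^ (-x))) (chainF p n a)

/-- The action of the generators of `U_q sl(2)` on the spin chain `H_N`, the `N`-fold tensor power
of the fundamental module `X_{2,1} = ℂ v_+ ⊕ ℂ v_-`. -/
def chainGen (p N : ℕ) : Gen → Module.End ℂ (Chain N)
  | .K => chainDiag N fun x => q p ^ x
  | .Kinv => chainDiag N fun x => q p ^ (-x)
  | .E => chainE p N 1
  | .F => chainF p N 1
  | .e => (chainDiag N fun x => q p ^ x) ^ p * chainE p N p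
  | .f => (-1 : ℂ) ^ p • chainF p N p
  | .h => (2 : ℂ)⁻¹ • ((chainDiag N fun x => q p ^ x) ^ p * chainE p N p *
      ((-1 : ℂ) ^ p • chainF p N p) - (-1 : ℂ) ^ p • chainF p N p *
      ((chainDiag N fun x => q p ^ x) ^ p * chainE p N p))

section chain

variable {p : ℕ}

/-- The `q`-binomial coefficient `[x choose t]` for `t ≤ p`. -/
def qBin (p : ℕ) (x : ℤ) (t : ℕ) : ℂ :=
  if t < p then (∏ i ∈ Finset.range t, qInt p (x - i)) * (qFact p t)⁻¹
  else (-1) ^ (x + p) * ((x / p : ℤ) : ℂ)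

lemma qBin_p (x : ℤ) : qBin p x p = (-1) ^ (x + p) * ((x / p : ℤ) : ℂ) := by simp [qBin]

lemma qBin_zero (hp : 2 ≤ p) (x : ℤ) : qBin p x 0 = 1 := by
  simp [qBin, qFact, (by omega : 0 < p)]

lemma qBin_one (hp : 2 ≤ p) (x : ℤ) : qBin p x 1 = qInt p x := by
  simp [qBin, qFact, (by omega : 1 < p), qInt_one hp]

lemma qBin_pred (hp : 2 ≤ p) (x : ℤ) : qBin p x (p - 1) =
    if (p : ℤ) ∣ x + 1 then (-1) ^ (x + p + (x + 1) / p) else 0 := by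
  have h : ∏ i ∈ Finset.range (p - 1), qInt p (x - i) =
      ∏ i ∈ Finset.range (p - 1), qInt p ((x + 1 - p) + (i + 1)) := by
    rw [← Finset.prod_range_reflect]
    refine Finset.prod_congr rfl fun i hi => ?_
    rw [Finset.mem_range] at hi
    congr 1
    omega
  have hF := qFact_ne hp (n := p - 1) (by omega)
  rw [qBin, if_pos (by omega), h, prod_qInt_pred hp]
  have h2 : (p : ℤ) ∣ x + 1 - p ↔ (p : ℤ) ∣ x + 1 := by
    constructor
    · intro h; simpa using dvd_add h (dvd_refl (p : ℤ))
    · intro h; exact dvd_sub h (dvd_refl _)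
  simp only [h2]
  split_ifs with h3
  · rw [mul_assoc, mul_inv_cancel₀ hF, mul_one]
    have : (x + 1 - p) / (p : ℤ) = (x + 1) / p - 1 := by
      rw [Int.sub_ediv_of_dvd _ (dvd_refl _), Int.ediv_self (by omega)]
    rw [this]
    exact neg_one_zpow_congr (c := -p) (by ring)
  · simp

lemma qBin_succ (hp : 2 ≤ p) (x : ℤ) {t : ℕ} (ht : t + 1 ≤ p) :
    qBin p (x + 1) (t + 1) = q p ^ ((t : ℤ) + 1) * qBin p x (t + 1) +
      q p ^ ((t : ℤ) - x) * qBin p x t := by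
  have hq := q_ne p
  have hq' := q_sub_ne hp
  rcases ht.lt_or_eq with h | h
  · have h1 := qFact_ne hp h
    rw [qFact_succ] at h1
    have h2 := left_ne_zero_of_mul h1
    have h3 := right_ne_zero_of_mul h1
    have key : qInt p (x + 1) = q p ^ ((t : ℤ) + 1) * qInt p (x - t) +
        q p ^ ((t : ℤ) - x) * qInt p (t + 1) := by
      simp only [qInt]
      rw [← mul_div_assoc, ← mul_div_assoc, ← add_div]
      congr 1
      simp only [mul_sub, ← zpow_add₀ hq]
      ring_nf
    rw [qBin, if_pos h, qBin, if_pos h, qBin, if_pos (by omega), Finset.prod_range_succ',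
      Finset.prod_range_succ, qFact_succ]
    have : ∀ i ∈ Finset.range t, qInt p (x + 1 - ((i + 1 : ℕ) : ℤ)) = qInt p (x - i) := by
      intro i _; congr 1; push_cast; ring
    rw [Finset.prod_congr rfl this, Nat.cast_zero, sub_zero, key]
    field_simp
  · subst h
    have e3 := ediv_sub_one hp (x + 1)
    rw [add_sub_cancel_right] at e3
    have h4 := qBin_pred hp x
    rw [Nat.add_sub_cancel] at h4
    have h5 := q_pow_p hp
    push_cast at h5
    rw [qBin_p, qBin_p, h4, e3, h5]
    split_ifs with h
    · have e6 : (t : ℤ) - x = 0 + (1 - (x + 1) / ((t + 1 : ℕ) : ℤ)) * ((t + 1 : ℕ) : ℤ) := by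
        have := Int.ediv_mul_cancel h
        rw [sub_mul, this]; push_cast; ring
      rw [e6, q_shift hp, zpow_zero, mul_one, ← zpow_add₀ (by norm_num)]
      have : (-1 : ℂ) ^ (1 - (x + 1) / ((t + 1 : ℕ) : ℤ) +
          (x + ((t + 1 : ℕ) : ℤ) + (x + 1) / ((t + 1 : ℕ) : ℤ))) =
          (-1 : ℂ) ^ (x + 1 + ((t + 1 : ℕ) : ℤ)) := by congr 1; ring
      rw [this, add_right_comm, zpow_add_one₀ (by norm_num)]
      push_cast; ring
    · rw [add_right_comm, zpow_add_one₀ (by norm_num)]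
      push_cast; ring

lemma qBin_succ' (hp : 2 ≤ p) (x : ℤ) {t : ℕ} (ht : t + 1 ≤ p) :
    qBin p (x + 1) (t + 1) = q p ^ (-((t : ℤ) + 1)) * qBin p x (t + 1) +
      q p ^ (x - (t : ℤ)) * qBin p x t := by
  have hq := q_ne p
  have hq' := q_sub_ne hp
  rcases ht.lt_or_eq with h | h
  · have h1 := qFact_ne hp h
    rw [qFact_succ] at h1
    have h2 := left_ne_zero_of_mul h1
    have h3 := right_ne_zero_of_mul h1
    have key : qInt p (x + 1) = q p ^ (-((t : ℤ) + 1)) * qInt p (x - t) +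
        q p ^ (x - (t : ℤ)) * qInt p (t + 1) := by
      simp only [qInt]
      rw [← mul_div_assoc, ← mul_div_assoc, ← add_div]
      congr 1
      simp only [mul_sub, ← zpow_add₀ hq]
      ring_nf
    rw [qBin, if_pos h, qBin, if_pos h, qBin, if_pos (by omega), Finset.prod_range_succ',
      Finset.prod_range_succ, qFact_succ]
    have : ∀ i ∈ Finset.range t, qInt p (x + 1 - ((i + 1 : ℕ) : ℤ)) = qInt p (x - i) := by
      intro i _; congr 1; push_cast; ring
    rw [Finset.prod_congr rfl this, Nat.cast_zero, sub_zero, key]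
    field_simp
  · subst h
    have e3 := ediv_sub_one hp (x + 1)
    rw [add_sub_cancel_right] at e3
    have h4 := qBin_pred hp x
    rw [Nat.add_sub_cancel] at h4
    have h5 := q_pow_p hp
    push_cast at h5
    rw [qBin_p, qBin_p, h4, e3, zpow_neg, h5]
    split_ifs with h
    · have e6 : x - (t : ℤ) = 0 + ((x + 1) / ((t + 1 : ℕ) : ℤ) - 1) * ((t + 1 : ℕ) : ℤ) := by
        have := Int.ediv_mul_cancel h
        rw [sub_mul, this]; push_cast; ring
      rw [e6, q_shift hp, zpow_zero, mul_one, ← zpow_add₀ (by norm_num)]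
      have : (-1 : ℂ) ^ ((x + 1) / ((t + 1 : ℕ) : ℤ) - 1 +
          (x + ((t + 1 : ℕ) : ℤ) + (x + 1) / ((t + 1 : ℕ) : ℤ))) =
          (-1 : ℂ) ^ (x + 1 + ((t + 1 : ℕ) : ℤ)) :=
        neg_one_zpow_congr (c := (x + 1) / ((t + 1 : ℕ) : ℤ) - 1) (by ring)
      rw [this, add_right_comm, zpow_add_one₀ (by norm_num)]
      push_cast; ring
    · rw [add_right_comm, zpow_add_one₀ (by norm_num)]
      push_cast; ring

/-- For `t < p` the `q`-binomial coefficients are periodic up to a sign. -/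
lemma qBin_shift (hp : 2 ≤ p) (x : ℤ) {t : ℕ} (ht : t < p) :
    qBin p (x + p) t = (-1) ^ t * qBin p x t := by
  rw [qBin, if_pos ht, qBin, if_pos ht, ← mul_assoc]
  congr 1
  have : ∀ i ∈ Finset.range t, qInt p (x + p - i) = (-1) * qInt p (x - i) := fun i _ => by
    rw [show x + (p : ℤ) - i = (x - i) + p by ring, qInt_shift_one hp]; ring
  rw [Finset.prod_congr rfl this, Finset.prod_mul_distrib, Finset.prod_const, Finset.card_range]

lemma qBin_zero_left (hp : 2 ≤ p) {t : ℕ} (h0 : t ≠ 0) : qBin p 0 t = 0 := by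
  obtain ⟨j, rfl⟩ : ∃ j, t = j + 1 := ⟨t - 1, by omega⟩
  rw [qBin]
  split_ifs
  · rw [Finset.prod_range_succ']; simp [qInt_zero]
  · simp

lemma diag_mul (n : ℕ) (φ ψ : ℤ → ℂ) :
    chainDiag n φ * chainDiag n ψ = chainDiag n fun x => φ x * ψ x := by
  induction n generalizing φ ψ with
  | zero =>
    simp [chainDiag, smul_smul, mul_comm]
  | succ n ih => simp [chainDiag, blk_mul, ih]

lemma diag_smul (n : ℕ) (z : ℂ) (φ : ℤ → ℂ) :
    z • chainDiag n φ = chainDiag n fun x => z * φ x := by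
  induction n generalizing φ with
  | zero => simp [chainDiag, smul_smul]
  | succ n ih => simp [chainDiag, blk_smul, ih]

lemma diag_add (n : ℕ) (φ ψ : ℤ → ℂ) :
    chainDiag n φ + chainDiag n ψ = chainDiag n fun x => φ x + ψ x := by
  induction n generalizing φ ψ with
  | zero => simp [chainDiag, add_smul]
  | succ n ih => simp [chainDiag, blk_add, ih]

lemma diag_one (n : ℕ) : (chainDiag n fun _ => 1) = 1 := by
  induction n with
  | zero => exact one_smul ℂ _
  | succ n ih => simp [chainDiag, blk_one, ih]

lemma diag_pow (n : ℕ) (φ : ℤ → ℂ) (j : ℕ) :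
    chainDiag n φ ^ j = chainDiag n fun x => φ x ^ j := by
  induction j with
  | zero => simp [diag_one]
  | succ j ih => simp only [pow_succ, ih, diag_mul]

lemma diag_E (n : ℕ) (φ : ℤ → ℂ) (a : ℤ) :
    chainDiag n φ * chainE p n a = chainE p n a * chainDiag n fun x => φ (x + 2 * a) := by
  induction n generalizing φ a with
  | zero =>
    by_cases h : a = 0
    · subst h; simp [chainDiag, chainE]
    · simp only [chainE, if_neg h, mul_zero, zero_mul]
  | succ n ih =>
    simp only [chainDiag, chainE, blk_mul, zero_mul, mul_zero, add_zero, zero_add, smul_mul_assoc,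
      mul_smul_comm, ih, smul_zero]
    congr 3 <;> congr 1 <;> funext x <;> congr 1 <;> ring

lemma diag_F (n : ℕ) (φ : ℤ → ℂ) (a : ℤ) :
    chainDiag n φ * chainF p n a = chainF p n a * chainDiag n fun x => φ (x - 2 * a) := by
  induction n generalizing φ a with
  | zero =>
    by_cases h : a = 0
    · subst h; simp [chainDiag, chainF]
    · simp only [chainF, if_neg h, mul_zero, zero_mul]
  | succ n ih =>
    simp only [chainDiag, chainF, blk_mul, zero_mul, mul_zero, add_zero, zero_add, smul_mul_assoc,
      mul_smul_comm, ih, ← mul_assoc]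
    simp only [mul_assoc, diag_mul, smul_zero, add_zero]
    congr 3 <;> (try congr 1) <;> funext x <;> ring_nf

lemma E_zero (n : ℕ) : chainE p n 0 = 1 ∧ ∀ a < 0, chainE p n a = 0 := by
  induction n with
  | zero => exact ⟨rfl, fun a ha => by rw [chainE, if_neg ha.ne]⟩
  | succ n ih =>
    refine ⟨?_, fun a ha => ?_⟩
    · rw [chainE, ih.1, ih.2 _ (by norm_num)]; simp [blk_one]
    · rw [chainE, ih.2 a ha, ih.2 _ (by omega)]; simp [blk_zero]

lemma F_zero (n : ℕ) : chainF p n 0 = 1 ∧ ∀ a < 0, chainF p n a = 0 := by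
  induction n with
  | zero => exact ⟨rfl, fun a ha => by rw [chainF, if_neg ha.ne]⟩
  | succ n ih =>
    refine ⟨?_, fun a ha => ?_⟩
    · rw [chainF, ih.1, ih.2 _ (by norm_num)]; simp [blk_one]
    · rw [chainF, ih.2 a ha, ih.2 _ (by omega)]; simp [blk_zero]

lemma E_mul (hp : 2 ≤ p) (n : ℕ) (a : ℤ) {b : ℕ} (hb : b ≤ p) :
    chainE p n a * chainE p n b = qBin p (a + b) b • chainE p n (a + b) := by
  induction n generalizing a b with
  | zero =>
    by_cases h : b = 0
    · subst h; simp [chainE, qBin_zero hp]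
    · have h' : (b : ℤ) ≠ 0 := by omega
      simp only [chainE, if_neg h', mul_zero]
      split_ifs with h2
      · rw [h2, qBin_zero_left hp h, zero_smul]
      · rw [smul_zero]
  | succ n ih =>
    rcases Nat.eq_zero_or_pos b with rfl | h0
    · rw [Nat.cast_zero, (E_zero _).1, mul_one, add_zero, qBin_zero hp, one_smul]
    · obtain ⟨j, rfl⟩ : ∃ j, b = j + 1 := ⟨b - 1, by omega⟩
      have hq := q_ne p
      have e1 : ((j + 1 : ℕ) : ℤ) - 1 = (j : ℕ) := by push_cast; ring
      simp only [chainE, blk_mul, zero_mul, mul_zero, add_zero, zero_add, smul_mul_assoc,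
        mul_smul_comm, e1, ih _ hb, ih _ (by omega : j ≤ p), blk_smul, smul_smul, smul_zero]
      have e2 : a - 1 + ((j + 1 : ℕ) : ℤ) = a + j := by push_cast; ring
      have e3 : a + ((j + 1 : ℕ) : ℤ) - 1 = a + j := by push_cast; ring
      have e4 : a + ((j + 1 : ℕ) : ℤ) = a + j + 1 := by push_cast; ring
      rw [e2, e3, ← add_smul, e4, qBin_succ' hp _ hb, neg_add, neg_add]
      congr 2
      · simp only [zpow_add₀ hq, Nat.cast_add, Nat.cast_one]; ring
      · simp only [zpow_add₀ hq, neg_add, Nat.cast_add, Nat.cast_one]; ring_nf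
      · simp only [zpow_add₀ hq, neg_add, Nat.cast_add, Nat.cast_one]; ring

lemma F_mul (hp : 2 ≤ p) (n : ℕ) (a : ℤ) {b : ℕ} (hb : b ≤ p) :
    chainF p n a * chainF p n b = qBin p (a + b) b • chainF p n (a + b) := by
  induction n generalizing a b with
  | zero =>
    by_cases h : b = 0
    · subst h; simp [chainF, qBin_zero hp]
    · have h' : (b : ℤ) ≠ 0 := by omega
      simp only [chainF, if_neg h', mul_zero]
      split_ifs with h2
      · rw [h2, qBin_zero_left hp h, zero_smul]
      · rw [smul_zero]
  | succ n ih =>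
    rcases Nat.eq_zero_or_pos b with rfl | h0
    · rw [Nat.cast_zero, (F_zero _).1, mul_one, add_zero, qBin_zero hp, one_smul]
    · obtain ⟨j, rfl⟩ : ∃ j, b = j + 1 := ⟨b - 1, by omega⟩
      have hq := q_ne p
      have e1 : ((j + 1 : ℕ) : ℤ) - 1 = (j : ℕ) := by push_cast; ring
      have e2 : a - 1 + ((j + 1 : ℕ) : ℤ) = a + j := by push_cast; ring
      have e3 : a + ((j + 1 : ℕ) : ℤ) - 1 = a + j := by push_cast; ring
      have e4 : a + ((j + 1 : ℕ) : ℤ) = a + j + 1 := by push_cast; ring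
      have e5 : (chainDiag n fun x => q p ^ (-(x - 2 * ((j + 1 : ℕ) : ℤ)))) =
          q p ^ (2 * ((j + 1 : ℕ) : ℤ)) • chainDiag n fun x => q p ^ (-x) := by
        rw [diag_smul]; congr 1; funext x; rw [← zpow_add₀ hq]; congr 1; ring
      have e6 : chainF p n a * (chainF p n j * chainDiag n fun x => q p ^ (-x)) =
          (qBin p (a + j) j • chainF p n (a + j)) * chainDiag n fun x => q p ^ (-x) := by
        rw [← mul_assoc, ih _ (by omega)]
      have e7 : chainF p n (a - 1) * (chainDiag n fun x => q p ^ (-x)) * chainF p n (j + 1 : ℕ) =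
          q p ^ (2 * ((j + 1 : ℕ) : ℤ)) • ((qBin p (a + j) (j + 1) • chainF p n (a + j)) *
            chainDiag n fun x => q p ^ (-x)) := by
        rw [mul_assoc, diag_F, e5, mul_smul_comm, mul_smul_comm, ← mul_assoc, ih _ hb, e2]
      simp only [chainF, blk_mul, zero_mul, mul_zero, add_zero, zero_add, smul_mul_assoc,
        mul_smul_comm, e1, ih _ hb, e6, e7, blk_smul, smul_smul, smul_zero]
      rw [e3, ← add_smul, e4, qBin_succ hp _ hb]
      congr 2
      simp only [zpow_add₀ hq, zpow_sub₀ hq, Nat.cast_add, Nat.cast_one, two_mul, mul_add]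
      have h1 := zpow_ne_zero a hq
      have h2 := zpow_ne_zero (j : ℤ) hq
      field_simp

/-- The powers of `E` in terms of its divided powers. -/
lemma E_pow (hp : 2 ≤ p) (n : ℕ) (a : ℕ) :
    chainE p n 1 ^ a = qFact p a • chainE p n a := by
  induction a with
  | zero => simp [(E_zero n).1, qFact]
  | succ a ih =>
    have := E_mul hp n a (b := 1) (by omega)
    rw [Nat.cast_one, qBin_one hp] at this
    rw [pow_succ, ih, smul_mul_assoc, this, smul_smul, qFact_succ, Nat.cast_add, Nat.cast_one]

/-- The powers of `F` in terms of its divided powers. -/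
lemma F_pow (hp : 2 ≤ p) (n : ℕ) (a : ℕ) :
    chainF p n 1 ^ a = qFact p a • chainF p n a := by
  induction a with
  | zero => simp [(F_zero n).1, qFact]
  | succ a ih =>
    have := F_mul hp n a (b := 1) (by omega)
    rw [Nat.cast_one, qBin_one hp] at this
    rw [pow_succ, ih, smul_mul_assoc, this, smul_smul, qFact_succ, Nat.cast_add, Nat.cast_one]

end chain

section chain

variable {p : ℕ}

lemma diag_zero_apply (φ : ℤ → ℂ) : chainDiag 0 φ = φ 0 • (1 : Module.End ℂ (Chain 0)) := rfl

lemma diag_sub (n : ℕ) (φ ψ : ℤ → ℂ) :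
    chainDiag n φ - chainDiag n ψ = chainDiag n fun x => φ x - ψ x := by
  rw [sub_eq_iff_eq_add, diag_add]; simp

/-- The commutation formula for divided powers on the spin chain. -/
lemma E_F (hp : 2 ≤ p) (N : ℕ) (m n : ℤ) (hn : n ≤ p ∨ m ≤ p) :
    chainE p N m * chainF p N n = ∑ t ∈ Finset.range (p + 1),
      chainF p N (n - t) * chainE p N (m - t) * chainDiag N fun x => qBin p (x + m - n) t := by
  induction N generalizing m n with
  | zero =>
    rw [Finset.sum_range_succ']
    have h : ∀ t ∈ Finset.range p, chainF p 0 (n - (t + 1 : ℕ)) * chainE p 0 (m - (t + 1 : ℕ)) *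
        (chainDiag 0 fun x => qBin p (x + m - n) (t + 1)) = 0 := by
      intro t _
      rw [diag_zero_apply]
      simp only [chainE, chainF]
      split_ifs with h1 h2
      · have : (0 : ℤ) + m - n = 0 := by omega
        rw [this, qBin_zero_left hp (by omega)]; simp
      all_goals simp
    rw [Finset.sum_congr rfl h, Finset.sum_const_zero, zero_add, diag_zero_apply]
    simp only [qBin_zero hp, Nat.cast_zero, sub_zero, one_smul, mul_one, chainE, chainF]
    split_ifs <;> simp
  | succ N ih =>
    have hq := q_ne p
    have hD (a : ℤ) (φ : ℤ → ℂ) : (chainDiag N fun x => q p ^ (-x)) * (chainE p N a *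
        chainDiag N φ) = chainE p N a * (chainDiag N fun x => q p ^ (-x - 2 * a) * φ x) := by
      rw [← mul_assoc, diag_E, mul_assoc, diag_mul]
      congr 2; funext x; ring_nf
    simp only [chainE, chainF, chainDiag, blk_mul, blk_sum, zero_mul, mul_zero, add_zero,
      zero_add, smul_mul_assoc, mul_smul_comm, add_mul]
    congr 1
    · rw [ih m n hn, ← mul_assoc, ih (m - 1) (n - 1) (by omega)]
      rw [Finset.sum_range_succ', Finset.sum_range_succ _ p, Finset.sum_range_succ' _ p]
      have h0 : chainF p N (n - 1 - p) * chainE p N (m - 1 - p) = 0 := by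
        rcases hn with h | h
        · rw [(F_zero N).2 _ (by omega), zero_mul]
        · rw [(E_zero N).2 _ (by omega), mul_zero]
      rw [h0, zero_mul, add_zero, smul_add, add_right_comm, Finset.smul_sum,
        Finset.sum_mul, Finset.smul_sum, ← Finset.sum_add_distrib]
      congr 1
      · refine Finset.sum_congr rfl fun t ht => ?_
        rw [Finset.mem_range] at ht
        have e1 : n - ((t + 1 : ℕ) : ℤ) = n - 1 - t := by push_cast; ring
        have e2 : m - ((t + 1 : ℕ) : ℤ) = m - 1 - t := by push_cast; ring
        rw [e1, e2, mul_assoc _ (chainDiag N _), diag_mul, ← mul_smul_comm, ← mul_smul_comm,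
          ← mul_add, ← mul_smul_comm, diag_smul, diag_smul, diag_smul, diag_add]
        congr 2; funext x
        have e3 : x + 1 + m - n = (x + m - n) + 1 := by ring
        have e4 : x + (m - 1) - (n - 1) = x + m - n := by ring
        have e5 : n - 1 - x = (m - 1 - t) + (t - (x + m - n)) := by ring
        have e6 : m = (m - 1 - t) + (t + 1) := by ring
        have e7 : q p ^ (n - 1) * q p ^ (-x) = q p ^ (m - 1 - t) * q p ^ (t - (x + m - n)) := by
          rw [← zpow_add₀ hq, ← zpow_add₀ hq, ← e5]; rfl
        have e8 : q p ^ m = q p ^ (m - 1 - t) * q p ^ ((t : ℤ) + 1) := by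
          rw [← zpow_add₀ hq, ← e6]
        rw [e3, e4, qBin_succ hp _ ht, e8]
        linear_combination qBin p (x + m - n) t * e7
      · simp [qBin_zero hp]
    · rw [ih (m - 1) n (by omega)]
      refine Finset.sum_congr rfl fun t _ => ?_
      have e1 : m - 1 - (t : ℤ) = m - t - 1 := by ring
      rw [e1, smul_zero, add_zero]
      congr 2; funext x
      congr 1; ring
    · rw [← mul_assoc, ih m (n - 1) (by omega), Finset.sum_mul, Finset.smul_sum, Finset.smul_sum]
      refine Finset.sum_congr rfl fun t _ => ?_
      have e1 : n - 1 - (t : ℤ) = n - t - 1 := by ring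
      simp only [mul_assoc, diag_mul, hD, e1, ← mul_smul_comm, diag_smul]
      congr 3; funext x
      have e3 : x + m - (n - 1) = x + 1 + m - n := by ring
      have e4 : q p ^ (-m) * (q p ^ (n - 1) * q p ^ (-x)) =
          q p ^ (n - t - 1) * (q p ^ (m - t) * q p ^ (-x - 2 * (m - t))) := by
        simp only [← zpow_add₀ hq]; congr 1; ring
      rw [e3]
      linear_combination qBin p (x + 1 + m - n) t * e4
    · rw [ih m n hn]
      rw [Finset.sum_range_succ', Finset.sum_add_distrib, Finset.sum_range_succ _ p,
        Finset.sum_range_succ' _ p]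
      have h0 : chainF p N (n - p - 1) * (chainDiag N fun x => q p ^ (-x)) *
          chainE p N (m - p - 1) = 0 := by
        rcases hn with h | h
        · rw [(F_zero N).2 _ (by omega), zero_mul, zero_mul]
        · rw [(E_zero N).2 _ (by omega), mul_zero]
      rw [h0, zero_mul, smul_zero, add_zero, smul_add, ← add_assoc,
        Finset.smul_sum, ← Finset.sum_add_distrib]
      congr 1
      · refine Finset.sum_congr rfl fun t ht => ?_
        rw [Finset.mem_range] at ht
        have e1 : n - ((t + 1 : ℕ) : ℤ) = n - 1 - t := by push_cast; ring
        have e2 : m - ((t + 1 : ℕ) : ℤ) = m - 1 - t := by push_cast; ring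
        have e3 : n - (t : ℤ) - 1 = n - 1 - t := by ring
        have e4 : m - (t : ℤ) - 1 = m - 1 - t := by ring
        simp only [e1, e2, e3, e4, mul_assoc, hD, ← mul_smul_comm, ← mul_add, diag_smul, diag_add]
        congr 3; funext x
        have e5 : x - 1 + m - n = (x + m - n) - 1 := by ring
        have e6 : q p ^ (n - 1 - t) * q p ^ (-x - 2 * (m - 1 - t)) =
            q p ^ (-m) * q p ^ ((t : ℤ) - (x + m - n - 1)) := by
          simp only [← zpow_add₀ hq]; congr 1; ring
        have e7 : q p ^ (-(m - 1 - (t : ℤ))) = q p ^ (-m) * q p ^ ((t : ℤ) + 1) := by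
          simp only [← zpow_add₀ hq]; congr 1; ring
        have e8 := qBin_succ hp (x + m - n - 1) ht
        rw [sub_add_cancel] at e8
        rw [e5, e8, e7]
        linear_combination - qBin p (x + m - n - 1) t * e6
      · simp [qBin_zero hp]

lemma qBin_self (hp : 2 ≤ p) {a : ℕ} (ha : a < p) : qBin p a a = 1 := by
  rw [qBin, if_pos ha, ← Finset.prod_range_reflect]
  have : ∏ i ∈ Finset.range a, qInt p ((a : ℤ) - ((a - 1 - i : ℕ) : ℤ)) = qFact p a := by
    refine Finset.prod_congr rfl fun i hi => ?_
    rw [Finset.mem_range] at hi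
    congr 1; omega
  rw [this, mul_inv_cancel₀ (qFact_ne hp ha)]

lemma sum_two (hp : 2 ≤ p) {R : Type*} [AddCommMonoid R] (f : ℕ → R)
    (h : ∀ t, 2 ≤ t → f t = 0) : ∑ t ∈ Finset.range (p + 1), f t = f 0 + f 1 := by
  obtain ⟨j, rfl⟩ : ∃ j, p = j + 1 := ⟨p - 1, by omega⟩
  rw [Finset.sum_range_succ', Finset.sum_range_succ', Finset.sum_eq_zero, zero_add, add_comm]
  intro t _
  exact h _ (by omega)

lemma E_F_one (hp : 2 ≤ p) (N : ℕ) (m : ℤ) : chainE p N m * chainF p N 1 =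
    chainF p N 1 * chainE p N m +
      chainE p N (m - 1) * chainDiag N fun x => qInt p (x + m - 1) := by
  rw [E_F hp N m 1 (Or.inl (by omega)), sum_two hp]
  · simp [qBin_zero hp, qBin_one hp, diag_one, (F_zero N).1]
  · intro t ht
    rw [(F_zero N).2 _ (by omega), zero_mul, zero_mul]

lemma E_one_F (hp : 2 ≤ p) (N : ℕ) (n : ℤ) : chainE p N 1 * chainF p N n =
    chainF p N n * chainE p N 1 +
      chainF p N (n - 1) * chainDiag N fun x => qInt p (x + 1 - n) := by
  rw [E_F hp N 1 n (Or.inr (by omega)), sum_two hp]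
  · simp [qBin_zero hp, qBin_one hp, diag_one, (E_zero N).1]
  · intro t ht
    rw [(E_zero N).2 (1 - (t : ℤ)) (by omega), mul_zero, zero_mul]

lemma qBin_p_succ (hp : 2 ≤ p) : qBin p ((p : ℤ) + 1) p = -1 := by
  have h1 : ((p : ℤ) + 1) / p = 1 := by
    rw [Int.ediv_eq_iff_of_pos (by omega)]; constructor <;> omega
  rw [qBin_p, h1, neg_one_zpow_congr (b := 1) (c := p) (by ring)]; norm_num

lemma qInt_p_succ (hp : 2 ≤ p) : qInt p ((p : ℤ) + 1) = -1 := by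
  rw [add_comm, qInt_shift_one hp, qInt_one hp]

lemma E_comm (hp : 2 ≤ p) (N : ℕ) : chainE p N 1 * chainE p N p = chainE p N p * chainE p N 1 := by
  have := E_mul hp N p (b := 1) (by omega)
  rw [Nat.cast_one] at this
  rw [E_mul hp N 1 le_rfl, this, qBin_one hp, add_comm (1 : ℤ), qBin_p_succ hp, qInt_p_succ hp]

lemma F_comm (hp : 2 ≤ p) (N : ℕ) : chainF p N 1 * chainF p N p = chainF p N p * chainF p N 1 := by
  have := F_mul hp N p (b := 1) (by omega)
  rw [Nat.cast_one] at this
  rw [F_mul hp N 1 le_rfl, this, qBin_one hp, add_comm (1 : ℤ), qBin_p_succ hp, qInt_p_succ hp]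

lemma kappa_eq (hp : 2 ≤ p) (N : ℕ) :
    (chainDiag N fun x => q p ^ x) ^ p = chainDiag N fun x => (-1) ^ x := by
  rw [diag_pow]
  congr 1; funext x
  have := q_shift hp x 0
  rw [zpow_zero, mul_one, zero_add, zpow_mul] at this
  exact_mod_cast this

lemma kappa_E (N : ℕ) (m : ℤ) : Commute (chainDiag N fun x => (-1) ^ x) (chainE p N m) := by
  rw [Commute, SemiconjBy, diag_E]
  congr 2; funext x; exact neg_one_zpow_congr rfl

lemma kappa_F (N : ℕ) (m : ℤ) : Commute (chainDiag N fun x => (-1) ^ x) (chainF p N m) := by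
  rw [Commute, SemiconjBy, diag_F]
  congr 2; funext x; exact neg_one_zpow_congr (c := -m) (by ring)

lemma kappa_sq (N : ℕ) : (chainDiag N fun x => (-1) ^ x) * (chainDiag N fun x => (-1) ^ x) = 1 := by
  rw [diag_mul, ← diag_one]
  congr 1; funext x; rw [← mul_zpow]; norm_num

lemma add_ediv (hp : 2 ≤ p) (a : ℤ) (c : ℤ) : (a + c * p) / (p : ℤ) = a / p + c :=
  Int.add_mul_ediv_right _ _ (by omega)

/-- The Serre-type relation for `E^p/[p]!` and `F^p/[p]!`, first half. -/
lemma EFE (hp : 2 ≤ p) (N : ℕ) :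
    (2 : ℂ) • (chainE p N p * chainF p N p * chainE p N p) -
      chainF p N p * (chainE p N p * chainE p N p) -
      (chainE p N p * chainE p N p) * chainF p N p =
    (2 * (-1) ^ p : ℂ) • (chainE p N p * chainDiag N fun x => (-1) ^ x) := by
  have g (t : ℕ) (h1 : t ≤ p) : chainE p N (p - t) * chainE p N p =
      (((-1) ^ (p + t) : ℂ) * (if t = 0 then 2 else 1)) • chainE p N (2 * p - t) := by
    have e1 : (p : ℤ) - t + p = 2 * p - t := by ring
    rw [E_mul hp N _ le_rfl, e1, qBin_p]
    congr 2
    · rw [← zpow_natCast]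
      exact neg_one_zpow_congr (c := p - t) (by push_cast; ring)
    · split_ifs with h0
      · subst h0
        have : (2 * (p : ℤ) - (0 : ℕ)) / p = 2 := by
          rw [Int.ediv_eq_iff_of_pos (by omega)]; constructor <;> push_cast <;> linarith
        rw [this]; norm_num
      · have : (2 * (p : ℤ) - t) / p = 1 := by
          rw [Int.ediv_eq_iff_of_pos (by omega)]; constructor <;> omega
        rw [this]; norm_num
  have g0 := g 0 (by omega)
  simp only [Nat.cast_zero, sub_zero, add_zero, if_true] at g0
  have s2 : ((-1 : ℂ) ^ p) * (-1) ^ p = 1 := sign_sq p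
  have key : ∀ t ∈ Finset.range (p + 1),
      (2 : ℂ) • (chainF p N (p - t) * chainE p N (p - t) *
        (chainDiag N fun x => qBin p (x + p - p) t) * chainE p N p) -
      ((-1) ^ p * 2 : ℂ) • (chainF p N (p - t) * chainE p N (2 * p - t) *
        chainDiag N fun x => qBin p (x + 2 * p - p) t) =
      (if t = 0 then ((-1) ^ p * 2 : ℂ) • (chainF p N p * chainE p N (2 * p)) else 0) +
      (if t = p then (2 * (-1) ^ p : ℂ) • (chainE p N p * chainDiag N fun x => (-1) ^ x)
        else 0) := by
    intro t ht
    rw [Finset.mem_range] at ht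
    have e1 : chainF p N (p - t) * chainE p N (p - t) *
        (chainDiag N fun x => qBin p (x + p - p) t) * chainE p N p =
        chainF p N (p - t) * chainE p N (2 * p - t) * chainDiag N fun x =>
          (((-1) ^ (p + t) : ℂ) * (if t = 0 then 2 else 1)) * qBin p (x + 2 * p) t := by
      rw [mul_assoc, diag_E, ← mul_assoc, mul_assoc (chainF p N _), g t (by omega), mul_smul_comm,
        smul_mul_assoc, ← mul_smul_comm, diag_smul]
      simp only [add_sub_cancel_right]
    rw [e1, ← mul_smul_comm, ← mul_smul_comm, ← mul_sub, diag_smul, diag_smul, diag_sub]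
    rcases Nat.eq_zero_or_pos t with rfl | h0
    · have h0p : (0 : ℕ) ≠ p := by omega
      have h1 : (fun _ : ℤ => (2 : ℂ) * ((-1) ^ p * 2 * 1) - (-1) ^ p * 2 * 1) =
          fun _ => ((-1) ^ p * 2) * 1 := by funext x; ring
      simp only [Nat.cast_zero, sub_zero, qBin_zero hp, if_true, add_zero, if_neg h0p]
      rw [h1, ← diag_smul, diag_one, mul_smul_comm, mul_one]
    · rw [if_neg (by omega), if_neg (by omega), zero_add]
      split_ifs with h1
      · subst h1
        have e2 (x : ℤ) : x + 2 * (t : ℤ) - t = x + t := by ring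
        have e4 (x : ℤ) : (x + (t : ℤ)) / t = x / t + 1 := by simpa using add_ediv hp x 1
        simp only [sub_self, (F_zero N).1, one_mul, e2, e4, qBin_p, add_ediv hp]
        have e3 : 2 * (t : ℤ) - t = t := by ring
        rw [e3, ← mul_smul_comm, diag_smul]
        congr 2; funext x
        have m1 : (-1 : ℂ) ^ (x + 2 * (t : ℤ) + t) = (-1) ^ x * (-1) ^ t := by
          rw [← zpow_natCast, ← zpow_add₀ (by norm_num)]
          exact neg_one_zpow_congr (c := t) (by ring)
        have m2 : (-1 : ℂ) ^ (x + (t : ℤ) + t) = (-1) ^ x :=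
          neg_one_zpow_congr (c := t) (by ring)
        rw [m1, m2, pow_add, s2]
        push_cast; ring
      · have e2 (x : ℤ) : x + 2 * (p : ℤ) - p = x + p := by ring
        have e3 (x : ℤ) : x + 2 * (p : ℤ) = x + p + p := by ring
        have : (fun x => (2 : ℂ) * ((-1) ^ (p + t) * 1 * qBin p (x + 2 * p) t) -
            ((-1) ^ p * 2) * qBin p (x + 2 * p - p) t) = fun x => 0 * qBin p x t := by
          funext x
          rw [e2, e3, qBin_shift hp _ (by omega), qBin_shift hp _ (by omega), pow_add]
          linear_combination (2 * (-1 : ℂ) ^ p * (-1) ^ t * qBin p x t) * sign_sq t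
        rw [this, ← diag_smul, zero_smul, mul_zero]
  rw [g0, smul_mul_assoc, E_F hp N p p (Or.inl le_rfl), E_F hp N (2 * p) p (Or.inl le_rfl),
    Finset.sum_mul, Finset.smul_sum, Finset.smul_sum, sub_right_comm, ← Finset.sum_sub_distrib,
    Finset.sum_congr rfl key, Finset.sum_add_distrib, Finset.sum_ite_eq', Finset.sum_ite_eq',
    if_pos (by simp), if_pos (by simp), mul_smul_comm, add_sub_cancel_left]

/-- The Serre-type relation for `E^p/[p]!` and `F^p/[p]!`, second half. -/
lemma FEF (hp : 2 ≤ p) (N : ℕ) :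
    (2 : ℂ) • (chainF p N p * (chainE p N p * chainF p N p)) -
      (chainF p N p * chainF p N p) * chainE p N p -
      chainE p N p * (chainF p N p * chainF p N p) =
    (2 * (-1) ^ p : ℂ) • (chainF p N p * chainDiag N fun x => (-1) ^ x) := by
  have g (t : ℕ) (h1 : t ≤ p) : chainF p N p * chainF p N (p - t) =
      (((-1) ^ (p + t) : ℂ) * (if t = 0 then 2 else 1)) • chainF p N (2 * p - t) := by
    have e0 : (p : ℤ) - t = (p - t : ℕ) := by omega
    have e1 : (p : ℤ) + (p - t : ℕ) = 2 * p - t := by omega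
    rw [e0, F_mul hp N _ (by omega), e1]
    congr 1
    split_ifs with h0
    · subst h0
      have : (2 * (p : ℤ)) / p = 2 := by
        rw [Int.ediv_eq_iff_of_pos (by omega)]; constructor <;> linarith
      rw [Nat.sub_zero, Nat.cast_zero, sub_zero, qBin_p, this, ← zpow_natCast]
      rw [neg_one_zpow_congr (b := p) (c := p) (by ring)]
      norm_num
    · have e2 : 2 * (p : ℤ) - t = (p - t : ℕ) + p := by omega
      rw [e2, qBin_shift hp _ (by omega), qBin_self hp (by omega), mul_one, mul_one,
        ← zpow_natCast, ← zpow_natCast]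
      exact neg_one_zpow_congr (c := - t) (by omega)
  have g0 := g 0 (by omega)
  simp only [Nat.cast_zero, sub_zero, add_zero, if_true] at g0
  have s2 : ((-1 : ℂ) ^ p) * (-1) ^ p = 1 := sign_sq p
  have key : ∀ t ∈ Finset.range (p + 1),
      (2 : ℂ) • (chainF p N p * (chainF p N (p - t) * chainE p N (p - t) *
        (chainDiag N fun x => qBin p (x + p - p) t))) -
      ((-1) ^ p * 2 : ℂ) • (chainF p N (2 * p - t) * chainE p N (p - t) *
        chainDiag N fun x => qBin p (x + p - 2 * p) t) =
      (if t = 0 then ((-1) ^ p * 2 : ℂ) • (chainF p N (2 * p) * chainE p N p) else 0) +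
      (if t = p then (2 * (-1) ^ p : ℂ) • (chainF p N p * chainDiag N fun x => (-1) ^ x)
        else 0) := by
    intro t ht
    rw [Finset.mem_range] at ht
    have e1 : chainF p N p * (chainF p N (p - t) * chainE p N (p - t) *
        (chainDiag N fun x => qBin p (x + p - p) t)) =
        chainF p N (2 * p - t) * chainE p N (p - t) * chainDiag N fun x =>
          (((-1) ^ (p + t) : ℂ) * (if t = 0 then 2 else 1)) * qBin p x t := by
      rw [← mul_assoc, ← mul_assoc, g t (by omega), smul_mul_assoc,
        smul_mul_assoc, ← mul_smul_comm, diag_smul]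
      simp only [add_sub_cancel_right]
    rw [e1, ← mul_smul_comm, ← mul_smul_comm, ← mul_sub, diag_smul, diag_smul, diag_sub]
    rcases Nat.eq_zero_or_pos t with rfl | h0
    · have h0p : (0 : ℕ) ≠ p := by omega
      have h1 : (fun _ : ℤ => (2 : ℂ) * ((-1) ^ p * 2 * 1) - (-1) ^ p * 2 * 1) =
          fun _ => ((-1) ^ p * 2) * 1 := by funext x; ring
      simp only [Nat.cast_zero, sub_zero, qBin_zero hp, if_true, add_zero, if_neg h0p]
      rw [h1, ← diag_smul, diag_one, mul_smul_comm, mul_one]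
    · rw [if_neg (by omega), if_neg (by omega), zero_add]
      split_ifs with h1
      · subst h1
        have e2 (x : ℤ) : x + (t : ℤ) - 2 * t = x + (-1) * t := by ring
        simp only [sub_self, (E_zero N).1, mul_one, e2, qBin_p, add_ediv hp]
        have e3 : 2 * (t : ℤ) - t = t := by ring
        rw [e3, ← mul_smul_comm, diag_smul]
        congr 2; funext x
        have m1 : (-1 : ℂ) ^ (x + (t : ℤ)) = (-1) ^ x * (-1) ^ t := by
          rw [zpow_add₀ (by norm_num), zpow_natCast]
        have m2 : (-1 : ℂ) ^ (x + -1 * (t : ℤ) + t) = (-1) ^ x := by congr 1; ring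
        rw [m1, m2, pow_add, s2]
        push_cast; ring
      · have : (fun x => (2 : ℂ) * ((-1) ^ (p + t) * 1 * qBin p x t) -
            ((-1) ^ p * 2) * qBin p (x + p - 2 * p) t) = fun x => 0 * qBin p x t := by
          funext x
          have e2 : x = (x + p - 2 * p) + p := by ring
          have := qBin_shift hp (x + p - 2 * p) (t := t) (by omega)
          rw [← e2] at this
          rw [this, pow_add]
          linear_combination (2 * (-1 : ℂ) ^ p * qBin p (x + p - 2 * p) t) * sign_sq t
        rw [this, ← diag_smul, zero_smul, mul_zero]
  rw [g0, mul_smul_comm, E_F hp N p p (Or.inl le_rfl), E_F hp N p (2 * p) (Or.inr le_rfl),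
    Finset.mul_sum, Finset.smul_sum, Finset.smul_sum, sub_right_comm, ← Finset.sum_sub_distrib,
    Finset.sum_congr rfl key, Finset.sum_add_distrib, Finset.sum_ite_eq', Finset.sum_ite_eq',
    if_pos (by simp), if_pos (by simp), smul_mul_assoc, add_sub_cancel_left]

lemma kBr_chain (N : ℕ) : kBr p (chainDiag N fun x => q p ^ x) (chainDiag N fun x => q p ^ (-x)) =
    chainDiag N fun x => qInt p (x + 1) := by
  have hq := q_ne p
  rw [kBr, diag_smul, diag_smul, diag_sub, diag_smul]
  congr 1; funext x
  rw [qInt, zpow_add_one₀ hq, neg_add, zpow_add₀ hq, zpow_neg_one]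
  ring

lemma h_e_aux {R : Type*} [Ring R] [Algebra ℂ R] {κ E F : R} {s : ℂ} (hs : s * s = 1)
    (kE : κ * E = E * κ) (kF : κ * F = F * κ) (kk : κ * κ = 1)
    (h : (2 : ℂ) • (E * F * E) - F * (E * E) - E * E * F = (2 * s) • (E * κ)) :
    (2 : ℂ)⁻¹ • (κ * E * s • F - s • F * (κ * E)) * (κ * E) -
      κ * E * (2 : ℂ)⁻¹ • (κ * E * s • F - s • F * (κ * E)) = κ * E := by
  have kE' (x : R) : κ * (E * x) = E * (κ * x) := by rw [← mul_assoc, kE, mul_assoc]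
  have kF' (x : R) : κ * (F * x) = F * (κ * x) := by rw [← mul_assoc, kF, mul_assoc]
  simp only [mul_assoc] at h
  simp only [mul_assoc, kE, kE', kF, kF', kk, mul_one, smul_mul_assoc, mul_smul_comm, mul_sub,
    sub_mul]
  have h2 := congrArg (fun x => ((2 : ℂ)⁻¹ * s) • x) h
  simp only [smul_sub, smul_smul] at h2
  have e1 : (2 : ℂ)⁻¹ * s * (2 * s) = 1 := by linear_combination hs
  rw [e1, one_smul] at h2
  rw [← h2]
  module

lemma h_f_aux {R : Type*} [Ring R] [Algebra ℂ R] {κ E F : R} {s : ℂ} (hs : s * s = 1)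
    (kE : κ * E = E * κ) (kF : κ * F = F * κ) (kk : κ * κ = 1)
    (h : (2 : ℂ) • (F * (E * F)) - F * F * E - E * (F * F) = (2 * s) • (F * κ)) :
    (2 : ℂ)⁻¹ • (κ * E * s • F - s • F * (κ * E)) * s • F -
      s • F * (2 : ℂ)⁻¹ • (κ * E * s • F - s • F * (κ * E)) = - (s • F) := by
  have h2 := congrArg (fun x => ((2 : ℂ)⁻¹) • (x * κ)) h
  simp only [mul_assoc, smul_sub, smul_smul, sub_mul, smul_mul_assoc, kk, mul_one] at h2
  simp only [mul_assoc, kE, kF, smul_mul_assoc, mul_smul_comm, mul_sub,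
    sub_mul, smul_sub, smul_smul]
  have e1 : (2 : ℂ)⁻¹ * (2 * s) = s := by ring
  rw [e1] at h2
  have e2 : (2 : ℂ)⁻¹ * (s * s) = 2⁻¹ := by rw [hs, mul_one]
  have e3 : s * ((2 : ℂ)⁻¹ * s) = 2⁻¹ := by linear_combination (2 : ℂ)⁻¹ * hs
  simp only [e2, e3]
  rw [← h2]
  module

lemma chain_isUq (hp : 2 ≤ p) (N : ℕ) : IsUq p (chainGen p N) := by
  have hq := q_ne p
  have s2 : ((-1 : ℂ) ^ p) * (-1) ^ p = 1 := sign_sq p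
  have kE := (kappa_E (p := p) N p).eq
  have kF := (kappa_F (p := p) N p).eq
  have kE1 := (kappa_E (p := p) N 1).eq
  have kF1 := (kappa_F (p := p) N 1).eq
  have kk := kappa_sq N
  have hEFE := EFE hp N
  have hFEF := FEF hp N
  have hFp := qFact_ne hp (n := p - 1) (by omega)
  have c1 : ((p - 1 : ℕ) : ℤ) = p - 1 := by omega
  constructor <;> simp only [chainGen, kappa_eq hp]
  · rw [diag_mul, ← diag_one]
    congr 1; funext x; rw [← zpow_add₀ hq]; simp
  · rw [diag_mul, ← diag_one]
    congr 1; funext x; rw [← zpow_add₀ hq]; simp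
  · rw [diag_E, ← mul_smul_comm, diag_smul]
    congr 2; funext x; rw [zpow_add₀ hq, mul_comm]; norm_cast
  · rw [diag_F, ← mul_smul_comm, diag_smul]
    congr 2; funext x; rw [zpow_sub₀ hq, inv_pow, mul_comm, div_eq_inv_mul, one_mul,
      mul_comm]; norm_cast; rw [mul_comm]
  · rw [E_F_one hp, sub_self, (E_zero N).1, one_mul, add_sub_cancel_left, diag_sub, diag_smul]
    congr 1; funext x; rw [qInt, div_eq_inv_mul]; simp
  · rw [E_pow hp, qFact_p hp, zero_smul]
  · rw [F_pow hp, qFact_p hp, zero_smul]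
  · rw [mul_comm, pow_mul, kappa_eq hp, pow_two, kk]
  · exact h_e_aux s2 kE kF kk hEFE
  · exact h_f_aux s2 kE kF kk hFEF
  · rw [smul_smul]; norm_num
  · have h1 : (chainDiag N fun x => q p ^ x) * (chainDiag N fun x => (-1) ^ x) =
        (chainDiag N fun x => (-1) ^ x) * chainDiag N fun x => q p ^ x := by
      rw [diag_mul, diag_mul]; simp only [mul_comm]
    rw [← mul_assoc, h1, mul_assoc, mul_assoc, diag_E]
    congr 3; funext x
    have := q_shift hp 2 x
    norm_num at this
    exact this
  · rw [mul_smul_comm, smul_mul_assoc, diag_F]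
    congr 3; funext x
    have := q_shift hp (-2) x
    norm_num at this
    exact this
  · rw [← mul_assoc, ← kE1, mul_assoc, mul_assoc, E_comm hp]
  · rw [mul_smul_comm, smul_mul_assoc, F_comm hp]
  · rw [← mul_assoc, ← kF1, mul_assoc, mul_assoc, E_F_one hp, E_pow hp, kBr_chain, c1,
      mul_smul_comm, smul_smul, inv_mul_cancel₀ hFp, one_smul, mul_assoc, diag_E, ← mul_sub,
      sub_add_cancel_left, ← mul_neg, ← neg_one_smul ℂ (chainDiag N _), diag_smul]
    congr 3; funext x
    have e1 : x + 2 * ((p : ℤ) - 1) + 1 = x + p - 1 + p := by ring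
    rw [e1, qInt_shift_one hp]; ring
  · rw [mul_smul_comm, smul_mul_assoc, ← smul_sub, E_one_F hp, add_sub_cancel_left, F_pow hp,
      kBr_chain, c1, smul_mul_assoc, smul_smul, mul_assoc, inv_mul_cancel₀ hFp, mul_one,
      ← mul_smul_comm, ← mul_smul_comm, diag_smul, diag_smul]
    congr 2; funext x
    have e1 : x + 1 = x + 1 - p + p := by ring
    have e2 : qInt p (x + 1) = - qInt p (x + 1 - p) := by
      rw [← qInt_shift_one hp, ← e1]
    rw [e2]; ring

/-- The spin chain `H_N` as a module over `U_q sl(2)`. -/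
def chainRep (hp : 2 ≤ p) (N : ℕ) : U p →ₐ[ℂ] Module.End ℂ (Chain N) :=
  U.lift (chainGen p N) (chain_isUq hp N)

end chain
/-! ### The Temperley–Lieb algebra -/

/-- The defining relations of the Temperley–Lieb algebra on `N` sites with loop weight `q + q⁻¹`.
The generator with index `i` acts on the neighbouring sites `i` and `i + 1`, where sites are
numbered from `0`. -/
inductive TLRel (p N : ℕ) :
    FreeAlgebra ℂ (Fin (N - 1)) → FreeAlgebra ℂ (Fin (N - 1)) → Prop
  | sq (i : Fin (N - 1)) : TLRel p N (FreeAlgebra.ι ℂ i * FreeAlgebra.ι ℂ i)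
      ((q p + (q p)⁻¹) • FreeAlgebra.ι ℂ i)
  | braid (i j : Fin (N - 1)) (h : (i : ℕ) + 1 = j ∨ (j : ℕ) + 1 = i) :
      TLRel p N (FreeAlgebra.ι ℂ i * FreeAlgebra.ι ℂ j * FreeAlgebra.ι ℂ i) (FreeAlgebra.ι ℂ i)
  | comm (i j : Fin (N - 1)) (h : (i : ℕ) + 2 ≤ j ∨ (j : ℕ) + 2 ≤ i) :
      TLRel p N (FreeAlgebra.ι ℂ i * FreeAlgebra.ι ℂ j) (FreeAlgebra.ι ℂ j * FreeAlgebra.ι ℂ i)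

/-- The Temperley–Lieb algebra `TL_q(N)` at `q = exp(iπ/p)`. -/
def TL (p N : ℕ) : Type := RingQuot (TLRel p N)

instance (p N : ℕ) : Ring (TL p N) := inferInstanceAs (Ring (RingQuot (TLRel p N)))

instance (p N : ℕ) : Algebra ℂ (TL p N) := inferInstanceAs (Algebra ℂ (RingQuot (TLRel p N)))

/-- The generators of the Temperley–Lieb algebra. -/
def TL.gen (p N : ℕ) (i : Fin (N - 1)) : TL p N :=
  RingQuot.mkAlgHom ℂ (TLRel p N) (FreeAlgebra.ι ℂ i)

/-- The Temperley–Lieb relations for a family of elements of an arbitrary algebra. -/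
structure IsTL (p N : ℕ) {A : Type*} [Ring A] [Algebra ℂ A] (g : Fin (N - 1) → A) : Prop where
  sq : ∀ i, g i * g i = (q p + (q p)⁻¹) • g i
  braid : ∀ i j : Fin (N - 1), (i : ℕ) + 1 = j ∨ (j : ℕ) + 1 = i → g i * g j * g i = g i
  comm : ∀ i j : Fin (N - 1), (i : ℕ) + 2 ≤ j ∨ (j : ℕ) + 2 ≤ i → g i * g j = g j * g i

lemma TL.isTL (p N : ℕ) : IsTL p N (TL.gen p N) := by
  have key : ∀ {x y}, TLRel p N x y →
      RingQuot.mkAlgHom ℂ (TLRel p N) x = RingQuot.mkAlgHom ℂ (TLRel p N) y :=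
    fun h => RingQuot.mkAlgHom_rel ℂ h
  constructor
  · intro i; simpa using! key (.sq i)
  · intro i j h; simpa using! key (.braid i j h)
  · intro i j h; simpa using! key (.comm i j h)

/-- The universal property of the Temperley–Lieb algebra. -/
def TL.lift {p N : ℕ} {A : Type*} [Ring A] [Algebra ℂ A] (g : Fin (N - 1) → A)
    (hg : IsTL p N g) : TL p N →ₐ[ℂ] A :=
  RingQuot.liftAlgHom ℂ ⟨FreeAlgebra.lift ℂ g, by
    intro x y h
    cases h with
    | sq i => simpa using hg.sq i
    | braid i j h => simpa using hg.braid i j h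
    | comm i j h => simpa using hg.comm i j h⟩

lemma TL.lift_gen {p N : ℕ} {A : Type*} [Ring A] [Algebra ℂ A] (g : Fin (N - 1) → A)
    (hg : IsTL p N g) (i : Fin (N - 1)) : TL.lift g hg (TL.gen p N i) = g i := by
  exact (RingQuot.liftAlgHom_mkAlgHom_apply ℂ _ _ _).trans (FreeAlgebra.lift_ι_apply g i)

/-- The anti-involution `e_i ↦ e_{N-i}` (in the numbering `1, …, N - 1` of the generators). -/
def tlAnti (p N : ℕ) : TL p N →ₐ[ℂ] (TL p N)ᵐᵒᵖ :=
  TL.lift (fun i => .op (TL.gen p N i.rev)) (by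
    have H := TL.isTL p N
    constructor
    · intro i
      apply MulOpposite.unop_injective
      exact H.sq _
    · intro i j h
      apply MulOpposite.unop_injective
      simp only [MulOpposite.unop_mul, MulOpposite.unop_op, ← mul_assoc]
      exact H.braid _ _ (by simp only [Fin.val_rev]; omega)
    · intro i j h
      apply MulOpposite.unop_injective
      exact H.comm _ _ (by simp only [Fin.val_rev]; omega))

/-! ### The XXZ representation -/

/-- The XXZ representation: the operator for the sites `i` and `i + 1`, which acts on their states
by `++ ↦ 0`, `+- ↦ q⁻¹ (+-) - (-+)`, `-+ ↦ q (-+) - (+-)` and `-- ↦ 0`. -/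
def xxz (p : ℕ) : (n : ℕ) → ℕ → Module.End ℂ (Chain n)
  | 0, _ => 0
  | 1, _ => 0
  | _ + 2, 0 => blk (blk 0 0 0 ((q p)⁻¹ • 1)) (blk 0 0 (-1) 0) (blk 0 (-1) 0 0)
      (blk (q p • 1) 0 0 0)
  | n + 2, i + 1 => blk (xxz p (n + 1) i) 0 0 (xxz p (n + 1) i)

section xxz

variable {p : ℕ}

lemma xxz_sq (n i : ℕ) : xxz p n i * xxz p n i = (q p + (q p)⁻¹) • xxz p n i := by
  induction i generalizing n with
  | zero =>
    rcases n with _ | _ | n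
    · simp [xxz]
    · simp [xxz]
    · have hq := q_ne p
      simp only [xxz, blk_mul, blk_add, blk_smul, mul_zero, add_zero, zero_add,
        smul_zero, mul_neg, mul_one, mul_smul_comm, neg_neg, smul_neg]
      congr 2 <;> match_scalars <;> field_simp <;> ring
  | succ i ih =>
    rcases n with _ | _ | n
    · simp [xxz]
    · simp [xxz]
    · simp [xxz, blk_mul, blk_smul, ih]

lemma xxz_braid (n i j : ℕ) (h : i + 1 = j ∨ j + 1 = i) (hi : i + 1 < n) (hj : j + 1 < n) :
    xxz p n i * xxz p n j * xxz p n i = xxz p n i := by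
  induction n generalizing i j with
  | zero => omega
  | succ n ih =>
    obtain ⟨n, rfl⟩ : ∃ k, n = k + 1 := ⟨n - 1, by omega⟩
    have hq := q_ne p
    rcases i with _ | i <;> rcases j with _ | j
    · omega
    · obtain rfl : j = 0 := by omega
      obtain ⟨n, rfl⟩ : ∃ k, n = k + 1 := ⟨n - 1, by omega⟩
      have h1 (z : ℂ) : (z • 1 : Module.End ℂ (Chain (n + 1))) = blk (z • 1) 0 0 (z • 1) := by
        rw [← blk_one, blk_smul]; simp
      have h2 : (-1 : Module.End ℂ (Chain (n + 1))) = blk (-1) 0 0 (-1) := by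
        have := h1 (-1)
        simpa using this
      simp [xxz, blk_mul, blk_add, smul_smul, hq, h1, h2]
    · obtain rfl : i = 0 := by omega
      obtain ⟨n, rfl⟩ : ∃ k, n = k + 1 := ⟨n - 1, by omega⟩
      simp [xxz, blk_mul, blk_smul, blk_zero, smul_smul, hq]
    · have := ih i j (by omega) (by omega) (by omega)
      simp [xxz, blk_mul, this]

lemma xxz_comm (n i j : ℕ) (h : i + 2 ≤ j) (hj : j + 1 < n) :
    xxz p n i * xxz p n j = xxz p n j * xxz p n i := by
  induction n generalizing i j with
  | zero => omega
  | succ n ih =>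
    obtain ⟨n, rfl⟩ : ∃ k, n = k + 1 := ⟨n - 1, by omega⟩
    obtain ⟨j, rfl⟩ : ∃ k, j = k + 1 := ⟨j - 1, by omega⟩
    rcases i with _ | i
    · obtain ⟨j, rfl⟩ : ∃ k, j = k + 1 := ⟨j - 1, by omega⟩
      obtain ⟨n, rfl⟩ : ∃ k, n = k + 1 := ⟨n - 1, by omega⟩
      simp [xxz, blk_mul]
    · have := ih i j (by omega) (by omega)
      simp [xxz, blk_mul, this]

lemma xxz_isTL (N : ℕ) : IsTL p N fun i => xxz p N i where
  sq i := xxz_sq N i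
  braid i j h := xxz_braid N i j h (by omega) (by omega)
  comm i j h := by
    rcases h with h | h
    · exact xxz_comm N i j h (by omega)
    · exact (xxz_comm N j i h (by omega)).symm

lemma xxz_diag (n i : ℕ) (φ : ℤ → ℂ) : Commute (xxz p n i) (chainDiag n φ) := by
  induction i generalizing n φ with
  | zero =>
    rcases n with _ | _ | n
    · simp [xxz]
    · simp [xxz]
    · simp [Commute, SemiconjBy, xxz, blk_mul, chainDiag]
  | succ i ih =>
    rcases n with _ | _ | n
    · simp [xxz]
    · simp [xxz]
    · have h (ψ : ℤ → ℂ) := (ih (n + 1) ψ).eq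
      simp only [Commute, SemiconjBy, xxz]
      rw [chainDiag]
      simp [blk_mul, h]

lemma xxz_E (n i : ℕ) (a : ℤ) : Commute (xxz p n i) (chainE p n a) := by
  induction i generalizing n a with
  | zero =>
    rcases n with _ | _ | n
    · simp [xxz]
    · simp [xxz]
    · have hq := q_ne p
      have hx := zpow_ne_zero a hq
      simp only [Commute, SemiconjBy, xxz, chainE, blk_mul, blk_add, blk_smul, mul_zero, zero_mul,
        add_zero, zero_add, smul_zero, mul_neg, neg_mul, one_mul, mul_one, smul_mul_assoc,
        mul_smul_comm, smul_neg, zpow_neg, zpow_sub_one₀ hq]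
      congr 2 <;> match_scalars <;> field_simp <;> ring
  | succ i ih =>
    rcases n with _ | _ | n
    · simp [xxz]
    · simp [xxz]
    · have h (ψ : ℤ) := (ih (n + 1) ψ).eq
      simp only [Commute, SemiconjBy, xxz]
      rw [chainE]
      simp [blk_mul, h]

lemma xxz_F (n i : ℕ) (a : ℤ) : Commute (xxz p n i) (chainF p n a) := by
  induction i generalizing n a with
  | zero =>
    rcases n with _ | _ | n
    · simp [xxz]
    · simp [xxz]
    · have hq := q_ne p
      have hx := zpow_ne_zero a hq
      have d1 : (chainDiag n fun x => q p ^ (-(x + 1))) =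
          (q p)⁻¹ • chainDiag n fun x => q p ^ (-x) := by
        rw [diag_smul]; congr 1; funext x
        rw [neg_add, zpow_add₀ hq, zpow_neg_one, mul_comm]
      have d2 : (chainDiag n fun x => q p ^ (-(x - 1))) =
          q p • chainDiag n fun x => q p ^ (-x) := by
        rw [diag_smul]; congr 1; funext x
        rw [neg_sub, sub_eq_add_neg, zpow_add₀ hq, zpow_one]
      simp only [Commute, SemiconjBy, xxz, chainF, chainDiag, blk_mul, blk_add, blk_smul, mul_zero,
        zero_mul, add_zero, zero_add, smul_zero, mul_neg, neg_mul, one_mul, mul_one,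
        smul_mul_assoc, mul_smul_comm, smul_neg, zpow_sub_one₀ hq, d1, d2]
      congr 2 <;> match_scalars <;> field_simp <;> ring
  | succ i ih =>
    rcases n with _ | _ | n
    · simp [xxz]
    · simp [xxz]
    · have h (ψ : ℤ) := (ih (n + 1) ψ).eq
      have h' (ψ : ℤ → ℂ) := (xxz_diag (p := p) (n + 1) i ψ).eq
      simp only [Commute, SemiconjBy, xxz]
      rw [chainF]
      simp only [blk_mul, h, ← h', mul_smul_comm, smul_mul_assoc, mul_assoc, mul_zero, zero_mul]
      simp only [← mul_assoc, h, smul_zero, add_zero, zero_add]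

end xxz
/-- The XXZ representation of the Temperley–Lieb algebra on the spin chain `H_N`. -/
def xxzRep (p N : ℕ) : TL p N →ₐ[ℂ] Module.End ℂ (Chain N) := TL.lift _ (xxz_isTL N)

lemma TL.induction {p N : ℕ} {P : TL p N → Prop} (hc : ∀ c : ℂ, P (algebraMap ℂ _ c))
    (hg : ∀ i, P (TL.gen p N i)) (hm : ∀ a b, P a → P b → P (a * b))
    (ha : ∀ a b, P a → P b → P (a + b)) (a : TL p N) : P a := by
  obtain ⟨x, rfl⟩ := RingQuot.mkAlgHom_surjective ℂ (TLRel p N) a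
  induction x using FreeAlgebra.induction with
  | grade0 r => rw [AlgHom.commutes]; exact hc r
  | grade1 x => exact hg x
  | mul a b h1 h2 => rw [map_mul]; exact hm _ _ h1 h2
  | add a b h1 h2 => rw [map_add]; exact ha _ _ h1 h2

lemma U.induction {p : ℕ} {P : U p → Prop} (hc : ∀ c : ℂ, P (algebraMap ℂ _ c))
    (hg : ∀ x, P (U.gen p x)) (hm : ∀ a b, P a → P b → P (a * b))
    (ha : ∀ a b, P a → P b → P (a + b)) (a : U p) : P a := by
  obtain ⟨x, rfl⟩ := RingQuot.mkAlgHom_surjective ℂ (UqRel p) a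
  induction x using FreeAlgebra.induction with
  | grade0 r => rw [AlgHom.commutes]; exact hc r
  | grade1 x => exact hg x
  | mul a b h1 h2 => rw [map_mul]; exact hm _ _ h1 h2
  | add a b h1 h2 => rw [map_add]; exact ha _ _ h1 h2

section commute

variable {p : ℕ} (hp : 2 ≤ p) (N : ℕ)

lemma xxz_chainGen (i : ℕ) (x : Gen) : Commute (xxz p N i) (chainGen p N x) := by
  have hD (φ) := xxz_diag (p := p) N i φ
  have he := ((hD fun x => q p ^ x).pow_right p).mul_right (xxz_E N i p)
  have hf := (xxz_F (p := p) N i p).smul_right ((-1 : ℂ) ^ p)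
  cases x with
  | E => exact xxz_E N i 1
  | F => exact xxz_F N i 1
  | K => exact hD _
  | Kinv => exact hD _
  | e => exact he
  | f => exact hf
  | h => exact ((he.mul_right hf).sub_right (hf.mul_right he)).smul_right _

/-- The actions of `U_q sl(2)` and of the Temperley–Lieb algebra on the spin chain commute. -/
lemma rep_commute (a : TL p N) (u : U p) : Commute (xxzRep p N a) (chainRep hp N u) := by
  induction u using U.induction with
  | hc c => rw [AlgHom.commutes]; exact (Algebra.commutes c _).symm
  | hm u v h1 h2 => rw [map_mul]; exact h1.mul_right h2
  | ha u v h1 h2 => rw [map_add]; exact h1.add_right h2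
  | hg x =>
    rw [chainRep, U.lift_gen]
    induction a using TL.induction with
    | hc c => rw [AlgHom.commutes]; exact Algebra.commutes c _
    | hm u v h1 h2 => rw [map_mul]; exact h1.mul_left h2
    | ha u v h1 h2 => rw [map_add]; exact h1.add_left h2
    | hg i =>
      rw [xxzRep, TL.lift_gen]
      exact xxz_chainGen N i x

/-- The operator of an element of the Temperley–Lieb algebra, as an endomorphism of the
`U_q sl(2)`-module `H_N`. -/
def xxzEnd : TL p N →+* Module.End (U p) (RepSpace (chainRep hp N)) where
  toFun a :=
    { toFun := fun v => (xxzRep p N a : Chain N →ₗ[ℂ] Chain N) v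
      map_add' := fun v w => map_add (xxzRep p N a) v w
      map_smul' := fun u v => LinearMap.congr_fun (rep_commute hp N a u).eq v }
  map_one' := by
    refine LinearMap.ext fun v => ?_
    exact LinearMap.congr_fun (map_one (xxzRep p N)) v
  map_mul' a b := by
    refine LinearMap.ext fun v => ?_
    exact LinearMap.congr_fun (map_mul (xxzRep p N) a b) v
  map_zero' := by
    refine LinearMap.ext fun v => ?_
    exact LinearMap.congr_fun (map_zero (xxzRep p N)) v
  map_add' a b := by
    refine LinearMap.ext fun v => ?_
    exact LinearMap.congr_fun (map_add (xxzRep p N) a b) v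

/-- The space `Hom_{U_q sl(2)}(H_N, M)`. -/
def HomSpace (M : Type) [AddCommGroup M] [Module (U p) M] : Type :=
  RepSpace (chainRep hp N) →ₗ[U p] M

end commute

section HomSpace

variable {p : ℕ} (hp : 2 ≤ p) (N : ℕ) (M : Type) [AddCommGroup M] [Module (U p) M]

instance : AddCommGroup (HomSpace hp N M) :=
  inferInstanceAs (AddCommGroup (RepSpace (chainRep hp N) →ₗ[U p] M))

/-- The left action of the Temperley–Lieb algebra, `(a • φ)(v) = φ(a† v)`, where `a ↦ a†` is the
anti-involution `e_i ↦ e_{N-i}`. -/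
instance : Module (TL p N) (HomSpace hp N M) where
  smul a φ := LinearMap.comp (σ₁₂ := RingHom.id (U p))
    (show RepSpace (chainRep hp N) →ₗ[U p] M from φ) (xxzEnd hp N (tlAnti p N a).unop)
  one_smul φ := by
    refine LinearMap.ext fun v => ?_
    change φ.toFun (xxzEnd hp N (tlAnti p N 1).unop v) = φ.toFun v
    simp
  mul_smul a b φ := by
    refine LinearMap.ext fun v => ?_
    change φ.toFun (xxzEnd hp N (tlAnti p N (a * b)).unop v) = φ.toFun
      (xxzEnd hp N (tlAnti p N b).unop (xxzEnd hp N (tlAnti p N a).unop v))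
    simp
  smul_zero a := by
    refine LinearMap.ext fun v => ?_
    rfl
  smul_add a φ ψ := by
    refine LinearMap.ext fun v => ?_
    rfl
  add_smul a b φ := by
    refine LinearMap.ext fun v => ?_
    change φ.toFun (xxzEnd hp N (tlAnti p N (a + b)).unop v) = φ.toFun
      (xxzEnd hp N (tlAnti p N a).unop v) + φ.toFun (xxzEnd hp N (tlAnti p N b).unop v)
    rw [← φ.map_add']
    simp
  zero_smul φ := by
    refine LinearMap.ext fun v => ?_
    change φ.toFun (xxzEnd hp N (tlAnti p N 0).unop v) = 0
    simp

end HomSpace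

open CategoryTheory in
/-- The functor `Hom_{U_q sl(2)}(H_N, -)` to modules over the Temperley–Lieb algebra. -/
def homFunctor {p : ℕ} (hp : 2 ≤ p) (N : ℕ) : ModuleCat.{0} (U p) ⥤ ModuleCat.{0} (TL p N) where
  obj M := ModuleCat.of (TL p N) (HomSpace hp N M)
  map {M M'} g := ModuleCat.ofHom
    { toFun := fun φ => LinearMap.comp (σ₁₂ := RingHom.id (U p)) g.hom
        (show RepSpace (chainRep hp N) →ₗ[U p] M from φ)
      map_add' := fun φ ψ => LinearMap.comp_add _ _ _
      map_smul' := fun _ _ => rfl }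
/-! ### Link states and standard modules -/

/-- A link state on `N` sites with `k` through-lines: a non-crossing partial matching of the sites
in which no unmatched site is below an arc. It is encoded by the involution `m` whose two-element
orbits are the arcs and whose fixed points are the `k` through-lines. -/
@[ext]
structure LinkState (N k : ℕ) where
  m : Fin N → Fin N
  invol : ∀ x, m (m x) = x
  noncross : ∀ x y, x < y → y < m x → m y ≠ y ∧ x < m y ∧ m y < m x
  card_fixed : (Finset.univ.filter fun x => m x = x).card = k

/-- The involution obtained from `m` by joining the sites `a` and `b` and the former partners of
`a` and `b`; if one of `a`, `b` is the end of a through-line, then the former partner of the other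
one becomes the end of a through-line. -/
def joinFun {N : ℕ} (a b : Fin N) (m : Fin N → Fin N) (x : Fin N) : Fin N :=
  if x = a then b else if x = b then a
  else if m x = a then (if m b = b then x else m b)
  else if m x = b then (if m a = a then x else m a)
  else m x

section link

variable {N k : ℕ}

lemma joinFun_invol (a b : Fin N) (hab : a ≠ b) (m : Fin N → Fin N) (h : ∀ x, m (m x) = x)
    (x : Fin N) : joinFun a b m (joinFun a b m x) = x := by
  have h1 := h x
  have h2 := h a
  have h3 := h b
  grind [joinFun]

set_option maxHeartbeats 1000000 in
lemma joinFun_noncross (a b : Fin N) (hab : (a : ℕ) + 1 = b) (m : Fin N → Fin N)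
    (h : ∀ x, m (m x) = x)
    (hn : ∀ x y, x < y → y < m x → m y ≠ y ∧ x < m y ∧ m y < m x)
    (x y : Fin N) (hxy : x < y) (hlt : y < joinFun a b m x) :
    joinFun a b m y ≠ y ∧ x < joinFun a b m y ∧ joinFun a b m y < joinFun a b m x := by
  have hc : ∀ z : Fin N, z ≤ a ∨ b ≤ z := fun z => by omega
  have hab' : a < b := by omega
  have hx := h x
  have hy := h y
  have ha := h a
  have hb := h b
  have := hn x y
  have := hn x a
  have := hn x b
  have := hn a x
  have := hn b x
  have := hn a y
  have := hn b y
  have := hn a b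
  have := hn (m x) a
  have := hn (m x) b
  have := hn (m x) y
  have := hn b (m y)
  have := hn (m a) (m y)
  have := hn (m a) x
  have := hn (m a) y
  have := hn (m a) b
  have := hn (m b) x
  have := hn (m b) y
  have := hn (m b) a
  have := hc x
  have := hc y
  have := hc (m x)
  have := hc (m y)
  have := hc (m a)
  have := hc (m b)
  clear hn h hc
  simp only [joinFun] at hlt ⊢
  split_ifs at hlt ⊢ <;> grind (splits := 30)

lemma joinFun_card (a b : Fin N) (hab : a ≠ b) (m : Fin N → Fin N) (h : ∀ x, m (m x) = x)
    (hf : ¬ (m a = a ∧ m b = b)) :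
    (Finset.univ.filter fun x => joinFun a b m x = x).card =
      (Finset.univ.filter fun x => m x = x).card := by
  by_cases ha : m a = a
  · refine Finset.card_equiv (Equiv.swap a (m b)) fun x => ?_
    have h1 := h x
    have h2 := h b
    simp only [Finset.mem_filter, Finset.mem_univ, true_and]
    rw [Equiv.swap_apply_def]
    grind [joinFun]
  · by_cases hb : m b = b
    · refine Finset.card_equiv (Equiv.swap b (m a)) fun x => ?_
      have h1 := h x
      have h2 := h a
      simp only [Finset.mem_filter, Finset.mem_univ, true_and]
      rw [Equiv.swap_apply_def]
      grind [joinFun]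
    · congr 1
      ext x
      have h1 := h x
      have h2 := h a
      have h3 := h b
      simp only [Finset.mem_filter, Finset.mem_univ, true_and]
      grind [joinFun]

/-- The left one of the two sites on which the generator `i` acts. -/
def siteL (i : Fin (N - 1)) : Fin N := ⟨i, by omega⟩

/-- The right one of the two sites on which the generator `i` acts. -/
def siteR (i : Fin (N - 1)) : Fin N := ⟨i + 1, by omega⟩

lemma site_ne (i : Fin (N - 1)) : siteL i ≠ siteR i := by
  simp [siteL, siteR, Fin.ext_iff]

/-- The link state obtained by stacking the generator `i` on a link state and removing a loop if
there is one. (The value is irrelevant if the generator contracts two through-lines.) -/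
def LinkState.join (i : Fin (N - 1)) (l : LinkState N k) : LinkState N k :=
  if hf : l.m (siteL i) = siteL i ∧ l.m (siteR i) = siteR i then l else
    { m := joinFun (siteL i) (siteR i) l.m
      invol := joinFun_invol _ _ (site_ne i) _ l.invol
      noncross := joinFun_noncross _ _ rfl _ l.invol l.noncross
      card_fixed := (joinFun_card _ _ (site_ne i) _ l.invol hf).trans l.card_fixed }

/-- The weight of stacking the generator `i` on a link state: `0` if it contracts two
through-lines, `q + q⁻¹` if it closes a loop, and `1` otherwise. -/
def LinkState.weight (p : ℕ) (i : Fin (N - 1)) (l : LinkState N k) : ℂ :=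
  if l.m (siteL i) = siteL i ∧ l.m (siteR i) = siteR i then 0
  else if l.m (siteL i) = siteR i then q p + (q p)⁻¹ else 1

/-- The action of the generators of the Temperley–Lieb algebra on the span of the link states. -/
def stGen (p N k : ℕ) (i : Fin (N - 1)) : Module.End ℂ (LinkState N k →₀ ℂ) :=
  Finsupp.linearCombination ℂ fun l => Finsupp.single (l.join i) (l.weight p i)

lemma stGen_single (p : ℕ) (i : Fin (N - 1)) (l : LinkState N k) (c : ℂ) :
    stGen p N k i (Finsupp.single l c) = Finsupp.single (l.join i) (c * l.weight p i) := by
  simp [stGen]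

lemma join_m (i : Fin (N - 1)) (l : LinkState N k) (x : Fin N) : (l.join i).m x =
    if l.m (siteL i) = siteL i ∧ l.m (siteR i) = siteR i then l.m x
    else joinFun (siteL i) (siteR i) l.m x := by
  rw [LinkState.join]
  split_ifs <;> rfl

lemma join_of_arc (i : Fin (N - 1)) (l : LinkState N k) (h : l.m (siteL i) = siteR i) :
    l.join i = l := by
  ext x : 2
  have h1 := l.invol x
  have h2 := l.invol (siteL i)
  have h3 := site_ne i
  rw [join_m]
  grind [joinFun]

lemma weight_of_arc (p : ℕ) (i : Fin (N - 1)) (l : LinkState N k) (h : l.m (siteL i) = siteR i) :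
    l.weight p i = q p + (q p)⁻¹ := by
  have h3 := site_ne i
  rw [LinkState.weight, if_neg (by rw [h]; exact fun h => h3 h.1.symm), if_pos h]

lemma arc_of_weight (p : ℕ) (i : Fin (N - 1)) (l : LinkState N k) (h : l.weight p i ≠ 0) :
    (l.join i).m (siteL i) = siteR i := by
  rw [LinkState.weight] at h
  rw [join_m]
  grind [joinFun]

lemma snake (p : ℕ) (i j : Fin (N - 1)) (hij : (i : ℕ) + 1 = j ∨ (j : ℕ) + 1 = i)
    (l : LinkState N k) (h : l.m (siteL i) = siteR i) :
    (l.join j).join i = l ∧ l.weight p j = 1 ∧ (l.join j).weight p i = 1 := by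
  have hi := site_ne i
  have hj := site_ne j
  have inv := l.invol
  have h2 := l.invol (siteL i)
  have h3 := l.invol (siteL j)
  have h4 := l.invol (siteR j)
  have hs : siteR i = siteL j ∧ siteL i ≠ siteL j ∧ siteL i ≠ siteR j ∨
      siteR j = siteL i ∧ siteL i ≠ siteL j ∧ siteR i ≠ siteL j ∧ siteR i ≠ siteR j := by
    simp only [siteL, siteR, Fin.ext_iff, ne_eq]
    omega
  refine ⟨?_, ?_, ?_⟩
  · ext x : 2
    have h1 := l.invol x
    rw [join_m, joinFun]
    simp only [join_m, joinFun]
    grind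
  · simp only [LinkState.weight]
    grind
  · simp only [LinkState.weight, join_m, joinFun]
    grind

lemma far (p : ℕ) (i j : Fin (N - 1)) (hij : (i : ℕ) + 2 ≤ j) (l : LinkState N k) :
    (Finsupp.single ((l.join i).join j) (l.weight p i * (l.join i).weight p j)) =
    Finsupp.single ((l.join j).join i) (l.weight p j * (l.join j).weight p i) := by
  have hi := site_ne i
  have hj := site_ne j
  have hs : siteL i ≠ siteL j ∧ siteL i ≠ siteR j ∧ siteR i ≠ siteL j ∧ siteR i ≠ siteR j := by
    simp only [siteL, siteR, Fin.ext_iff, ne_eq]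
    omega
  have inv := l.invol
  have h1 := l.invol (siteL i)
  have h2 := l.invol (siteR i)
  have h3 := l.invol (siteL j)
  have h4 := l.invol (siteR j)
  have hw : l.weight p i * (l.join i).weight p j = l.weight p j * (l.join j).weight p i := by
    simp only [LinkState.weight, join_m, joinFun]
    grind (splits := 40)
  rw [hw]
  by_cases h0 : l.weight p j * (l.join j).weight p i = 0
  · simp [h0]
  · congr 1
    simp only [LinkState.weight, join_m, joinFun] at h0
    ext x : 2
    have h5 := l.invol x
    simp only [join_m, joinFun]
    grind (splits := 40)

lemma st_isTL (p N k : ℕ) : IsTL p N (stGen p N k) where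
  sq i := by
    refine Finsupp.lhom_ext fun l c => ?_
    rw [Module.End.mul_apply, stGen_single, stGen_single, LinearMap.smul_apply, stGen_single,
      Finsupp.smul_single, smul_eq_mul]
    by_cases h : l.weight p i = 0
    · simp [h]
    · have := arc_of_weight p i l h
      rw [join_of_arc i _ this, weight_of_arc p i _ this]
      congr 1; ring
  braid i j hij := by
    refine Finsupp.lhom_ext fun l c => ?_
    simp only [Module.End.mul_apply, stGen_single]
    by_cases h : l.weight p i = 0
    · simp [h]
    · have := arc_of_weight p i l h
      obtain ⟨h1, h2, h3⟩ := snake p i j hij _ this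
      rw [h1, h2, h3, mul_one, mul_one]
  comm i j hij := by
    refine Finsupp.lhom_ext fun l c => ?_
    simp only [Module.End.mul_apply, stGen_single, mul_assoc]
    rw [← smul_eq_mul, ← Finsupp.smul_single, ← smul_eq_mul (a := c), ← Finsupp.smul_single]
    rcases hij with h | h
    · rw [far p i j h]
    · rw [far p j i h]

end link
/-- The representation of the Temperley–Lieb algebra on the span of the link states on `N` sites
with `k` through-lines. -/
def stRep (p N k : ℕ) : TL p N →ₐ[ℂ] Module.End ℂ (LinkState N k →₀ ℂ) :=
  TL.lift _ (st_isTL p N k)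

/-- The standard module `St_{k/2}` of the Temperley–Lieb algebra (zero for `k > N`). -/
def standardMod (p N k : ℕ) : ModuleCat.{0} (TL p N) :=
  ModuleCat.of (TL p N) (RepSpace (stRep p N k))

/-- The costandard module, the contragredient of `St_{k/2}`. -/
def costandardMod (p N k : ℕ) : ModuleCat.{0} (TL p N) :=
  ModuleCat.of (TL p N) (RepSpace (contraRep (stRep p N k) (tlAnti p N)))

/-- The maximal proper submodule of `St_{k/2}`: the sum of its proper submodules. There is one
exception: for `p = 2` (loop weight `0`) and `k = 0` there is no irreducible module attached to
`St_0`, and the whole module is taken. -/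
def maxSub (p N k : ℕ) : Submodule (TL p N) (standardMod p N k) :=
  if p = 2 ∧ k = 0 then ⊤ else sSup {W | W ≠ ⊤}

/-- The irreducible module attached to `St_{k/2}`, the quotient of `St_{k/2}` by its maximal proper
submodule (zero for `k > N`, and for `k = 0` if `p = 2`). -/
def irrMod (p N k : ℕ) : ModuleCat.{0} (TL p N) :=
  ModuleCat.of (TL p N) (standardMod p N k ⧸ maxSub p N k)

section zigzag

variable {R : Type} [Ring R]

/-- `M` is a zig-zag module `A → S ← B`: it has a submodule `S` with quotient `A ⊕ B`, and neither
the subquotient built from `A` and `S` nor the one built from `B` and `S` splits (except when one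
of its two constituents is zero). -/
def IsZigZag (M A S B : ModuleCat.{0} R) : Prop :=
  ∃ (ι : S →ₗ[R] M) (π : M →ₗ[R] A × B), Function.Injective ι ∧ Function.Surjective π ∧
    LinearMap.range ι = LinearMap.ker π ∧
    (Nontrivial S → Nontrivial A → ¬ ∃ σ : A →ₗ[R] M, ∀ a, π (σ a) = (a, 0)) ∧
    (Nontrivial S → Nontrivial B → ¬ ∃ σ : B →ₗ[R] M, ∀ b, π (σ b) = (0, b))

end zigzag

section cover

open CategoryTheory

variable {A : Type} [Ring A] [Algebra ℂ A]

/-- A module over a complex algebra is finite-dimensional if it is so over `ℂ`. -/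
def IsFinDim (M : ModuleCat.{0} A) : Prop :=
  Module.Finite ℂ ((ModuleCat.restrictScalars (algebraMap ℂ A)).obj M)

/-- `π : P ⟶ X` is a projective cover in the category of finite-dimensional modules: `P` is
finite-dimensional and projective in that category, `π` is surjective, and its kernel is
superfluous. -/
structure IsProjectiveCover {P X : ModuleCat.{0} A} (π : P ⟶ X) : Prop where
  finDim : IsFinDim P
  lifts : ∀ (M M' : ModuleCat.{0} A), IsFinDim M → IsFinDim M' → ∀ (g : M ⟶ M') (f : P ⟶ M'),
    Function.Surjective g → ∃ h : P ⟶ M, h ≫ g = f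
  surjective : Function.Surjective π
  superfluous : ∀ W : Submodule A P, W ⊔ LinearMap.ker π.hom = ⊤ → W = ⊤

end cover

section modules

variable {p : ℕ} (hp : 2 ≤ p)

/-- The irreducible `U_q sl(2)`-module `X_{s,r}` of dimension `s r`, for `1 ≤ s ≤ p`, `r ≥ 1`. -/
def simpleMod {s : ℕ} (r : ℕ) (hs : s ≤ p) : ModuleCat.{0} (U p) :=
  ModuleCat.of (U p) (RepSpace (simpleRep (r := r) hp hs))

/-- The Weyl module `N_{s,r}` of dimension `p (r + 1) - s`, for `1 ≤ s ≤ p - 1`, `r ≥ 1`. -/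
def weylMod (s r : ℕ) : ModuleCat.{0} (U p) :=
  ModuleCat.of (U p) (RepSpace (weylRep hp ((r + 1) * p - s - 1)))

/-- The contragredient Weyl module. -/
def coweylMod (s r : ℕ) : ModuleCat.{0} (U p) :=
  ModuleCat.of (U p) (RepSpace (contraRep (weylRep hp ((r + 1) * p - s - 1)) (uAnti hp)))

end modules

end

end XXZ

namespace XXZ

noncomputable section

open LinearMap (comp_apply ext range ker comp_assoc mem_ker comp_zero zero_comp comp_add range_eq_top)
open LinearMap renaming congr_fun → lin_congr, smul_apply → lin_smul, zero_apply → lin_zero, add_apply → lin_add, sub_apply → lin_sub, sum_apply → lin_sum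
open Module (finrank)
open Module.End (mul_apply one_apply)
open Function (Surjective Injective update)

/-! ### Separation of points by a subalgebra of functions -/

lemma exists_delta {α : Type*} (S : Subalgebra ℂ (α → ℂ)) (T : Finset α) (x : α)
    (h : ∀ y ∈ T, y ≠ x → ∃ c ∈ S, c y ≠ c x) :
    ∃ c ∈ S, c x = 1 ∧ ∀ y ∈ T, y ≠ x → c y = 0 := by
  classical
  induction T using Finset.induction_on with
  | empty => exact ⟨1, S.one_mem, rfl, by simp⟩
  | insert a T ha ih =>
    obtain ⟨c, hc, h1, h2⟩ := ih fun y hy => h y (Finset.mem_insert_of_mem hy)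
    by_cases hax : a = x
    · refine ⟨c, hc, h1, fun y hy hyx => ?_⟩
      rcases Finset.mem_insert.1 hy with rfl | hy
      · exact absurd hax hyx
      · exact h2 y hy hyx
    · obtain ⟨d, hd, hd'⟩ := h a (Finset.mem_insert_self _ _) hax
      refine ⟨c * ((d x - d a)⁻¹ • (d - algebraMap ℂ _ (d a))),
        S.mul_mem hc (S.smul_mem (S.sub_mem hd (S.algebraMap_mem _)) _), ?_, fun y hy hyx => ?_⟩
      · have : d x - d a ≠ 0 := sub_ne_zero.2 hd'.symm
        simp [h1, this]
      · rcases Finset.mem_insert.1 hy with rfl | hy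
        · simp
        · simp [h2 y hy hyx]

lemma exists_eq_on {α : Type*} (S : Subalgebra ℂ (α → ℂ)) (T : Finset α)
    (h : ∀ x ∈ T, ∀ y ∈ T, y ≠ x → ∃ c ∈ S, c y ≠ c x) (φ : α → ℂ) :
    ∃ c ∈ S, ∀ x ∈ T, c x = φ x := by
  classical
  have H : ∀ x ∈ T, ∃ c ∈ S, c x = 1 ∧ ∀ y ∈ T, y ≠ x → c y = 0 :=
    fun x hx => exists_delta S T x (h x hx)
  choose! c hc h1 h2 using H
  refine ⟨∑ x ∈ T, φ x • c x, S.sum_mem fun x hx => S.smul_mem (hc x hx) _, fun x hx => ?_⟩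
  rw [Finset.sum_apply, Finset.sum_eq_single x]
  · simp [h1 x hx]
  · intro y hy hyx
    simp [h2 y hy x hx hyx.symm]
  · exact fun h => absurd hx h

/-- A subspace of `ℂ^ι` stable under a family of diagonal operators that separates the basis
vectors contains the components of its elements. -/
lemma single_mem_of_diag {ι κ : Type*} [Fintype ι] [DecidableEq ι] (W : Submodule ℂ (ι → ℂ))
    (d : κ → ι → ℂ) (hW : ∀ k, ∀ w ∈ W, d k * w ∈ W)
    (hd : ∀ i j, (∀ k, d k i = d k j) → i = j) {w : ι → ℂ} (hw : w ∈ W) (j : ι) :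
    Pi.single j (w j) ∈ W := by
  let S : Subalgebra ℂ (ι → ℂ) :=
    { carrier := {c | ∀ w ∈ W, c * w ∈ W}
      mul_mem' := fun {a b} ha hb w hw => by rw [mul_assoc]; exact ha _ (hb _ hw)
      add_mem' := fun {a b} ha hb w hw => by rw [add_mul]; exact W.add_mem (ha _ hw) (hb _ hw)
      algebraMap_mem' := fun r w hw => by
        rw [← Algebra.smul_def]; exact W.smul_mem _ hw }
  obtain ⟨c, hc, h1, h2⟩ := exists_delta S Finset.univ j fun y _ hy => by
    by_contra! H
    exact hy (hd y j fun k => H (d k) (hW k))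
  convert hc w hw using 1
  funext i
  by_cases hi : i = j
  · subst hi; simp [h1]
  · simp [h2 i (Finset.mem_univ _) hi, hi]

/-! ### Finite-dimensional representations of `sl(2)` -/

section sl2

variable {V V' : Type*} [AddCommGroup V] [Module ℂ V] [FiniteDimensional ℂ V]
  [AddCommGroup V'] [Module ℂ V']

lemma sl2_highest {e f h : Module.End ℂ V} (h1 : h * e - e * h = e) (h2 : h * f - f * h = -f)
    (h3 : e * f - f * e = (2 : ℂ) • h) {x : V} {ν : ℂ} (hx : x ≠ 0) (hex : e x = 0)
    (hhx : h x = ν • x) : ∃ n : ℕ, 2 * ν = n := by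
  let : LieRing (Module.End ℂ V) := LieRing.ofAssociativeRing
  by_cases h0 : h = 0
  · refine ⟨0, ?_⟩
    rw [h0, lin_zero, eq_comm, smul_eq_zero, or_iff_left hx] at hhx
    simp [hhx]
  · have t : IsSl2Triple ((2 : ℂ) • h) e f :=
      { h_ne_zero := by simpa using h0
        lie_e_f := h3
        lie_h_e_nsmul := by
          rw [Ring.lie_def, smul_mul_assoc, mul_smul_comm, ← smul_sub, h1, two_smul, two_nsmul]
        lie_h_f_nsmul := by
          rw [Ring.lie_def, smul_mul_assoc, mul_smul_comm, ← smul_sub, h2, two_smul, two_nsmul,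
            neg_add] }
    have P : t.HasPrimitiveVectorWith x (2 * ν) :=
      { ne_zero := hx
        lie_h := by
          change ((2 : ℂ) • h) x = _
          rw [lin_smul, hhx, smul_smul]
        lie_e := hex }
    exact P.exists_nat

lemma exists_max_pow {e : Module.End ℂ V} (he : IsNilpotent e) {x : V} (hx : x ≠ 0) :
    ∃ m : ℕ, (e ^ m) x ≠ 0 ∧ e ((e ^ m) x) = 0 := by
  obtain ⟨n, hn⟩ := he
  obtain ⟨m, h1, h2⟩ := Nat.exists_not_and_succ_of_not_zero_of_exists (p := fun m => (e ^ m) x = 0)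
    (by simpa using hx) ⟨n, by simp [hn]⟩
  exact ⟨m, h1, by rw [← mul_apply, ← pow_succ']; exact h2⟩

lemma isNilpotent_of_eigenvalue {h : Module.End ℂ V} (H : ∀ μ, h.HasEigenvalue μ → μ = 0) :
    IsNilpotent h := by
  have h1 : h.maxGenEigenspace 0 = ⊤ := by
    rw [eq_top_iff, ← h.iSup_maxGenEigenspace_eq_top]
    refine iSup_le fun μ => ?_
    by_cases hμ : μ = 0
    · rw [hμ]
    · have : h.maxGenEigenspace μ = ⊥ := by
        by_contra h2
        apply hμ
        apply H
        rw [Module.End.maxGenEigenspace_eq] at h2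
        exact Module.End.hasEigenvalue_of_hasGenEigenvalue
          (k := h.maxGenEigenspaceIndex μ) h2
      rw [this]; exact bot_le
  rw [Module.End.maxGenEigenspace_eq] at h1
  refine ⟨h.maxGenEigenspaceIndex 0, ext fun x => ?_⟩
  have : x ∈ h.genEigenspace 0 (h.maxGenEigenspaceIndex 0) := by rw [h1]; trivial
  rw [Module.End.mem_genEigenspace_nat] at this
  simpa using this

lemma sl2_e_shift {e h : Module.End ℂ V} (h1 : h * e - e * h = e) {x : V} {ν : ℂ}
    (hx : h x = ν • x) (m : ℕ) : h ((e ^ m) x) = (ν + m) • (e ^ m) x := by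
  induction m with
  | zero => simpa using hx
  | succ m ih =>
    have := lin_congr h1 ((e ^ m) x)
    rw [lin_sub, mul_apply, mul_apply, ih, map_smul,
      sub_eq_iff_eq_add] at this
    rw [pow_succ', mul_apply, this]
    push_cast; module

lemma sl2_e_nilpotent {e h : Module.End ℂ V} (h1 : h * e - e * h = e) : IsNilpotent e := by
  refine isNilpotent_of_eigenvalue fun μ hμ => ?_
  by_contra h0
  obtain ⟨x, hx⟩ := hμ.exists_hasEigenvector
  -- `e` restricted to its `μ`-eigenspace would be invertible
  have key : ∀ n : ℕ, h * e ^ n - e ^ n * h = (n : ℂ) • e ^ n := by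
    intro n
    induction n with
    | zero => simp
    | succ n ih =>
      have : h * e ^ (n + 1) - e ^ (n + 1) * h =
          (h * e ^ n - e ^ n * h) * e + e ^ n * (h * e - e * h) := by
        rw [pow_succ]; noncomm_ring
      rw [this, ih, h1, smul_mul_assoc, ← pow_succ]
      push_cast; module
  have hp : ∀ P : Polynomial ℂ, h * Polynomial.aeval e P - Polynomial.aeval e P * h =
      Polynomial.aeval e (Polynomial.X * Polynomial.derivative P) := by
    intro P
    induction P using Polynomial.induction_on' with
    | add P Q hP hQ =>
      simp only [map_add, mul_add, add_mul] at hP hQ ⊢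
      rw [← hP, ← hQ]; abel
    | monomial n a =>
      rw [← Polynomial.C_mul_X_pow_eq_monomial]
      simp only [map_mul, Polynomial.aeval_C, map_pow, Polynomial.aeval_X,
        Polynomial.derivative_C_mul, Polynomial.derivative_X_pow]
      rw [← Algebra.smul_def, mul_smul_comm, smul_mul_assoc, ← smul_sub, key]
      rcases n with _ | n
      · simp
      · simp only [Nat.add_sub_cancel, map_natCast]
        rw [← Algebra.smul_def, mul_smul_comm, pow_succ']
        congr 1
        rw [← mul_assoc, ← Nat.cast_commute, mul_assoc, Nat.cast_smul_eq_nsmul, nsmul_eq_mul]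
  have hmin := hp (minpoly ℂ e)
  rw [minpoly.aeval, mul_zero, zero_mul, sub_zero] at hmin
  have hdvd := minpoly.dvd ℂ e hmin.symm
  have hroot : (minpoly ℂ e).IsRoot μ := Module.End.isRoot_of_hasEigenvalue hμ
  have hne : minpoly ℂ e ≠ 0 := minpoly.ne_zero (Algebra.IsIntegral.isIntegral e)
  have hm1 : 0 < (minpoly ℂ e).rootMultiplicity μ := (Polynomial.rootMultiplicity_pos hne).2 hroot
  have hne' : Polynomial.X * Polynomial.derivative (minpoly ℂ e) ≠ 0 := by
    refine mul_ne_zero Polynomial.X_ne_zero fun h => ?_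
    have : Nontrivial V := ⟨x, 0, hx.2⟩
    have : Nontrivial (Module.End ℂ V) := inferInstance
    have := Polynomial.derivative_eq_zero.1 h
    exact (minpoly.natDegree_pos (Algebra.IsIntegral.isIntegral e)).ne' this
  have hle := Polynomial.rootMultiplicity_le_rootMultiplicity_of_dvd hne' hdvd μ
  rw [Polynomial.rootMultiplicity_mul hne',
    Polynomial.derivative_rootMultiplicity_of_root hroot] at hle
  have : Polynomial.rootMultiplicity μ (Polynomial.X : Polynomial ℂ) = 0 := by
    rw [Polynomial.rootMultiplicity_eq_zero]
    simpa using h0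
  omega

lemma sl2_trivial_of_casimir {e f h : Module.End ℂ V} (h1 : h * e - e * h = e)
    (h2 : h * f - f * h = -f) (h3 : e * f - f * e = (2 : ℂ) • h)
    (hΩ : IsNilpotent (f * e + h * h + h)) : e = 0 := by
  have aux : ∀ (e f h : Module.End ℂ V), h * e - e * h = e → h * f - f * h = -f →
      e * f - f * e = (2 : ℂ) • h → IsNilpotent (f * e + h * h + h) →
      ∀ μ, h.HasEigenvalue μ → ∃ m : ℕ, μ = -m := by
    intro e f h h1 h2 h3 hΩ μ hμ
    obtain ⟨x, hx⟩ := hμ.exists_hasEigenvector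
    obtain ⟨m, hm1, hm2⟩ := exists_max_pow (sl2_e_nilpotent h1) hx.2
    have hhm := sl2_e_shift h1 hx.apply_eq_smul m
    obtain ⟨n, hn⟩ := sl2_highest h1 h2 h3 hm1 hm2 hhm
    set y := (e ^ m) x
    have hy : (f * e + h * h + h) y = ((μ + m) * (μ + m) + (μ + m)) • y := by
      simp only [lin_add, mul_apply, hm2, hhm, map_zero, map_smul]
      module
    have hy' : ∀ k : ℕ, ((f * e + h * h + h) ^ k) y = ((μ + m) * (μ + m) + (μ + m)) ^ k • y := by
      intro k
      induction k with
      | zero => simp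
      | succ k ih => rw [pow_succ', mul_apply, ih, map_smul, hy, smul_smul, pow_succ]
    obtain ⟨k, hk⟩ := hΩ
    have := hy' k
    rw [hk, lin_zero, eq_comm, smul_eq_zero, or_iff_left hm1] at this
    have := eq_zero_of_pow_eq_zero this
    have h4 : (μ + m) = n / 2 := by linear_combination hn / 2
    rw [h4] at this
    have h5 : (n : ℂ) * (n + 2) = 0 := by linear_combination 4 * this
    have h6 : n = 0 := by
      have : ((n * (n + 2) : ℕ) : ℂ) = 0 := by push_cast; exact h5
      have := Nat.cast_eq_zero.1 this
      simpa using this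
    refine ⟨m, ?_⟩
    rw [h6] at h4
    linear_combination h4
  have hnil : IsNilpotent h := isNilpotent_of_eigenvalue fun μ hμ => by
    obtain ⟨m, hm⟩ := aux e f h h1 h2 h3 hΩ μ hμ
    have hμ' : (-h).HasEigenvalue (-μ) := by
      obtain ⟨x, hx⟩ := hμ.exists_hasEigenvector
      refine Module.End.hasEigenvalue_of_hasEigenvector (x := x) ⟨?_, hx.2⟩
      rw [Module.End.mem_eigenspace_iff, LinearMap.neg_apply, hx.apply_eq_smul, neg_smul]
    obtain ⟨m', hm'⟩ := aux f e (-h) (by rw [neg_mul, mul_neg, sub_neg_eq_add, neg_add_eq_sub,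
        ← neg_sub, h2, neg_neg])
      (by rw [neg_mul, mul_neg, sub_neg_eq_add, neg_add_eq_sub, ← neg_sub, h1])
      (by rw [smul_neg, ← h3, neg_sub])
      (by
        convert hΩ using 1
        have : e * f = f * e + (2 : ℂ) • h := by rw [← h3]; abel
        rw [this, two_smul]; noncomm_ring) _ hμ'
    have h4 : ((m + m' : ℕ) : ℂ) = 0 := by push_cast; linear_combination hm + hm'
    have := Nat.cast_eq_zero.1 h4
    rw [hm, (by omega : m = 0)]; simp
  obtain ⟨n, hn⟩ := hnil
  have key : ∀ n : ℕ, (h - 1) ^ n * e = e * h ^ n := by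
    intro n
    induction n with
    | zero => simp
    | succ n ih =>
      have : (h - 1) * e = e * h := by rw [sub_mul, one_mul, sub_eq_iff_eq_add.1 h1]; abel
      rw [pow_succ, mul_assoc, this, ← mul_assoc, ih, mul_assoc, ← pow_succ]
  have h4 := key n
  rw [hn, mul_zero] at h4
  have hu : IsUnit (h - 1) := IsNilpotent.isUnit_sub_one ⟨n, hn⟩
  exact ((hu.pow n).mul_right_eq_zero).1 h4

lemma sl2_trivial_of_casimir' {e f h : Module.End ℂ V} (h1 : h * e - e * h = e)
    (h2 : h * f - f * h = -f) (h3 : e * f - f * e = (2 : ℂ) • h)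
    (hΩ : IsNilpotent (f * e + h * h + h)) : f = 0 :=
  sl2_trivial_of_casimir (e := f) (f := e) (h := -h)
    (by rw [neg_mul, mul_neg, sub_neg_eq_add, neg_add_eq_sub, ← neg_sub, h2, neg_neg])
    (by rw [neg_mul, mul_neg, sub_neg_eq_add, neg_add_eq_sub, ← neg_sub, h1])
    (by rw [smul_neg, ← h3, neg_sub])
    (by
      convert hΩ using 1
      have : e * f = f * e + (2 : ℂ) • h := by rw [← h3]; abel
      rw [this, two_smul]; noncomm_ring)

lemma sl2_invariant_lift {e f h : Module.End ℂ V} (h1 : h * e - e * h = e)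
    (h2 : h * f - f * h = -f) (h3 : e * f - f * e = (2 : ℂ) • h)
    {e' f' h' : Module.End ℂ V'} (L : V →ₗ[ℂ] V') (hLe : ∀ x, L (e x) = e' (L x))
    (hLf : ∀ x, L (f x) = f' (L x)) (hLh : ∀ x, L (h x) = h' (L x)) {v : V}
    (he : e' (L v) = 0) (hh : h' (L v) = 0) :
    ∃ v0, L v0 = L v ∧ e v0 = 0 ∧ f v0 = 0 ∧ h v0 = 0 := by
  set Ω := f * e + h * h + h with hΩ
  set Ω' := f' * e' + h' * h' + h' with hΩ'
  have eqe : h * e = e * h + e := by rw [← sub_eq_iff_eq_add'.1 h1]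
  have eqf : h * f = f * h - f := by rw [sub_eq_iff_eq_add.1 h2]; abel
  have eqef : e * f = f * e + (2 : ℂ) • h := by rw [← sub_eq_iff_eq_add'.1 h3]
  have ce : Ω * e = e * Ω := by
    have a1 : e * (f * e) = f * (e * e) + (2 : ℂ) • (e * h) + (2 : ℂ) • e := by
      rw [← mul_assoc, eqef, add_mul, mul_assoc, smul_mul_assoc, eqe]; module
    have a2 : h * h * e = e * (h * h) + (2 : ℂ) • (e * h) + e := by
      rw [mul_assoc, eqe, mul_add, ← mul_assoc, eqe, add_mul, mul_assoc]; module
    rw [hΩ, add_mul, add_mul, mul_add, mul_add, a1, a2, eqe, mul_assoc]; module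
  have cf : Ω * f = f * Ω := by
    have a1 : f * e * f = f * (f * e) + (2 : ℂ) • (f * h) := by
      rw [mul_assoc, eqef, mul_add, mul_smul_comm]
    have a2 : h * h * f = f * (h * h) - (2 : ℂ) • (f * h) + f := by
      rw [mul_assoc, eqf, mul_sub, ← mul_assoc, eqf, sub_mul, mul_assoc]; module
    rw [hΩ, add_mul, add_mul, mul_add, mul_add, a1, a2, eqf]; module
  have ch : Ω * h = h * Ω := by
    have a1 : h * (f * e) = f * e * h := by
      rw [← mul_assoc, eqf, sub_mul, mul_assoc, eqe, mul_add, mul_assoc]; abel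
    rw [hΩ, add_mul, add_mul, mul_add, mul_add, a1, mul_assoc h h h]
  have hLΩ : ∀ x, L (Ω x) = Ω' (L x) := fun x => by
    simp only [hΩ, hΩ', lin_add, mul_apply, map_add, hLe, hLf, hLh]
  have hLP : ∀ (P : Polynomial ℂ) x, L (Polynomial.aeval Ω P x) = Polynomial.aeval Ω' P (L x) := by
    intro P x
    induction P using Polynomial.induction_on' with
    | add P Q hP hQ => simp [hP, hQ]
    | monomial n a =>
      have : ∀ n : ℕ, ∀ x, L ((Ω ^ n) x) = (Ω' ^ n) (L x) := by
        intro n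
        induction n with
        | zero => simp
        | succ n ih => intro x; rw [pow_succ, mul_apply, ih, hLΩ, pow_succ]; rfl
      simp [Polynomial.aeval_monomial, this, Algebra.algebraMap_eq_smul_one]
  have hΩv : Ω' (L v) = 0 := by
    simp [hΩ', he, hh]
  have hPv : ∀ P : Polynomial ℂ, Polynomial.aeval Ω' P (L v) = P.eval 0 • L v := by
    intro P
    have : L v ∈ Module.End.eigenspace Ω' 0 := by
      rw [Module.End.mem_eigenspace_iff, hΩv, zero_smul]
    by_cases h0 : L v = 0
    · simp [h0]
    · exact Module.End.aeval_apply_of_hasEigenvector ⟨this, h0⟩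
  have hne : minpoly ℂ Ω ≠ 0 := minpoly.ne_zero (Algebra.IsIntegral.isIntegral Ω)
  obtain ⟨g, hg1, hg2⟩ := Polynomial.exists_eq_pow_rootMultiplicity_mul_and_not_dvd _ hne 0
  set n := (minpoly ℂ Ω).rootMultiplicity 0
  have hg0 : g.eval 0 ≠ 0 := fun h => hg2 (Polynomial.dvd_iff_isRoot.2 h)
  set W : Submodule ℂ V := ker (Ω ^ n) with hW
  have stab : ∀ x : Module.End ℂ V, Ω * x = x * Ω → ∀ w ∈ W, x w ∈ W := by
    intro x hx w hw
    have hx' : Ω ^ n * x = x * Ω ^ n := (Commute.pow_left hx n).eq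
    rw [hW, mem_ker] at hw ⊢
    rw [← mul_apply, hx', mul_apply, hw, map_zero]
  have se := stab e ce
  have sf := stab f cf
  have sh := stab h ch
  let e1 : Module.End ℂ W := e.restrict se
  let f1 : Module.End ℂ W := f.restrict sf
  let k1 : Module.End ℂ W := h.restrict sh
  have r1 : k1 * e1 - e1 * k1 = e1 := ext fun x => Subtype.ext (lin_congr h1 x)
  have r2 : k1 * f1 - f1 * k1 = -f1 :=
    ext fun x => Subtype.ext (lin_congr h2 x)
  have r3 : e1 * f1 - f1 * e1 = (2 : ℂ) • k1 :=
    ext fun x => Subtype.ext (lin_congr h3 x)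
  have rpow : ∀ (j : ℕ) (x : W), (((f1 * e1 + k1 * k1 + k1) ^ j) x : V) = (Ω ^ j) x := by
    intro j
    induction j with
    | zero => intro x; rfl
    | succ j ih => intro x; rw [pow_succ, mul_apply, ih, pow_succ]; rfl
  have rn : IsNilpotent (f1 * e1 + k1 * k1 + k1) :=
    ⟨n, ext fun x => Subtype.ext ((rpow n x).trans x.2)⟩
  have r4 : e1 = 0 := sl2_trivial_of_casimir r1 r2 r3 rn
  have r5 : f1 = 0 := sl2_trivial_of_casimir' r1 r2 r3 rn
  have r6 : k1 = 0 := by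
    rw [r4, r5] at r3
    simpa using r3.symm
  have hmem : Polynomial.aeval Ω g v ∈ W := by
    rw [hW, mem_ker, ← mul_apply]
    have := minpoly.aeval ℂ Ω
    rw [hg1, map_mul] at this
    simp only [map_zero, sub_zero, map_pow, Polynomial.aeval_X] at this
    rw [this, lin_zero]
  refine ⟨(g.eval 0)⁻¹ • Polynomial.aeval Ω g v, ?_, ?_, ?_, ?_⟩
  · rw [map_smul, hLP, hPv, smul_smul, inv_mul_cancel₀ hg0, one_smul]
  · rw [map_smul]
    have : e (Polynomial.aeval Ω g v) = 0 :=
      congrArg Subtype.val (lin_congr r4 ⟨_, hmem⟩)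
    rw [this, smul_zero]
  · rw [map_smul]
    have : f (Polynomial.aeval Ω g v) = 0 :=
      congrArg Subtype.val (lin_congr r5 ⟨_, hmem⟩)
    rw [this, smul_zero]
  · rw [map_smul]
    have : h (Polynomial.aeval Ω g v) = 0 :=
      congrArg Subtype.val (lin_congr r6 ⟨_, hmem⟩)
    rw [this, smul_zero]

end sl2

/-! ### Modules over the quantum group -/

instance {A V : Type} [Ring A] [Algebra ℂ A] [AddCommGroup V] [Module ℂ V] [Module.Finite ℂ V]
    (ρ : A →ₐ[ℂ] Module.End ℂ V) : Module.Finite ℂ (RepSpace ρ) :=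
  inferInstanceAs (Module.Finite ℂ V)

instance chain_finite : ∀ n, Module.Finite ℂ (Chain n)
  | 0 => inferInstanceAs (Module.Finite ℂ ℂ)
  | n + 1 => by
    have := chain_finite n
    exact inferInstanceAs (Module.Finite ℂ (Chain n × Chain n))

def RepSpace.out {A V : Type} [Ring A] [Algebra ℂ A] [AddCommGroup V] [Module ℂ V]
    (ρ : A →ₐ[ℂ] Module.End ℂ V) : RepSpace ρ ≃ₗ[ℂ] V := LinearEquiv.refl ℂ V

/-- The simple module `X_{s,r}`. -/
abbrev SX {p s : ℕ} (hp : 2 ≤ p) (hs : s ≤ p) (r : ℕ) : Type := RepSpace (simpleRep (r := r) hp hs)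

/-- The Weyl module of dimension `k + 1`. -/
abbrev DW {p : ℕ} (hp : 2 ≤ p) (k : ℕ) : Type := RepSpace (weylRep hp k)

/-- The contragredient Weyl module of dimension `k + 1`. -/
abbrev CW {p : ℕ} (hp : 2 ≤ p) (k : ℕ) : Type := RepSpace (contraRep (weylRep hp k) (uAnti hp))

/-- The spin chain as a module over the quantum group. -/
abbrev HC {p : ℕ} (hp : 2 ≤ p) (N : ℕ) : Type := RepSpace (chainRep hp N)

section basics

variable {p : ℕ} {Y Y' : Type*} [AddCommGroup Y] [Module ℂ Y] [Module (U p) Y]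
  [IsScalarTower ℂ (U p) Y] [AddCommGroup Y'] [Module ℂ Y'] [Module (U p) Y']
  [IsScalarTower ℂ (U p) Y']

lemma gen_smul_lift {V : Type} [AddCommGroup V] [Module ℂ V] (g : Gen → Module.End ℂ V)
    (hg : IsUq p g) (x : Gen) (v : RepSpace (U.lift g hg)) :
    U.gen p x • v = (g x : V →ₗ[ℂ] V) v := by
  rw [RepSpace.smul_def, U.lift_gen]

instance (priority := 50) smulCommTower : SMulCommClass ℂ (U p) Y where
  smul_comm c u y := by
    rw [← algebraMap_smul (U p) c (u • y), ← algebraMap_smul (U p) c y, smul_smul, smul_smul,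
      Algebra.commutes]

lemma smul_comm_U (c : ℂ) (u : U p) (y : Y) : u • c • y = c • u • y := (smul_comm c u y).symm

lemma act_K_Kinv (y : Y) : U.gen p .K • U.gen p .Kinv • y = y := by
  rw [smul_smul, (U.isUq p).K_Kinv, one_smul]

lemma act_Kinv_K (y : Y) : U.gen p .Kinv • U.gen p .K • y = y := by
  rw [smul_smul, (U.isUq p).Kinv_K, one_smul]

lemma act_K_F (y : Y) : U.gen p .K • U.gen p .F • y =
    q p ^ (-2 : ℤ) • U.gen p .F • U.gen p .K • y := by
  rw [smul_smul, (U.isUq p).K_F, smul_assoc, mul_smul]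
  congr 1; simp

lemma act_E_F (y : Y) : U.gen p .E • U.gen p .F • y = U.gen p .F • U.gen p .E • y +
    (q p - (q p)⁻¹)⁻¹ • (U.gen p .K • y - U.gen p .Kinv • y) := by
  have := congrArg (· • y) (U.isUq p).E_F
  simp only [sub_smul, mul_smul, smul_assoc] at this
  rw [← this]; abel

lemma act_e_f (y : Y) : U.gen p .e • U.gen p .f • y = U.gen p .f • U.gen p .e • y +
    (2 : ℂ) • U.gen p .h • y := by
  have := congrArg (· • y) (U.isUq p).e_f
  simp only [sub_smul, mul_smul, smul_assoc] at this
  rw [← this]; abel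

lemma act_h_f (y : Y) : U.gen p .h • U.gen p .f • y = U.gen p .f • U.gen p .h • y -
    U.gen p .f • y := by
  have := congrArg (· • y) (U.isUq p).h_f
  simp only [sub_smul, mul_smul, neg_smul] at this
  rw [sub_eq_iff_eq_add.1 this]; abel

lemma act_E_f (y : Y) : U.gen p .E • U.gen p .f • y = U.gen p .f • U.gen p .E • y +
    ((-1) ^ (p + 1) * (qFact p (p - 1))⁻¹) • (U.gen p .F ^ (p - 1) •
      kBr p (U.gen p .K) (U.gen p .Kinv) • y) := by
  have := congrArg (· • y) (U.isUq p).E_f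
  simp only [sub_smul] at this
  rw [smul_assoc, mul_smul, mul_smul, mul_smul (U.gen p .F ^ (p - 1))] at this
  rw [← this]; abel

lemma act_F_e (y : Y) : U.gen p .F • U.gen p .e • y = U.gen p .e • U.gen p .F • y +
    ((qFact p (p - 1))⁻¹) • (U.gen p .K ^ p • kBr p (U.gen p .K) (U.gen p .Kinv) •
      U.gen p .E ^ (p - 1) • y) := by
  have := congrArg (· • y) (U.isUq p).F_e
  simp only [sub_smul, mul_smul, smul_assoc] at this
  rw [← this]; abel

lemma h_eq : U.gen p .h = (2 : ℂ)⁻¹ • (U.gen p .e * U.gen p .f - U.gen p .f * U.gen p .e) := by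
  rw [(U.isUq p).e_f, smul_smul]; norm_num

/-- A linear map that commutes with the generators is a homomorphism of modules. -/
def mkHom (f : Y →ₗ[ℂ] Y') (hE : ∀ y, f (U.gen p .E • y) = U.gen p .E • f y)
    (hF : ∀ y, f (U.gen p .F • y) = U.gen p .F • f y)
    (hK : ∀ y, f (U.gen p .K • y) = U.gen p .K • f y)
    (he : ∀ y, f (U.gen p .e • y) = U.gen p .e • f y)
    (hf : ∀ y, f (U.gen p .f • y) = U.gen p .f • f y) : Y →ₗ[U p] Y' where
  toFun := f
  map_add' := map_add f
  map_smul' u := by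
    have H : ∀ y, f (u • y) = u • f y := by
      induction u using U.induction with
      | hc c => intro y; rw [algebraMap_smul, algebraMap_smul, map_smul]
      | hm u v h1 h2 => intro y; rw [mul_smul, h1, h2, mul_smul]
      | ha u v h1 h2 => intro y; rw [add_smul, map_add, h1, h2, add_smul]
      | hg x =>
        intro y
        cases x with
        | E => exact hE y
        | F => exact hF y
        | K => exact hK y
        | e => exact he y
        | f => exact hf y
        | Kinv =>
          have := hK (U.gen p .Kinv • y)
          rw [act_K_Kinv] at this
          rw [this, act_Kinv_K]
        | h =>
          simp only [h_eq, smul_assoc, sub_smul, mul_smul, map_smul, map_sub, he, hf]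
    exact H

@[simp] lemma mkHom_apply (f : Y →ₗ[ℂ] Y') (hE hF hK he hf) (y : Y) :
    mkHom (p := p) f hE hF hK he hf y = f y := rfl

/-- A homomorphism of modules over `U p` is `ℂ`-linear. -/
def toC (f : Y →ₗ[U p] Y') : Y →ₗ[ℂ] Y' where
  toFun := f
  map_add' := map_add f
  map_smul' c y := by
    rw [← algebraMap_smul (U p) c y, map_smul, algebraMap_smul]; rfl

@[simp] lemma toC_apply (f : Y →ₗ[U p] Y') (y : Y) : toC f y = f y := rfl

lemma hom_smul (f : Y →ₗ[U p] Y') (c : ℂ) (y : Y) : f (c • y) = c • f y := (toC f).map_smul c y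

/-! ### Highest-weight vectors -/

lemma K_pow_F {z : Y} {c : ℂ} (hK : U.gen p .K • z = c • z) (n : ℕ) :
    U.gen p .K • U.gen p .F ^ n • z = (c * q p ^ (-2 * n : ℤ)) • U.gen p .F ^ n • z := by
  induction n with
  | zero => simpa using hK
  | succ n ih =>
    rw [pow_succ', mul_smul, act_K_F, ih, smul_comm_U, smul_smul]
    congr 1
    rw [mul_left_comm, ← zpow_add₀ (q_ne p)]
    congr 2; push_cast; ring

lemma Kinv_of_K {z : Y} {c : ℂ} (hc : c ≠ 0) (hK : U.gen p .K • z = c • z) :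
    U.gen p .Kinv • z = c⁻¹ • z := by
  have := congrArg (U.gen p .Kinv • ·) hK
  simp only [act_Kinv_K, smul_comm_U] at this
  rw [eq_inv_smul_iff₀ hc, ← this]

lemma E_pow_F (hp : 2 ≤ p) {z : Y} {ε : ℂ} (hε : ε * ε = 1) (s : ℤ)
    (hK : U.gen p .K • z = (ε * q p ^ (s - 1)) • z) (hE : U.gen p .E • z = 0) (n : ℕ) :
    U.gen p .E • U.gen p .F ^ (n + 1) • z =
      (ε * qInt p (n + 1) * qInt p (s - (n + 1))) • U.gen p .F ^ n • z := by
  have hq := q_ne p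
  have hε0 : ε ≠ 0 := left_ne_zero_of_mul_eq_one hε
  have hεi : ε⁻¹ = ε := inv_eq_of_mul_eq_one_left hε
  have key : ∀ n : ℤ, qInt p (n + 1) * qInt p (s - (n + 1)) = qInt p n * qInt p (s - n) +
      (q p - (q p)⁻¹)⁻¹ * (q p ^ (s - 1 - 2 * n) - q p ^ (-(s - 1 - 2 * n))) := by
    intro n
    have hq' := q_sub_ne hp
    simp only [qInt]
    have e1 : s - (n + 1) = s - n - 1 := by ring
    have e2 : s - 1 - 2 * n = s - n - n - 1 := by ring
    rw [e1, e2]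
    simp only [zpow_add₀ hq, zpow_sub₀ hq, zpow_neg, zpow_one]
    have := zpow_ne_zero n hq
    have := zpow_ne_zero s hq
    have hq2 : q p ^ 2 - 1 ≠ 0 := fun h => hq' (by field_simp; linear_combination h)
    field_simp
    ring
  have hKF : ∀ n : ℕ, (q p - (q p)⁻¹)⁻¹ • (U.gen p .K • U.gen p .F ^ n • z -
      U.gen p .Kinv • U.gen p .F ^ n • z) = (ε * ((q p - (q p)⁻¹)⁻¹ *
        (q p ^ (s - 1 - 2 * n) - q p ^ (-(s - 1 - 2 * n))))) • U.gen p .F ^ n • z := by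
    intro n
    have h1 := K_pow_F hK n
    have e1 : ε * q p ^ (s - 1) * q p ^ (-2 * n : ℤ) = ε * q p ^ (s - 1 - 2 * n) := by
      rw [mul_assoc, ← zpow_add₀ hq]; ring_nf
    rw [e1] at h1
    rw [Kinv_of_K (mul_ne_zero hε0 (zpow_ne_zero _ hq)) h1, h1, ← sub_smul, smul_smul, mul_inv,
      hεi, ← zpow_neg]
    congr 1; ring
  induction n with
  | zero =>
    rw [zero_add, pow_one, act_E_F, hE, smul_zero, zero_add]
    have h0 := hKF 0
    have k0 := key 0
    simp only [pow_zero, one_smul, Nat.cast_zero] at h0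
    rw [h0]
    simp only [Nat.cast_zero, pow_zero, one_smul]
    have k1 : qInt p 1 * qInt p (s - 1) = (q p - (q p)⁻¹)⁻¹ * (q p ^ (s - 1) - q p ^ (-(s - 1))) := by
      simpa [qInt_zero] using k0
    simp only [mul_zero, sub_zero, zero_add, mul_assoc, k1]
  | succ n ih =>
    rw [pow_succ', mul_smul, act_E_F, ih, hKF, smul_comm_U, ← mul_smul, ← pow_succ', ← add_smul]
    congr 1
    have := key (n + 1)
    push_cast
    rw [mul_assoc, mul_assoc, this]; ring

lemma E_pow_succ_F (hp : 2 ≤ p) {z : Y} {ε : ℂ} (hε : ε * ε = 1) (s : ℤ)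
    (hK : U.gen p .K • z = (ε * q p ^ (s - 1)) • z) (hE : U.gen p .E • z = 0) (n m : ℕ)
    (hnm : n < m) : U.gen p .E ^ m • U.gen p .F ^ n • z = 0 := by
  induction n generalizing m with
  | zero =>
    obtain ⟨m, rfl⟩ : ∃ j, m = j + 1 := ⟨m - 1, by omega⟩
    rw [pow_succ, mul_smul, pow_zero, one_smul, hE, smul_zero]
  | succ n ih =>
    obtain ⟨m, rfl⟩ : ∃ j, m = j + 1 := ⟨m - 1, by omega⟩
    rw [pow_succ, mul_smul, E_pow_F hp hε s hK hE, smul_comm_U, ih m (by omega), smul_zero]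

lemma kBr_smul {z : Y} {c : ℂ} (hc : c ≠ 0) (hK : U.gen p .K • z = c • z) :
    kBr p (U.gen p .K) (U.gen p .Kinv) • z =
      ((q p - (q p)⁻¹)⁻¹ * (q p * c - (q p)⁻¹ * c⁻¹)) • z := by
  rw [kBr, smul_assoc, sub_smul, smul_assoc, smul_assoc, hK, Kinv_of_K hc hK]
  module

lemma comm_pow_F_f (n m : ℕ) (y : Y) : U.gen p .F ^ n • U.gen p .f ^ m • y =
    U.gen p .f ^ m • U.gen p .F ^ n • y := by
  rw [smul_smul, smul_smul, (Commute.pow_pow (U.isUq p).F_f n m).eq]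

/-- The linear map underlying the universal map out of `X_{s,r}`. -/
def simpleLin (p : ℕ) {Y : Type*} [AddCommGroup Y] [Module ℂ Y] [Module (U p) Y] (s r : ℕ) (y : Y) : (Fin s × Fin r → ℂ) →ₗ[ℂ] Y :=
  Fintype.linearCombination ℂ fun j : Fin s × Fin r =>
    U.gen p .F ^ (j.1 : ℕ) • U.gen p .f ^ (j.2 : ℕ) • y

lemma vec_eq_single {s r : ℕ} (n : Fin s) (m : Fin r) :
    (vec (n : ℕ) (m : ℕ) : Fin s × Fin r → ℂ) = Pi.single (n, m) 1 := by
  funext j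
  simp only [vec, Pi.single_apply, Prod.ext_iff, Fin.ext_iff, Nat.cast_inj]

lemma simpleLin_vec {s r : ℕ} (y : Y) {n m : ℕ} (hn : n < s) (hm : m < r) :
    simpleLin p s r y (vec n m) = U.gen p .F ^ n • U.gen p .f ^ m • y := by
  have := vec_eq_single (⟨n, hn⟩ : Fin s) (⟨m, hm⟩ : Fin r)
  simp only at this
  rw [this, simpleLin, Fintype.linearCombination_apply_single, one_smul]

lemma simple_ext {Z : Type*} [AddCommGroup Z] [Module ℂ Z] {s r : ℕ}
    {S T : (Fin s × Fin r → ℂ) →ₗ[ℂ] Z}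
    (h : ∀ n m : ℕ, n < s → m < r → S (vec n m) = T (vec n m)) : S = T := by
  refine (Pi.basisFun ℂ (Fin s × Fin r)).ext fun j => ?_
  have := h j.1 j.2 j.1.2 j.2.2
  rw [vec_eq_single] at this
  simpa using this

/-- The universal property of the simple module `X_{s,r}`. -/
lemma exists_simple_hom (hp : 2 ≤ p) {s r : ℕ} (hs : s ≤ p) (hs1 : 1 ≤ s) (hr : 1 ≤ r) (y : Y)
    (hK : U.gen p .K • y = ((-1) ^ (r - 1) * q p ^ ((s : ℤ) - 1)) • y)
    (hE : U.gen p .E • y = 0) (he : U.gen p .e • y = 0)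
    (hh : U.gen p .h • y = (((r : ℂ) - 1) / 2) • y)
    (hF : U.gen p .F ^ s • y = 0) (hf : U.gen p .f ^ r • y = 0) :
    ∃ φ : SX hp hs r →ₗ[U p] Y, ∀ n m : ℕ, n < s → m < r →
      φ (vec n m : Fin s × Fin r → ℂ) = U.gen p .F ^ n • U.gen p .f ^ m • y := by
  have hε : ((-1 : ℂ) ^ (r - 1)) * (-1) ^ (r - 1) = 1 := sign_sq _
  set ε : ℂ := (-1) ^ (r - 1)
  have hε0 : ε ≠ 0 := left_ne_zero_of_mul_eq_one hε
  have hq := q_ne p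
  have hc0 : ε * q p ^ ((s : ℤ) - 1) ≠ 0 := mul_ne_zero hε0 (zpow_ne_zero _ hq)
  have hKm : ∀ m : ℕ, U.gen p .K • U.gen p .f ^ m • y =
      (ε * q p ^ ((s : ℤ) - 1)) • U.gen p .f ^ m • y := by
    intro m
    rw [smul_smul, (Commute.pow_right (U.isUq p).K_f m).eq, mul_smul, hK, smul_comm_U]
  have hEm : ∀ m : ℕ, U.gen p .E • U.gen p .f ^ m • y = 0 := by
    intro m
    induction m with
    | zero => simpa using hE
    | succ m ih =>
      rw [pow_succ', mul_smul, act_E_f, ih, smul_zero, zero_add, kBr_smul hc0 (hKm m)]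
      rcases hs.lt_or_eq with h | h
      · have : U.gen p .F ^ (p - 1) • U.gen p .f ^ m • y = 0 := by
          rw [comm_pow_F_f, (by omega : p - 1 = (p - 1 - s) + s), pow_add, mul_smul, hF, smul_zero,
            smul_zero]
        rw [smul_comm_U, this, smul_zero, smul_zero]
      · have : (q p - (q p)⁻¹)⁻¹ * (q p * (ε * q p ^ ((s : ℤ) - 1)) -
            (q p)⁻¹ * (ε * q p ^ ((s : ℤ) - 1))⁻¹) = 0 := by
          rw [inv_eq_of_mul_eq_one_left (b := ε * q p ^ ((s : ℤ) - 1))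
            (a := ε * q p ^ (1 - (s : ℤ)))]
          · have h1 : q p * q p ^ ((s : ℤ) - 1) = -1 := by
              rw [← q_pow_p hp, h, ← zpow_one_add₀ hq]; congr 1; ring
            have h2 : (q p)⁻¹ * q p ^ (1 - (s : ℤ)) = -1 := by
              rw [← zpow_neg_one, ← zpow_add₀ hq, h, (by ring : -1 + (1 - (p : ℤ)) = -p), zpow_neg,
                q_pow_p hp]
              norm_num
            linear_combination (q p - (q p)⁻¹)⁻¹ * ε * (h1 - h2)
          · rw [mul_mul_mul_comm, hε, one_mul, ← zpow_add₀ hq]; simp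
        rw [this, zero_smul, smul_zero, smul_zero]
  have hhm : ∀ m : ℕ, U.gen p .h • U.gen p .f ^ m • y =
      (((r : ℂ) - 1) / 2 - m) • U.gen p .f ^ m • y := by
    intro m
    induction m with
    | zero => simpa using hh
    | succ m ih =>
      rw [pow_succ', mul_smul, act_h_f, ih, smul_comm_U]
      generalize U.gen p .f • U.gen p .f ^ m • y = w
      push_cast; module
  have hem : ∀ m : ℕ, U.gen p .e • U.gen p .f ^ (m + 1) • y =
      (((m : ℂ) + 1) * (r - (m + 1))) • U.gen p .f ^ m • y := by
    intro m
    induction m with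
    | zero =>
      rw [zero_add, pow_one, act_e_f, he, smul_zero, hh, zero_add, smul_smul, pow_zero, one_smul]
      congr 1; push_cast; ring
    | succ m ih =>
      rw [pow_succ', mul_smul, act_e_f, ih, hhm, smul_comm_U, ← mul_smul (U.gen p .f), ← pow_succ']
      generalize U.gen p .f ^ (m + 1) • y = w
      push_cast; module
  have hEnm := fun n m => E_pow_F hp hε s (hKm m) (hEm m) n
  have heF : ∀ n m : ℕ, n < s → U.gen p .e • U.gen p .F ^ n • U.gen p .f ^ m • y =
      U.gen p .F ^ n • U.gen p .e • U.gen p .f ^ m • y := by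
    intro n m hn
    induction n with
    | zero => simp
    | succ n ih =>
      have h1 := act_F_e (p := p) (U.gen p .F ^ n • U.gen p .f ^ m • y)
      rw [E_pow_succ_F hp hε s (hKm m) (hEm m) n _ (by omega), smul_zero, smul_zero, smul_zero,
        add_zero, ih (by omega)] at h1
      rw [pow_succ', mul_smul, ← h1, mul_smul]
  let S := simpleLin p s r y
  have hS : ∀ n m : ℕ, n < s → m < r → S (vec n m) = U.gen p .F ^ n • U.gen p .f ^ m • y :=
    fun n m hn hm => simpleLin_vec y hn hm
  have hop : ∀ u : U p, ∃ T : Y →ₗ[ℂ] Y, ∀ z, T z = u • z := fun u =>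
    ⟨Algebra.lsmul ℂ ℂ Y u, fun z => rfl⟩
  let S' : SX hp hs r →ₗ[ℂ] Y := S ∘ₗ (RepSpace.out (simpleRep (r := r) hp hs)).toLinearMap
  have main : ∀ x : Gen, (∀ n m : ℕ, n < s → m < r → S (simpleGen p s r x (vec n m)) =
      U.gen p x • S (vec n m)) → ∀ v : SX hp hs r, S' (U.gen p x • v) = U.gen p x • S' v := by
    intro x hx v
    obtain ⟨T, hT⟩ := hop (U.gen p x)
    have : S ∘ₗ (simpleGen p s r x) = T ∘ₗ S := simple_ext fun n m hn hm => by
      rw [comp_apply, comp_apply, hT, hx n m hn hm]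
    rw [← hT, show U.gen p x • v = _ from gen_smul_lift _ _ x v]
    exact lin_congr this (RepSpace.out _ v)
  refine ⟨mkHom S' (main .E ?_) (main .F ?_) (main .K ?_) (main .e ?_)
    (main .f ?_), fun n m hn hm => hS n m hn hm⟩
  · intro n m hn hm
    rw [sE, map_smul, hS n m hn hm]
    rcases n with _ | n
    · rw [pow_zero, one_smul, hEm]; simp [qInt_zero]
    · have e1 : ((n + 1 : ℕ) : ℤ) - 1 = (n : ℕ) := by push_cast; ring
      rw [e1, hS n m (by omega) hm, hEnm]; push_cast; rfl
  · intro n m hn hm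
    rw [sF (by omega), hS n m hn hm, ← mul_smul, ← pow_succ']
    by_cases h : n + 1 < s
    · rw [← hS _ _ h hm]; push_cast; rfl
    · obtain rfl : s = n + 1 := by omega
      rw [vec_zero (by push_cast; omega), map_zero, comm_pow_F_f, hF, smul_zero]
  · intro n m hn hm
    rw [sK, map_smul, hS n m hn hm, K_pow_F (hKm m)]
    congr 1
    rw [mul_assoc, ← zpow_add₀ hq]; ring_nf; rfl
  · intro n m hn hm
    rw [se, map_smul, hS n m hn hm, heF n m hn]
    rcases m with _ | m
    · rw [pow_zero, one_smul, he]; simp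
    · have e1 : ((m + 1 : ℕ) : ℤ) - 1 = (m : ℕ) := by push_cast; ring
      rw [e1, hS n m hn (by omega), hem, smul_comm_U]; push_cast; rfl
  · intro n m hn hm
    rw [sf (by omega), hS n m hn hm]
    have h1 : U.gen p .f • U.gen p .F ^ n • U.gen p .f ^ m • y =
        U.gen p .F ^ n • U.gen p .f ^ (m + 1) • y := by
      rw [comm_pow_F_f n m, comm_pow_F_f n (m + 1), pow_succ', mul_smul]
    rw [h1]
    by_cases h : m + 1 < r
    · rw [← hS _ _ hn h]; push_cast; rfl
    · obtain rfl : r = m + 1 := by omega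
      rw [vec_zero (by push_cast; omega), map_zero, hf, smul_zero]

end basics

/-! ### The simple modules -/

section simple

variable {p s r : ℕ} (hp : 2 ≤ p) (hs : s ≤ p)

def sv (r : ℕ) (n m : ℤ) : SX hp hs r := (vec n m : Fin s × Fin r → ℂ)

variable {hp hs}

lemma sv_zero {n m : ℤ} (h : ¬ ((0 ≤ n ∧ n < s) ∧ (0 ≤ m ∧ m < r))) : sv hp hs r n m = 0 :=
  vec_zero h

lemma sv_gen (x : Gen) (n m : ℤ) : U.gen p x • sv hp hs r n m = simpleGen p s r x (vec n m) :=
  gen_smul_lift _ _ _ _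

lemma sv_E (n m : ℤ) : U.gen p .E • sv hp hs r n m =
    ((-1) ^ (r - 1) * qInt p n * qInt p (s - n)) • sv hp hs r (n - 1) m :=
  (sv_gen _ _ _).trans (sE n m)

lemma sv_e (n m : ℤ) : U.gen p .e • sv hp hs r n m =
    ((m : ℂ) * (r - m)) • sv hp hs r n (m - 1) :=
  (sv_gen _ _ _).trans (se n m)

lemma sv_K (n m : ℤ) : U.gen p .K • sv hp hs r n m =
    ((-1) ^ (r - 1) * q p ^ ((s : ℤ) - 1 - 2 * n)) • sv hp hs r n m :=
  (sv_gen _ _ _).trans (sK n m)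

lemma sv_h (n m : ℤ) : U.gen p .h • sv hp hs r n m =
    (((r : ℂ) - 1 - 2 * m) / 2) • sv hp hs r n m :=
  (sv_gen _ _ _).trans (sh n m)

lemma sv_F {n : ℤ} (hn : n ≠ -1) (m : ℤ) : U.gen p .F • sv hp hs r n m = sv hp hs r (n + 1) m :=
  (sv_gen _ _ _).trans (sF hn)

lemma sv_f {m : ℤ} (hm : m ≠ -1) (n : ℤ) : U.gen p .f • sv hp hs r n m = sv hp hs r n (m + 1) :=
  (sv_gen _ _ _).trans (sf hm)

lemma sv_F_pow (j : ℕ) {n : ℤ} (hn : 0 ≤ n) (m : ℤ) :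
    U.gen p .F ^ j • sv hp hs r n m = sv hp hs r (n + j) m := by
  induction j with
  | zero => simp
  | succ j ih => rw [pow_succ', mul_smul, ih, sv_F (by omega)]; congr 1; push_cast; ring

lemma sv_f_pow (j : ℕ) {m : ℤ} (hm : 0 ≤ m) (n : ℤ) :
    U.gen p .f ^ j • sv hp hs r n m = sv hp hs r n (m + j) := by
  induction j with
  | zero => simp
  | succ j ih => rw [pow_succ', mul_smul, ih, sv_f (by omega)]; congr 1; push_cast; ring

lemma sv_generate (n m : ℕ) : sv hp hs r n m =
    U.gen p .F ^ n • U.gen p .f ^ m • sv hp hs r 0 0 := by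
  rw [sv_f_pow _ le_rfl, sv_F_pow _ le_rfl]; simp

lemma sv_ne (n : Fin s) (m : Fin r) : sv hp hs r (n : ℕ) (m : ℕ) ≠ 0 := by
  intro h
  have := congrFun (show (vec (n : ℕ) (m : ℕ) : Fin s × Fin r → ℂ) = 0 from h) (n, m)
  simp [vec] at this

lemma sx_span {W : Submodule (U p) (SX hp hs r)} (h : sv hp hs r 0 0 ∈ W) : W = ⊤ := by
  rw [eq_top_iff]
  intro v _
  have hv : v = ∑ j : Fin s × Fin r, (v : Fin s × Fin r → ℂ) j • sv hp hs r (j.1 : ℕ) (j.2 : ℕ) := by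
    have := pi_eq_sum_univ' (v : Fin s × Fin r → ℂ)
    refine this.trans (Finset.sum_congr rfl fun j _ => ?_)
    congr 1
    change _ = (vec (j.1 : ℕ) (j.2 : ℕ) : Fin s × Fin r → ℂ)
    rw [vec_eq_single]
  rw [hv]
  refine W.sum_mem fun j _ => ?_
  rw [← algebraMap_smul (U p), sv_generate]
  exact W.smul_mem _ (W.smul_mem _ (W.smul_mem _ h))

lemma smul_mem_C {Y : Type*} [AddCommGroup Y] [Module ℂ Y] [Module (U p) Y]
    [IsScalarTower ℂ (U p) Y] (W : Submodule (U p) Y) (c : ℂ) {y : Y} (hy : y ∈ W) : c • y ∈ W := by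
  rw [← algebraMap_smul (U p)]; exact W.smul_mem _ hy

lemma mem_of_smul_mem {Y : Type*} [AddCommGroup Y] [Module ℂ Y] [Module (U p) Y]
    [IsScalarTower ℂ (U p) Y] (W : Submodule (U p) Y) {c : ℂ} (hc : c ≠ 0) {y : Y}
    (hy : c • y ∈ W) : y ∈ W := by
  have := smul_mem_C W c⁻¹ hy
  rwa [smul_smul, inv_mul_cancel₀ hc, one_smul] at this

lemma q_zpow_inj (hp : 2 ≤ p) {a b : ℤ} (h : q p ^ a = q p ^ b) : (2 * p : ℤ) ∣ a - b := by
  have h1 : q p ^ (a - b) = 1 := by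
    rw [zpow_sub₀ (q_ne p), h, div_self (zpow_ne_zero _ (q_ne p))]
  obtain ⟨c, hc⟩ := (q_zpow_eq_iff hp (a - b)).1 (by rw [zpow_neg, h1, inv_one])
  have h2 := q_shift hp c 0
  rw [zero_add, mul_comm, ← hc, h1, zpow_zero, mul_one] at h2
  rcases Int.even_or_odd c with ⟨d, hd⟩ | hd
  · exact ⟨d, by rw [hc, hd]; ring⟩
  · rw [hd.neg_one_zpow] at h2
    norm_num at h2

instance sx_simple [NeZero s] [NeZero r] : IsSimpleModule (U p) (SX hp hs r) := by
  have hs0 : 0 < s := Nat.pos_of_ne_zero (NeZero.ne s)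
  have hr0 : 0 < r := Nat.pos_of_ne_zero (NeZero.ne r)
  have : Nontrivial (SX hp hs r) := ⟨sv hp hs r 0 0, 0, sv_ne ⟨0, hs0⟩ ⟨0, hr0⟩⟩
  rw [isSimpleModule_iff]
  refine { eq_bot_or_eq_top := fun W => ?_ }
  rw [or_iff_not_imp_left]
  intro hW
  obtain ⟨w, hw, hw0⟩ := W.exists_mem_ne_zero_of_ne_bot hW
  have hw0' : (w : Fin s × Fin r → ℂ) ≠ 0 := hw0
  obtain ⟨j, hj⟩ := Function.ne_iff.1 hw0'
  -- diagonal operators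
  have hK : ∀ v : Fin s × Fin r → ℂ, simpleGen p s r .K v =
      (fun j : Fin s × Fin r => (-1) ^ (r - 1) * q p ^ ((s : ℤ) - 1 - 2 * (j.1 : ℕ))) * v := by
    intro v
    refine lin_congr (f := simpleGen p s r .K) (g := LinearMap.mulLeft ℂ
      (fun j : Fin s × Fin r => (-1) ^ (r - 1) * q p ^ ((s : ℤ) - 1 - 2 * (j.1 : ℕ))))
      (simple_ext fun n m hn hm => ?_) v
    rw [sK, LinearMap.mulLeft_apply]
    funext j
    simp only [Pi.smul_apply, Pi.mul_apply, vec, smul_eq_mul]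
    split_ifs with h
    · rw [h.1]
    · simp
  have hh : ∀ v : Fin s × Fin r → ℂ, simpleGen p s r .h v =
      (fun j : Fin s × Fin r => ((r : ℂ) - 1 - 2 * (j.2 : ℕ)) / 2) * v := by
    intro v
    refine lin_congr (f := simpleGen p s r .h) (g := LinearMap.mulLeft ℂ
      (fun j : Fin s × Fin r => ((r : ℂ) - 1 - 2 * (j.2 : ℕ)) / 2))
      (simple_ext fun n m hn hm => ?_) v
    rw [sh, LinearMap.mulLeft_apply]
    funext j
    simp only [Pi.smul_apply, Pi.mul_apply, vec, smul_eq_mul]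
    split_ifs with h
    · have := h.2
      rw [Nat.cast_inj] at this
      rw [this]; simp
    · simp
  have hmem := single_mem_of_diag (W.restrictScalars ℂ : Submodule ℂ (Fin s × Fin r → ℂ))
    (fun b : Bool => if b then
      (fun j : Fin s × Fin r => (-1) ^ (r - 1) * q p ^ ((s : ℤ) - 1 - 2 * (j.1 : ℕ)))
      else fun j => ((r : ℂ) - 1 - 2 * (j.2 : ℕ)) / 2)
    (by
      intro b w hw
      cases b
      · have h1 := W.smul_mem (U.gen p .h)
          (x := (RepSpace.out (simpleRep (r := r) hp hs)).symm w) hw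
        have h2 : U.gen p .h • (RepSpace.out (simpleRep (r := r) hp hs)).symm w =
            (RepSpace.out (simpleRep (r := r) hp hs)).symm _ :=
          (gen_smul_lift _ _ _ _).trans (hh w)
        rw [h2] at h1
        exact h1
      · have h1 := W.smul_mem (U.gen p .K)
          (x := (RepSpace.out (simpleRep (r := r) hp hs)).symm w) hw
        have h2 : U.gen p .K • (RepSpace.out (simpleRep (r := r) hp hs)).symm w =
            (RepSpace.out (simpleRep (r := r) hp hs)).symm _ :=
          (gen_smul_lift _ _ _ _).trans (hK w)
        rw [h2] at h1
        exact h1)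
    (by
      intro i j hij
      have h1 := hij true
      have h2 := hij false
      simp only [if_true, Bool.false_eq_true, if_false] at h1 h2
      have h3 := mul_left_cancel₀ (pow_ne_zero (r - 1) (by norm_num : (-1 : ℂ) ≠ 0)) h1
      obtain ⟨c, hc⟩ := q_zpow_inj hp h3
      have b1 := i.1.2
      have b2 := j.1.2
      have hc' : ((j.1 : ℕ) : ℤ) - (i.1 : ℕ) = p * c := by linarith
      have : c = 0 := by
        by_contra h0
        rcases lt_or_gt_of_ne h0 with h | h
        · nlinarith
        · nlinarith
      subst this
      have h4 : ((i.2 : ℕ) : ℂ) = (j.2 : ℕ) := by linear_combination -h2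
      have h5 : (i.2 : ℕ) = j.2 := by exact_mod_cast h4
      exact Prod.ext (Fin.ext (by omega)) (Fin.ext h5))
    (w := w) hw j
  have h1 : sv hp hs r (j.1 : ℕ) (j.2 : ℕ) ∈ W := by
    refine mem_of_smul_mem W (c := (w : Fin s × Fin r → ℂ) j) hj ?_
    have : ((w : Fin s × Fin r → ℂ) j) • (vec (j.1 : ℕ) (j.2 : ℕ) : Fin s × Fin r → ℂ) =
        Pi.single j ((w : Fin s × Fin r → ℂ) j) := by
      rw [vec_eq_single]
      funext i; simp [Pi.single_apply]
    rw [← this] at hmem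
    exact hmem
  have h2 : ∀ n : ℕ, n < s → sv hp hs r n (j.2 : ℕ) ∈ W → sv hp hs r 0 (j.2 : ℕ) ∈ W := by
    intro n hn
    induction n with
    | zero => exact fun h => h
    | succ n ih =>
      intro h
      apply ih (by omega)
      have h3 := W.smul_mem (U.gen p .E) h
      rw [sv_E] at h3
      have e1 : ((n + 1 : ℕ) : ℤ) - 1 = (n : ℕ) := by push_cast; ring
      rw [e1] at h3
      refine mem_of_smul_mem W (mul_ne_zero (mul_ne_zero (pow_ne_zero _ (by norm_num)) ?_) ?_) h3
      · rw [Ne, qInt_eq_zero_iff hp]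
        intro h
        have := Int.le_of_dvd (by omega) h
        omega
      · rw [Ne, qInt_eq_zero_iff hp]
        intro h
        have := Int.le_of_dvd (by omega) h
        omega
  have h3 : ∀ m : ℕ, m < r → sv hp hs r 0 m ∈ W → sv hp hs r 0 0 ∈ W := by
    intro m hm
    induction m with
    | zero => exact fun h => h
    | succ m ih =>
      intro h
      apply ih (by omega)
      have h3 := W.smul_mem (U.gen p .e) h
      rw [sv_e] at h3
      have e1 : ((m + 1 : ℕ) : ℤ) - 1 = (m : ℕ) := by push_cast; ring
      rw [e1] at h3
      refine mem_of_smul_mem W (mul_ne_zero ?_ ?_) h3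
      · exact_mod_cast (by omega : m + 1 ≠ 0)
      · rw [sub_ne_zero]
        exact_mod_cast (by omega : r ≠ m + 1)
  exact sx_span (h3 _ j.2.2 (h2 _ j.1.2 h1))

lemma sx_no_invariant (hr : 1 < r) (y : SX hp hs r) (he : U.gen p .e • y = 0)
    (hf : U.gen p .f • y = 0) : y = 0 := by
  rw [show y = (y : Fin s × Fin r → ℂ) from rfl]
  have h1 : simpleGen p s r .e (y : Fin s × Fin r → ℂ) = 0 := (gen_smul_lift _ _ _ _).symm.trans he
  have h2 : simpleGen p s r .f (y : Fin s × Fin r → ℂ) = 0 := (gen_smul_lift _ _ _ _).symm.trans hf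
  refine funext fun j => ?_
  by_cases hj : (j.2 : ℕ) + 1 < r
  · have : LinearMap.proj (R := ℂ) (φ := fun _ => ℂ) (j.1, (⟨j.2 + 1, hj⟩ : Fin r)) ∘ₗ
        simpleGen p s r .f = LinearMap.proj (R := ℂ) (φ := fun _ => ℂ) j := by
      refine simple_ext fun n m hn hm => ?_
      rw [comp_apply, sf (by omega)]
      simp [vec]
    have := lin_congr this (RepSpace.out _ y)
    rw [comp_apply, show simpleGen p s r .f (RepSpace.out _ y) = 0 from h2, map_zero] at this
    exact this.symm
  · have hj' : (j.2 : ℕ) - 1 + 1 = j.2 := by omega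
    have : LinearMap.proj (R := ℂ) (φ := fun _ => ℂ) (j.1, (⟨j.2 - 1, by omega⟩ : Fin r)) ∘ₗ
        simpleGen p s r .e = (((j.2 : ℕ) : ℂ) * (r - (j.2 : ℕ))) •
          LinearMap.proj (R := ℂ) (φ := fun _ => ℂ) j := by
      refine simple_ext fun n m hn hm => ?_
      rw [comp_apply, se]
      simp only [map_smul, LinearMap.proj_apply, vec, lin_smul, smul_eq_mul, Nat.cast_inj]
      by_cases h : (j.2 : ℕ) = m
      · have : (((j.2 : ℕ) - 1 : ℕ) : ℤ) = (m : ℤ) - 1 := by omega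
        rw [h] at this ⊢
        simp [this]
      · have : ¬ (((j.2 : ℕ) - 1 : ℕ) : ℤ) = (m : ℤ) - 1 := by omega
        simp [this, h]
    have := lin_congr this (RepSpace.out _ y)
    rw [comp_apply, show simpleGen p s r .e (RepSpace.out _ y) = 0 from h1, map_zero, lin_smul, LinearMap.proj_apply, eq_comm,
      smul_eq_zero] at this
    refine this.resolve_left (mul_ne_zero ?_ ?_)
    · exact_mod_cast (by omega : (j.2 : ℕ) ≠ 0)
    · rw [sub_ne_zero]
      have := j.2.2
      exact_mod_cast (by omega : r ≠ (j.2 : ℕ))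

end simple

/-! ### The Weyl modules -/

section weyl

variable {p k : ℕ} {hp : 2 ≤ p}

def wv (hp : 2 ≤ p) (k : ℕ) (j : ℤ) : DW hp k := (RepSpace.out (weylRep hp k)).symm (wvec j)

lemma wv_gen (x : Gen) (j : ℤ) : U.gen p x • wv hp k j = weylGen p k x (wvec j) :=
  gen_smul_lift _ _ _ _

lemma wv_zero {j : ℤ} (h : ¬ (0 ≤ j ∧ j ≤ k)) : wv hp k j = 0 := wvec_zero h

lemma wv_E (j : ℤ) : U.gen p .E • wv hp k j = qInt p (k - j + 1) • wv hp k (j - 1) :=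
  (wv_gen _ _).trans (wE j)

lemma wv_F (j : ℤ) : U.gen p .F • wv hp k j = qInt p (j + 1) • wv hp k (j + 1) :=
  (wv_gen _ _).trans (wF j)

lemma wv_K (j : ℤ) : U.gen p .K • wv hp k j = q p ^ ((k : ℤ) - 2 * j) • wv hp k j :=
  (wv_gen _ _).trans (wK j)

lemma wv_h (j : ℤ) : U.gen p .h • wv hp k j =
    (((((k : ℤ) - j) / p - j / p : ℤ) : ℂ) / 2) • wv hp k j :=
  (wv_gen _ _).trans (wh j)

lemma wv_e (j : ℤ) : U.gen p .e • wv hp k j =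
    ((-1) ^ j * ((((k : ℤ) - j) / p + 1 : ℤ) : ℂ)) • wv hp k (j - p) :=
  (wv_gen _ _).trans (we j)

lemma wv_f (j : ℤ) : U.gen p .f • wv hp k j =
    ((-1) ^ (j + p) * ((j / p + 1 : ℤ) : ℂ)) • wv hp k (j + p) :=
  (wv_gen _ _).trans (wf j)

lemma wvec_eq_single (j : Fin (k + 1)) : (wvec (j : ℕ) : Fin (k + 1) → ℂ) = Pi.single j 1 := by
  funext i
  simp only [wvec, Pi.single_apply, Fin.ext_iff, Nat.cast_inj]

lemma weyl_ext {Z : Type*} [AddCommGroup Z] [Module ℂ Z] {S T : (Fin (k + 1) → ℂ) →ₗ[ℂ] Z}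
    (h : ∀ j : ℕ, j ≤ k → S (wvec j) = T (wvec j)) : S = T := by
  refine (Pi.basisFun ℂ (Fin (k + 1))).ext fun j => ?_
  have := h j (by omega)
  rw [wvec_eq_single] at this
  simpa using this

lemma wv_sum (v : DW hp k) : v = ∑ j : Fin (k + 1), (RepSpace.out _ v) j • wv hp k (j : ℕ) := by
  have := pi_eq_sum_univ' (RepSpace.out _ v)
  refine this.trans (Finset.sum_congr rfl fun j _ => ?_)
  congr 1
  change _ = (wvec (j : ℕ) : Fin (k + 1) → ℂ)
  rw [wvec_eq_single]

lemma wv_ne {j : ℤ} (h : 0 ≤ j ∧ j ≤ k) : wv hp k j ≠ 0 := by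
  obtain ⟨h1, h2⟩ := h
  lift j to ℕ using h1
  intro h
  have := congrFun (show (wvec j : Fin (k + 1) → ℂ) = 0 from h) ⟨j, by omega⟩
  simp [wvec] at this

lemma weyl_mem_coord (W : Submodule (U p) (DW hp k)) {w : DW hp k} (hw : w ∈ W)
    (j : Fin (k + 1)) : (RepSpace.out _ w) j • wv hp k (j : ℕ) ∈ W := by
  have hp' : (p : ℤ) ≠ 0 := by omega
  have hK : ∀ v : Fin (k + 1) → ℂ, weylGen p k .K v =
      (fun j : Fin (k + 1) => q p ^ ((k : ℤ) - 2 * (j : ℕ))) * v := by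
    intro v
    refine lin_congr (f := weylGen p k .K) (g := LinearMap.mulLeft ℂ
      (fun j : Fin (k + 1) => q p ^ ((k : ℤ) - 2 * (j : ℕ)))) (weyl_ext fun n hn => ?_) v
    rw [wK, LinearMap.mulLeft_apply]
    funext j
    simp only [Pi.smul_apply, Pi.mul_apply, wvec, smul_eq_mul]
    split_ifs with h
    · rw [h]
    · simp
  have hh : ∀ v : Fin (k + 1) → ℂ, weylGen p k .h v = (fun j : Fin (k + 1) =>
      (((((k : ℤ) - (j : ℕ)) / p - (j : ℕ) / p : ℤ) : ℂ) / 2)) * v := by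
    intro v
    refine lin_congr (f := weylGen p k .h) (g := LinearMap.mulLeft ℂ
      (fun j : Fin (k + 1) => (((((k : ℤ) - (j : ℕ)) / p - (j : ℕ) / p : ℤ) : ℂ) / 2)))
      (weyl_ext fun n hn => ?_) v
    rw [wh, LinearMap.mulLeft_apply]
    funext j
    simp only [Pi.smul_apply, Pi.mul_apply, wvec, smul_eq_mul]
    split_ifs with h
    · rw [h]
    · simp
  have hmem := single_mem_of_diag (W.restrictScalars ℂ : Submodule ℂ (Fin (k + 1) → ℂ))
    (fun b : Bool => if b then (fun j : Fin (k + 1) => q p ^ ((k : ℤ) - 2 * (j : ℕ)))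
      else fun j => (((((k : ℤ) - (j : ℕ)) / p - (j : ℕ) / p : ℤ) : ℂ) / 2))
    (by
      intro b w hw
      cases b
      · have h1 := W.smul_mem (U.gen p .h) (x := (RepSpace.out (weylRep hp k)).symm w) hw
        have h2 : U.gen p .h • (RepSpace.out (weylRep hp k)).symm w =
            (RepSpace.out (weylRep hp k)).symm _ :=
          (gen_smul_lift _ _ _ _).trans (hh w)
        rw [h2] at h1
        exact h1
      · have h1 := W.smul_mem (U.gen p .K) (x := (RepSpace.out (weylRep hp k)).symm w) hw
        have h2 : U.gen p .K • (RepSpace.out (weylRep hp k)).symm w =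
            (RepSpace.out (weylRep hp k)).symm _ :=
          (gen_smul_lift _ _ _ _).trans (hK w)
        rw [h2] at h1
        exact h1)
    (by
      intro i j hij
      have h1 := hij true
      have h2 := hij false
      simp only [if_true, Bool.false_eq_true, if_false] at h1 h2
      obtain ⟨c, hc⟩ := q_zpow_inj hp h1
      have hc' : ((j : ℕ) : ℤ) = (i : ℕ) + c * p := by linarith
      rw [div_left_inj' (by norm_num), Int.cast_inj] at h2
      have e1 : (k : ℤ) - (j : ℕ) = (k - (i : ℕ)) + (-c) * p := by rw [hc']; ring
      rw [e1, hc', Int.add_mul_ediv_right _ _ hp', Int.add_mul_ediv_right _ _ hp'] at h2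
      have : c = 0 := by omega
      subst this
      exact Fin.ext (by omega))
    (w := w) hw j
  have : ((RepSpace.out _ w) j) • (wvec (j : ℕ) : Fin (k + 1) → ℂ) =
      Pi.single j ((RepSpace.out _ w) j) := by
    rw [wvec_eq_single]
    funext i; simp [Pi.single_apply]
  have h2 : ((RepSpace.out _ w) j) • (wvec (j : ℕ) : Fin (k + 1) → ℂ) ∈
    (W.restrictScalars ℂ : Submodule ℂ (Fin (k + 1) → ℂ)) := this ▸ hmem
  exact h2

section mem

variable {W : Submodule (U p) (DW hp k)} {j : ℤ}

lemma wv_mem_F (h : wv hp k j ∈ W) (hj : ¬ (p : ℤ) ∣ j + 1) : wv hp k (j + 1) ∈ W := by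
  have := W.smul_mem (U.gen p .F) h
  rw [wv_F] at this
  exact mem_of_smul_mem W (by rwa [Ne, qInt_eq_zero_iff hp]) this

lemma wv_mem_E (h : wv hp k j ∈ W) (hj : ¬ (p : ℤ) ∣ k - j + 1) : wv hp k (j - 1) ∈ W := by
  have := W.smul_mem (U.gen p .E) h
  rw [wv_E] at this
  exact mem_of_smul_mem W (by rwa [Ne, qInt_eq_zero_iff hp]) this

lemma wv_mem_f (h : wv hp k j ∈ W) (hj : 0 ≤ j) : wv hp k (j + p) ∈ W := by
  have := W.smul_mem (U.gen p .f) h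
  rw [wv_f] at this
  refine mem_of_smul_mem W (mul_ne_zero (zpow_ne_zero _ (by norm_num)) ?_) this
  have := Int.ediv_nonneg hj (by omega : (0 : ℤ) ≤ p)
  rw [Int.cast_ne_zero]; omega

lemma wv_mem_e (h : wv hp k j ∈ W) (hj : j ≤ k) : wv hp k (j - p) ∈ W := by
  have := W.smul_mem (U.gen p .e) h
  rw [wv_e] at this
  refine mem_of_smul_mem W (mul_ne_zero (zpow_ne_zero _ (by norm_num)) ?_) this
  have := Int.ediv_nonneg (by omega : (0 : ℤ) ≤ k - j) (by omega : (0 : ℤ) ≤ p)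
  rw [Int.cast_ne_zero]; omega

lemma wv_mem_f_mul (h : wv hp k j ∈ W) (hj : 0 ≤ j) (m : ℕ) : wv hp k (j + m * p) ∈ W := by
  induction m with
  | zero => simpa using h
  | succ m ih =>
    have := wv_mem_f ih (by positivity)
    convert this using 1; push_cast; ring_nf

lemma wv_mem_F_add {b : ℕ} (h : wv hp k j ∈ W) (m : ℤ) (hj : j = b + m * p) (n : ℕ)
    (hn : b + n < p) : wv hp k (j + n) ∈ W := by
  induction n with
  | zero => simpa using h
  | succ n ih =>
    have := wv_mem_F (ih (by omega)) (by
      rintro ⟨c, hc⟩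
      rw [hj] at hc
      have : ((b + n + 1 : ℕ) : ℤ) = p * (c - m) := by push_cast; linear_combination hc
      have h3 := Int.le_of_dvd (by omega) ⟨_, this⟩
      omega)
    convert this using 1; push_cast; ring_nf

lemma weyl_span (h : wv hp k 0 ∈ W) : W = ⊤ := by
  rw [eq_top_iff]
  intro v _
  rw [wv_sum v]
  refine W.sum_mem fun j _ => smul_mem_C W _ ?_
  have h1 := wv_mem_f_mul h le_rfl ((j : ℕ) / p)
  have h2 := wv_mem_F_add (b := 0) h1 ((j : ℕ) / p : ℕ) (by simp) ((j : ℕ) % p)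
    (by rw [zero_add]; exact Nat.mod_lt _ (by omega))
  convert h2 using 1
  have := Nat.div_add_mod (j : ℕ) p
  have h3 : ((p * ((j : ℕ) / p) + (j : ℕ) % p : ℕ) : ℤ) = (j : ℕ) := by rw [this]
  rw [← h3]
  push_cast; ring_nf

end mem

variable {s r : ℕ} (hs : s ≤ p) (hs1 : 1 ≤ s) (hr : 1 ≤ r) (hk : k + 1 + s = (r + 1) * p)

lemma weyl_f_pow (j : ℤ) (m : ℕ) : ∃ c : ℂ, U.gen p .f ^ m • wv hp k j = c • wv hp k (j + m * p) := by
  induction m with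
  | zero => exact ⟨1, by simp⟩
  | succ m ih =>
    obtain ⟨c, hc⟩ := ih
    refine ⟨_, by
      rw [pow_succ', mul_smul, hc, smul_comm_U, wv_f, smul_smul]
      congr 2; push_cast; ring⟩

lemma weyl_F_pow (j : ℤ) (n : ℕ) : U.gen p .F ^ n • wv hp k j =
    (∏ i ∈ Finset.range n, qInt p (j + (i + 1))) • wv hp k (j + n) := by
  induction n with
  | zero => simp
  | succ n ih =>
    rw [pow_succ', mul_smul, ih, smul_comm_U, wv_F, smul_smul, Finset.prod_range_succ]
    congr 2
    · congr 1; ring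
    · push_cast; ring

include hs1 hr hk in
lemma exists_simple_weyl : ∃ ι : SX hp hs r →ₗ[U p] DW hp k,
    ι (sv hp hs r 0 0) = wv hp k (p - s) := by
  have hkz : (k : ℤ) + 1 + s = (r + 1) * p := by exact_mod_cast hk
  have hq := q_ne p
  obtain ⟨φ, hφ⟩ := exists_simple_hom (Y := DW hp k) hp hs hs1 hr (wv hp k (p - s))
    (by
      rw [wv_K]
      congr 1
      have : (k : ℤ) - 2 * (p - s) = (s - 1) + (r - 1 : ℤ) * p := by linear_combination hkz
      rw [this, q_shift hp]
      congr 1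
      rw [← zpow_natCast]; congr 1; omega)
    (by
      rw [wv_E, (qInt_eq_zero_iff hp _).2 ⟨r, by linear_combination hkz⟩, zero_smul])
    (by rw [wv_e, wv_zero (by omega), smul_zero])
    (by
      rw [wv_h]
      congr 2
      have h1 : ((k : ℤ) - (p - s)) / p = r - 1 := by
        rw [Int.ediv_eq_iff_of_pos (by omega)]
        constructor <;> [skip; skip] <;> nlinarith
      have h2 : ((p : ℤ) - s) / p = 0 := Int.ediv_eq_zero_of_lt (by omega) (by omega)
      rw [h1, h2]; push_cast; ring)
    (by
      rw [weyl_F_pow, Finset.prod_eq_zero (i := s - 1) (by simp; omega), zero_smul]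
      rw [qInt_eq_zero_iff hp]
      exact ⟨1, by push_cast [hs1]; ring⟩)
    (by
      obtain ⟨c, hc⟩ := weyl_f_pow (hp := hp) (k := k) (p - s) r
      rw [hc, wv_zero, smul_zero]
      intro h
      nlinarith [h.2])
  refine ⟨φ, ?_⟩
  have := hφ 0 0 (by omega) (by omega)
  simp only [pow_zero, one_smul, Nat.cast_zero] at this
  exact this

/-- The embedding of the socle of a Weyl module. -/
def socWeyl : SX hp hs r →ₗ[U p] DW hp k := (exists_simple_weyl (hp := hp) hs hs1 hr hk).choose

lemma socWeyl_sv : socWeyl (hp := hp) hs hs1 hr hk (sv hp hs r 0 0) = wv hp k (p - s) :=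
  (exists_simple_weyl (hp := hp) hs hs1 hr hk).choose_spec

include hs1 hr in
lemma simple_hom_injective {Y : Type*} [AddCommGroup Y] [Module (U p) Y]
    (φ : SX hp hs r →ₗ[U p] Y) (h : φ ≠ 0) : Injective φ := by
  have : NeZero s := ⟨by omega⟩
  have : NeZero r := ⟨by omega⟩
  exact (LinearMap.injective_or_eq_zero φ).resolve_right h

include hs1 hr in
lemma simple_hom_surjective {Y : Type*} [AddCommGroup Y] [Module (U p) Y]
    (φ : Y →ₗ[U p] SX hp hs r) (h : φ ≠ 0) : Surjective φ := by
  have : NeZero s := ⟨by omega⟩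
  have : NeZero r := ⟨by omega⟩
  exact (LinearMap.surjective_or_eq_zero φ).resolve_right h

lemma socWeyl_injective : Injective (socWeyl (hp := hp) hs hs1 hr hk) := by
  refine simple_hom_injective hs hs1 hr _ fun h => ?_
  have h1 := socWeyl_sv (hp := hp) hs hs1 hr hk
  rw [h, lin_zero] at h1
  have hkz : (k : ℤ) + 1 + s = (r + 1) * p := by exact_mod_cast hk
  have : (1 : ℤ) ≤ r := by omega
  exact wv_ne (hp := hp) (k := k) (j := p - s) ⟨by omega, by nlinarith⟩ h1.symm

lemma mem_range_socWeyl {j : ℕ} (hj : p - s ≤ j % p) (hjk : j ≤ k) :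
    wv hp k j ∈ range (socWeyl (hp := hp) hs hs1 hr hk) := by
  have h0 : wv hp k ((p - s : ℕ) : ℤ) ∈ range (socWeyl (hp := hp) hs hs1 hr hk) :=
    ⟨sv hp hs r 0 0, by rw [socWeyl_sv]; congr 1; omega⟩
  have h1 := wv_mem_f_mul h0 (by positivity) (j / p)
  have h2 := wv_mem_F_add (b := p - s) h1 (j / p : ℕ) rfl (j % p - (p - s))
    (by have := Nat.mod_lt j (by omega : 0 < p); omega)
  convert h2 using 1
  have h4 := Nat.div_add_mod j p
  have : ((p * (j / p) + j % p : ℕ) : ℤ) = (j : ℕ) := by rw [h4]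
  rw [← this]
  push_cast [hj]
  ring_nf

include hs hs1 hk in
lemma weyl_down (W : Submodule (U p) (DW hp k)) {j : ℕ} (hj : j % p < p - s) (hjk : j ≤ k)
    (h : wv hp k j ∈ W) : W = ⊤ := by
  have hkz : (k : ℤ) + 1 + s = (r + 1) * p := by exact_mod_cast hk
  have h1 : ∀ n m : ℕ, n < p - s → wv hp k (n + m * p) ∈ W → wv hp k (m * p) ∈ W := by
    intro n m hn
    induction n with
    | zero => simp
    | succ n ih =>
      intro h
      refine ih (by omega) ?_
      have := wv_mem_E h (by
        rintro ⟨c, hc⟩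
        have h3 : ((p - s - (n + 1) : ℕ) : ℤ) = p * (c - (r - m)) := by
          push_cast [hs, (by omega : n + 1 ≤ p - s)] at hc ⊢
          linear_combination hc - hkz
        have h4 := Int.le_of_dvd (by omega) ⟨_, h3⟩
        omega)
      convert this using 1; push_cast; ring_nf
  have h2 : ∀ m : ℕ, m * p ≤ k → wv hp k ((m : ℤ) * p) ∈ W → wv hp k 0 ∈ W := by
    intro m
    induction m with
    | zero => simp
    | succ m ih =>
      intro hm h
      refine ih (by nlinarith) ?_
      have := wv_mem_e h (by exact_mod_cast hm)
      convert this using 1; push_cast; ring_nf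
  refine weyl_span (h2 (j / p) ?_ (h1 (j % p) (j / p) hj ?_))
  · exact (Nat.div_mul_le_self j p).trans hjk
  · convert h using 2
    have h4 := Nat.div_add_mod j p
    have : ((p * (j / p) + j % p : ℕ) : ℤ) = (j : ℕ) := by rw [h4]
    rw [← this]
    push_cast; ring_nf

lemma weyl_eq_top (W : Submodule (U p) (DW hp k))
    (h : ¬ W ≤ range (socWeyl (hp := hp) hs hs1 hr hk)) : W = ⊤ := by
  by_contra hW
  apply h
  intro w hw
  rw [wv_sum w]
  refine Submodule.sum_mem _ fun j _ => ?_
  by_cases h0 : (RepSpace.out _ w) j = 0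
  · rw [h0, zero_smul]; exact Submodule.zero_mem _
  · refine smul_mem_C _ _ (mem_range_socWeyl hs hs1 hr hk ?_ (by omega))
    by_contra h1
    exact hW (weyl_down hs hs1 hk W (by omega) (by omega)
      (mem_of_smul_mem W h0 (weyl_mem_coord W hw j)))

lemma range_socWeyl_le (W : Submodule (U p) (DW hp k)) (h : W ≠ ⊥) :
    range (socWeyl (hp := hp) hs hs1 hr hk) ≤ W := by
  have : NeZero s := ⟨by omega⟩
  have : NeZero r := ⟨by omega⟩
  by_cases h1 : W ≤ range (socWeyl (hp := hp) hs hs1 hr hk)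
  · obtain ⟨w, hw, hw0⟩ := W.exists_mem_ne_zero_of_ne_bot h
    obtain ⟨x, hx⟩ := h1 hw
    have h2 : W.comap (socWeyl (hp := hp) hs hs1 hr hk) = ⊤ := by
      refine (eq_bot_or_eq_top _).resolve_left fun h3 => ?_
      have : x ∈ W.comap (socWeyl (hp := hp) hs hs1 hr hk) := by
        rw [Submodule.mem_comap, hx]; exact hw
      rw [h3, Submodule.mem_bot] at this
      rw [this, map_zero] at hx
      exact hw0 hx.symm
    rintro _ ⟨y, rfl⟩
    have : y ∈ W.comap (socWeyl (hp := hp) hs hs1 hr hk) := by rw [h2]; trivial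
    exact this
  · rw [weyl_eq_top hs hs1 hr hk W h1]; exact le_top

end weyl

/-! ### Contragredient modules -/

section dual

variable {p : ℕ} {hp : 2 ≤ p}

lemma uAnti_gen (x : Gen) : uAnti hp (U.gen p x) = antiGen p x := U.lift_gen _ _ x

lemma uAnti_uAnti (u : U p) : (uAnti hp (uAnti hp u).unop).unop = u := by
  have hpow : U.gen p .K ^ p * U.gen p .K ^ p = 1 := (U.isUq p).Kpow_sq
  have hs : ((-1 : ℂ) ^ p) * (-1) ^ p = 1 := by rw [← mul_pow]; simp
  induction u using U.induction with
  | hc c => simp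
  | hm a b ha hb => simp [ha, hb]
  | ha a b ha hb => simp [ha, hb]
  | hg x =>
    have hK : uAnti hp (U.gen p .K ^ p) = MulOpposite.op (U.gen p .K ^ p) := by
      rw [map_pow, uAnti_gen]; rfl
    cases x <;> simp only [uAnti_gen, antiGen, MulOpposite.unop_op, map_smul, map_mul, hK,
      MulOpposite.unop_smul, MulOpposite.unop_mul]
    · rw [smul_mul_assoc, smul_smul, hs, one_smul, mul_assoc, ← (U.isUq p).Kpow_e.eq, ← mul_assoc,
        hpow, one_mul]
    · rw [smul_mul_assoc, smul_smul, hs, one_smul, mul_assoc, ← (U.isUq p).Kpow_f.eq, ← mul_assoc,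
        hpow, one_mul]

variable {V V' : Type} [AddCommGroup V] [Module ℂ V] [AddCommGroup V'] [Module ℂ V']
  (hp) (ρ : U p →ₐ[ℂ] Module.End ℂ V) (ρ' : U p →ₐ[ℂ] Module.End ℂ V')

/-- The contragredient of the module afforded by a representation. -/
abbrev DualRep : Type := RepSpace (contraRep ρ (uAnti hp))

/-- The pairing of a module with its contragredient. -/
def ev : DualRep hp ρ →ₗ[ℂ] RepSpace ρ →ₗ[ℂ] ℂ := (LinearMap.id : Module.Dual ℂ V →ₗ[ℂ] _)

variable {hp ρ ρ'}

lemma ev_smul (u : U p) (φ : DualRep hp ρ) (v : RepSpace ρ) :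
    ev hp ρ (u • φ) v = ev hp ρ φ ((uAnti hp u).unop • v) := rfl

lemma ev_ext {φ ψ : DualRep hp ρ} (h : ∀ v, ev hp ρ φ v = ev hp ρ ψ v) : φ = ψ :=
  ext (M := V) (M₃ := ℂ) h

lemma ev_E (φ : DualRep hp ρ) (v : RepSpace ρ) :
    ev hp ρ (U.gen p .E • φ) v = ev hp ρ φ (U.gen p .F • v) := by rw [ev_smul, uAnti_gen]; rfl

lemma ev_F (φ : DualRep hp ρ) (v : RepSpace ρ) :
    ev hp ρ (U.gen p .F • φ) v = ev hp ρ φ (U.gen p .E • v) := by rw [ev_smul, uAnti_gen]; rfl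

lemma ev_K (φ : DualRep hp ρ) (v : RepSpace ρ) :
    ev hp ρ (U.gen p .K • φ) v = ev hp ρ φ (U.gen p .K • v) := by rw [ev_smul, uAnti_gen]; rfl

lemma ev_h (φ : DualRep hp ρ) (v : RepSpace ρ) :
    ev hp ρ (U.gen p .h • φ) v = ev hp ρ φ (U.gen p .h • v) := by rw [ev_smul, uAnti_gen]; rfl

lemma ev_e (φ : DualRep hp ρ) (v : RepSpace ρ) :
    ev hp ρ (U.gen p .e • φ) v = (-1) ^ p * ev hp ρ φ (U.gen p .K ^ p • U.gen p .f • v) := by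
  rw [ev_smul, uAnti_gen]
  simp only [antiGen, MulOpposite.unop_op, smul_assoc, mul_smul, map_smul, smul_eq_mul]

lemma ev_f (φ : DualRep hp ρ) (v : RepSpace ρ) :
    ev hp ρ (U.gen p .f • φ) v = (-1) ^ p * ev hp ρ φ (U.gen p .K ^ p • U.gen p .e • v) := by
  rw [ev_smul, uAnti_gen]
  simp only [antiGen, MulOpposite.unop_op, smul_assoc, mul_smul, map_smul, smul_eq_mul]

/-- The transpose of a homomorphism. -/
def transp (f : RepSpace ρ →ₗ[U p] RepSpace ρ') : DualRep hp ρ' →ₗ[U p] DualRep hp ρ where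
  toFun φ := (show RepSpace ρ →ₗ[ℂ] ℂ from (ev hp ρ' φ).comp (toC f))
  map_add' φ ψ := by rw [map_add]; rfl
  map_smul' u φ := by
    refine ev_ext fun v => ?_
    exact (congrArg (ev hp ρ' φ) (f.map_smul (uAnti hp u).unop v)).symm

lemma ev_transp (f : RepSpace ρ →ₗ[U p] RepSpace ρ') (φ : DualRep hp ρ') (v : RepSpace ρ) :
    ev hp ρ (transp f φ) v = ev hp ρ' φ (f v) := rfl

/-- A homomorphism `Y' → Y*` as a homomorphism `Y → Y'*`. -/
def flipHom (g : RepSpace ρ' →ₗ[U p] DualRep hp ρ) : RepSpace ρ →ₗ[U p] DualRep hp ρ' where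
  toFun v := (show RepSpace ρ' →ₗ[ℂ] ℂ from ((ev hp ρ).comp (toC g)).flip v)
  map_add' v w := by rw [map_add]; rfl
  map_smul' u v := by
    refine ev_ext fun w => ?_
    have h := congrArg (fun z => ev hp ρ z v) (g.map_smul (uAnti hp u).unop w)
    refine Eq.trans ?_ h.symm
    change _ = ev hp ρ ((uAnti hp u).unop • g w) v
    rw [ev_smul, uAnti_uAnti]
    rfl

lemma ev_flipHom (g : RepSpace ρ' →ₗ[U p] DualRep hp ρ) (v : RepSpace ρ) (w : RepSpace ρ') :
    ev hp ρ' (flipHom g v) w = ev hp ρ (g w) v := rfl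

lemma K_pow_smul {Y : Type*} [AddCommGroup Y] [Module ℂ Y] [Module (U p) Y]
    [IsScalarTower ℂ (U p) Y] {y : Y} {c : ℂ} (h : U.gen p .K • y = c • y) (n : ℕ) :
    U.gen p .K ^ n • y = c ^ n • y := by
  induction n with
  | zero => simp
  | succ n ih => rw [pow_succ', mul_smul, ih, smul_comm_U, h, smul_smul, pow_succ]

end dual

/-! ### Self-duality of the irreducible modules -/

section selfdual

variable {p s r : ℕ} {hp : 2 ≤ p} (hs : s ≤ p) (hs1 : 1 ≤ s) (hr : 1 ≤ r)

def sd (hp : 2 ≤ p) (r : ℕ) (n m : ℤ) : DualRep hp (simpleRep (r := r) hp hs) :=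
  (Fintype.linearCombination ℂ (vec n m : Fin s × Fin r → ℂ) : (Fin s × Fin r → ℂ) →ₗ[ℂ] ℂ)

lemma ev_sd (n m : ℤ) {n' m' : ℕ} (hn : n' < s) (hm : m' < r) :
    ev hp _ (sd hs hp r n m) (sv hp hs r n' m') = if (n' : ℤ) = n ∧ (m' : ℤ) = m then 1 else 0 := by
  have h : (vec (n' : ℤ) (m' : ℤ) : Fin s × Fin r → ℂ) = Pi.single (⟨n', hn⟩, ⟨m', hm⟩) 1 :=
    vec_eq_single (⟨n', hn⟩ : Fin s) (⟨m', hm⟩ : Fin r)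
  change (Fintype.linearCombination ℂ (vec n m : Fin s × Fin r → ℂ)) (vec n' m') = _
  rw [h, Fintype.linearCombination_apply_single, one_smul]
  simp [vec]

lemma ev_sd' (n m : ℤ) {n' m' : ℤ} (h : ¬ (n' = n ∧ m' = m)) :
    ev hp _ (sd hs hp r n m) (sv hp hs r n' m') = 0 := by
  by_cases h1 : ((0 ≤ n' ∧ n' < s) ∧ (0 ≤ m' ∧ m' < r))
  · obtain ⟨⟨h1, h2⟩, h3, h4⟩ := h1
    lift n' to ℕ using h1
    lift m' to ℕ using h3
    rw [ev_sd hs _ _ (by omega) (by omega), if_neg h]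
  · rw [sv_zero h1, map_zero]

lemma sd_ext {φ ψ : DualRep hp (simpleRep (r := r) hp hs)}
    (h : ∀ n m : ℕ, n < s → m < r → ev hp _ φ (sv hp hs r n m) = ev hp _ ψ (sv hp hs r n m)) :
    φ = ψ :=
  simple_ext (Z := ℂ) h

lemma sd_zero {n m : ℤ} (h : ¬ ((0 ≤ n ∧ n < s) ∧ (0 ≤ m ∧ m < r))) : sd hs hp r n m = 0 := by
  refine sd_ext hs fun n' m' hn hm => ?_
  rw [ev_sd' hs, map_zero, lin_zero]
  rintro ⟨rfl, rfl⟩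
  exact h ⟨⟨by omega, by omega⟩, by omega, by omega⟩

lemma sd_K (n m : ℤ) : U.gen p .K • sd hs hp r n m =
    ((-1) ^ (r - 1) * q p ^ ((s : ℤ) - 1 - 2 * n)) • sd hs hp r n m := by
  refine sd_ext hs fun n' m' hn hm => ?_
  rw [ev_K, sv_K, map_smul, map_smul, lin_smul]
  by_cases h : (n' : ℤ) = n ∧ (m' : ℤ) = m
  · rw [h.1]
  · rw [ev_sd' hs _ _ h, smul_zero, smul_zero]

lemma sd_h (n m : ℤ) : U.gen p .h • sd hs hp r n m =
    (((r : ℂ) - 1 - 2 * m) / 2) • sd hs hp r n m := by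
  refine sd_ext hs fun n' m' hn hm => ?_
  rw [ev_h, sv_h, map_smul, map_smul, lin_smul]
  by_cases h : (n' : ℤ) = n ∧ (m' : ℤ) = m
  · rw [← h.2, Int.cast_natCast]
  · rw [ev_sd' hs _ _ h, smul_zero, smul_zero]

lemma sd_F (n m : ℤ) : ∃ c : ℂ, U.gen p .F • sd hs hp r n m = c • sd hs hp r (n + 1) m := by
  refine ⟨(-1) ^ (r - 1) * qInt p (n + 1) * qInt p (s - (n + 1)), sd_ext hs fun n' m' hn hm => ?_⟩
  rw [ev_F, sv_E, map_smul, map_smul, lin_smul]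
  by_cases h : (n' : ℤ) = n + 1 ∧ (m' : ℤ) = m
  · have e : (n' : ℤ) - 1 = n := by omega
    by_cases h0 : 0 ≤ n
    · lift n to ℕ using h0
      rw [e, ← h.2, ev_sd hs _ _ (by omega) hm, ev_sd hs _ _ hn hm]
      rw [if_pos ⟨rfl, rfl⟩, if_pos ⟨h.1, rfl⟩, h.1]
    · rw [(by omega : (n' : ℤ) - 1 = -1), sv_zero (by omega), map_zero,
        (by omega : n + 1 = 0), qInt_zero]
      simp
  · rw [ev_sd' hs _ _ h, ev_sd' hs _ _ (by omega), smul_zero, smul_zero]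

lemma sd_f (n m : ℤ) : ∃ c : ℂ, U.gen p .f • sd hs hp r n m = c • sd hs hp r n (m + 1) := by
  refine ⟨(-1) ^ p * (((m + 1 : ℤ) : ℂ) * (r - (m + 1 : ℤ)) *
    ((-1) ^ (r - 1) * q p ^ ((s : ℤ) - 1 - 2 * n)) ^ p), sd_ext hs fun n' m' hn hm => ?_⟩
  rw [ev_f, sv_e, smul_comm_U, K_pow_smul (sv_K _ _), smul_smul, map_smul, map_smul,
    lin_smul, smul_eq_mul, smul_eq_mul]
  by_cases h : (n' : ℤ) = n ∧ (m' : ℤ) = m + 1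
  · have e : (m' : ℤ) - 1 = m := by omega
    by_cases h0 : 0 ≤ m
    · lift m to ℕ using h0
      rw [e, h.2, ← h.1, ev_sd hs _ _ hn (by omega)]
      have := ev_sd (hp := hp) hs n' (m + 1) (n' := n') (m' := m') hn hm
      rw [h.2, if_pos ⟨rfl, rfl⟩] at this
      rw [this, if_pos ⟨rfl, rfl⟩]
      push_cast
      ring
    · have : (m' : ℤ) = 0 := by omega
      rw [this, (by omega : m + 1 = 0)]; simp
  · rw [ev_sd' hs _ _ h, ev_sd' hs _ _ (by omega), mul_zero, mul_zero, mul_zero]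

include hs1 hr in
lemma exists_selfDual : ∃ φ : SX hp hs r →ₗ[U p] DualRep hp (simpleRep (r := r) hp hs),
    φ (sv hp hs r 0 0) = sd hs hp r 0 0 := by
  have hF : ∀ n : ℕ, ∃ c : ℂ, U.gen p .F ^ n • sd hs hp r 0 0 = c • sd hs hp r n 0 := by
    intro n
    induction n with
    | zero => exact ⟨1, by simp⟩
    | succ n ih =>
      obtain ⟨c, hc⟩ := ih
      obtain ⟨d, hd⟩ := sd_F (hp := hp) (r := r) hs n 0
      exact ⟨c * d, by rw [pow_succ', mul_smul, hc, smul_comm_U, hd, smul_smul]; push_cast; rfl⟩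
  have hf : ∀ n : ℕ, ∃ c : ℂ, U.gen p .f ^ n • sd hs hp r 0 0 = c • sd hs hp r 0 n := by
    intro n
    induction n with
    | zero => exact ⟨1, by simp⟩
    | succ n ih =>
      obtain ⟨c, hc⟩ := ih
      obtain ⟨d, hd⟩ := sd_f (hp := hp) (r := r) hs 0 n
      exact ⟨c * d, by rw [pow_succ', mul_smul, hc, smul_comm_U, hd, smul_smul]; push_cast; rfl⟩
  obtain ⟨φ, hφ⟩ := exists_simple_hom (Y := DualRep hp (simpleRep (r := r) hp hs)) hp hs hs1 hr
    (sd hs hp r 0 0)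
    (by rw [sd_K]; simp)
    (by
      refine sd_ext hs fun n' m' hn hm => ?_
      rw [ev_E, sv_F (by omega), ev_sd' hs _ _ (by omega), map_zero, lin_zero])
    (by
      refine sd_ext hs fun n' m' hn hm => ?_
      rw [ev_e, sv_f (by omega), K_pow_smul (sv_K _ _), map_smul, ev_sd' hs _ _ (by omega),
        smul_zero, mul_zero, map_zero, lin_zero])
    (by rw [sd_h]; simp)
    (by obtain ⟨c, hc⟩ := hF s; rw [hc, sd_zero hs (by omega), smul_zero])
    (by obtain ⟨c, hc⟩ := hf r; rw [hc, sd_zero hs (by omega), smul_zero])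
  refine ⟨φ, ?_⟩
  have := hφ 0 0 (by omega) (by omega)
  simp only [pow_zero, one_smul, Nat.cast_zero] at this
  exact this

lemma finrank_SX : finrank ℂ (SX hp hs r) = s * r := by
  have : finrank ℂ (Fin s × Fin r → ℂ) = s * r := by simp
  exact this

/-- An irreducible module is isomorphic to its contragredient. -/
def selfDual : SX hp hs r ≃ₗ[U p] DualRep hp (simpleRep (r := r) hp hs) :=
  LinearEquiv.ofBijective (exists_selfDual hs hs1 hr).choose (by
    have h := (exists_selfDual (hp := hp) hs hs1 hr).choose_spec
    have hi : Injective (exists_selfDual (hp := hp) hs hs1 hr).choose := by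
      refine simple_hom_injective hs hs1 hr _ fun h0 => ?_
      rw [h0, lin_zero] at h
      have h2 := ev_sd (hp := hp) (r := r) hs 0 0 (n' := 0) (m' := 0) (by omega) (by omega)
      rw [← h, map_zero, lin_zero] at h2
      simp at h2
    refine ⟨hi, ?_⟩
    have hd : finrank ℂ (SX hp hs r) =
        finrank ℂ (DualRep hp (simpleRep (r := r) hp hs)) :=
      (Subspace.dual_finrank_eq (K := ℂ) (V := Fin s × Fin r → ℂ)).symm
    exact (LinearMap.injective_iff_surjective_of_finrank_eq_finrank (f := toC _) hd).1 hi)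

end selfdual

/-! ### The contragredient Weyl modules -/

section coweyl

variable {p k : ℕ} {hp : 2 ≤ p}

def cd (hp : 2 ≤ p) (k : ℕ) (j : ℤ) : CW hp k :=
  (Fintype.linearCombination ℂ (wvec j : Fin (k + 1) → ℂ) : (Fin (k + 1) → ℂ) →ₗ[ℂ] ℂ)

/-- The pairing of a Weyl module and its contragredient. -/
abbrev evw (φ : CW hp k) (v : DW hp k) : ℂ := ev hp (weylRep hp k) φ v

lemma ev_cd (j : ℤ) {i : ℕ} (hi : i ≤ k) :
    evw (cd hp k j) (wv hp k i) = if (i : ℤ) = j then 1 else 0 := by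
  have h : (wvec (i : ℤ) : Fin (k + 1) → ℂ) = Pi.single ⟨i, by omega⟩ 1 :=
    wvec_eq_single (⟨i, by omega⟩ : Fin (k + 1))
  change (Fintype.linearCombination ℂ (wvec j : Fin (k + 1) → ℂ)) (wvec i) = _
  rw [h, Fintype.linearCombination_apply_single, one_smul]
  simp [wvec]

lemma ev_cd' (j : ℤ) {i : ℤ} (h : i ≠ j) : evw (cd hp k j) (wv hp k i) = 0 := by
  by_cases h1 : 0 ≤ i ∧ i ≤ k
  · obtain ⟨h1, h2⟩ := h1
    lift i to ℕ using h1
    rw [ev_cd _ (by omega), if_neg h]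
  · rw [evw, wv_zero h1, map_zero]

lemma cd_ext {φ ψ : CW hp k} (h : ∀ i : ℕ, i ≤ k → evw φ (wv hp k i) = evw ψ (wv hp k i)) :
    φ = ψ :=
  weyl_ext (Z := ℂ) h

lemma cd_zero {j : ℤ} (h : ¬ (0 ≤ j ∧ j ≤ k)) : cd hp k j = 0 := by
  refine cd_ext fun i hi => ?_
  rw [ev_cd' _ (by rintro rfl; exact h ⟨by omega, by omega⟩)]
  simp [evw]

lemma cd_ne {j : ℕ} (h : j ≤ k) : cd hp k j ≠ 0 := by
  intro h0
  have := ev_cd (hp := hp) (k := k) j h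
  rw [h0] at this
  simp [evw] at this

lemma cd_K (j : ℤ) : U.gen p .K • cd hp k j = q p ^ ((k : ℤ) - 2 * j) • cd hp k j := by
  refine cd_ext fun i hi => ?_
  rw [evw, ev_K, wv_K, map_smul, evw, map_smul, lin_smul]
  by_cases h : (i : ℤ) = j
  · rw [h]
  · have := ev_cd' (hp := hp) (k := k) j h
    rw [evw] at this
    rw [this, smul_zero, smul_zero]

lemma cd_h (j : ℤ) : U.gen p .h • cd hp k j =
    (((((k : ℤ) - j) / p - j / p : ℤ) : ℂ) / 2) • cd hp k j := by
  refine cd_ext fun i hi => ?_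
  rw [evw, ev_h, wv_h, map_smul, evw, map_smul, lin_smul]
  by_cases h : (i : ℤ) = j
  · rw [h]
  · have := ev_cd' (hp := hp) (k := k) j h
    rw [evw] at this
    rw [this, smul_zero, smul_zero]

lemma cd_F {j : ℤ} (hj : 0 ≤ j) : U.gen p .F • cd hp k j = qInt p (k - j) • cd hp k (j + 1) := by
  refine cd_ext fun i hi => ?_
  rw [evw, ev_F, wv_E, map_smul, evw, map_smul, lin_smul]
  change _ • evw _ _ = _ • evw _ _
  by_cases h : (i : ℤ) = j + 1
  · lift j to ℕ using hj
    rw [ev_cd _ hi, if_pos h, h, (by ring : (k : ℤ) - (j + 1) + 1 = k - j), add_sub_cancel_right,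
      ev_cd _ (by omega), if_pos rfl]
  · rw [ev_cd' _ h, ev_cd' _ (by omega), smul_zero, smul_zero]

lemma cd_f {j : ℤ} (hj : 0 ≤ j) : ∃ c : ℂ, U.gen p .f • cd hp k j = c • cd hp k (j + p) := by
  refine ⟨(-1) ^ p * (((-1) ^ (j + p) * ((((k : ℤ) - (j + p)) / p + 1 : ℤ) : ℂ)) *
    (q p ^ ((k : ℤ) - 2 * j)) ^ p), cd_ext fun i hi => ?_⟩
  rw [evw, ev_f, wv_e, smul_comm_U, K_pow_smul (wv_K _), smul_smul, map_smul, evw, map_smul,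
    lin_smul]
  change _ * (_ • evw _ _) = _ • evw _ _
  by_cases h : (i : ℤ) = j + p
  · lift j to ℕ using hj
    rw [ev_cd _ hi, if_pos h, h, add_sub_cancel_right, ev_cd _ (by omega), if_pos rfl]
    simp only [smul_eq_mul, mul_assoc]
  · rw [ev_cd' _ h, ev_cd' _ (by omega), smul_zero, smul_zero, mul_zero]

/-- The only singular vectors of a contragredient Weyl module are the multiples of `cd 0`. -/
lemma singular_coweyl {φ : CW hp k} (hE : U.gen p .E • φ = 0) (he : U.gen p .e • φ = 0) :
    φ = evw φ (wv hp k 0) • cd hp k 0 := by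
  refine cd_ext fun i hi => ?_
  rw [evw, evw, map_smul, lin_smul]
  change evw _ _ = _ • evw _ _
  by_cases h0 : i = 0
  · subst h0
    have := ev_cd (hp := hp) (k := k) 0 (Nat.zero_le k)
    rw [Nat.cast_zero] at this ⊢
    rw [this, if_pos rfl, smul_eq_mul, mul_one]
  rw [ev_cd' _ (by omega), smul_zero]
  by_cases hd : (p : ℤ) ∣ i
  · have h1 : evw (U.gen p .e • φ) (wv hp k (i - p)) = 0 := by rw [he, evw, map_zero]; rfl
    rw [evw, ev_e, wv_f, smul_comm_U, K_pow_smul (wv_K _), sub_add_cancel, map_smul, map_smul] at h1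
    have hi' := Int.le_of_dvd (by omega) hd
    have := Int.ediv_nonneg (by omega : (0 : ℤ) ≤ i - p) (by omega : (0 : ℤ) ≤ p)
    simp only [smul_eq_mul, mul_eq_zero] at h1
    rcases h1 with h1 | (h1 | h1) | h1 | h1
    · simp at h1
    · exact absurd h1 (zpow_ne_zero _ (by norm_num))
    · exact absurd (Int.cast_eq_zero.1 h1) (by omega)
    · exact absurd h1 (pow_ne_zero _ (zpow_ne_zero _ (q_ne p)))
    · exact h1
  · have h1 : evw (U.gen p .E • φ) (wv hp k (i - 1)) = 0 := by rw [hE, evw, map_zero]; rfl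
    rw [evw, ev_E, wv_F, map_smul, sub_add_cancel, smul_eq_mul, mul_eq_zero,
      qInt_eq_zero_iff hp] at h1
    exact h1.resolve_left hd

section headsoc

variable {s r : ℕ} (hs : s ≤ p) (hs1 : 1 ≤ s) (hr : 1 ≤ r)

include hs1 hr in
lemma exists_simple_coweyl (hk : k + 1 = (r - 1) * p + s) :
    ∃ ι : SX hp hs r →ₗ[U p] CW hp k, ι (sv hp hs r 0 0) = cd hp k 0 := by
  obtain ⟨r', rfl⟩ : ∃ r', r = r' + 1 := ⟨r - 1, by omega⟩
  rw [Nat.add_sub_cancel] at hk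
  have hkz : (k : ℤ) + 1 = r' * p + s := by exact_mod_cast hk
  have hF : ∀ n : ℕ, U.gen p .F ^ n • cd hp k 0 =
      (∏ i ∈ Finset.range n, qInt p (k - i)) • cd hp k n := by
    intro n
    induction n with
    | zero => simp
    | succ n ih =>
      rw [pow_succ', mul_smul, ih, smul_comm_U, cd_F (by omega), smul_smul,
        Finset.prod_range_succ]
      push_cast; rfl
  have hf : ∀ n : ℕ, ∃ c : ℂ, U.gen p .f ^ n • cd hp k 0 = c • cd hp k (n * p) := by
    intro n
    induction n with
    | zero => exact ⟨1, by simp⟩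
    | succ n ih =>
      obtain ⟨c, hc⟩ := ih
      obtain ⟨d, hd⟩ := cd_f (hp := hp) (k := k) (j := n * p) (by positivity)
      refine ⟨c * d, ?_⟩
      rw [pow_succ', mul_smul, hc, smul_comm_U, hd, smul_smul]
      push_cast; ring_nf
  obtain ⟨φ, hφ⟩ := exists_simple_hom (Y := CW hp k) hp hs hs1 hr (cd hp k 0)
    (by
      rw [cd_K]
      congr 1
      rw [(by linear_combination hkz : (k : ℤ) - 2 * 0 = (s - 1) + r' * p), q_shift hp,
        Nat.add_sub_cancel, zpow_natCast])
    (by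
      refine cd_ext fun i hi => ?_
      rw [evw, ev_E, wv_F, map_smul]
      change _ • evw _ _ = _
      rw [ev_cd' _ (by omega), smul_zero]; simp [evw])
    (by
      refine cd_ext fun i hi => ?_
      rw [evw, ev_e, wv_f, smul_comm_U, K_pow_smul (wv_K _), map_smul, map_smul]
      change _ * (_ • (_ • evw _ _)) = _
      rw [ev_cd' _ (by omega), smul_zero, smul_zero, mul_zero]; simp [evw])
    (by
      rw [cd_h]
      congr 2
      have h1 : (k : ℤ) / p = r' := by
        rw [Int.ediv_eq_iff_of_pos (by omega)]; constructor <;> linarith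
      simp [h1])
    (by
      rw [hF, Finset.prod_eq_zero (i := s - 1) (by simp; omega), zero_smul]
      rw [qInt_eq_zero_iff hp]
      exact ⟨r', by push_cast [hs1]; linear_combination hkz⟩)
    (by
      obtain ⟨c, hc⟩ := hf (r' + 1)
      rw [hc, cd_zero, smul_zero]
      push_cast
      rintro ⟨-, h⟩
      nlinarith)
  refine ⟨φ, ?_⟩
  have := hφ 0 0 (by omega) (by omega)
  simp only [pow_zero, one_smul, Nat.cast_zero] at this
  exact this

/-- The embedding of the socle of a contragredient Weyl module. -/
def socCoweyl (hk : k + 1 = (r - 1) * p + s) : SX hp hs r →ₗ[U p] CW hp k :=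
  (exists_simple_coweyl (hp := hp) hs hs1 hr hk).choose

lemma socCoweyl_sv (hk : k + 1 = (r - 1) * p + s) :
    socCoweyl (hp := hp) hs hs1 hr hk (sv hp hs r 0 0) = cd hp k 0 :=
  (exists_simple_coweyl (hp := hp) hs hs1 hr hk).choose_spec

lemma socCoweyl_ne (hk : k + 1 = (r - 1) * p + s) : socCoweyl (hp := hp) hs hs1 hr hk ≠ 0 := by
  intro h
  have h1 := socCoweyl_sv (hp := hp) hs hs1 hr hk
  rw [h, lin_zero] at h1
  exact cd_ne (hp := hp) (k := k) (j := 0) (Nat.zero_le _) h1.symm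

lemma socCoweyl_injective (hk : k + 1 = (r - 1) * p + s) :
    Injective (socCoweyl (hp := hp) hs hs1 hr hk) :=
  simple_hom_injective hs hs1 hr _ (socCoweyl_ne hs hs1 hr hk)

lemma finrank_DW : finrank ℂ (DW hp k) = k + 1 := by
  have : finrank ℂ (Fin (k + 1) → ℂ) = k + 1 := by simp
  exact this

lemma finrank_CW : finrank ℂ (CW hp k) = k + 1 :=
  (Subspace.dual_finrank_eq (K := ℂ) (V := Fin (k + 1) → ℂ)).trans (by simp)

include hs1 hr in
/-- A homomorphism from an irreducible module to a contragredient Weyl module is zero unless the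
highest weights agree. -/
lemma hom_simple_coweyl (g : SX hp hs r →ₗ[U p] CW hp k) (h : g ≠ 0) :
    k + 1 = (r - 1) * p + s := by
  have hr0 : r ≠ 0 := by omega
  set φ := g (sv hp hs r 0 0) with hφ
  have hφ0 : φ ≠ 0 := by
    intro h0
    refine h (LinearMap.ker_eq_top.1 (sx_span ?_))
    exact h0
  have h1 := singular_coweyl (φ := φ)
    (by rw [hφ, ← map_smul, sv_E, qInt_zero]; simp)
    (by rw [hφ, ← map_smul, sv_e]; simp)
  have h2 : evw φ (wv hp k 0) ≠ 0 := fun h0 => hφ0 (by rw [h1, h0, zero_smul])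
  have hcd : cd hp k 0 ≠ 0 := by exact_mod_cast cd_ne (hp := hp) (k := k) (j := 0) (Nat.zero_le _)
  have hK : U.gen p .K • φ = ((-1) ^ (r - 1) * q p ^ ((s : ℤ) - 1 - 2 * 0)) • φ := by
    rw [hφ, ← map_smul, ← hom_smul, sv_K]
  have hh : U.gen p .h • φ = (((r : ℂ) - 1 - 2 * (0 : ℤ)) / 2) • φ := by
    rw [hφ, ← map_smul, ← hom_smul, sv_h]
  rw [h1, smul_comm_U, cd_K, smul_smul, smul_smul, smul_left_inj hcd, mul_comm (evw φ _),
    mul_left_inj' h2] at hK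
  rw [h1, smul_comm_U, cd_h, smul_smul, smul_smul, smul_left_inj hcd, mul_comm (evw φ _),
    mul_left_inj' h2] at hh
  have h3 : (k : ℤ) / p = r - 1 := by
    have h4 : (((k : ℤ) / p : ℤ) : ℂ) = ((r - 1 : ℤ) : ℂ) := by
      simp only [sub_zero, Int.zero_ediv, Int.cast_zero, mul_zero] at hh
      push_cast at hh ⊢
      linear_combination 2 * hh
    exact_mod_cast h4
  have h5 : q p ^ ((k : ℤ) - 2 * 0) = q p ^ (((s : ℤ) - 1 - 2 * 0) + (r - 1 : ℤ) * p) := by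
    rw [hK, q_shift hp]
    congr 1
    rw [← zpow_natCast]
    congr 1; omega
  obtain ⟨c, hc⟩ := q_zpow_inj hp h5
  rw [Int.ediv_eq_iff_of_pos (by omega)] at h3
  have : c = 0 := by
    have h6 : 2 * (p : ℤ) * c < p * 1 := by linarith [h3.2]
    have h7 : p * (-1 : ℤ) < 2 * (p : ℤ) * c := by linarith [h3.1]
    rw [mul_assoc, mul_left_comm] at h6 h7
    have h8 := lt_of_mul_lt_mul_left h6 (by omega)
    have h9 := lt_of_mul_lt_mul_left h7 (by omega)
    omega
  subst this
  have : ((k + 1 : ℕ) : ℤ) = ((r - 1) * p + s : ℕ) := by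
    push_cast [hr]
    linear_combination hc
  exact_mod_cast this

variable (hk : k + 1 + s = (r + 1) * p)

/-- The projection of a contragredient Weyl module to its head. -/
def headCoweyl : CW hp k →ₗ[U p] SX hp hs r :=
  (selfDual (hp := hp) hs hs1 hr).symm.toLinearMap.comp (transp (socWeyl hs hs1 hr hk))

lemma selfDual_headCoweyl (φ : CW hp k) : selfDual hs hs1 hr (headCoweyl hs hs1 hr hk φ) =
    transp (socWeyl hs hs1 hr hk) φ := by
  simp [headCoweyl]

lemma headCoweyl_eq_zero (φ : CW hp k) : headCoweyl (hp := hp) hs hs1 hr hk φ = 0 ↔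
    ∀ x, evw φ (socWeyl hs hs1 hr hk x) = 0 := by
  rw [headCoweyl, comp_apply, LinearEquiv.coe_coe, LinearEquiv.map_eq_zero_iff]
  constructor
  · intro h x
    rw [evw, ← ev_transp, h, map_zero, lin_zero]
  · intro h
    refine ev_ext fun x => ?_
    rw [ev_transp, map_zero, lin_zero]
    exact h x

lemma coweyl_eq_top (W : Submodule (U p) (CW hp k))
    (h : ¬ W ≤ ker (headCoweyl (hp := hp) hs hs1 hr hk)) : W = ⊤ := by
  let A : Submodule (U p) (DW hp k) :=
    { carrier := {v | ∀ φ ∈ W, evw φ v = 0}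
      add_mem' := fun {a b} ha hb φ hφ => by rw [evw, map_add]; change evw φ a + evw φ b = 0; rw [ha φ hφ, hb φ hφ, add_zero]
      zero_mem' := fun φ _ => map_zero _
      smul_mem' := fun u v hv φ hφ => by
        have := hv _ (W.smul_mem (uAnti hp u).unop hφ)
        rwa [evw, ev_smul, uAnti_uAnti] at this }
  have hA : A = ⊥ := by
    by_contra hA
    apply h
    intro φ hφ
    rw [mem_ker, headCoweyl_eq_zero]
    intro x
    exact range_socWeyl_le hs hs1 hr hk A hA ⟨x, rfl⟩ φ hφ
  let W' : Submodule ℂ (Module.Dual ℂ (Fin (k + 1) → ℂ)) := W.restrictScalars ℂ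
  have hW' : W'.dualCoannihilator = ⊥ := by
    rw [eq_bot_iff]
    intro v hv
    have : (RepSpace.out (weylRep hp k)).symm v ∈ A := fun φ hφ =>
      (Submodule.mem_dualCoannihilator _).1 hv φ hφ
    rw [hA] at this
    exact this
  have : W' = ⊤ := by
    rw [← Subspace.dualCoannihilator_dualAnnihilator_eq (W := W'), hW',
      Submodule.dualAnnihilator_bot]
  rw [eq_top_iff]
  intro φ _
  have h2 : (φ : Module.Dual ℂ (Fin (k + 1) → ℂ)) ∈ W' := by rw [this]; trivial
  exact h2

lemma headCoweyl_surjective : Surjective (headCoweyl (hp := hp) hs hs1 hr hk) := by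
  refine simple_hom_surjective hs hs1 hr _ fun h => ?_
  have hi := socWeyl_injective (hp := hp) hs hs1 hr hk
  have h2 : ∀ φ : CW hp k, evw φ (socWeyl hs hs1 hr hk (sv hp hs r 0 0)) = 0 := fun φ =>
    (headCoweyl_eq_zero hs hs1 hr hk φ).1 (by rw [h]; rfl) _
  rw [socWeyl_sv] at h2
  have hkz : (k : ℤ) + 1 + s = (r + 1) * p := by exact_mod_cast hk
  have h3 := h2 (cd hp k (p - s))
  have h4 := ev_cd (hp := hp) (k := k) ((p : ℤ) - s) (i := p - s) (by
    have : (1 : ℤ) ≤ r := by omega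
    zify [hs]; nlinarith)
  rw [if_pos (by omega), (by omega : ((p - s : ℕ) : ℤ) = p - s), h3] at h4
  exact zero_ne_one h4

/-- The kernel of the projection to the head, for `s < p`, is the socle. -/
lemma ker_headCoweyl (hsp : s < p) (hs' : p - s ≤ p) (hs1' : 1 ≤ p - s) (hr' : 1 ≤ r + 1)
    (hk' : k + 1 = (r + 1 - 1) * p + (p - s)) :
    ker (headCoweyl (hp := hp) hs hs1 hr hk) =
      range (socCoweyl (hp := hp) hs' hs1' hr' hk') := by
  have h1 := LinearMap.finrank_range_add_finrank_ker (toC (headCoweyl (hp := hp) hs hs1 hr hk))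
  have h2 := LinearMap.finrank_range_of_inj (f := toC (socCoweyl (hp := hp) hs' hs1' hr' hk'))
    (socCoweyl_injective hs' hs1' hr' hk')
  have h3 : range (toC (headCoweyl (hp := hp) hs hs1 hr hk)) = ⊤ :=
    range_eq_top.2 (headCoweyl_surjective hs hs1 hr hk)
  rw [h3, finrank_top, finrank_SX, finrank_CW] at h1
  rw [finrank_SX] at h2
  obtain ⟨d, hd⟩ : ∃ d, p - s = d := ⟨_, rfl⟩
  have hd' : p = s + d := by omega
  have hk2 : k + 1 = (r + 1) * d + r * s := by
    rw [Nat.add_sub_cancel] at hk'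
    rw [hk', hd, hd']; ring
  have hle : range (socCoweyl (hp := hp) hs' hs1' hr' hk') ≤
      ker (headCoweyl (hp := hp) hs hs1 hr hk) := by
    by_contra hle
    have h4 := coweyl_eq_top hs hs1 hr hk _ hle
    have h5 : range (toC (socCoweyl (hp := hp) hs' hs1' hr' hk')) = ⊤ :=
      eq_top_iff.2 fun y _ => by
        have : y ∈ range (socCoweyl (hp := hp) hs' hs1' hr' hk') := by rw [h4]; trivial
        exact this
    rw [h5, finrank_top, finrank_CW, hd] at h2
    nlinarith
  have := Submodule.eq_of_le_of_finrank_eq (K := ℂ)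
    (S₁ := range (toC (socCoweyl (hp := hp) hs' hs1' hr' hk')))
    (S₂ := ker (toC (headCoweyl (hp := hp) hs hs1 hr hk))) hle (by
      rw [h2, hd]; nlinarith)
  refine le_antisymm (fun x hx => ?_) hle
  have h6 : x ∈ ker (toC (headCoweyl (hp := hp) hs hs1 hr hk)) := hx
  rw [← this] at h6
  exact h6

/-- The projection of a Weyl module to its head. -/
def headWeyl (hs' : p - s ≤ p) (hs1' : 1 ≤ p - s) (hr' : 1 ≤ r + 1)
    (hk' : k + 1 = (r + 1 - 1) * p + (p - s)) : DW hp k →ₗ[U p] SX hp hs' (r + 1) :=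
  (selfDual (hp := hp) hs' hs1' hr').symm.toLinearMap.comp (flipHom (socCoweyl hs' hs1' hr' hk'))

lemma selfDual_headWeyl (hs' : p - s ≤ p) (hs1' : 1 ≤ p - s) (hr' : 1 ≤ r + 1)
    (hk' : k + 1 = (r + 1 - 1) * p + (p - s)) (v : DW hp k) :
    selfDual hs' hs1' hr' (headWeyl hs' hs1' hr' hk' v) =
      flipHom (socCoweyl hs' hs1' hr' hk') v := by
  simp [headWeyl]

lemma headWeyl_surjective (hs' : p - s ≤ p) (hs1' : 1 ≤ p - s) (hr' : 1 ≤ r + 1)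
    (hk' : k + 1 = (r + 1 - 1) * p + (p - s)) :
    Surjective (headWeyl (hp := hp) hs' hs1' hr' hk') := by
  refine simple_hom_surjective hs' hs1' hr' _ fun h => ?_
  have h1 := selfDual_headWeyl (hp := hp) hs' hs1' hr' hk' (wv hp k 0)
  rw [h, lin_zero, map_zero] at h1
  have h2 := ev_flipHom (socCoweyl (hp := hp) hs' hs1' hr' hk') (wv hp k 0)
    (sv hp hs' (r + 1) 0 0)
  rw [← h1, socCoweyl_sv, map_zero, lin_zero] at h2
  have h3 := ev_cd (hp := hp) (k := k) 0 (Nat.zero_le k)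
  rw [Nat.cast_zero, if_pos rfl, evw, ← h2] at h3
  exact zero_ne_one h3

lemma ker_headWeyl (hsp : s < p) (hs' : p - s ≤ p) (hs1' : 1 ≤ p - s) (hr' : 1 ≤ r + 1)
    (hk' : k + 1 = (r + 1 - 1) * p + (p - s)) :
    ker (headWeyl (hp := hp) hs' hs1' hr' hk') =
      range (socWeyl (hp := hp) hs hs1 hr hk) := by
  have h1 := LinearMap.finrank_range_add_finrank_ker (toC (headWeyl (hp := hp) hs' hs1' hr' hk'))
  have h2 := LinearMap.finrank_range_of_inj (f := toC (socWeyl (hp := hp) hs hs1 hr hk))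
    (socWeyl_injective hs hs1 hr hk)
  have hsur := headWeyl_surjective (hp := hp) hs' hs1' hr' hk'
  have h3 : range (toC (headWeyl (hp := hp) hs' hs1' hr' hk')) = ⊤ :=
    range_eq_top.2 hsur
  rw [h3, finrank_top, finrank_SX, finrank_DW] at h1
  rw [finrank_SX] at h2
  have hle : ker (headWeyl (hp := hp) hs' hs1' hr' hk') ≤
      range (socWeyl (hp := hp) hs hs1 hr hk) := by
    by_contra hle
    have h4 := weyl_eq_top hs hs1 hr hk _ hle
    have h5 : range (toC (headWeyl (hp := hp) hs' hs1' hr' hk')) = ⊥ := by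
      rw [LinearMap.range_eq_bot]
      exact ext fun v => lin_congr (LinearMap.ker_eq_top.1 h4) v
    have h6 := finrank_SX (hp := hp) (r := r + 1) hs'
    rw [h3] at h5
    have h7 := finrank_top ℂ (SX hp hs' (r + 1))
    rw [h5, finrank_bot, h6] at h7
    rcases Nat.mul_eq_zero.1 h7.symm with h8 | h8 <;> omega
  obtain ⟨d, hd⟩ : ∃ d, p - s = d := ⟨_, rfl⟩
  have hd' : p = s + d := by omega
  have hk2 : k + 1 = (r + 1) * d + r * s := by
    rw [Nat.add_sub_cancel] at hk'
    rw [hk', hd, hd']; ring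
  have := Submodule.eq_of_le_of_finrank_eq (K := ℂ)
    (S₁ := ker (toC (headWeyl (hp := hp) hs' hs1' hr' hk')))
    (S₂ := range (toC (socWeyl (hp := hp) hs hs1 hr hk))) hle (by
      rw [h2]
      rw [show (p - s) * (r + 1) = d * (r + 1) by rw [hd]] at h1
      nlinarith)
  refine le_antisymm hle (fun x hx => ?_)
  have h6 : x ∈ range (toC (socWeyl (hp := hp) hs hs1 hr hk)) := hx
  rw [← this] at h6
  exact h6

include hs hs1 hk in
/-- A Weyl module with `r > 1` has no invariants under the Lusztig `sl(2)`. -/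
lemma weyl_no_invariant (hsp : s < p) (hr2 : 1 < r) (y : DW hp k) (he : U.gen p .e • y = 0)
    (hf : U.gen p .f • y = 0) : y = 0 := by
  have hs' : p - s ≤ p := Nat.sub_le _ _
  have hs1' : 1 ≤ p - s := by omega
  have hr' : 1 ≤ r + 1 := by omega
  have hr : 1 ≤ r := by omega
  have hk' : k + 1 = (r + 1 - 1) * p + (p - s) := by
    rw [Nat.add_sub_cancel]
    have : (r + 1) * p = r * p + p := by ring
    omega
  have h1 : headWeyl (hp := hp) hs' hs1' hr' hk' y = 0 :=
    sx_no_invariant (by omega) _ (by rw [← map_smul, he, map_zero])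
      (by rw [← map_smul, hf, map_zero])
  have h2 : y ∈ range (socWeyl (hp := hp) hs hs1 hr hk) := by
    rw [← ker_headWeyl hs hs1 hr hk hsp hs' hs1' hr' hk']; exact h1
  obtain ⟨x, rfl⟩ := h2
  have hi := socWeyl_injective (hp := hp) hs hs1 hr hk
  rw [sx_no_invariant hr2 x (hi (by rw [map_smul, he, map_zero]))
    (hi (by rw [map_smul, hf, map_zero])), map_zero]

/-- The isomorphism of `X_{s,1}` with a contragredient Weyl module. -/
lemma socCoweyl_bijective (hk : k + 1 = (1 - 1) * p + s) :
    Function.Bijective (socCoweyl (hp := hp) hs hs1 le_rfl hk) := by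
  have hi := socCoweyl_injective (hp := hp) hs hs1 le_rfl hk
  refine ⟨hi, (LinearMap.injective_iff_surjective_of_finrank_eq_finrank
    (f := toC (socCoweyl (hp := hp) hs hs1 le_rfl hk)) ?_).1 hi⟩
  rw [finrank_SX, finrank_CW]; omega

end headsoc

end coweyl

/-! ### Homomorphisms of spin chains -/

section chainhom

variable {p : ℕ}

lemma hc_smul {N : ℕ} {hp : 2 ≤ p} (x : Gen) (v : HC hp N) :
    U.gen p x • v = (RepSpace.out (chainRep hp N)).symm (chainGen p N x (RepSpace.out _ v)) :=
  gen_smul_lift _ _ _ _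

lemma diag_congr (n : ℕ) {φ ψ : ℤ → ℂ} (h : ∀ x ∈ Finset.Icc (-(n : ℤ)) n, φ x = ψ x) :
    chainDiag n φ = chainDiag n ψ := by
  induction n generalizing φ ψ with
  | zero => rw [chainDiag, chainDiag, h 0 (by simp)]
  | succ n ih =>
    rw [chainDiag, chainDiag, ih fun x hx => h _ ?_, ih fun x hx => h _ ?_]
    all_goals
      rw [Finset.mem_Icc] at hx ⊢
      push_cast
      omega

/-- Every function agrees on a finite set of weights with an element of the algebra generated by
the characters of the Cartan part of the quantum group. -/
lemma diag_dense (hp : 2 ≤ p) (S : Subalgebra ℂ (ℤ → ℂ)) (h1 : (fun x => q p ^ x) ∈ S)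
    (h2 : (fun x => qBin p x p) ∈ S) (T : Finset ℤ) (φ : ℤ → ℂ) : ∃ c ∈ S, ∀ x ∈ T, c x = φ x := by
  refine exists_eq_on S T (fun x _ y _ hxy => ?_) φ
  by_contra! h
  have e1 := h _ h1
  have e2 := h _ h2
  simp only [qBin_p] at e1 e2
  obtain ⟨c, hc⟩ := q_zpow_inj hp e1
  have hp' : (p : ℤ) ≠ 0 := by omega
  obtain rfl : y = x + 2 * c * p := by linear_combination hc
  rw [Int.add_mul_ediv_right _ _ hp', neg_one_zpow_congr (a := x + 2 * c * p + p) (b := x + p)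
    (c := c * p) (by ring)] at e2
  have e3 := mul_left_cancel₀ (zpow_ne_zero _ (by norm_num)) e2
  rw [Int.cast_inj] at e3
  have : c = 0 := by omega
  subst this
  simp at hxy

lemma qBin_mem (hp : 2 ≤ p) (S : Subalgebra ℂ (ℤ → ℂ)) (h1 : (fun x => q p ^ x) ∈ S)
    (h2 : (fun x => q p ^ (-x)) ∈ S) {t : ℕ} (ht : t < p) : (fun x => qBin p x t) ∈ S := by
  have h3 : ∀ i : ℕ, (fun x : ℤ => qInt p (x - i)) ∈ S := by
    intro i
    have : (fun x : ℤ => qInt p (x - i)) = ((q p - (q p)⁻¹)⁻¹ * q p ^ (-(i : ℤ))) • (fun x : ℤ => q p ^ x) -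
        ((q p - (q p)⁻¹)⁻¹ * q p ^ (i : ℤ)) • (fun x : ℤ => q p ^ (-x)) := by
      funext x
      simp only [qInt, Pi.sub_apply, Pi.smul_apply, smul_eq_mul]
      rw [sub_eq_add_neg x, zpow_add₀ (q_ne p), neg_add, neg_neg, zpow_add₀ (q_ne p)]
      ring
    rw [this]
    exact S.sub_mem (S.smul_mem h1 _) (S.smul_mem h2 _)
  have : (fun x => qBin p x t) =
      (qFact p t)⁻¹ • ∏ i ∈ Finset.range t, (fun x : ℤ => qInt p (x - i)) := by
    funext x
    simp only [qBin, if_pos ht, Pi.smul_apply, Finset.prod_apply, smul_eq_mul]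
    ring
  rw [this]
  exact S.smul_mem (S.prod_mem fun i _ => h3 i) _

/-- A linear map between spin chains that commutes with all divided powers and with the weight
operators. -/
structure IsU (p : ℕ) {m n : ℕ} (f : Chain m →ₗ[ℂ] Chain n) : Prop where
  E : ∀ a v, f (chainE p m a v) = chainE p n a (f v)
  F : ∀ a v, f (chainF p m a v) = chainF p n a (f v)
  D : ∀ φ v, f (chainDiag m φ v) = chainDiag n φ (f v)

section IsU

variable {l m n : ℕ} {f g : Chain m →ₗ[ℂ] Chain n}

lemma IsU.comp {g : Chain l →ₗ[ℂ] Chain m} (hf : IsU p f) (hg : IsU p g) : IsU p (f ∘ₗ g) where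
  E a v := by simp [hg.E, hf.E]
  F a v := by simp [hg.F, hf.F]
  D φ v := by simp [hg.D, hf.D]

lemma IsU.add (hf : IsU p f) (hg : IsU p g) : IsU p (f + g) where
  E a v := by simp [hg.E, hf.E]
  F a v := by simp [hg.F, hf.F]
  D φ v := by simp [hg.D, hf.D]

lemma IsU.sub (hf : IsU p f) (hg : IsU p g) : IsU p (f - g) where
  E a v := by simp [hg.E, hf.E]
  F a v := by simp [hg.F, hf.F]
  D φ v := by simp [hg.D, hf.D]

lemma IsU.smul (c : ℂ) (hf : IsU p f) : IsU p (c • f) where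
  E a v := by simp [hf.E]
  F a v := by simp [hf.F]
  D φ v := by simp [hf.D]

lemma IsU.id : IsU p (LinearMap.id : Chain n →ₗ[ℂ] Chain n) := ⟨fun _ _ => rfl, fun _ _ => rfl, fun _ _ => rfl⟩

lemma IsU.zero : IsU p (0 : Chain m →ₗ[ℂ] Chain n) :=
  ⟨fun _ _ => by simp, fun _ _ => by simp, fun _ _ => by simp⟩

lemma IsU.xxz (n i : ℕ) : IsU p (xxz p n i : Chain n →ₗ[ℂ] Chain n) where
  E a v := lin_congr (xxz_E n i a).eq v
  F a v := lin_congr (xxz_F n i a).eq v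
  D φ v := lin_congr (xxz_diag n i φ).eq v

lemma IsU.of_xxzRep (N : ℕ) (a : TL p N) : IsU p (xxzRep p N a : Chain N →ₗ[ℂ] Chain N) := by
  induction a using TL.induction with
  | hc c => rw [AlgHom.commutes]; exact IsU.smul c IsU.id
  | hg i => rw [xxzRep, TL.lift_gen]; exact IsU.xxz _ _
  | hm a b ha hb => rw [map_mul]; exact ha.comp hb
  | ha a b ha hb => rw [map_add]; exact ha.add hb

lemma IsU.gen (hf : IsU p f) (x : Gen) (v : Chain m) :
    f (chainGen p m x v) = chainGen p n x (f v) := by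
  have he : ∀ v, f (chainGen p m .e v) = chainGen p n .e (f v) := by
    intro v
    simp only [chainGen, diag_pow, mul_apply, hf.E, hf.D]
  have hf' : ∀ v, f (chainGen p m .f v) = chainGen p n .f (f v) := by
    intro v
    simp only [chainGen, lin_smul, map_smul, hf.F]
  cases x with
  | E => exact hf.E _ _
  | F => exact hf.F _ _
  | K => exact hf.D _ _
  | Kinv => exact hf.D _ _
  | e => exact he v
  | f => exact hf' v
  | h =>
    change f (((2 : ℂ)⁻¹ • (chainGen p m .e * chainGen p m .f - chainGen p m .f * chainGen p m .e)) v) =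
      ((2 : ℂ)⁻¹ • (chainGen p n .e * chainGen p n .f - chainGen p n .f * chainGen p n .e)) (f v)
    simp only [lin_smul, lin_sub, mul_apply, map_smul, map_sub,
      he, hf']

/-- The homomorphism of modules over the quantum group given by a map of spin chains. -/
def IsU.hom (hp : 2 ≤ p) (hf : IsU p f) : HC hp m →ₗ[U p] HC hp n :=
  mkHom (show HC hp m →ₗ[ℂ] HC hp n from f)
    (fun v => by rw [hc_smul, hc_smul]; exact hf.gen .E v)
    (fun v => by rw [hc_smul, hc_smul]; exact hf.gen .F v)
    (fun v => by rw [hc_smul, hc_smul]; exact hf.gen .K v)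
    (fun v => by rw [hc_smul, hc_smul]; exact hf.gen .e v)
    (fun v => by rw [hc_smul, hc_smul]; exact hf.gen .f v)

def under {hp : 2 ≤ p} (g : HC hp m →ₗ[U p] HC hp n) : Chain m →ₗ[ℂ] Chain n :=
  show HC hp m →ₗ[ℂ] HC hp n from toC g

lemma qBin_add_p_ne (hp : 2 ≤ p) (a : ℕ) : qBin p ((a : ℤ) + p) p ≠ 0 := by
  rw [qBin_p]
  refine mul_ne_zero (zpow_ne_zero _ (by norm_num)) ?_
  rw [Int.add_ediv_of_dvd_right (dvd_refl _), Int.ediv_self (by omega), Int.cast_ne_zero]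
  have := Int.ediv_nonneg (by omega : (0 : ℤ) ≤ a) (by omega : (0 : ℤ) ≤ p)
  omega

lemma isU_of_gen (hp : 2 ≤ p) (h : ∀ x v, f (chainGen p m x v) = chainGen p n x (f v)) :
    IsU p f := by
  have hE1 := h .E
  have hF1 := h .F
  have hK := h .K
  have hKi := h .Kinv
  have he := h .e
  have hf' := h .f
  simp only [chainGen] at hE1 hF1 hK hKi he hf'
  have hpow : ∀ (A : Module.End ℂ (Chain m)) (B : Module.End ℂ (Chain n))
      (_ : ∀ v, f (A v) = B (f v)) (j : ℕ) v, f ((A ^ j) v) = (B ^ j) (f v) := by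
    intro A B hAB j
    induction j with
    | zero => simp
    | succ j ih => intro v; rw [pow_succ', pow_succ', mul_apply, hAB, ih]; rfl
  have hEp : ∀ v, f (chainE p m p v) = chainE p n p (f v) := by
    intro v
    have h1 := he v
    simp only [kappa_eq hp, mul_apply] at h1
    have h2 : ∀ v, f (chainDiag m (fun x => (-1) ^ x) v) = chainDiag n (fun x => (-1) ^ x) (f v) := by
      intro v
      rw [← kappa_eq hp, ← kappa_eq hp]
      exact hpow _ _ hK p v
    rw [h2] at h1
    have h3 := congrArg (chainDiag n fun x => (-1) ^ x) h1
    rw [← mul_apply, ← mul_apply, kappa_sq] at h3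
    exact h3
  have hFp : ∀ v, f (chainF p m p v) = chainF p n p (f v) := by
    intro v
    have h1 := hf' v
    rw [lin_smul, lin_smul, map_smul] at h1
    exact smul_right_injective _ (pow_ne_zero p (by norm_num : (-1 : ℂ) ≠ 0)) h1
  have hE : ∀ (a : ℕ) v, f (chainE p m a v) = chainE p n a (f v) := by
    intro a
    induction a using Nat.strong_induction_on with
    | _ a ih =>
    intro v
    by_cases ha : a < p
    · have h2 := hpow _ _ hE1 a v
      rw [E_pow hp, E_pow hp, lin_smul, lin_smul, map_smul] at h2
      exact smul_right_injective _ (qFact_ne hp ha) h2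
    · obtain ⟨b, rfl⟩ : ∃ b, a = b + p := ⟨a - p, by omega⟩
      have h1 := lin_congr (E_mul hp m b le_rfl) v
      have h2 := lin_congr (E_mul hp n b le_rfl) (f v)
      rw [mul_apply, lin_smul] at h1 h2
      rw [← hEp, ← ih b (by omega), h1, map_smul] at h2
      push_cast
      exact smul_right_injective _ (qBin_add_p_ne hp b) h2
  have hF : ∀ (a : ℕ) v, f (chainF p m a v) = chainF p n a (f v) := by
    intro a
    induction a using Nat.strong_induction_on with
    | _ a ih =>
    intro v
    by_cases ha : a < p
    · have h2 := hpow _ _ hF1 a v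
      rw [F_pow hp, F_pow hp, lin_smul, lin_smul, map_smul] at h2
      exact smul_right_injective _ (qFact_ne hp ha) h2
    · obtain ⟨b, rfl⟩ : ∃ b, a = b + p := ⟨a - p, by omega⟩
      have h1 := lin_congr (F_mul hp m b le_rfl) v
      have h2 := lin_congr (F_mul hp n b le_rfl) (f v)
      rw [mul_apply, lin_smul] at h1 h2
      rw [← hFp, ← ih b (by omega), h1, map_smul] at h2
      push_cast
      exact smul_right_injective _ (qBin_add_p_ne hp b) h2
  let S : Subalgebra ℂ (ℤ → ℂ) :=
    { carrier := {φ | ∀ v, f (chainDiag m φ v) = chainDiag n φ (f v)}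
      mul_mem' := fun {a b} ha hb v => by
        change f (chainDiag m (fun x => a x * b x) v) = chainDiag n (fun x => a x * b x) (f v)
        rw [← diag_mul, ← diag_mul, mul_apply, ha, hb]; rfl
      add_mem' := fun {a b} ha hb v => by
        change f (chainDiag m (fun x => a x + b x) v) = chainDiag n (fun x => a x + b x) (f v)
        rw [← diag_add, ← diag_add, lin_add, map_add, ha, hb]; rfl
      algebraMap_mem' := fun c v => by
        change f (chainDiag m (fun x => c) v) = chainDiag n (fun x => c) (f v)
        have h1 : ∀ j, chainDiag j (fun _ => c) = c • (1 : Module.End ℂ (Chain j)) := by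
          intro j; rw [← diag_one, diag_smul]; simp
        rw [h1, h1]; simp }
  have hS : (fun x => qBin p x p) ∈ S := by
    intro v
    have h1 := lin_congr (E_F hp m p p (Or.inl le_rfl)) v
    have h2 := lin_congr (E_F hp n p p (Or.inl le_rfl)) (f v)
    rw [Finset.sum_range_succ, lin_add, lin_sum] at h1 h2
    simp only [mul_apply, sub_self, (F_zero _).1, (E_zero _).1, one_apply,
      add_sub_cancel_right] at h1 h2
    rw [← hFp, ← hEp, h1, map_add, map_sum, Finset.sum_congr rfl] at h2
    · exact add_left_cancel h2
    intro t ht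
    rw [Finset.mem_range] at ht
    have h3 : (p : ℤ) - t = (p - t : ℕ) := by omega
    rw [h3, hF, hE, qBin_mem hp S hK hKi ht]
  refine ⟨fun a v => ?_, fun a v => ?_, fun φ v => ?_⟩
  · by_cases ha : 0 ≤ a
    · lift a to ℕ using ha; exact hE a v
    · rw [(E_zero m).2 a (by omega), (E_zero n).2 a (by omega)]; simp
  · by_cases ha : 0 ≤ a
    · lift a to ℕ using ha; exact hF a v
    · rw [(F_zero m).2 a (by omega), (F_zero n).2 a (by omega)]; simp
  · obtain ⟨c, hc, h⟩ := diag_dense hp S hK hS (Finset.Icc (-(m : ℤ)) m ∪ Finset.Icc (-(n : ℤ)) n) φ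
    rw [← diag_congr m (φ := c) (ψ := φ) fun x hx => h x (Finset.mem_union_left _ hx),
      ← diag_congr n (φ := c) (ψ := φ) fun x hx => h x (Finset.mem_union_right _ hx)]
    exact hc v

lemma isU_under {hp : 2 ≤ p} (g : HC hp m →ₗ[U p] HC hp n) : IsU p (under g) := by
  refine isU_of_gen hp fun x v => ?_
  have := g.map_smul (U.gen p x) ((RepSpace.out (chainRep hp m)).symm v)
  rw [hc_smul, hc_smul] at this
  exact this

end IsU

def pl {n : ℕ} : Chain (n + 1) →ₗ[ℂ] Chain n := LinearMap.fst ℂ (Chain n) (Chain n)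

def mi {n : ℕ} : Chain (n + 1) →ₗ[ℂ] Chain n := LinearMap.snd ℂ (Chain n) (Chain n)

def mk {n : ℕ} (u d : Chain n) : Chain (n + 1) := (u, d)

section components

variable {m n : ℕ} {f : Chain m →ₗ[ℂ] Chain n}

@[simp] lemma pl_mk (u d : Chain n) : pl (mk u d) = u := rfl

@[simp] lemma mi_mk (u d : Chain n) : mi (mk u d) = d := rfl

lemma chain_ext {v w : Chain (n + 1)} (h1 : pl v = pl w) (h2 : mi v = mi w) : v = w :=
  Prod.ext h1 h2

lemma mk_pl_mi (v : Chain (n + 1)) : mk (pl v) (mi v) = v := rfl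

lemma mk_add (u d u' d' : Chain n) : mk u d + mk u' d' = mk (u + u') (d + d') := rfl

lemma mk_smul (c : ℂ) (u d : Chain n) : c • mk u d = mk (c • u) (c • d) := rfl

@[simp] lemma mk_zero : mk (0 : Chain n) 0 = 0 := rfl

lemma pl_E (a : ℤ) (v : Chain (n + 1)) :
    pl (chainE p (n + 1) a v) = q p ^ a • chainE p n a (pl v) + chainE p n (a - 1) (mi v) := rfl

lemma mi_E (a : ℤ) (v : Chain (n + 1)) :
    mi (chainE p (n + 1) a v) = q p ^ (-a) • chainE p n a (mi v) :=
  zero_add _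

lemma pl_F (a : ℤ) (v : Chain (n + 1)) : pl (chainF p (n + 1) a v) = chainF p n a (pl v) :=
  add_zero _

lemma mi_F (a : ℤ) (v : Chain (n + 1)) : mi (chainF p (n + 1) a v) =
    q p ^ (a - 1) • chainF p n (a - 1) (chainDiag n (fun x => q p ^ (-x)) (pl v)) +
      chainF p n a (mi v) := rfl

lemma pl_D (φ : ℤ → ℂ) (v : Chain (n + 1)) :
    pl (chainDiag (n + 1) φ v) = chainDiag n (fun x => φ (x + 1)) (pl v) := add_zero _

lemma mi_D (φ : ℤ → ℂ) (v : Chain (n + 1)) :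
    mi (chainDiag (n + 1) φ v) = chainDiag n (fun x => φ (x - 1)) (mi v) := zero_add _

lemma pl_xxz (i : ℕ) (v : Chain (n + 2)) :
    pl (xxz p (n + 2) (i + 1) v) = xxz p (n + 1) i (pl v) := add_zero _

lemma mi_xxz (i : ℕ) (v : Chain (n + 2)) :
    mi (xxz p (n + 2) (i + 1) v) = xxz p (n + 1) i (mi v) := zero_add _

/-- The map `1 ⊗ f` on chains with one more site. -/
def up (f : Chain m →ₗ[ℂ] Chain n) : Chain (m + 1) →ₗ[ℂ] Chain (n + 1) := LinearMap.prodMap f f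

@[simp] lemma pl_up (v : Chain (m + 1)) : pl (up f v) = f (pl v) := rfl

@[simp] lemma mi_up (v : Chain (m + 1)) : mi (up f v) = f (mi v) := rfl

lemma IsU.up (hf : IsU p f) : IsU p (up f) where
  E a v := chain_ext
    (by simp only [pl_up, mi_up, pl_E, map_add, map_smul, hf.E])
    (by simp only [mi_up, mi_E, map_smul, hf.E])
  F a v := chain_ext
    (by simp only [pl_up, pl_F, hf.F])
    (by simp only [pl_up, mi_up, mi_F, map_add, map_smul, hf.F, hf.D])
  D φ v := chain_ext
    (by simp only [pl_up, pl_D, hf.D])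
    (by simp only [mi_up, mi_D, hf.D])

/-- The contraction of the two outermost sites. -/
def cap (p n : ℕ) : Chain (n + 2) →ₗ[ℂ] Chain n := (q p)⁻¹ • (mi ∘ₗ pl) - pl ∘ₗ mi

lemma cap_apply (v : Chain (n + 2)) : cap p n v = (q p)⁻¹ • mi (pl v) - pl (mi v) := rfl

lemma diag_shift_q (n : ℕ) (c : ℤ) (v : Chain n) : chainDiag n (fun x => q p ^ (-(x + c))) v =
    q p ^ (-c) • chainDiag n (fun x => q p ^ (-x)) v := by
  rw [← lin_smul, diag_smul]
  congr 2; funext x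
  rw [neg_add, zpow_add₀ (q_ne p), mul_comm]

lemma isU_cap : IsU p (cap p n) where
  E a v := by
    have hq := q_ne p
    have hx := zpow_ne_zero a hq
    simp only [cap_apply, pl_E, mi_E, map_add, map_sub, map_smul, zpow_neg, zpow_sub_one₀ hq]
    match_scalars <;> field_simp <;> ring
  F a v := by
    have hq := q_ne p
    have hx := zpow_ne_zero a hq
    simp only [cap_apply, pl_F, mi_F, map_add, map_sub, map_smul, pl_D, diag_shift_q,
      zpow_sub_one₀ hq, zpow_neg_one]
    match_scalars <;> field_simp <;> ring
  D φ v := by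
    simp only [cap_apply, pl_D, mi_D, map_sub, map_smul]
    simp

/-- The creation of a pair of outermost sites. -/
def cup (p n : ℕ) : Chain n →ₗ[ℂ] Chain (n + 2) where
  toFun v := mk (mk 0 v) (mk (-(q p) • v) 0)
  map_add' v w := by simp only [mk_add, smul_add, add_zero]
  map_smul' c v := by simp only [mk_smul, smul_zero, RingHom.id_apply, smul_comm c]

lemma cup_apply (v : Chain n) : cup p n v = mk (mk 0 v) (mk (-(q p) • v) 0) := rfl

lemma pl_xxz_zero (v : Chain (n + 2)) : pl (xxz p (n + 2) 0 v) = mk 0 (cap p n v) := by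
  refine chain_ext ?_ ?_
  · change (0 : Chain n) + 0 + (0 + 0) = 0; simp
  · change (0 : Chain n) + (q p)⁻¹ • mi (pl v) + (- pl (mi v) + 0) = _
    rw [mi_mk, cap_apply]; module

lemma mi_xxz_zero (v : Chain (n + 2)) : mi (xxz p (n + 2) 0 v) = mk (-(q p) • cap p n v) 0 := by
  refine chain_ext ?_ ?_
  · change (0 : Chain n) + - mi (pl v) + (q p • pl (mi v) + 0) = _
    rw [pl_mk, cap_apply, smul_sub, smul_smul, neg_mul, mul_inv_cancel₀ (q_ne p)]; module
  · change (0 : Chain n) + 0 + (0 + 0) = 0; simp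

lemma cup_cap (v : Chain (n + 2)) : cup p n (cap p n v) = xxz p (n + 2) 0 v :=
  chain_ext (pl_xxz_zero v).symm (mi_xxz_zero v).symm

lemma cap_surjective : Surjective (cap p n) := by
  intro v
  refine ⟨mk 0 (mk (-v) 0), ?_⟩
  rw [cap_apply]
  simp

lemma isU_cup : IsU p (cup p n) where
  E a v := by
    obtain ⟨w, rfl⟩ := cap_surjective (p := p) v
    rw [← (isU_cap (p := p)).E, cup_cap, cup_cap, (IsU.xxz _ _).E]
  F a v := by
    obtain ⟨w, rfl⟩ := cap_surjective (p := p) v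
    rw [← (isU_cap (p := p)).F, cup_cap, cup_cap, (IsU.xxz _ _).F]
  D a v := by
    obtain ⟨w, rfl⟩ := cap_surjective (p := p) v
    rw [← (isU_cap (p := p)).D, cup_cap, cup_cap, (IsU.xxz _ _).D]

end components

end chainhom

/-! ### Lowest-weight functionals on the spin chain -/

section cohw

variable {p n : ℕ}

/-- `l` is a functional of weight `k` that vanishes on the images of `F` and `F^p/[p]!`. -/
structure IsCoHW (p : ℕ) {n : ℕ} (k : ℤ) (l : Chain n →ₗ[ℂ] ℂ) : Prop where
  D : ∀ φ v, l (chainDiag n φ v) = φ k * l v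
  F1 : ∀ v, l (chainF p n 1 v) = 0
  Fp : ∀ v, l (chainF p n p v) = 0

/-- The space of the functionals of weight `k` that vanish on the images of the `F^a/[a]!`. -/
def coHW (p n : ℕ) (k : ℤ) : Submodule ℂ (Chain n →ₗ[ℂ] ℂ) where
  carrier := {l | IsCoHW p k l}
  add_mem' {a b} ha hb := ⟨fun φ v => by simp [ha.D, hb.D, mul_add],
    fun v => by simp [ha.F1, hb.F1], fun v => by simp [ha.Fp, hb.Fp]⟩
  zero_mem' := ⟨fun φ v => by simp, fun v => by simp, fun v => by simp⟩
  smul_mem' c a ha := ⟨fun φ v => by simp [ha.D, mul_left_comm],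
    fun v => by simp [ha.F1], fun v => by simp [ha.Fp]⟩

lemma mem_coHW {k : ℤ} {l : Chain n →ₗ[ℂ] ℂ} : l ∈ coHW p n k ↔ IsCoHW p k l := Iff.rfl

variable {k : ℤ} {l : Chain n →ₗ[ℂ] ℂ}

lemma IsCoHW.comp {m : ℕ} {f : Chain m →ₗ[ℂ] Chain n} (hl : IsCoHW p k l) (hf : IsU p f) :
    IsCoHW p k (l ∘ₗ f) :=
  ⟨fun φ v => by simp [hf.D, hl.D], fun v => by simp [hf.F, hl.F1],
    fun v => by simp [hf.F, hl.Fp]⟩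

lemma IsCoHW.F (hp : 2 ≤ p) (hl : IsCoHW p k l) {a : ℤ} (ha : 1 ≤ a) (v : Chain n) :
    l (chainF p n a v) = 0 := by
  lift a to ℕ using by omega
  induction a using Nat.strong_induction_on generalizing v with
  | _ a ih =>
  by_cases hap : a < p
  · obtain ⟨b, rfl⟩ : ∃ b, a = b + 1 := ⟨a - 1, by omega⟩
    have h1 := lin_congr (F_pow hp n (b + 1)) v
    rw [pow_succ', mul_apply, lin_smul] at h1
    have h2 := congrArg l h1
    rw [hl.F1, map_smul, smul_eq_mul] at h2
    exact (mul_eq_zero.1 h2.symm).resolve_left (qFact_ne hp hap)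
  · obtain ⟨b, rfl⟩ : ∃ b, a = b + p := ⟨a - p, by omega⟩
    by_cases hb : b = 0
    · subst hb; rw [zero_add]; exact hl.Fp v
    have h1 := lin_congr (F_mul hp n b le_rfl) v
    rw [mul_apply, lin_smul] at h1
    have h2 := congrArg l h1
    rw [ih b (by omega) (chainF p n p v) (by omega), map_smul, smul_eq_mul] at h2
    push_cast
    exact (mul_eq_zero.1 h2.symm).resolve_left (qBin_add_p_ne hp b)

lemma IsCoHW.E_D (hl : IsCoHW p k l) (a : ℤ) (ψ : ℤ → ℂ) (v : Chain n) :
    l (chainE p n a (chainDiag n ψ v)) = ψ (k - 2 * a) * l (chainE p n a v) := by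
  have h := lin_congr (diag_E (p := p) n (fun x => ψ (x - 2 * a)) a) v
  simp only [add_sub_cancel_right, mul_apply] at h
  rw [← h, hl.D]

lemma IsCoHW.E_F1 (hp : 2 ≤ p) (hl : IsCoHW p k l) (m : ℤ) (v : Chain n) :
    l (chainE p n m (chainF p n 1 v)) = qInt p (k - m + 1) * l (chainE p n (m - 1) v) := by
  have h := lin_congr (E_F_one hp n m) v
  simp only [mul_apply, lin_add] at h
  rw [h, map_add, hl.F1, zero_add, hl.E_D]
  congr 2; ring

lemma IsCoHW.E_Fp (hp : 2 ≤ p) (hl : IsCoHW p k l) (m : ℤ) (v : Chain n) :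
    l (chainE p n m (chainF p n p v)) = qBin p (k - m + p) p * l (chainE p n (m - p) v) := by
  have h := lin_congr (E_F hp n m p (Or.inl le_rfl)) v
  rw [Finset.sum_range_succ, lin_add, lin_sum] at h
  simp only [mul_apply, sub_self, (F_zero _).1, one_apply] at h
  rw [h, map_add, map_sum, Finset.sum_eq_zero, zero_add, hl.E_D]
  · congr 2; ring
  · intro t ht
    rw [Finset.mem_range] at ht
    exact hl.F hp (by omega) _

lemma IsCoHW.h (hp : 2 ≤ p) (hl : IsCoHW p k l) (v : Chain n) :
    l (chainGen p n .h v) = ((k / p : ℤ) : ℂ) / 2 * l v := by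
  have h1 : chainGen p n .h v = (2 : ℂ)⁻¹ • (chainDiag n (fun x => (-1) ^ x)
      (chainE p n p ((-1 : ℂ) ^ p • chainF p n p v)) - (-1 : ℂ) ^ p • chainF p n p
        (chainDiag n (fun x => (-1) ^ x) (chainE p n p v))) := by
    rw [chainGen, kappa_eq hp]; rfl
  rw [h1, map_smul, map_sub, hl.D, map_smul, map_smul, map_smul, hl.Fp, smul_zero, sub_zero,
    hl.E_Fp hp, sub_self, (E_zero n).1, one_apply, sub_add_cancel, qBin_p]
  have : ((-1 : ℂ) ^ k * (-1) ^ p) * (-1) ^ (k + p) = 1 := by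
    rw [← zpow_natCast, ← zpow_add₀ (by norm_num), ← zpow_add₀ (by norm_num),
      neg_one_zpow_congr (b := 0) (c := k + p) (by ring), zpow_zero]
  simp only [smul_eq_mul]
  linear_combination ((k / p : ℤ) : ℂ) / 2 * l v * this

/-- There are no lowest-weight functionals of negative weight. -/
lemma IsCoHW.eq_zero (hp : 2 ≤ p) (hl : IsCoHW p k l) (hk : k < 0) : l = 0 := by
  by_contra hl0
  have H := chain_isUq hp n
  have hmul : ∀ A B : Module.End ℂ (Chain n),
      (LinearMap.dualMap A * LinearMap.dualMap B : Module.End ℂ (Module.Dual ℂ (Chain n))) =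
        LinearMap.dualMap (B * A) := fun A B => rfl
  have hsub : ∀ A B : Module.End ℂ (Chain n), (LinearMap.dualMap A - LinearMap.dualMap B :
      Module.End ℂ (Module.Dual ℂ (Chain n))) = LinearMap.dualMap (A - B) := fun A B => by
    ext x v; simp
  obtain ⟨j, hj⟩ := sl2_highest (V := Module.Dual ℂ (Chain n))
    (e := LinearMap.dualMap (chainGen p n .f)) (f := LinearMap.dualMap (chainGen p n .e))
    (h := LinearMap.dualMap (chainGen p n .h))
    (by rw [hmul, hmul, hsub, ← neg_sub, H.h_f, neg_neg])
    (by
      rw [hmul, hmul, hsub, ← neg_sub, H.h_e]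
      ext x v; simp)
    (by
      rw [hmul, hmul, hsub, H.e_f]
      ext x v; simp)
    (x := l) (ν := ((k / p : ℤ) : ℂ) / 2) hl0
    (by
      ext v
      change l (((-1 : ℂ) ^ p • chainF p n p) v) = 0
      rw [lin_smul, map_smul, hl.Fp, smul_zero])
    (by
      ext v
      exact hl.h hp v)
  have h2 : ((k / p : ℤ) : ℂ) = ((j : ℤ) : ℂ) := by push_cast at hj ⊢; linear_combination hj
  have h3 := Int.cast_injective h2
  have := Int.ediv_neg_of_neg_of_pos hk (by omega : (0 : ℤ) < p)
  omega

/-- The images of `E^a/[a]!` with `a > k` are annihilated by the functionals of weight `k`. -/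
lemma IsCoHW.E_eq_zero (hp : 2 ≤ p) (hl : IsCoHW p k l) (hk : 0 ≤ k) {a : ℤ} (ha : k < a)
    (v : Chain n) : l (chainE p n a v) = 0 := by
  lift a to ℕ using by omega
  induction a using Nat.strong_induction_on generalizing v with
  | _ a ih =>
  have h : IsCoHW p (k - 2 * a) (l ∘ₗ chainE p n a) := by
    refine ⟨fun φ v => hl.E_D a φ v, fun v => ?_, fun v => ?_⟩
    · rw [comp_apply, hl.E_F1 hp]
      by_cases h1 : k < a - 1
      · have := ih (a - 1) (by omega) v (by omega)
        rw [Nat.cast_sub (by omega), Nat.cast_one] at this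
        rw [this, mul_zero]
      · rw [(by omega : k - a + 1 = 0), qInt_zero, zero_mul]
    · rw [comp_apply, hl.E_Fp hp]
      by_cases h1 : k < a - p
      · have := ih (a - p) (by omega) v (by omega)
        rw [Nat.cast_sub (by omega)] at this
        rw [this, mul_zero]
      · rw [qBin_p, Int.ediv_eq_zero_of_lt (by omega) (by omega)]; simp
  exact lin_congr (h.eq_zero hp (by omega)) v

/-! ### Homomorphisms to contragredient Weyl modules -/

variable {k : ℕ} {hp : 2 ≤ p}

/-- The map to the contragredient Weyl module with the matrix elements of a functional. -/
def xiLin (hp : 2 ≤ p) (k : ℕ) (l : Chain n →ₗ[ℂ] ℂ) : HC hp n →ₗ[ℂ] CW hp k :=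
  ∑ j ∈ Finset.range (k + 1),
    (l ∘ₗ chainE p n j ∘ₗ (RepSpace.out (chainRep hp n)).toLinearMap).smulRight (cd hp k j)

lemma ev_xiLin {l : Chain n →ₗ[ℂ] ℂ} (hl : IsCoHW p k l) (v : HC hp n) (i : ℤ) :
    evw (xiLin hp k l v) (wv hp k i) = l (chainE p n i (RepSpace.out _ v)) := by
  have h0 : xiLin hp k l v = ∑ j ∈ Finset.range (k + 1),
      l (chainE p n j (RepSpace.out _ v)) • cd hp k j := by
    rw [xiLin, lin_sum]; rfl
  by_cases hi : 0 ≤ i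
  · by_cases hik : i ≤ k
    · lift i to ℕ using hi
      rw [h0, evw, map_sum, lin_sum, Finset.sum_eq_single i]
      · rw [map_smul, lin_smul]
        change _ • evw _ _ = _
        rw [ev_cd _ (by omega), if_pos rfl, smul_eq_mul, mul_one]
      · intro j _ hj
        rw [map_smul, lin_smul]
        change _ • evw _ _ = _
        rw [ev_cd' _ (by exact_mod_cast hj.symm), smul_zero]
      · intro h; simp at h; omega
    · rw [wv_zero (by omega), evw, map_zero, hl.E_eq_zero hp (by omega) (by omega)]
  · rw [wv_zero (by omega), evw, map_zero, (E_zero n).2 i (by omega)]; simp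

/-- The homomorphism to the contragredient Weyl module given by a lowest-weight functional. -/
def xiHom {l : Chain n →ₗ[ℂ] ℂ} (hl : IsCoHW p k l) : HC hp n →ₗ[U p] CW hp k :=
  mkHom (xiLin hp k l)
    (fun v => cd_ext fun i hi => by
      rw [ev_xiLin hl, hc_smul, evw, ev_E, wv_F, map_smul]
      change _ = _ • evw _ _
      rw [ev_xiLin hl]
      change l (chainE p n i (chainE p n 1 (RepSpace.out _ v))) = _
      have h := lin_congr (E_mul hp n i (b := 1) (by omega)) (RepSpace.out _ v)
      rw [mul_apply, lin_smul, Nat.cast_one, qBin_one hp] at h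
      rw [h, map_smul])
    (fun v => cd_ext fun i hi => by
      rw [ev_xiLin hl, hc_smul, evw, ev_F, wv_E, map_smul]
      change _ = _ • evw _ _
      rw [ev_xiLin hl]
      exact hl.E_F1 hp _ _)
    (fun v => cd_ext fun i hi => by
      rw [ev_xiLin hl, hc_smul, evw, ev_K, wv_K, map_smul]
      change _ = _ • evw _ _
      rw [ev_xiLin hl]
      exact hl.E_D _ _ _)
    (fun v => cd_ext fun i hi => by
      rw [ev_xiLin hl, hc_smul, evw, ev_e, wv_f, smul_comm_U, K_pow_smul (wv_K _), map_smul, map_smul]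
      change _ = _ * (_ • (_ • evw _ _))
      rw [ev_xiLin hl]
      change l (chainE p n i (((chainDiag n fun x => q p ^ x) ^ p)
        (chainE p n p (RepSpace.out _ v)))) = _
      have h := lin_congr (E_mul hp n i (b := p) le_rfl) (RepSpace.out _ v)
      rw [mul_apply, lin_smul, qBin_p, Int.add_ediv_of_dvd_right (dvd_refl _),
        Int.ediv_self (by omega)] at h
      have h2 := q_shift hp ((k : ℤ) - 2 * (i + p)) 0
      rw [zpow_zero, mul_one, zero_add, zpow_mul, zpow_natCast] at h2
      rw [kappa_eq hp, hl.E_D, h, map_smul, h2,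
        neg_one_zpow_congr (a := (i : ℤ) + p + p) (b := i) (c := p) (by ring),
        neg_one_zpow_congr (a := (k : ℤ) - 2 * i) (b := k) (c := -i) (by ring),
        neg_one_zpow_congr (a := (k : ℤ) - 2 * (i + p)) (b := k) (c := -(i + p)) (by ring),
        zpow_add₀ (by norm_num)]
      simp only [zpow_natCast, smul_eq_mul]
      have h3 : ((-1 : ℂ) ^ p) * (-1) ^ p = 1 := by rw [← mul_pow]; simp
      linear_combination (-(-1 : ℂ) ^ i * ((((i : ℤ) / p + 1 : ℤ) : ℂ)) * (-1) ^ k *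
        l (chainE p n (i + p) (RepSpace.out _ v))) * h3)
    (fun v => cd_ext fun i hi => by
      rw [ev_xiLin hl, hc_smul, evw, ev_f, wv_e, smul_comm_U, K_pow_smul (wv_K _), map_smul, map_smul]
      change _ = _ * (_ • (_ • evw _ _))
      rw [ev_xiLin hl]
      change l (chainE p n i (((-1 : ℂ) ^ p • chainF p n p) (RepSpace.out _ v))) = _
      have h2 := q_shift hp ((k : ℤ) - 2 * (i - p)) 0
      rw [zpow_zero, mul_one, zero_add, zpow_mul, zpow_natCast] at h2
      rw [lin_smul, map_smul, map_smul, hl.E_Fp hp, qBin_p,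
        Int.add_ediv_of_dvd_right (dvd_refl _), Int.ediv_self (by omega), h2,
        neg_one_zpow_congr (a := (k : ℤ) - i + p + p) (b := k + i) (c := p - i) (by ring),
        neg_one_zpow_congr (a := (k : ℤ) - 2 * (i - p)) (b := k) (c := p - i) (by ring),
        zpow_add₀ (by norm_num)]
      simp only [zpow_natCast, smul_eq_mul]
      ring)

lemma ev_xiHom {l : Chain n →ₗ[ℂ] ℂ} (hl : IsCoHW p k l) (v : HC hp n) (i : ℤ) :
    evw (xiHom hl v) (wv hp k i) = l (chainE p n i (RepSpace.out _ v)) := ev_xiLin hl v i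

/-- The functional given by the highest-weight component of a homomorphism. -/
def coHead (g : HC hp n →ₗ[U p] CW hp k) : Chain n →ₗ[ℂ] ℂ :=
  show HC hp n →ₗ[ℂ] ℂ from ((ev hp (weylRep hp k)).flip (wv hp k 0)).comp (toC g)

lemma coHead_apply (g : HC hp n →ₗ[U p] CW hp k) (v : Chain n) :
    coHead g v = evw (g ((RepSpace.out (chainRep hp n)).symm v)) (wv hp k 0) := rfl

lemma isCoHW_coHead (g : HC hp n →ₗ[U p] CW hp k) : IsCoHW p k (coHead g) := by
  have hgen : ∀ x v, coHead g (chainGen p n x v) =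
      evw (U.gen p x • g ((RepSpace.out (chainRep hp n)).symm v)) (wv hp k 0) := by
    intro x v
    rw [coHead_apply, ← map_smul, hc_smul]; rfl
  have hF1 : ∀ v, coHead g (chainF p n 1 v) = 0 := by
    intro v
    refine (hgen .F v).trans ?_
    rw [evw, ev_F, wv_E, wv_zero (by omega), smul_zero, map_zero]
  have hFp : ∀ v, coHead g (chainF p n p v) = 0 := by
    intro v
    have h := hgen .f v
    rw [evw, ev_f, wv_e, wv_zero (by omega), smul_zero, smul_zero, map_zero, mul_zero, chainGen,
      lin_smul, map_smul] at h
    exact (smul_eq_zero.1 h).resolve_left (pow_ne_zero _ (by norm_num))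
  have hK : ∀ v, coHead g (chainDiag n (fun x => q p ^ x) v) = q p ^ (k : ℤ) * coHead g v := by
    intro v
    refine (hgen .K v).trans ?_
    rw [evw, ev_K, wv_K, map_smul, mul_zero, sub_zero]; rfl
  have hKi : ∀ v, coHead g (chainDiag n (fun x => q p ^ (-x)) v) =
      q p ^ (-(k : ℤ)) * coHead g v := by
    intro v
    have h := hK (chainDiag n (fun x => q p ^ (-x)) v)
    rw [← mul_apply, diag_mul] at h
    simp only [← zpow_add₀ (q_ne p), add_neg_cancel, zpow_zero, diag_one, one_apply] at h
    rw [h, ← mul_assoc, ← zpow_add₀ (q_ne p), neg_add_cancel, zpow_zero, one_mul]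
  let S : Subalgebra ℂ (ℤ → ℂ) :=
    { carrier := {φ | ∀ v, coHead g (chainDiag n φ v) = φ k * coHead g v}
      mul_mem' := fun {a b} ha hb v => by
        change coHead g (chainDiag n (fun x => a x * b x) v) = a k * b k * _
        rw [← diag_mul, mul_apply, ha, hb, mul_assoc]
      add_mem' := fun {a b} ha hb v => by
        change coHead g (chainDiag n (fun x => a x + b x) v) = (a k + b k) * _
        rw [← diag_add, lin_add, map_add, ha, hb, add_mul]
      algebraMap_mem' := fun c v => by
        change coHead g (chainDiag n (fun x => c) v) = c * _
        have h1 : chainDiag n (fun _ => c) = c • (1 : Module.End ℂ (Chain n)) := by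
          rw [← diag_one, diag_smul]; simp
        rw [h1]; simp }
  have hF : ∀ (a : ℕ) (_ : a < p) (_ : 1 ≤ a) v, coHead g (chainF p n a v) = 0 := by
    intro a ha ha1 v
    obtain ⟨b, rfl⟩ : ∃ b, a = b + 1 := ⟨a - 1, by omega⟩
    have h1 := lin_congr (F_pow hp n (b + 1)) v
    rw [pow_succ', mul_apply, lin_smul] at h1
    have h2 := congrArg (coHead g) h1
    rw [hF1, map_smul, smul_eq_mul] at h2
    exact (mul_eq_zero.1 h2.symm).resolve_left (qFact_ne hp ha)
  have hS : (fun x => qBin p x p) ∈ S := by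
    intro v
    have h := lin_congr (E_F hp n p p (Or.inl le_rfl)) v
    rw [Finset.sum_range_succ, lin_add, lin_sum] at h
    simp only [mul_apply, sub_self, (F_zero _).1, (E_zero _).1, one_apply,
      add_sub_cancel_right] at h
    have h1 := congrArg (coHead g) h
    rw [map_add, map_sum, Finset.sum_eq_zero, zero_add] at h1
    · rw [← h1]
      have h3 := hgen .h v
      rw [evw, ev_h, wv_h, map_smul] at h3
      have h4 : chainGen p n .h v = (2 : ℂ)⁻¹ • (chainDiag n (fun x => (-1) ^ x)
          (chainE p n p ((-1 : ℂ) ^ p • chainF p n p v)) - (-1 : ℂ) ^ p • chainF p n p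
            (chainDiag n (fun x => (-1) ^ x) (chainE p n p v))) := by
        rw [chainGen, kappa_eq hp]; rfl
      have h5 : ∀ v, coHead g (chainDiag n (fun x => (-1) ^ x) v) = (-1) ^ k * coHead g v := by
        intro v
        have : ∀ (j : ℕ) v, coHead g (((chainDiag n fun x => q p ^ x) ^ j) v) =
            (q p ^ (k : ℤ)) ^ j * coHead g v := by
          intro j
          induction j with
          | zero => simp
          | succ j ih =>
            intro v
            rw [pow_succ', mul_apply, hK, ih]; ring
        rw [← kappa_eq hp, this]
        have h2 := q_shift hp (k : ℤ) 0
        rw [zpow_zero, mul_one, zero_add, zpow_mul, zpow_natCast] at h2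
        rw [h2, zpow_natCast]
      rw [h4, map_smul, map_sub, h5, map_smul, map_smul, map_smul, hFp, smul_zero, sub_zero] at h3
      change _ = _ • coHead g v at h3
      simp only [smul_eq_mul, Int.sub_zero, Int.zero_ediv] at h3
      change _ = qBin p k p * _
      rw [qBin_p, zpow_add₀ (by norm_num)]
      have h6 : ((-1 : ℂ) ^ p) * (-1) ^ p = 1 := by rw [← mul_pow]; simp
      have h7 : ((-1 : ℂ) ^ k) * (-1) ^ k = 1 := by rw [← mul_pow]; simp
      simp only [zpow_natCast]
      linear_combination 2 * (-1) ^ k * (-1) ^ p * h3 -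
        coHead g (chainE p n p (chainF p n p v)) * ((-1) ^ p * (-1) ^ p * h7 + h6)
    · intro t ht
      rw [Finset.mem_range] at ht
      have h3 : (p : ℤ) - t = (p - t : ℕ) := by omega
      by_cases ht0 : t = 0
      · subst ht0; rw [Nat.cast_zero, sub_zero]; exact hFp _
      · rw [h3]; exact hF _ (by omega) (by omega) _
  refine ⟨fun φ v => ?_, hF1, hFp⟩
  obtain ⟨c, hc, h⟩ := diag_dense hp S hK hS (insert (k : ℤ) (Finset.Icc (-(n : ℤ)) n)) φ
  rw [← diag_congr n (φ := c) (ψ := φ) fun x hx => h x (Finset.mem_insert_of_mem hx),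
    ← h k (Finset.mem_insert_self _ _)]
  exact hc v

lemma coHead_xiHom {l : Chain n →ₗ[ℂ] ℂ} (hl : IsCoHW p k l) : coHead (xiHom (hp := hp) hl) = l := by
  ext v
  rw [coHead_apply, ev_xiHom, (E_zero n).1]; rfl

lemma coHead_injective : Injective (coHead : (HC hp n →ₗ[U p] CW hp k) → _) := by
  intro g g' h
  let A : Submodule (U p) (DW hp k) :=
    { carrier := {w | ∀ v, evw (g v) w = evw (g' v) w}
      add_mem' := fun {a b} ha hb v => by
        rw [evw, map_add, evw, map_add]; exact congrArg₂ (· + ·) (ha v) (hb v)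
      zero_mem' := fun v => by rw [evw, map_zero, evw, map_zero]
      smul_mem' := fun u w hw v => by
        have := hw ((uAnti hp u).unop • v)
        rwa [map_smul, map_smul, evw, evw, ev_smul, ev_smul, uAnti_uAnti] at this }
  have hA : A = ⊤ := weyl_span fun v => lin_congr h (RepSpace.out _ v)
  refine ext fun v => cd_ext fun i _ => ?_
  have : wv hp k i ∈ A := by rw [hA]; trivial
  exact this v

/-- The homomorphisms to a contragredient Weyl module are given by lowest-weight functionals. -/
def xiEquiv (hp : 2 ≤ p) (n k : ℕ) : (HC hp n →ₗ[U p] CW hp k) ≃+ coHW p n k where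
  toFun g := ⟨coHead g, isCoHW_coHead g⟩
  invFun l := xiHom l.2
  left_inv g := coHead_injective (coHead_xiHom _)
  right_inv l := Subtype.ext (coHead_xiHom _)
  map_add' g g' := Subtype.ext (ext fun v => by
    let v' := (RepSpace.out (chainRep hp n)).symm v
    exact lin_congr (map_add (ev hp (weylRep hp k)) (g v') (g' v')) (wv hp k 0))

end cohw

/-! ### Functionals on the spin chain given by coefficients -/

section fo

variable {p : ℕ}

/-- The functional on the spin chain with prescribed values on the words in `+` and `-`; the
outermost factor of the chain has the largest number. -/
def fo : (n : ℕ) → ((ℕ → Bool) → ℂ) → Chain n →ₗ[ℂ] ℂ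
  | 0, c => (c fun _ => true) • (LinearMap.id : ℂ →ₗ[ℂ] ℂ)
  | n + 1, c => fo n (fun ε => c (update ε n true)) ∘ₗ pl +
      fo n (fun ε => c (update ε n false)) ∘ₗ mi

lemma fo_succ (n : ℕ) (c : (ℕ → Bool) → ℂ) (v : Chain (n + 1)) : fo (n + 1) c v =
    fo n (fun ε => c (update ε n true)) (pl v) +
      fo n (fun ε => c (update ε n false)) (mi v) := rfl

lemma fo_smul (n : ℕ) (z : ℂ) (c : (ℕ → Bool) → ℂ) : fo n (fun ε => z * c ε) = z • fo n c := by
  induction n generalizing c with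
  | zero => rw [fo, fo, mul_smul]; rfl
  | succ n ih => rw [fo, fo, ih, ih, smul_add]; rfl

lemma fo_sub (n : ℕ) (c d : (ℕ → Bool) → ℂ) : fo n (fun ε => c ε - d ε) = fo n c - fo n d := by
  induction n generalizing c d with
  | zero => rw [fo, fo, fo, sub_smul]; rfl
  | succ n ih =>
    refine ext fun v => ?_
    rw [lin_sub, fo_succ, fo_succ, fo_succ, ih, ih]
    simp only [lin_sub]
    ring

lemma fo_zero (n : ℕ) : fo n (fun _ => 0) = 0 := by
  have := fo_smul n 0 (fun _ => 0)
  simpa using this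

/-- The word with prescribed letters at the sites `a` and `a + 1`. -/
def st (ε : ℕ → Bool) (a : ℕ) (b b' : Bool) : ℕ → Bool :=
  fun z => if z = a then b else if z = a + 1 then b' else ε z

lemma update_st (ε : ℕ → Bool) (a : ℕ) (b b' : Bool) :
    update (update ε a b) (a + 1) b' = st ε a b b' := by
  funext z
  simp only [Function.update_apply, st]
  split_ifs with h1 h2 <;> first | rfl | omega

/-- The coefficients of the composition of a functional with a generator of the Temperley–Lieb
algebra that acts on the sites `a` and `a + 1`. -/
def tw (p a : ℕ) (c : (ℕ → Bool) → ℂ) (ε : ℕ → Bool) : ℂ :=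
  if ε a = ε (a + 1) then 0 else
    (if ε a then -q p else 1) * ((q p)⁻¹ * c (st ε a false true) - c (st ε a true false))

lemma fo_xxz (n i a : ℕ) (h : a + i + 2 = n) (c : (ℕ → Bool) → ℂ) (v : Chain n) :
    fo n c (xxz p n i v) = fo n (tw p a c) v := by
  have hq := q_ne p
  induction i generalizing n c with
  | zero =>
    obtain rfl : n = a + 2 := by omega
    have h1 : ∀ b b', (fun ε => tw p a c (st ε a b b')) =
        fun ε => if b = b' then 0 else
          (if b then -q p else 1) * ((q p)⁻¹ * c (st ε a false true) - c (st ε a true false)) := by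
      intro b b'
      funext ε
      have h2 : ∀ b1 b2, st (st ε a b b') a b1 b2 = st ε a b1 b2 := by
        intro b1 b2
        funext z
        simp only [st]
        split_ifs <;> rfl
      rw [tw, h2, h2]
      simp [st]
    simp only [fo_succ, pl_xxz_zero, mi_xxz_zero, pl_mk, mi_mk, map_zero, h1, update_st]
    simp only [Bool.true_eq_false, Bool.false_eq_true, if_true, if_false, fo_zero, one_mul, fo_smul, fo_sub,
      lin_zero, lin_sub, lin_smul, smul_eq_mul, cap_apply,
      map_sub, map_smul]
    field_simp
    ring
  | succ i ih =>
    obtain ⟨m, rfl⟩ : ∃ m, n = m + 2 := ⟨n - 2, by omega⟩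
    have h1 : ∀ b, (fun ε => tw p a c (update ε (m + 1) b)) =
        tw p a fun ε => c (update ε (m + 1) b) := by
      intro b
      funext ε
      have h2 : ∀ b1 b2, st (update ε (m + 1) b) a b1 b2 =
          update (st ε a b1 b2) (m + 1) b := by
        intro b1 b2
        funext z
        simp only [Function.update_apply, st]
        split_ifs <;> first | rfl | omega
      rw [tw, tw, h2, h2, Function.update_of_ne (by omega), Function.update_of_ne (by omega)]
    rw [fo_succ (m + 1), fo_succ (m + 1), pl_xxz, mi_xxz, ih (m + 1) (by omega), ih (m + 1) (by omega), h1, h1]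

end fo

/-! ### The functionals of the link states -/

section link

variable {p n k : ℕ}

/-- The weight of a site of a link state: through-lines have the letter `+`, and the two ends of an
arc have different letters. -/
def wt (p : ℕ) (l : LinkState n k) (ε : ℕ → Bool) (x : Fin n) : ℂ :=
  if l.m x = x then (if ε x then 1 else 0)
  else if x < l.m x then (if ε x = ε (l.m x) then 0 else if ε x then q p else 1)
  else 1

/-- The sign of a word. -/
def gauge (n : ℕ) (ε : ℕ → Bool) : ℂ := ∏ x ∈ Finset.range n, if Odd x ∧ ε x = false then -1 else 1

/-- The functional of a link state. -/
def lam (p : ℕ) (l : LinkState n k) : Chain n →ₗ[ℂ] ℂ :=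
  fo n fun ε => gauge n ε * ∏ x, wt p l ε x

lemma gauge_st (ε : ℕ → Bool) {a : ℕ} (h : a + 1 < n) :
    gauge n (st ε a true false) = - gauge n (st ε a false true) := by
  have ha : a ∈ Finset.range n := Finset.mem_range.2 (by omega)
  have hb : a + 1 ∈ (Finset.range n).erase a := by
    rw [Finset.mem_erase, Finset.mem_range]; omega
  have h2 : ∀ b b', gauge n (st ε a b b') = (if Odd a ∧ b = false then -1 else 1) *
      ((if Odd (a + 1) ∧ b' = false then -1 else 1) * ∏ x ∈ ((Finset.range n).erase a).erase (a + 1),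
        if Odd x ∧ ε x = false then -1 else 1) := by
    intro b b'
    rw [gauge, ← Finset.mul_prod_erase _ _ ha, ← Finset.mul_prod_erase _ _ hb]
    congr 1
    · simp [st]
    congr 1
    · simp [st]
    refine Finset.prod_congr rfl fun x hx => ?_
    simp only [Finset.mem_erase] at hx
    rw [st, if_neg hx.2.1, if_neg hx.1]
  rw [h2, h2]
  by_cases h : Odd a <;> simp [h, Nat.odd_add_one]

lemma wt_arc (l : LinkState n k) (a b : Fin n) (hab : (b : ℕ) = a + 1) (h : l.m a = b)
    (ε : ℕ → Bool) : ∃ R : ℂ, ∀ b1 b2, ∏ x, wt p l (st ε a b1 b2) x =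
      (if b1 = b2 then 0 else if b1 then q p else 1) * R := by
  have hba : l.m b = a := by rw [← h, l.invol]
  have hne : a ≠ b := by rintro rfl; omega
  have hlt : a < b := by rw [Fin.lt_def]; omega
  refine ⟨∏ x ∈ (Finset.univ.erase a).erase b, wt p l ε x, fun b1 b2 => ?_⟩
  rw [← Finset.mul_prod_erase _ _ (Finset.mem_univ a),
    ← Finset.mul_prod_erase _ _ (Finset.mem_erase.2 ⟨hne.symm, Finset.mem_univ b⟩)]
  have e1 : wt p l (st ε a b1 b2) a = if b1 = b2 then 0 else if b1 then q p else 1 := by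
    rw [wt, h, if_neg hne.symm, if_pos hlt]
    simp [st, hab]
  have e2 : wt p l (st ε a b1 b2) b = 1 := by
    rw [wt, hba, if_neg hne, if_neg hlt.not_gt]
  rw [e1, e2, one_mul]
  congr 1
  refine Finset.prod_congr rfl fun x hx => ?_
  simp only [Finset.mem_erase] at hx
  have hx1 : (x : ℕ) ≠ a := fun h => hx.2.1 (Fin.ext h)
  have hx2 : (x : ℕ) ≠ a + 1 := fun h => hx.1 (Fin.ext (by omega))
  have hx3 : (l.m x : ℕ) ≠ a := fun h => hx.1 (by rw [← l.invol x, Fin.ext h, ‹l.m a = b›])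
  have hx4 : (l.m x : ℕ) ≠ a + 1 := fun h => hx.2.1 (by
    rw [← l.invol x, Fin.ext (h.trans hab.symm), hba])
  simp only [wt, st, if_neg hx1, if_neg hx2, if_neg hx3, if_neg hx4]

set_option maxHeartbeats 2000000 in
lemma wt_join (l : LinkState n k) (i : Fin (n - 1)) (ε : ℕ → Bool) :
    (q p)⁻¹ * ∏ x, wt p l (st ε i false true) x + ∏ x, wt p l (st ε i true false) x =
      l.weight p i * ∏ x, wt p (l.join i) (st ε i false true) x := by
  have hq := q_ne p
  have hi : (siteL i : ℕ) = i := rfl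
  have hr : (siteR i : ℕ) = i + 1 := rfl
  have hne := site_ne i
  by_cases h0 : l.m (siteL i) = siteL i ∧ l.m (siteR i) = siteR i
  · rw [LinkState.weight, if_pos h0, zero_mul, Finset.prod_eq_zero (Finset.mem_univ (siteL i)),
      Finset.prod_eq_zero (Finset.mem_univ (siteR i))]
    · simp
    · rw [wt, if_pos h0.2]; simp [st, hr]
    · rw [wt, if_pos h0.1]; simp [st, hi]
  by_cases h1 : l.m (siteL i) = siteR i
  · obtain ⟨R, hR⟩ := wt_arc (p := p) l (siteL i) (siteR i) hr h1 ε
    rw [hi] at hR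
    rw [join_of_arc i l h1, weight_of_arc p i l h1, hR, hR]
    simp
    ring
  have hw : l.weight p i = 1 := by rw [LinkState.weight, if_neg h0, if_neg h1]
  set a := siteL i with ha
  set b := siteR i with hb
  have hlt : a < b := by rw [Fin.lt_def]; omega
  have inva := l.invol a
  have invb := l.invol b
  have hm : ∀ x, (l.join i).m x = joinFun a b l.m x := fun x => by rw [join_m, if_neg h0]
  let T : Finset (Fin n) := {a, b, l.m a, l.m b}
  have hrest : ∀ b1 b2, ∏ x ∈ Tᶜ, wt p l (st ε i b1 b2) x = ∏ x ∈ Tᶜ, wt p l ε x := by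
    intro b1 b2
    refine Finset.prod_congr rfl fun x hx => ?_
    simp only [T, Finset.mem_compl, Finset.mem_insert, Finset.mem_singleton, not_or] at hx
    have hx1 : (x : ℕ) ≠ i := fun h => hx.1 (Fin.ext h)
    have hx2 : (x : ℕ) ≠ i + 1 := fun h => hx.2.1 (Fin.ext h)
    have hx3 : (l.m x : ℕ) ≠ i := fun h => hx.2.2.1 (by
      rw [← l.invol x]; congr 1; exact Fin.ext h)
    have hx4 : (l.m x : ℕ) ≠ i + 1 := fun h => hx.2.2.2 (by
      rw [← l.invol x]; congr 1; exact Fin.ext h)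
    simp only [wt, st, if_neg hx1, if_neg hx2, if_neg hx3, if_neg hx4]
  have hrest' : ∏ x ∈ Tᶜ, wt p (l.join i) (st ε i false true) x = ∏ x ∈ Tᶜ, wt p l ε x := by
    rw [← hrest false true]
    refine Finset.prod_congr rfl fun x hx => ?_
    simp only [T, Finset.mem_compl, Finset.mem_insert, Finset.mem_singleton, not_or] at hx
    have : (l.join i).m x = l.m x := by
      have := l.invol x
      rw [hm, joinFun, if_neg hx.1, if_neg hx.2.1, if_neg, if_neg]
      · intro h; rw [h] at this; exact hx.2.2.2 this.symm
      · intro h; rw [h] at this; exact hx.2.2.1 this.symm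
    rw [wt, wt, this]
  rw [hw, one_mul, ← Finset.prod_mul_prod_compl T, ← Finset.prod_mul_prod_compl T,
    ← Finset.prod_mul_prod_compl T (wt p (l.join i) _), hrest, hrest, hrest', ← mul_assoc, ← add_mul]
  congr 1
  have hc : ∀ z : Fin n, z ≤ a ∨ b ≤ z := fun z => by rw [Fin.le_def, Fin.le_def]; omega
  have sa : ∀ b1 b2, st ε i b1 b2 a = b1 := fun b1 b2 => by simp [st, hi]
  have sb : ∀ b1 b2, st ε i b1 b2 b = b2 := fun b1 b2 => by simp [st, hr]
  have so : ∀ b1 b2 (z : Fin n), z ≠ a → z ≠ b → st ε i b1 b2 z = ε z := fun b1 b2 z h1 h2 => by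
    rw [st, if_neg (fun h : (z : ℕ) = i => h1 (Fin.ext h)),
      if_neg (fun h : (z : ℕ) = i + 1 => h2 (Fin.ext h))]
  have ma : (l.join i).m a = b := by rw [hm, joinFun, if_pos rfl]
  have mb : (l.join i).m b = a := by rw [hm, joinFun, if_neg hne.symm, if_pos rfl]
  have wa : ∀ ε', wt p (l.join i) ε' a = if ε' a = ε' b then 0 else if ε' a then q p else 1 := by
    intro ε'; rw [wt, ma, if_neg hne.symm, if_pos hlt]
  have wb : ∀ ε', wt p (l.join i) ε' b = 1 := by
    intro ε'; rw [wt, mb, if_neg hne, if_neg hlt.not_gt]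
  by_cases hfa : l.m a = a
  · have hfb : l.m b ≠ b := fun h => h0 ⟨hfa, h⟩
    have hy : b < l.m b := by
      rcases lt_or_gt_of_ne hfb with h | h
      · have h2 : l.m b < a := lt_of_le_of_ne ((hc _).resolve_right h.not_ge) fun h3 => by
          rw [← invb, h3, hfa] at hne; exact hne rfl
        exact absurd hfa (l.noncross _ a h2 (by rw [invb]; exact hlt)).1
      · exact h
    have hya : l.m b ≠ a := (hlt.trans hy).ne'
    have hT : T = {a, b, l.m b} := by
      ext z; simp only [T, hfa, Finset.mem_insert, Finset.mem_singleton]; tauto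
    have my : (l.join i).m (l.m b) = l.m b := by
      rw [hm, joinFun, if_neg hya, if_neg hfb, invb, if_neg hne.symm, if_pos rfl, if_pos hfa]
    rw [hT]
    simp only [Finset.prod_insert (show a ∉ ({b, l.m b} : Finset (Fin n)) by simp [hne, hya.symm]),
      Finset.prod_insert (show b ∉ ({l.m b} : Finset (Fin n)) by simp [hfb.symm]),
      Finset.prod_singleton]
    rw [wa, wb]
    simp only [wt, hfa, if_true, if_neg hfb, if_pos hy, invb, if_neg hfb.symm, if_neg hy.not_gt, my,
      sa, sb, so _ _ _ hya hfb]
    cases ε (l.m b) <;> simp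
  · by_cases hfb : l.m b = b
    · have hy : l.m a < a := by
        rcases lt_or_gt_of_ne hfa with h | h
        · exact h
        · have h2 : b < l.m a := lt_of_le_of_ne ((hc _).resolve_left h.not_ge) (Ne.symm h1)
          exact absurd hfb (l.noncross a b hlt h2).1
      have hyb : l.m a ≠ b := (hy.trans hlt).ne
      have hT : T = {a, b, l.m a} := by
        ext z; simp only [T, hfb, Finset.mem_insert, Finset.mem_singleton]; tauto
      have my : (l.join i).m (l.m a) = l.m a := by
        rw [hm, joinFun, if_neg hfa, if_neg hyb, inva, if_pos rfl, if_pos hfb]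
      rw [hT]
      simp only [Finset.prod_insert (show a ∉ ({b, l.m a} : Finset (Fin n)) by simp [hne, Ne.symm hfa]),
        Finset.prod_insert (show b ∉ ({l.m a} : Finset (Fin n)) by simp [hyb.symm]),
        Finset.prod_singleton]
      rw [wa, wb]
      simp only [wt, hfb, if_true, if_neg hfa, if_neg hy.not_gt, inva, if_neg (Ne.symm hfa), if_pos hy, my,
        sa, sb, so _ _ _ hfa hyb]
      cases ε (l.m a) <;> simp [hq]
    · have hxb : l.m a ≠ b := h1
      have hya : l.m b ≠ a := fun h => h1 (by rw [← h, invb])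
      have hxy : l.m a ≠ l.m b := fun h => hne (by rw [← inva, h, invb])
      have mx : (l.join i).m (l.m a) = l.m b := by
        rw [hm, joinFun, if_neg hfa, if_neg hxb, inva, if_pos rfl, if_neg hfb]
      have my : (l.join i).m (l.m b) = l.m a := by
        rw [hm, joinFun, if_neg hya, if_neg hfb, invb, if_neg hne.symm, if_pos rfl, if_neg hfa]
      have wx : ∀ ε', wt p (l.join i) ε' (l.m a) = if l.m a < l.m b then
          (if ε' (l.m a) = ε' (l.m b) then 0 else if ε' (l.m a) then q p else 1) else 1 := by
        intro ε'; rw [wt, mx, if_neg hxy.symm]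
      have wy : ∀ ε', wt p (l.join i) ε' (l.m b) = if l.m b < l.m a then
          (if ε' (l.m b) = ε' (l.m a) then 0 else if ε' (l.m b) then q p else 1) else 1 := by
        intro ε'; rw [wt, my, if_neg hxy]
      simp only [T, Finset.prod_insert (show a ∉ ({b, l.m a, l.m b} : Finset (Fin n)) by
          simp [hne, Ne.symm hfa, hya.symm]),
        Finset.prod_insert (show b ∉ ({l.m a, l.m b} : Finset (Fin n)) by
          simp [hxb.symm, Ne.symm hfb]),
        Finset.prod_insert (show l.m a ∉ ({l.m b} : Finset (Fin n)) by simp [hxy]),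
        Finset.prod_singleton]
      rw [wa, wb, wx, wy]
      simp only [wt, inva, invb, if_neg hfa, if_neg hfb, if_neg (Ne.symm hfa), if_neg (Ne.symm hfb),
        sa, sb, so _ _ _ hfa hxb, so _ _ _ hya hfb]
      have n1 := l.noncross a b hlt
      have n2 := l.noncross (l.m b) a
      rw [invb] at n2
      have c1 := hc (l.m a)
      have c2 := hc (l.m b)
      rcases lt_or_gt_of_ne hfa with ha1 | ha1
      · rcases lt_or_gt_of_ne hfb with hb1 | hb1
        · have h3 : l.m b < l.m a :=
            (n2 (lt_of_le_of_ne (c2.resolve_right hb1.not_ge) hya) hlt).2.1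
          rw [if_neg ha1.not_gt, if_neg hb1.not_gt, if_pos ha1, if_pos hb1, if_neg h3.not_gt, if_pos h3]
          cases ε (l.m a) <;> cases ε (l.m b) <;> simp [ha1.not_gt, hb1.not_gt, ha1, hb1, hq]
        · have h3 : l.m a < l.m b := ha1.trans (hlt.trans hb1)
          rw [if_neg ha1.not_gt, if_pos hb1, if_pos ha1, if_neg hb1.not_gt, if_pos h3, if_neg h3.not_gt]
          cases ε (l.m a) <;> cases ε (l.m b) <;> simp [ha1.not_gt, hb1.not_gt, ha1, hb1, hq]
      · have h4 : b < l.m a := lt_of_le_of_ne (c1.resolve_left ha1.not_ge) hxb.symm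
        obtain ⟨-, h5, h6⟩ := n1 h4
        have hb1 : b < l.m b := lt_of_le_of_ne (c2.resolve_left h5.not_ge) (Ne.symm hfb)
        rw [if_pos ha1, if_pos hb1, if_neg ha1.not_gt, if_neg hb1.not_gt, if_neg h6.not_gt, if_pos h6]
        cases ε (l.m a) <;> cases ε (l.m b) <;> simp [ha1.not_gt, hb1.not_gt, ha1, hb1, hq]

lemma lam_xxz (l : LinkState n k) (i : Fin (n - 1)) (v : Chain n) :
    lam p l (xxz p n (i.rev : Fin (n - 1)) v) = l.weight p i * lam p (l.join i) v := by
  have hi := i.2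
  have hir : (i.rev : ℕ) = n - 1 - (i + 1) := Fin.val_rev i
  rw [lam, fo_xxz n _ i (by omega), lam, ← smul_eq_mul, ← lin_smul, ← fo_smul]
  congr 2
  funext ε
  have hg := gauge_st (n := n) ε (a := i) (by omega)
  have hj := wt_join (p := p) l i ε
  have key : l.weight p i = 0 ∨ ∃ R : ℂ, ∀ b1 b2, ∏ x, wt p (l.join i) (st ε i b1 b2) x =
      (if b1 = b2 then 0 else if b1 then q p else 1) * R := by
    by_cases h0 : l.weight p i = 0
    · exact Or.inl h0
    · exact Or.inr (wt_arc (l.join i) (siteL i) (siteR i) rfl (arc_of_weight p i l h0) ε)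
  have hst : st ε i (ε i) (ε (i + 1)) = ε := by
    funext z
    simp only [st]
    split_ifs with h1 h2
    · rw [h1]
    · rw [h2]
    · rfl
  have hD : (q p)⁻¹ * (gauge n (st ε i false true) * ∏ x, wt p l (st ε i false true) x) -
      gauge n (st ε i true false) * ∏ x, wt p l (st ε i true false) x =
      gauge n (st ε i false true) * (l.weight p i * ∏ x, wt p (l.join i) (st ε i false true) x) := by
    rw [hg, ← hj]; ring
  rw [tw, hD]
  rcases key with h0 | ⟨R, hR⟩
  · rw [h0]; simp
  · rw [hR]
    have h2 : ∏ x, wt p (l.join i) ε x =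
        (if ε i = ε (i + 1) then 0 else if ε i then q p else 1) * R := by
      rw [← hR, hst]
    rw [h2]
    have h3 : gauge n ε = gauge n (st ε i (ε i) (ε (i + 1))) := by rw [hst]
    rw [h3]
    cases ε i <;> cases ε (i + 1) <;> simp [hg] <;> ring

end link

/-! ### Removing and adding the last site of a link state -/

section last

variable {p n k k' : ℕ}

instance : Finite (LinkState n k) :=
  Finite.of_injective (fun l => l.m) fun _ _ h => LinkState.ext h

/-- Remove the last site of a link state; its partner becomes a through-line. -/
def resFun (l : LinkState (n + 1) k) (x : Fin n) : Fin n :=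
  if h : l.m x.castSucc = Fin.last n then x else (l.m x.castSucc).castPred h

lemma castSucc_resFun (l : LinkState (n + 1) k) (x : Fin n) : (resFun l x).castSucc =
    if l.m x.castSucc = Fin.last n then x.castSucc else l.m x.castSucc := by
  rw [resFun]; split_ifs <;> simp

lemma resFun_card (l : LinkState (n + 1) k) : (Finset.univ.filter fun x => resFun l x = x).card =
    if l.m (Fin.last n) = Fin.last n then k - 1 else k + 1 := by
  have h1 := l.card_fixed
  rw [Fin.univ_castSuccEmb, Finset.filter_cons] at h1
  have h2 : ∀ x, resFun l x = x ↔ l.m x.castSucc = x.castSucc ∨ l.m x.castSucc = Fin.last n := by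
    intro x
    rw [← Fin.castSucc_inj, castSucc_resFun]
    split_ifs with h <;> simp [h]
  simp only [h2]
  split_ifs at h1 ⊢ with h
  · rw [Finset.card_cons, Finset.filter_map, Finset.card_map] at h1
    refine Nat.eq_sub_of_add_eq (Eq.trans ?_ h1)
    congr 2
    refine Finset.filter_congr fun x _ => ?_
    simp only [Function.comp, Fin.coe_castSuccEmb]
    rw [or_iff_left]
    intro h3
    have := l.invol x.castSucc
    rw [h3, h] at this
    exact (Fin.castSucc_lt_last x).ne' this
  · rw [Finset.filter_map, Finset.card_map] at h1
    obtain ⟨y, hy⟩ := Fin.eq_castSucc_of_ne_last h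
    rw [Finset.filter_or, Finset.card_union_of_disjoint]
    · congr 1
      rw [Finset.card_eq_one]
      refine ⟨y, ?_⟩
      ext x
      simp only [Finset.mem_filter, Finset.mem_univ, true_and, Finset.mem_singleton]
      constructor
      · intro h3; exact Fin.castSucc_injective _ (by rw [hy, ← h3, l.invol])
      · rintro rfl; rw [hy, l.invol]
    · rw [Finset.disjoint_filter]
      intro x _ h3 h4
      exact (Fin.castSucc_lt_last x).ne (h3.symm.trans h4)

/-- The link state obtained by removing the last site. -/
def res (l : LinkState (n + 1) k)
    (hk : k' = if l.m (Fin.last n) = Fin.last n then k - 1 else k + 1) : LinkState n k' where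
  m := resFun l
  invol x := by
    have h0 := castSucc_resFun l x
    rw [← Fin.castSucc_inj, castSucc_resFun, h0]
    by_cases h1 : l.m x.castSucc = Fin.last n
    · rw [if_pos h1, if_pos h1]
    · rw [if_neg h1, l.invol, if_neg (Fin.castSucc_lt_last x).ne]
  noncross x y hxy hy := by
    have h1 := castSucc_resFun l x
    have h2 := castSucc_resFun l y
    have h3 := l.noncross x.castSucc y.castSucc (by simpa using hxy)
    have h4 := Fin.castSucc_lt_last y
    have h5 := l.noncross x.castSucc
    have h6 := l.invol y.castSucc
    rw [← Fin.castSucc_lt_castSucc_iff, h1] at hy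
    suffices (resFun l y).castSucc ≠ y.castSucc ∧ x.castSucc < (resFun l y).castSucc ∧
        (resFun l y).castSucc < (resFun l x).castSucc by simpa using this
    rw [h1, h2]
    have h7 : x.castSucc < y.castSucc := by simpa using hxy
    by_cases h8 : l.m x.castSucc = Fin.last n
    · rw [if_pos h8] at hy
      exact absurd hy h7.not_gt
    · rw [if_neg h8] at hy ⊢
      have h9 := h3 hy
      have h10 : l.m y.castSucc ≠ Fin.last n := fun h => by
        rw [h] at h9
        exact h9.2.2.not_ge (Fin.le_last _)
      rw [if_neg h10]
      exact h9
  card_fixed := (resFun_card l).trans hk.symm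

lemma castSucc_res (l : LinkState (n + 1) k)
    (hk : k' = if l.m (Fin.last n) = Fin.last n then k - 1 else k + 1) (x : Fin n) :
    ((res l hk).m x).castSucc =
      if l.m x.castSucc = Fin.last n then x.castSucc else l.m x.castSucc :=
  castSucc_resFun l x

lemma link_pos (l : LinkState (n + 1) k) (h : l.m (Fin.last n) = Fin.last n) : 1 ≤ k := by
  rw [← l.card_fixed]
  exact Finset.card_pos.2 ⟨Fin.last n, by simp [h]⟩

lemma gauge_update (ε : ℕ → Bool) (b : Bool) : gauge (n + 1) (update ε n b) =
    gauge n ε * if Odd n ∧ b = false then -1 else 1 := by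
  rw [gauge, Finset.prod_range_succ, gauge]
  congr 1
  · refine Finset.prod_congr rfl fun x hx => ?_
    rw [Finset.mem_range] at hx
    rw [Function.update_of_ne (by omega)]
  · simp

lemma update_castSucc (ε : ℕ → Bool) (b : Bool) (x : Fin n) :
    update ε n b (x.castSucc : ℕ) = ε x := by
  rw [Function.update_of_ne (by simp; omega)]; rfl

lemma lam_through (l : LinkState (n + 1) k)
    (hk : k' = if l.m (Fin.last n) = Fin.last n then k - 1 else k + 1)
    (h : l.m (Fin.last n) = Fin.last n) : lam p l = lam p (res l hk) ∘ₗ pl := by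
  refine ext fun v => ?_
  have h1 : ∀ ε b, gauge (n + 1) (update ε n b) *
      ∏ x, wt p l (update ε n b) x = if b then
        gauge n ε * ∏ x, wt p (res l hk) ε x else 0 := by
    intro ε b
    rw [gauge_update, Fin.prod_univ_castSucc]
    have e1 : wt p l (update ε n b) (Fin.last n) = if b then 1 else 0 := by
      rw [wt, if_pos h]; simp
    have e2 : ∀ x : Fin n, wt p l (update ε n b) x.castSucc = wt p (res l hk) ε x := by
      intro x
      have h3 : l.m x.castSucc ≠ Fin.last n := by
        intro h3
        have := l.invol x.castSucc
        rw [h3, h] at this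
        exact (Fin.castSucc_lt_last x).ne' this
      have h4 := castSucc_res l hk x
      rw [if_neg h3] at h4
      simp only [wt, ← h4, update_castSucc, Fin.castSucc_inj, Fin.castSucc_lt_castSucc_iff]
    rw [e1, Finset.prod_congr rfl fun x _ => e2 x]
    cases b <;> simp
  rw [lam, fo_succ]
  simp only [h1, if_true, Bool.false_eq_true, if_false, fo_zero]
  simp [lam]

lemma lam_arc (l : LinkState (n + 1) k)
    (hk : k' = if l.m (Fin.last n) = Fin.last n then k - 1 else k + 1)
    (h : l.m (Fin.last n) ≠ Fin.last n) (d : Chain n) :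
    lam p l (mk 0 d) = ((if Odd n then -1 else 1) * q p) * lam p (res l hk) d := by
  obtain ⟨y, hy⟩ := Fin.eq_castSucc_of_ne_last h
  have hy' : l.m y.castSucc = Fin.last n := by rw [hy, l.invol]
  have h1 : ∀ ε, gauge (n + 1) (update ε n false) *
      ∏ x, wt p l (update ε n false) x = ((if Odd n then -1 else 1) * q p) *
        (gauge n ε * ∏ x, wt p (res l hk) ε x) := by
    intro ε
    rw [gauge_update, Fin.prod_univ_castSucc]
    have e1 : wt p l (update ε n false) (Fin.last n) = 1 := by
      rw [wt, if_neg h, if_neg (Fin.le_last _).not_gt]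
    have e2 : ∀ x : Fin n, wt p l (update ε n false) x.castSucc =
        wt p (res l hk) ε x * if x = y then q p else 1 := by
      intro x
      have h4 := castSucc_res l hk x
      by_cases hx : x = y
      · subst hx
        rw [if_pos hy', Fin.castSucc_inj] at h4
        rw [wt, hy', if_neg (Fin.castSucc_lt_last x).ne', if_pos (Fin.castSucc_lt_last x),
          update_castSucc, wt, if_pos h4, if_pos rfl]
        cases h5 : ε x <;> simp
      · have h3 : l.m x.castSucc ≠ Fin.last n := by
          intro h3
          apply hx
          have := l.invol x.castSucc
          rw [h3, ← hy, Fin.castSucc_inj] at this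
          exact this.symm
        rw [if_neg h3] at h4
        rw [if_neg hx, mul_one]
        simp only [wt, ← h4, update_castSucc, Fin.castSucc_inj, Fin.castSucc_lt_castSucc_iff]
    rw [e1, Finset.prod_congr rfl fun x _ => e2 x, Finset.prod_mul_distrib, Finset.prod_ite_eq']
    simp only [Finset.mem_univ, if_true, and_true]
    ring
  rw [lam, fo_succ, pl_mk, mi_mk, map_zero, zero_add]
  simp only [h1, fo_smul]
  rfl

lemma res_injective {l l' : LinkState (n + 1) k} (h : l.m (Fin.last n) ≠ Fin.last n)
    (h' : l'.m (Fin.last n) ≠ Fin.last n)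
    (hk : k' = if l.m (Fin.last n) = Fin.last n then k - 1 else k + 1)
    (hk' : k' = if l'.m (Fin.last n) = Fin.last n then k - 1 else k + 1)
    (hr : res l hk = res l' hk') : l = l' := by
  have key : ∀ (l : LinkState (n + 1) k) (h : l.m (Fin.last n) ≠ Fin.last n)
      (hk : k' = if l.m (Fin.last n) = Fin.last n then k - 1 else k + 1),
      ∃ y : Fin n, l.m y.castSucc = Fin.last n ∧ (res l hk).m y = y ∧
        ∀ z, (res l hk).m z = z → z ≤ y := by
    intro l h hk
    obtain ⟨y, hy⟩ := Fin.eq_castSucc_of_ne_last h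
    have hy' : l.m y.castSucc = Fin.last n := by rw [hy, l.invol]
    refine ⟨y, hy', ?_, fun z hz => ?_⟩
    · rw [← Fin.castSucc_inj, castSucc_res, if_pos hy']
    · by_contra hlt
      have h1 := l.noncross y.castSucc z.castSucc (by simpa using hlt)
        (by rw [hy']; exact Fin.castSucc_lt_last z)
      rw [← Fin.castSucc_inj, castSucc_res, if_neg] at hz
      · exact h1.1 hz
      · rw [hy'] at h1; exact h1.2.2.ne
  obtain ⟨y, hy1, hy2, hy3⟩ := key l h hk
  obtain ⟨z, hz1, hz2, hz3⟩ := key l' h' hk'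
  rw [hr] at hy2 hy3
  obtain rfl : y = z := le_antisymm (hz3 _ hy2) (hy3 _ hz2)
  ext x : 2
  induction x using Fin.lastCases with
  | last => rw [← hy1, l.invol, hy1, ← hz1, l'.invol]
  | cast x =>
    by_cases hx : x = y
    · subst hx; rw [hy1, hz1]
    · have h1 := castSucc_res l hk x
      have h2 := castSucc_res l' hk' x
      have inj : ∀ l : LinkState (n + 1) k, l.m y.castSucc = Fin.last n →
          l.m x.castSucc ≠ Fin.last n := by
        intro l h3 h4
        have := l.invol x.castSucc
        rw [h4, ← h3, l.invol, Fin.castSucc_inj] at this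
        exact hx this.symm
      rw [if_neg (inj l hy1), hr] at h1
      rw [if_neg (inj l' hz1), h1] at h2
      exact h2

lemma exists_through (l : LinkState n k) : ∃ l' : LinkState (n + 1) (k + 1),
    ∃ h : l'.m (Fin.last n) = Fin.last n, res l' (by rw [if_pos h, Nat.add_sub_cancel]) = l := by
  let f : Fin (n + 1) → Fin (n + 1) := Fin.lastCases (Fin.last n) fun x => (l.m x).castSucc
  have f1 : f (Fin.last n) = Fin.last n := Fin.lastCases_last
  have f2 : ∀ x, f (Fin.castSucc x) = (l.m x).castSucc := fun x => Fin.lastCases_castSucc x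
  refine ⟨{ m := f, invol := fun x => ?_, noncross := fun x y => ?_, card_fixed := ?_ }, f1, ?_⟩
  · induction x using Fin.lastCases with
    | last => rw [f1, f1]
    | cast x => rw [f2, f2, l.invol]
  · induction x using Fin.lastCases with
    | last => intro h; exact absurd h (Fin.le_last _).not_gt
    | cast x =>
      induction y using Fin.lastCases with
      | last => intro _ h; exact absurd h (Fin.le_last _).not_gt
      | cast y =>
        simp only [f2, Fin.castSucc_lt_castSucc_iff, ne_eq, Fin.castSucc_inj]
        exact l.noncross x y
  · rw [Fin.univ_castSuccEmb, Finset.filter_cons, if_pos f1, Finset.card_cons,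
      Finset.filter_map, Finset.card_map]
    congr 1
    rw [← l.card_fixed]
    congr 1
    refine Finset.filter_congr fun x _ => ?_
    simp only [Function.comp, Fin.coe_castSuccEmb, f2, Fin.castSucc_inj]
  · ext x : 2
    rw [← Fin.castSucc_inj, castSucc_res]
    change (if f x.castSucc = _ then _ else f x.castSucc) = _
    rw [f2, if_neg (Fin.castSucc_lt_last _).ne]

lemma exists_close (l : LinkState n (k + 1)) : ∃ l' : LinkState (n + 1) k,
    ∃ h : l'.m (Fin.last n) ≠ Fin.last n, res l' (by rw [if_neg h]) = l := by
  classical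
  have hne : (Finset.univ.filter fun x => l.m x = x).Nonempty := by
    rw [← Finset.card_pos, l.card_fixed]; omega
  set y := (Finset.univ.filter fun x => l.m x = x).max' hne with hy
  have hy1 : l.m y = y := by
    have := Finset.max'_mem _ hne
    rw [← hy] at this
    simpa using this
  have hy2 : ∀ z, l.m z = z → z ≤ y := fun z hz => Finset.le_max' _ _ (by simpa using hz)
  let f : Fin (n + 1) → Fin (n + 1) :=
    Fin.lastCases y.castSucc fun x => if x = y then Fin.last n else (l.m x).castSucc
  have f1 : f (Fin.last n) = y.castSucc := Fin.lastCases_last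
  have f2 : ∀ x, f (Fin.castSucc x) = if x = y then Fin.last n else (l.m x).castSucc :=
    fun x => Fin.lastCases_castSucc x
  have hny : ∀ x, x ≠ y → l.m x ≠ y := fun x hx h => hx (by rw [← l.invol x, h, hy1])
  have hinv : ∀ x, f (f x) = x := by
    intro x
    induction x using Fin.lastCases with
    | last => rw [f1, f2, if_pos rfl]
    | cast x =>
      rw [f2]
      split_ifs with h
      · rw [f1, h]
      · rw [f2, if_neg (hny x h), l.invol]
  refine ⟨{ m := f, invol := hinv, noncross := fun x z => ?_, card_fixed := ?_ }, ?_, ?_⟩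
  · induction x using Fin.lastCases with
    | last => intro h; exact absurd h (Fin.le_last _).not_gt
    | cast x =>
      induction z using Fin.lastCases with
      | last => intro _ h; exact absurd h (Fin.le_last _).not_gt
      | cast z =>
        intro h1 h2
        rw [Fin.castSucc_lt_castSucc_iff] at h1
        rw [f2] at h2
        split_ifs at h2 with h3
        · subst h3
          have hz : z ≠ y := h1.ne'
          have hz2 : l.m z ≠ z := fun h => absurd (hy2 z h) h1.not_ge
          have hz3 : y < l.m z := by
            by_contra h4
            have h5 : l.m z < y := lt_of_le_of_ne (not_lt.1 h4) (hny z hz)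
            exact (l.noncross (l.m z) y h5 (by rw [l.invol]; exact h1)).1 hy1
          rw [f2, f2, if_neg hz, if_pos rfl, ne_eq, Fin.castSucc_inj, Fin.castSucc_lt_castSucc_iff]
          exact ⟨hz2, hz3, Fin.castSucc_lt_last _⟩
        · rw [Fin.castSucc_lt_castSucc_iff] at h2
          have h4 := l.noncross x z h1 h2
          have hz : z ≠ y := fun h => h4.1 (by rw [h, hy1])
          rw [f2, f2, if_neg hz, if_neg h3, ne_eq, Fin.castSucc_inj, Fin.castSucc_lt_castSucc_iff,
            Fin.castSucc_lt_castSucc_iff]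
          exact h4
  · rw [Fin.univ_castSuccEmb, Finset.filter_cons, if_neg (by rw [f1]; exact (Fin.castSucc_lt_last y).ne),
      Finset.filter_map, Finset.card_map]
    have h1 : (Finset.univ.filter fun x => l.m x = x) =
        insert y (Finset.univ.filter fun x => x ≠ y ∧ l.m x = x) := by
      ext x
      simp only [Finset.mem_filter, Finset.mem_univ, true_and, Finset.mem_insert]
      by_cases hx : x = y
      · simp [hx, hy1]
      · simp [hx]
    have h2 := l.card_fixed
    rw [h1, Finset.card_insert_of_notMem (by simp)] at h2
    rw [← Nat.succ_inj.1 h2]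
    congr 1
    refine Finset.filter_congr fun x _ => ?_
    simp only [Function.comp, Fin.coe_castSuccEmb, f2]
    by_cases hx : x = y
    · simp [hx, (Fin.castSucc_lt_last y).ne']
    · simp [hx]
  · change f _ ≠ _
    rw [f1]; exact (Fin.castSucc_lt_last y).ne
  · ext x : 2
    rw [← Fin.castSucc_inj, castSucc_res]
    change (if f x.castSucc = _ then _ else f x.castSucc) = _
    rw [f2]
    by_cases hx : x = y
    · rw [if_pos hx, if_pos rfl, hx, hy1]
    · rw [if_neg hx, if_neg (Fin.castSucc_lt_last _).ne]

end last

/-! ### Standard modules and lowest-weight functionals -/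

section standard

variable {p n k : ℕ}

lemma exists_adjacent_arc (l : LinkState n k) (h : ∃ x, l.m x ≠ x) :
    ∃ i : Fin (n - 1), l.m (siteL i) = siteR i := by
  have h1 : ∃ d : ℕ, ∃ x : Fin n, (l.m x : ℕ) = x + d + 1 := by
    obtain ⟨x, hx⟩ := h
    rcases lt_or_gt_of_ne hx with h | h
    · exact ⟨x - l.m x - 1, l.m x, by rw [l.invol]; rw [Fin.lt_def] at h; omega⟩
    · exact ⟨l.m x - x - 1, x, by rw [Fin.lt_def] at h; omega⟩
  classical
  obtain ⟨x, hx⟩ := Nat.find_spec h1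
  have hmin := fun d => Nat.find_min h1 (m := d)
  set d := Nat.find h1
  have hlt := (l.m x).2
  by_cases hd : d = 0
  · refine ⟨⟨x, by omega⟩, ?_⟩
    have e : siteL (⟨x, by omega⟩ : Fin (n - 1)) = x := rfl
    rw [e]
    exact Fin.ext (by rw [hx, hd]; rfl)
  · exfalso
    obtain ⟨y, hy⟩ : ∃ y : Fin n, (y : ℕ) = x + 1 := ⟨⟨x + 1, by omega⟩, rfl⟩
    obtain ⟨h2, h3, h4⟩ := l.noncross x y (by rw [Fin.lt_def]; omega) (by rw [Fin.lt_def]; omega)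
    rw [Fin.lt_def] at h3 h4
    have h5 : (l.m y : ℕ) ≠ y := fun h => h2 (Fin.ext h)
    exact hmin (l.m y - y - 1) (by omega) ⟨y, by omega⟩

lemma isCoHW_lam (hp : 2 ≤ p) (l : LinkState n k) : IsCoHW p k (lam p l) := by
  induction n using Nat.strong_induction_on generalizing k with
  | _ n IH =>
  by_cases h : ∃ x, l.m x ≠ x
  · obtain ⟨i, hi⟩ := exists_adjacent_arc l h
    obtain ⟨d, hd⟩ : ∃ d : ℕ, (i : ℕ) + d + 2 = n := ⟨n - i - 2, by omega⟩
    clear h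
    induction d generalizing l i with
    | zero =>
      obtain ⟨m, rfl⟩ : ∃ m, n = m + 2 := ⟨n - 2, by omega⟩
      have hl1 : siteL i = (Fin.last m).castSucc := Fin.ext (show (i : ℕ) = m by omega)
      have hr1 : siteR i = Fin.last (m + 1) := Fin.ext (show (i : ℕ) + 1 = m + 1 by omega)
      rw [hl1, hr1] at hi
      have hlast : l.m (Fin.last (m + 1)) ≠ Fin.last (m + 1) := by
        rw [← hi, l.invol]; exact fun h => absurd (h.trans hi) (Fin.castSucc_lt_last _).ne
      have hk1 : k + 1 = if l.m (Fin.last (m + 1)) = Fin.last (m + 1) then k - 1 else k + 1 := by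
        rw [if_neg hlast]
      have hres : (res l hk1).m (Fin.last m) = Fin.last m := by
        rw [← Fin.castSucc_inj, castSucc_res, if_pos hi]
      have hk2 : k = if (res l hk1).m (Fin.last m) = Fin.last m then k + 1 - 1 else k + 1 + 1 := by
        rw [if_pos hres, Nat.add_sub_cancel]
      have h2 : lam p l = ((if Odd m then -1 else 1) * q p) •
          (lam p (res (res l hk1) hk2) ∘ₗ cap p m) := by
        have hm : (Fin.last m).castSucc ≠ Fin.last (m + 1) := (Fin.castSucc_lt_last _).ne
        have h3 : ∀ ε b b', gauge (m + 2) (st ε m b b') * ∏ x, wt p l (st ε m b b') x =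
            (if b = b' then 0 else if b then -((if Odd m then -1 else 1) * q p)
              else (if Odd m then -1 else 1)) *
              (gauge m ε * ∏ x, wt p (res (res l hk1) hk2) ε x) := by
          intro ε b b'
          rw [Fin.prod_univ_castSucc, Fin.prod_univ_castSucc]
          have e1 : wt p l (st ε m b b') (Fin.last (m + 1)) = 1 := by
            rw [wt, if_neg hlast, if_neg (Fin.le_last _).not_gt]
          have e2 : wt p l (st ε m b b') (Fin.last m).castSucc =
              if b = b' then 0 else if b then q p else 1 := by
            rw [wt, hi, if_neg hm.symm, if_pos (Fin.castSucc_lt_last _)]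
            simp [st]
          have e3 : ∀ x : Fin m, wt p l (st ε m b b') x.castSucc.castSucc =
              wt p (res (res l hk1) hk2) ε x := by
            intro x
            have h4 : l.m x.castSucc.castSucc ≠ Fin.last (m + 1) := by
              intro h4
              have := l.invol x.castSucc.castSucc
              rw [h4, ← hi, l.invol, Fin.castSucc_inj] at this
              exact (Fin.castSucc_lt_last x).ne' this
            have h5 := castSucc_res l hk1 x.castSucc
            rw [if_neg h4] at h5
            have h6 := castSucc_res (res l hk1) hk2 x
            rw [if_neg] at h6
            · simp only [wt, ← h5, ← h6, Fin.castSucc_inj, Fin.castSucc_lt_castSucc_iff,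
                ← update_st, Fin.val_castSucc]
              rw [Function.update_of_ne, Function.update_of_ne, Function.update_of_ne,
                Function.update_of_ne]
              all_goals
                intro h
                have := ((res (res l hk1) hk2).m x).2
                have := x.2
                omega
            · intro h7
              rw [h7] at h5
              have := l.invol x.castSucc.castSucc
              rw [← h5, hi] at this
              exact (Fin.castSucc_lt_last _).ne' this
          rw [e1, e2, Finset.prod_congr rfl fun x _ => e3 x, ← update_st, gauge_update, gauge_update]
          by_cases ho : Odd m <;> cases b <;> cases b' <;> simp [ho, Nat.odd_add_one] <;> ring
        refine ext fun v => ?_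
        simp only [lam, fo_succ, update_st, h3]
        simp only [Bool.true_eq_false, Bool.false_eq_true, if_true, if_false, zero_mul, fo_zero,
          fo_smul, lin_zero, lin_smul, smul_eq_mul, comp_apply,
          cap_apply, map_sub, map_smul]
        have hq := q_ne p
        field_simp
        ring
      rw [h2]
      exact (coHW p (m + 2) k).smul_mem _ ((IH m (by omega) _).comp isU_cap)
    | succ d ih =>
      let j : Fin (n - 1) := ⟨i + 1, by omega⟩
      obtain ⟨h1, h2, h3⟩ := snake p i j (Or.inl rfl) l hi
      have h4 : lam p l = lam p (l.join j) ∘ₗ xxz p n (i.rev : Fin (n - 1)) := by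
        refine ext fun v => ?_
        rw [comp_apply, lam_xxz, h1, h3, one_mul]
      rw [h4]
      refine (ih (l.join j) j (arc_of_weight p j l (by rw [h2]; exact one_ne_zero)) ?_).comp
        (IsU.xxz _ _)
      simp only [j]; omega
  · push Not at h
    cases n with
    | zero =>
      have hk : k = 0 := by rw [← l.card_fixed]; simp
      subst hk
      refine ⟨fun φ v => ?_, fun v => ?_, fun v => ?_⟩
      · rw [diag_zero_apply]; simp
      · rw [chainF, if_neg one_ne_zero]; simp
      · rw [chainF, if_neg (by omega)]; simp
    | succ n =>
      have hk : k - 1 = if l.m (Fin.last n) = Fin.last n then k - 1 else k + 1 := by rw [if_pos (h _)]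
      have h1 := IH n (by omega) (res l hk)
      have hk0 := link_pos l (h _)
      rw [lam_through l hk (h _)]
      refine ⟨fun φ v => ?_, fun v => ?_, fun v => ?_⟩
      · rw [comp_apply, pl_D, h1.D]
        congr 2; omega
      · rw [comp_apply, pl_F, h1.F1]
      · rw [comp_apply, pl_F, h1.Fp]

lemma lam_zero_apply (l : LinkState 0 k) (v : Chain 0) : lam p l v = (show ℂ from v) := by
  have h : (gauge 0 (fun _ => true) * ∏ x, wt p l (fun _ => true) x) • (show ℂ from v) = v := by
    simp only [gauge, Finset.range_zero, Finset.prod_empty, Finset.univ_eq_empty, mul_one]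
    exact one_mul (show ℂ from v)
  exact h

lemma linearIndependent_lam (n k : ℕ) : LinearIndependent ℂ fun l : LinkState n k => lam p l := by
  classical
  induction n generalizing k with
  | zero =>
    have hs : Subsingleton (LinkState 0 k) := ⟨fun a b => LinkState.ext (Subsingleton.elim _ _)⟩
    rw [linearIndependent_subsingleton_index_iff]
    intro l h
    have := lin_congr h (1 : ℂ)
    exact one_ne_zero (α := ℂ) ((lam_zero_apply l (show Chain 0 from (1 : ℂ))).symm.trans this)
  | succ n ih =>
    have : Fintype (LinkState (n + 1) k) := Fintype.ofFinite _
    rw [Fintype.linearIndependent_iff]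
    intro g hg
    have hval : ∀ v, ∑ l, g l * lam p l v = 0 := by
      intro v
      have := lin_congr hg v
      simpa [lin_sum] using this
    let A := {l : LinkState (n + 1) k // l.m (Fin.last n) ≠ Fin.last n}
    let rA : A → LinkState n (k + 1) := fun l => res l.1 (by rw [if_neg l.2])
    have hrA : Injective rA := fun l l' h => Subtype.ext (res_injective l.2 l'.2 _ _ h)
    have hA := (ih (k + 1)).comp rA hrA
    have hc : (if Odd n then -1 else 1 : ℂ) * q p ≠ 0 :=
      mul_ne_zero (by split_ifs <;> norm_num) (q_ne p)
    have harc : ∀ l : A, g l.1 = 0 := by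
      rw [Fintype.linearIndependent_iff] at hA
      refine hA (fun l => g l.1) (ext fun d => ?_)
      have h1 := hval (mk 0 d)
      rw [← Finset.sum_filter_add_sum_filter_not _ fun l : LinkState (n + 1) k =>
        l.m (Fin.last n) ≠ Fin.last n, Finset.sum_subtype (p := fun l : LinkState (n + 1) k =>
        l.m (Fin.last n) ≠ Fin.last n) _ (by simp), Finset.sum_eq_zero (s := Finset.filter _ _),
        add_zero] at h1
      · rw [lin_sum, lin_zero]
        refine (mul_eq_zero.1 (Eq.trans ?_ h1)).resolve_left hc
        rw [Finset.mul_sum]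
        refine Finset.sum_congr rfl fun l _ => ?_
        rw [lam_arc l.1 (by rw [if_neg l.2]) l.2]
        change _ * (g l.1 * _) = _
        ring_nf
        rfl
      · intro l hl
        simp only [Finset.mem_filter, Finset.mem_univ, true_and, not_not] at hl
        rw [lam_through l rfl hl]
        simp
    let B := {l : LinkState (n + 1) k // l.m (Fin.last n) = Fin.last n}
    let rB : B → LinkState n (k - 1) := fun l => res l.1 (by rw [if_pos l.2])
    have hrB : Injective rB := by
      intro l l' h
      refine Subtype.ext (LinkState.ext (funext fun x => ?_))
      induction x using Fin.lastCases with
      | last => rw [l.2, l'.2]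
      | cast x =>
        have key : ∀ l : B, l.1.m x.castSucc = ((rB l).m x).castSucc := by
          intro l
          rw [castSucc_res, if_neg]
          intro h3
          have := l.1.invol x.castSucc
          rw [h3, l.2] at this
          exact (Fin.castSucc_lt_last x).ne' this
        rw [key, key, h]
    have hB := (ih (k - 1)).comp rB hrB
    have hthr : ∀ l : B, g l.1 = 0 := by
      rw [Fintype.linearIndependent_iff] at hB
      refine hB (fun l => g l.1) (ext fun d => ?_)
      have h1 := hval (mk d 0)
      rw [← Finset.sum_filter_add_sum_filter_not _ fun l : LinkState (n + 1) k =>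
        l.m (Fin.last n) = Fin.last n, Finset.sum_subtype (p := fun l : LinkState (n + 1) k =>
        l.m (Fin.last n) = Fin.last n) _ (by simp), Finset.sum_eq_zero (s := Finset.filter _ _),
        add_zero] at h1
      · rw [lin_sum, lin_zero, ← h1]
        refine Finset.sum_congr rfl fun l _ => ?_
        rw [lam_through l.1 (by rw [if_pos l.2]) l.2]
        rfl
      · intro l hl
        simp only [Finset.mem_filter, Finset.mem_univ, true_and] at hl
        rw [harc ⟨l, hl⟩, zero_mul]
    intro l
    by_cases hl : l.m (Fin.last n) = Fin.last n
    · exact hthr ⟨l, hl⟩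
    · exact harc ⟨l, hl⟩

def inMi {n : ℕ} : Chain n →ₗ[ℂ] Chain (n + 1) := LinearMap.inr ℂ (Chain n) (Chain n)

def inPl {n : ℕ} : Chain n →ₗ[ℂ] Chain (n + 1) := LinearMap.inl ℂ (Chain n) (Chain n)

lemma IsCoHW.comp_mi {k : ℤ} {l : Chain (n + 1) →ₗ[ℂ] ℂ} (hl : IsCoHW p k l) :
    IsCoHW p (k + 1) (l ∘ₗ inMi) := by
  have e : ∀ d : Chain n, inMi d = XXZ.mk 0 d := fun _ => rfl
  refine ⟨fun φ v => ?_, fun v => ?_, fun v => ?_⟩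
  · have h := hl.D (fun x => φ (x + 1)) (XXZ.mk 0 v)
    rw [comp_apply, comp_apply, e, e, ← h]
    congr 1
    refine chain_ext ?_ ?_
    · rw [pl_D, pl_mk, pl_mk, map_zero]
    · rw [mi_D, mi_mk, mi_mk]
      simp
  · have h := hl.F1 (XXZ.mk 0 v)
    rw [comp_apply, e, ← h]
    congr 1
    refine chain_ext ?_ ?_
    · rw [pl_F, pl_mk, pl_mk, map_zero]
    · rw [mi_F, mi_mk, mi_mk, pl_mk]; simp
  · have h := hl.Fp (XXZ.mk 0 v)
    rw [comp_apply, e, ← h]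
    congr 1
    refine chain_ext ?_ ?_
    · rw [pl_F, pl_mk, pl_mk, map_zero]
    · rw [mi_F, mi_mk, mi_mk, pl_mk]; simp

lemma IsCoHW.of_pl {k : ℤ} {l : Chain n →ₗ[ℂ] ℂ} (hl : IsCoHW p k (l ∘ₗ pl)) :
    IsCoHW p (k - 1) l := by
  refine ⟨fun φ v => ?_, fun v => ?_, fun v => ?_⟩
  · have h := hl.D (fun x => φ (x - 1)) (XXZ.mk v 0)
    rw [comp_apply, comp_apply, pl_D, pl_mk] at h
    simpa using h
  · have h := hl.F1 (XXZ.mk v 0)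
    rwa [comp_apply, pl_F, pl_mk] at h
  · have h := hl.Fp (XXZ.mk v 0)
    rwa [comp_apply, pl_F, pl_mk] at h

lemma coHW_le_span (hp : 2 ≤ p) (n k : ℕ) :
    coHW p n k ≤ Submodule.span ℂ (Set.range fun l : LinkState n k => lam p l) := by
  induction n generalizing k with
  | zero =>
    intro l hl
    have hl' : IsCoHW p k l := hl
    by_cases hk : k = 0
    · subst hk
      let l0 : LinkState 0 0 := ⟨id, fun _ => rfl, fun x => x.elim0, by simp⟩
      have : l = l (show Chain 0 from (1 : ℂ)) • lam p l0 := by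
        refine ext fun v => ?_
        rw [lin_smul, lam_zero_apply, smul_eq_mul, mul_comm]
        refine Eq.trans ?_ (map_smul l (show ℂ from v) (show Chain 0 from (1 : ℂ)))
        exact congrArg (fun t : ℂ => l (show Chain 0 from t)) (mul_one (show ℂ from v)).symm
      rw [this]
      exact Submodule.smul_mem _ _ (Submodule.subset_span ⟨l0, rfl⟩)
    · have : l = 0 := by
        refine ext fun v => ?_
        have h := hl'.D (fun x => if x = 0 then 1 else 0) v
        rw [diag_zero_apply] at h
        simpa [hk] using h
      rw [this]; exact Submodule.zero_mem _
  | succ n ih =>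
    intro l hl
    have hl' : IsCoHW p k l := hl
    let im : Chain n →ₗ[ℂ] Chain (n + 1) := inMi
    have hc : (if Odd n then -1 else 1 : ℂ) * q p ≠ 0 :=
      mul_ne_zero (by split_ifs <;> norm_num) (q_ne p)
    set S := Submodule.span ℂ (Set.range fun l : LinkState (n + 1) k => lam p l) with hS
    have h1 : l ∘ₗ im ∈ S.map (LinearMap.lcomp ℂ ℂ im) := by
      have h2 := ih (k + 1) (show IsCoHW p ((k + 1 : ℕ) : ℤ) (l ∘ₗ im) by
        push_cast; exact hl'.comp_mi)
      refine (Submodule.span_le.2 ?_) h2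
      rintro _ ⟨l2, rfl⟩
      obtain ⟨l3, h3, rfl⟩ := exists_close l2
      refine ⟨((if Odd n then -1 else 1 : ℂ) * q p)⁻¹ • lam p l3,
        S.smul_mem _ (Submodule.subset_span ⟨l3, rfl⟩), ext fun d => ?_⟩
      change ((if Odd n then -1 else 1 : ℂ) * q p)⁻¹ * lam p l3 (mk 0 d) = _
      rw [lam_arc l3 (by rw [if_neg h3]) h3, inv_mul_cancel_left₀ hc]
    obtain ⟨l4, h4, h5⟩ := h1
    have h6 : IsCoHW p k l4 := by
      have : S ≤ coHW p (n + 1) k := Submodule.span_le.2 (by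
        rintro _ ⟨l2, rfl⟩; exact isCoHW_lam hp l2)
      exact this h4
    have h7 : IsCoHW p k (l - l4) := (coHW p (n + 1) k).sub_mem hl' h6
    let l5 : Chain n →ₗ[ℂ] ℂ := (l - l4) ∘ₗ inPl
    have h8 : l - l4 = l5 ∘ₗ pl := by
      refine ext fun v => ?_
      have e : v = mk (pl v) 0 + mk 0 (mi v) := by rw [mk_add, add_zero, zero_add, mk_pl_mi]
      have e2 : (l - l4) (mk 0 (mi v)) = 0 := by
        have := lin_congr h5 (mi v)
        rw [lin_sub, sub_eq_zero]
        exact this.symm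
      conv_lhs => rw [e, map_add, e2, add_zero]
      rfl
    rw [h8] at h7
    have h9 := h7.of_pl
    have h10 : l5 ∘ₗ pl ∈ S := by
      cases k with
      | zero =>
        rw [h9.eq_zero hp (by simp), zero_comp]
        exact S.zero_mem
      | succ k =>
        have h11 := ih k (show IsCoHW p (k : ℤ) l5 by
          convert h9 using 1; push_cast; ring)
        have h12 : l5 ∘ₗ pl ∈ (Submodule.span ℂ (Set.range fun l : LinkState n k => lam p l)).map
            (LinearMap.lcomp ℂ ℂ (pl : Chain (n + 1) →ₗ[ℂ] Chain n)) := ⟨l5, h11, rfl⟩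
        rw [Submodule.map_span] at h12
        refine (Submodule.span_le.2 ?_) h12
        rintro _ ⟨_, ⟨l2, rfl⟩, rfl⟩
        obtain ⟨l3, h3, rfl⟩ := exists_through l2
        refine Submodule.subset_span ⟨l3, ?_⟩
        exact lam_through l3 _ h3
    rw [← sub_add_cancel l l4, h8]
    exact S.add_mem h10 h4

end standard

/-! ### The Temperley–Lieb action on the spaces of homomorphisms -/

section tl

variable {p : ℕ} {hp : 2 ≤ p} {N : ℕ}

lemma tlAnti_gen (i : Fin (N - 1)) : tlAnti p N (TL.gen p N i) = .op (TL.gen p N i.rev) :=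
  TL.lift_gen _ _ i

lemma tlAnti_tlAnti (a : TL p N) : (tlAnti p N (tlAnti p N a).unop).unop = a := by
  induction a using TL.induction with
  | hc c => rw [AlgHom.commutes, MulOpposite.algebraMap_apply, MulOpposite.unop_op, AlgHom.commutes]; rfl
  | hg i => rw [tlAnti_gen, MulOpposite.unop_op, tlAnti_gen, MulOpposite.unop_op, Fin.rev_rev]
  | hm a b h1 h2 => rw [map_mul, MulOpposite.unop_mul, map_mul, MulOpposite.unop_mul, h1, h2]
  | ha a b h1 h2 => rw [map_add, MulOpposite.unop_add, map_add, MulOpposite.unop_add, h1, h2]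

/-- The endomorphism of `H_N` given by an element of the Temperley–Lieb algebra. -/
def tlHom (hp : 2 ≤ p) (a : TL p N) : HC hp N →ₗ[U p] HC hp N := xxzEnd hp N a

section

variable {M M' : Type} [AddCommGroup M] [Module (U p) M] [AddCommGroup M'] [Module (U p) M']

def toHS (φ : HC hp N →ₗ[U p] M) : HomSpace hp N M := φ

def ofHS (φ : HomSpace hp N M) : HC hp N →ₗ[U p] M := φ

lemma ofHS_smul (a : TL p N) (φ : HomSpace hp N M) :
    ofHS (a • φ) = (ofHS φ).comp (tlHom hp (tlAnti p N a).unop) := rfl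

lemma ofHS_add (φ ψ : HomSpace hp N M) : ofHS (φ + ψ) = ofHS φ + ofHS ψ := rfl

lemma anti_smul (a : TL p N) (φ : HC hp N →ₗ[U p] M) :
    toHS (φ.comp (tlHom hp a)) = (tlAnti p N a).unop • toHS φ := by
  change φ.comp (tlHom hp a) = φ.comp (tlHom hp (tlAnti p N (tlAnti p N a).unop).unop)
  rw [tlAnti_tlAnti]

/-- Composition with a homomorphism, on the Hom spaces. -/
def hsMap (hp : 2 ≤ p) (N : ℕ) (g : M →ₗ[U p] M') : HomSpace hp N M →ₗ[TL p N] HomSpace hp N M' where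
  toFun φ := toHS (g.comp (ofHS φ))
  map_add' _ _ := comp_add _ _ _
  map_smul' _ _ := rfl

lemma hsMap_injective (g : M →ₗ[U p] M') (hg : Injective g) :
    Injective (hsMap hp N g) := by
  intro φ ψ h
  refine ext fun v => hg ?_
  exact lin_congr (show g.comp (ofHS φ) = g.comp (ofHS ψ) from h) v

/-- An isomorphism of modules induces an isomorphism of Hom spaces. -/
def hsEquiv (hp : 2 ≤ p) (N : ℕ) (g : M ≃ₗ[U p] M') : HomSpace hp N M ≃ₗ[TL p N] HomSpace hp N M' :=
  LinearEquiv.ofLinear (hsMap hp N g.toLinearMap) (hsMap hp N g.symm.toLinearMap)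
    (by
      refine ext fun φ => ext fun v => ?_
      exact g.apply_symm_apply _)
    (by
      refine ext fun φ => ext fun v => ?_
      exact g.symm_apply_apply _)

end

variable {k : ℕ}

/-- The functional attached to an element of the standard module. -/
def stLam (p N k : ℕ) : (LinkState N k →₀ ℂ) →ₗ[ℂ] Chain N →ₗ[ℂ] ℂ :=
  Finsupp.linearCombination ℂ fun l => lam p l

lemma stLam_single (l : LinkState N k) (c : ℂ) : stLam p N k (Finsupp.single l c) = c • lam p l :=
  Finsupp.linearCombination_single ..

lemma stLam_smul (a : TL p N) (v : LinkState N k →₀ ℂ) :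
    stLam p N k ((stRep p N k a : (LinkState N k →₀ ℂ) →ₗ[ℂ] _) v) =
      stLam p N k v ∘ₗ (xxzRep p N (tlAnti p N a).unop : Chain N →ₗ[ℂ] Chain N) := by
  induction a using TL.induction generalizing v with
  | hc c =>
    rw [AlgHom.commutes, AlgHom.commutes, MulOpposite.algebraMap_apply, MulOpposite.unop_op,
      AlgHom.commutes, Module.algebraMap_end_apply, map_smul]
    refine ext fun x => ?_
    simp [Module.algebraMap_end_apply]
  | hg i =>
    rw [stRep, TL.lift_gen, tlAnti_gen, MulOpposite.unop_op, xxzRep, TL.lift_gen]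
    induction v using Finsupp.induction_linear with
    | zero => simp
    | add x y h1 h2 => rw [map_add, map_add, h1, h2, map_add, LinearMap.add_comp]
    | single l c =>
      rw [stGen_single, stLam_single, stLam_single]
      refine ext fun x => ?_
      rw [lin_smul, comp_apply, lin_smul, lam_xxz, smul_eq_mul,
        smul_eq_mul, mul_assoc]
  | hm a b h1 h2 =>
    rw [map_mul, mul_apply, h1, h2, map_mul, MulOpposite.unop_mul, map_mul]
    rfl
  | ha a b h1 h2 =>
    rw [map_add, lin_add, map_add, h1, h2, map_add, MulOpposite.unop_add, map_add]
    exact (comp_add _ _ _).symm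

lemma stLam_injective : Injective (stLam p N k) := linearIndependent_lam N k

lemma range_stLam (hp : 2 ≤ p) : range (stLam p N k) = coHW p N k := by
  refine le_antisymm ?_ ?_
  · rintro _ ⟨v, rfl⟩
    induction v using Finsupp.induction_linear with
    | zero => rw [map_zero]; exact Submodule.zero_mem _
    | add x y h1 h2 => rw [map_add]; exact Submodule.add_mem _ h1 h2
    | single l c => rw [stLam_single]; exact Submodule.smul_mem _ _ (isCoHW_lam hp l)
  · refine (coHW_le_span hp N k).trans (Submodule.span_le.2 ?_)
    rintro _ ⟨l, rfl⟩
    exact ⟨Finsupp.single l 1, by rw [stLam_single, one_smul]⟩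

lemma isCoHW_stLam (hp : 2 ≤ p) (v : LinkState N k →₀ ℂ) : IsCoHW p k (stLam p N k v) := by
  have : stLam p N k v ∈ coHW p N k := by rw [← range_stLam hp]; exact ⟨v, rfl⟩
  exact this

def stHom (hp : 2 ≤ p) (N k : ℕ) : RepSpace (stRep p N k) →ₗ[TL p N] HomSpace hp N (CW hp k) where
  toFun v := toHS (xiHom (isCoHW_stLam hp (RepSpace.out _ v)))
  map_add' v w := by
    refine coHead_injective ?_
    refine (coHead_xiHom _).trans ?_
    have h := congrArg Subtype.val (map_add (xiEquiv hp N k)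
      (xiHom (isCoHW_stLam hp (RepSpace.out _ v))) (xiHom (isCoHW_stLam hp (RepSpace.out _ w))))
    refine Eq.trans ?_ h.symm
    change _ = coHead _ + coHead _
    rw [coHead_xiHom, coHead_xiHom]
    exact map_add (stLam p N k) _ _
  map_smul' a v := by
    refine coHead_injective ?_
    refine (coHead_xiHom _).trans ?_
    refine (stLam_smul a _).trans ?_
    exact congrArg (fun l : Chain N →ₗ[ℂ] ℂ => l ∘ₗ
      (xxzRep p N (tlAnti p N a).unop : Chain N →ₗ[ℂ] Chain N))
      (coHead_xiHom (hp := hp) (isCoHW_stLam hp (RepSpace.out _ v))).symm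

lemma coHead_stHom (v : RepSpace (stRep p N k)) :
    coHead (ofHS (stHom hp N k v)) = stLam p N k (RepSpace.out _ v) :=
  coHead_xiHom (isCoHW_stLam hp _)

lemma stHom_bijective : Function.Bijective (stHom hp N k) := by
  constructor
  · intro v w h
    refine stLam_injective (p := p) ?_
    have := congrArg (fun x => coHead (ofHS x)) h
    simp only [coHead_stHom] at this
    exact this
  · intro φ
    have h : coHead (ofHS φ) ∈ range (stLam p N k) := by
      rw [range_stLam hp]; exact isCoHW_coHead _
    obtain ⟨v, hv⟩ := h
    refine ⟨(RepSpace.out _).symm v, coHead_injective ?_⟩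
    refine (coHead_stHom (hp := hp) _).trans hv

/-- The standard module is the module of homomorphisms to the contragredient Weyl module. -/
def stEquiv (hp : 2 ≤ p) (N k : ℕ) : RepSpace (stRep p N k) ≃ₗ[TL p N] HomSpace hp N (CW hp k) :=
  LinearEquiv.ofBijective (stHom hp N k) stHom_bijective

/-- The standard module as the module of homomorphisms to an irreducible module. -/
def stEquivSimple (hp : 2 ≤ p) (N : ℕ) {s : ℕ} (hs : s ≤ p) (hs1 : 1 ≤ s) :
    HomSpace hp N (SX hp hs 1) ≃ₗ[TL p N] RepSpace (stRep p N (s - 1)) :=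
  (hsEquiv hp N (LinearEquiv.ofBijective _ (socCoweyl_bijective hs hs1
    (show (s - 1) + 1 = (1 - 1) * p + s by omega)))).trans (stEquiv hp N (s - 1)).symm

end tl

/-! ### Modules over the small quantum group -/

section small

/-- The structure of a module over the algebra generated by `E`, `F`, `K^{±1}`. -/
structure Small (p : ℕ) (V : Type) [AddCommGroup V] [Module ℂ V] where
  E : Module.End ℂ V
  F : Module.End ℂ V
  K : Module.End ℂ V
  L : Module.End ℂ V
  KL : ∀ v, K (L v) = v
  LK : ∀ v, L (K v) = v
  KE : ∀ v, K (E v) = q p ^ (2 : ℤ) • E (K v)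
  KF : ∀ v, K (F v) = q p ^ (-2 : ℤ) • F (K v)
  EF : ∀ v, E (F v) = F (E v) + (q p - (q p)⁻¹)⁻¹ • (K v - L v)
  Epow : ∀ v, (E ^ p) v = 0
  Fpow : ∀ v, (F ^ p) v = 0
  Kpow : ∀ v, (K ^ (2 * p)) v = v

variable {p : ℕ} {V : Type} [AddCommGroup V] [Module ℂ V]

lemma Small.LE (A : Small p V) (v : V) : A.L (A.E v) = q p ^ (-2 : ℤ) • A.E (A.L v) := by
  have h := congrArg A.L (A.KE (A.L v))
  rw [A.LK, A.KL, map_smul] at h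
  rw [h, smul_smul, ← zpow_add₀ (q_ne p)]; simp

lemma Small.LF (A : Small p V) (v : V) : A.L (A.F v) = q p ^ (2 : ℤ) • A.F (A.L v) := by
  have h := congrArg A.L (A.KF (A.L v))
  rw [A.LK, A.KL, map_smul] at h
  rw [h, smul_smul, ← zpow_add₀ (q_ne p)]; simp

lemma pow_succ_apply' (f : Module.End ℂ V) (n : ℕ) (v : V) : (f ^ (n + 1)) v = f ((f ^ n) v) := by
  rw [pow_succ']; rfl

lemma Small.LF_pow (A : Small p V) (n : ℕ) (v : V) :
    A.L ((A.F ^ n) v) = q p ^ (2 * n : ℤ) • (A.F ^ n) (A.L v) := by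
  induction n with
  | zero => simp
  | succ n ih =>
    rw [pow_succ_apply', A.LF, ih, map_smul, smul_smul, ← zpow_add₀ (q_ne p), pow_succ_apply']
    congr 2; push_cast; ring

lemma qInt_succ' (hp : 2 ≤ p) (n : ℤ) : q p * qInt p n + q p ^ (-n) = qInt p (n + 1) := by
  have hq := q_ne p
  have h := q_sub_ne hp
  rw [qInt, qInt, eq_div_iff h, add_mul, mul_assoc, div_mul_cancel₀ _ h, neg_add, zpow_add₀ hq,
    zpow_add₀ hq, zpow_one, zpow_neg_one]
  ring

section T

variable (A : Small p V)

def Small.tE : Module.End ℂ (V × V) := LinearMap.prod (q p • A.E ∘ₗ LinearMap.fst ℂ V V +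
  LinearMap.snd ℂ V V) ((q p)⁻¹ • A.E ∘ₗ LinearMap.snd ℂ V V)

def Small.tF : Module.End ℂ (V × V) := LinearMap.prod (A.F ∘ₗ LinearMap.fst ℂ V V)
  (A.L ∘ₗ LinearMap.fst ℂ V V + A.F ∘ₗ LinearMap.snd ℂ V V)

def Small.tK : Module.End ℂ (V × V) := LinearMap.prodMap (q p • A.K) ((q p)⁻¹ • A.K)

lemma Small.tE_apply (v : V × V) : A.tE v = (q p • A.E v.1 + v.2, (q p)⁻¹ • A.E v.2) := rfl

lemma Small.tF_apply (v : V × V) : A.tF v = (A.F v.1, A.L v.1 + A.F v.2) := rfl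

lemma Small.tK_apply (v : V × V) : A.tK v = (q p • A.K v.1, (q p)⁻¹ • A.K v.2) := rfl

lemma Small.tE_pow (hp : 2 ≤ p) (n : ℕ) (v : V × V) : (A.tE ^ (n + 1)) v =
    (q p ^ (n + 1) • (A.E ^ (n + 1)) v.1 + qInt p (n + 1) • (A.E ^ n) v.2,
      (q p) ^ (-(n + 1) : ℤ) • (A.E ^ (n + 1)) v.2) := by
  induction n with
  | zero => simp [qInt_one hp, A.tE_apply]
  | succ n ih =>
    rw [pow_succ_apply', ih, A.tE_apply]
    refine Prod.ext ?_ ?_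
    · simp only [map_add, map_smul, ← pow_succ_apply', smul_add, smul_smul, add_assoc, ← add_smul]
      congr 2
      · ring
      · push_cast; rw [qInt_succ' hp]
    · simp only [map_smul, ← pow_succ_apply', smul_smul]
      congr 1
      rw [← zpow_neg_one, ← zpow_add₀ (q_ne p)]; congr 1; push_cast; ring

lemma Small.tF_pow (hq2 : q p ^ 2 - 1 ≠ 0) (n : ℕ) (v : V × V) : (A.tF ^ (n + 1)) v =
    ((A.F ^ (n + 1)) v.1, ((q p ^ (2 * (n + 1)) - 1) / (q p ^ 2 - 1)) •
      (A.F ^ n) (A.L v.1) + (A.F ^ (n + 1)) v.2) := by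
  induction n with
  | zero => simp [div_self hq2, A.tF_apply]
  | succ n ih =>
    rw [pow_succ_apply', ih, A.tF_apply]
    refine Prod.ext ?_ ?_
    · simp only [← pow_succ_apply']
    · simp only [map_add, map_smul, ← pow_succ_apply', A.LF_pow, ← add_assoc, ← add_smul]
      congr 2
      rw [show (2 * ((n + 1 : ℕ) : ℤ)) = ((2 * (n + 1) : ℕ) : ℤ) by push_cast; ring, zpow_natCast]
      field_simp
      ring

lemma Small.tK_pow (n : ℕ) (v : V × V) :
    (A.tK ^ n) v = (q p ^ n • (A.K ^ n) v.1, ((q p)⁻¹) ^ n • (A.K ^ n) v.2) := by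
  induction n with
  | zero => simp
  | succ n ih =>
    rw [pow_succ_apply', ih, A.tK_apply]
    simp only [map_smul, smul_smul, pow_succ', mul_apply]

lemma q_pow_two_mul (hp : 2 ≤ p) : q p ^ (2 * p) = 1 := by
  have := q_pow_p hp
  rw [zpow_natCast] at this
  rw [mul_comm, pow_mul, this]; norm_num

end T

/-- The tensor product of the two-dimensional module with a module. -/
def Small.T (hp : 2 ≤ p) (A : Small p V) : Small p (V × V) where
  E := A.tE
  F := A.tF
  K := A.tK
  L := LinearMap.prodMap ((q p)⁻¹ • A.L) (q p • A.L)
  KL v := Prod.ext (by simp [A.tK_apply, A.KL, smul_smul, q_ne p])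
    (by simp [A.tK_apply, A.KL, smul_smul, q_ne p])
  LK v := Prod.ext (by simp [A.tK_apply, A.LK, smul_smul, q_ne p])
    (by simp [A.tK_apply, A.LK, smul_smul, q_ne p])
  KE v := by
    have hq := q_ne p
    refine Prod.ext ?_ ?_
    · simp [A.tK_apply, A.tE_apply, A.KE, smul_smul]
      congr 2 <;> field_simp
    · simp [A.tK_apply, A.tE_apply, A.KE, smul_smul]
      congr 1; field_simp
  KF v := by
    have hq := q_ne p
    refine Prod.ext ?_ ?_
    · simp [A.tK_apply, A.tF_apply, A.KF, smul_smul, mul_comm]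
    · simp [A.tK_apply, A.tF_apply, A.KF, A.KL, A.LK, smul_smul]
      congr 2 <;> field_simp
  EF v := by
    have hq := q_ne p
    have hq' := q_sub_ne hp
    have h2 : q p ^ 2 - 1 ≠ 0 := fun h => hq' (by field_simp; linear_combination h)
    refine Prod.ext ?_ ?_
    · simp only [A.tK_apply, A.tE_apply, A.tF_apply, A.EF, map_add, map_smul, Prod.fst_add,
        Prod.smul_fst, Prod.fst_sub, LinearMap.prodMap_apply, lin_smul]
      match_scalars <;> field_simp <;> ring
    · simp only [A.tK_apply, A.tE_apply, A.tF_apply, A.EF, A.LE, map_add, map_smul, Prod.snd_add,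
        Prod.smul_snd, Prod.snd_sub, LinearMap.prodMap_apply, lin_smul, zpow_neg]
      match_scalars <;> field_simp <;> ring
  Epow v := by
    obtain ⟨n, rfl⟩ : ∃ n, p = n + 1 := ⟨p - 1, by omega⟩
    rw [A.tE_pow hp, A.Epow, A.Epow, (qInt_eq_zero_iff hp _).2 (by push_cast; exact dvd_refl _)]
    simp
  Fpow v := by
    have hq2 : q p ^ 2 - 1 ≠ 0 := fun h => q_sub_ne hp (by
      have := q_ne p
      field_simp; linear_combination h)
    have h2 := q_pow_two_mul hp
    obtain ⟨n, rfl⟩ : ∃ n, p = n + 1 := ⟨p - 1, by omega⟩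
    rw [A.tF_pow hq2, A.Fpow, A.Fpow, h2]
    simp
  Kpow v := by
    rw [A.tK_pow, A.Kpow, A.Kpow, inv_pow, q_pow_two_mul hp]; simp

def Small.ofIsUq (g : Gen → Module.End ℂ V) (hg : IsUq p g) : Small p V where
  E := g .E
  F := g .F
  K := g .K
  L := g .Kinv
  KL v := lin_congr hg.K_Kinv v
  LK v := lin_congr hg.Kinv_K v
  KE v := by simpa using lin_congr hg.K_E v
  KF v := by simpa using lin_congr hg.K_F v
  EF v := by
    have := lin_congr hg.E_F v
    simp only [lin_sub, mul_apply, lin_smul] at this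
    rw [← this]; abel
  Epow v := by rw [hg.E_pow]; rfl
  Fpow v := by rw [hg.F_pow]; rfl
  Kpow v := by rw [hg.K_pow]; rfl

end small

section smallHom

variable {p : ℕ} {V V' V'' : Type} [AddCommGroup V] [Module ℂ V] [AddCommGroup V'] [Module ℂ V']
  [AddCommGroup V''] [Module ℂ V'']

/-- The maps commuting with `E`, `F` and `K`. -/
structure SmallHom (A : Small p V) (B : Small p V') (f : V →ₗ[ℂ] V') : Prop where
  E : ∀ v, f (A.E v) = B.E (f v)
  F : ∀ v, f (A.F v) = B.F (f v)
  K : ∀ v, f (A.K v) = B.K (f v)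

variable {A : Small p V} {B : Small p V'} {C : Small p V''}

lemma SmallHom.L {f : V →ₗ[ℂ] V'} (hf : SmallHom A B f) (v : V) : f (A.L v) = B.L (f v) := by
  rw [← B.LK (f (A.L v)), ← hf.K, A.KL]

lemma SmallHom.comp {f : V →ₗ[ℂ] V'} {g : V' →ₗ[ℂ] V''} (hg : SmallHom B C g) (hf : SmallHom A B f) :
    SmallHom A C (g ∘ₗ f) :=
  ⟨fun v => by simp [hf.E, hg.E], fun v => by simp [hf.F, hg.F], fun v => by simp [hf.K, hg.K]⟩

/-- The spin chain as a module over the small quantum group. -/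
def chainSmall (hp : 2 ≤ p) (n : ℕ) : Small p (Chain n) := Small.ofIsUq _ (chain_isUq hp n)

/-- The lifting property for an endomorphism of the spin chain. -/
def SmallLift (hp : 2 ≤ p) {n : ℕ} (ε : Chain n →ₗ[ℂ] Chain n) : Prop :=
  ∀ (V V' : Type) [AddCommGroup V] [Module ℂ V] [AddCommGroup V'] [Module ℂ V']
    (A : Small p V) (B : Small p V') (g : V →ₗ[ℂ] V') (φ : Chain n →ₗ[ℂ] V'),
    SmallHom A B g → Surjective g → SmallHom (chainSmall hp n) B φ →
    ∃ ψ : Chain n →ₗ[ℂ] V, SmallHom (chainSmall hp n) A ψ ∧ ∀ v, g (ψ v) = φ (ε v)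

end smallHom

/-! ### Lifting of maps from the spin chain, for the small quantum group -/

section smallLift

variable {p : ℕ} {hp : 2 ≤ p} {m n : ℕ}

lemma chainSmall_succ_E (v : Chain (n + 1)) : (chainSmall hp (n + 1)).E v =
    mk (q p • (chainSmall hp n).E (pl v) + mi v) ((q p)⁻¹ • (chainSmall hp n).E (mi v)) := by
  refine chain_ext ?_ ?_
  · refine (pl_E 1 v).trans ?_
    rw [sub_self, (E_zero n).1, zpow_one]; rfl
  · refine (mi_E 1 v).trans ?_
    rw [zpow_neg_one]; rfl

lemma chainSmall_succ_F (v : Chain (n + 1)) : (chainSmall hp (n + 1)).F v =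
    mk ((chainSmall hp n).F (pl v)) ((chainSmall hp n).L (pl v) + (chainSmall hp n).F (mi v)) := by
  refine chain_ext ?_ ?_
  · exact pl_F 1 v
  · refine (mi_F 1 v).trans ?_
    rw [sub_self, (F_zero n).1, zpow_zero, one_smul]; rfl

lemma chainSmall_succ_K (v : Chain (n + 1)) : (chainSmall hp (n + 1)).K v =
    mk (q p • (chainSmall hp n).K (pl v)) ((q p)⁻¹ • (chainSmall hp n).K (mi v)) := by
  have h : ∀ c : ℤ, ∀ w : Chain n, chainDiag n (fun x => q p ^ (x + c)) w =
      q p ^ c • chainDiag n (fun x => q p ^ x) w := by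
    intro c w
    rw [← lin_smul, diag_smul]
    congr 2; funext x
    rw [← zpow_add₀ (q_ne p), add_comm]
  refine chain_ext ?_ ?_
  · refine (pl_D _ v).trans ?_
    rw [h, zpow_one]; rfl
  · refine (mi_D _ v).trans ?_
    have := h (-1) (mi v)
    rw [zpow_neg_one] at this
    exact this

lemma isU_small {f : Chain m →ₗ[ℂ] Chain n} (hf : IsU p f) :
    SmallHom (chainSmall hp m) (chainSmall hp n) f :=
  ⟨hf.E 1, hf.F 1, hf.D _⟩

lemma SmallLift.conj {ε : Chain m →ₗ[ℂ] Chain m} (h : SmallLift hp ε) {f : Chain m →ₗ[ℂ] Chain n}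
    {g : Chain n →ₗ[ℂ] Chain m} (hf : IsU p f) (hg : IsU p g) : SmallLift hp (f ∘ₗ ε ∘ₗ g) := by
  intro V V' _ _ _ _ A B c φ hc hs hφ
  obtain ⟨ψ, h1, h2⟩ := h V V' A B c (φ ∘ₗ f) hc hs (hφ.comp (isU_small hf))
  exact ⟨ψ ∘ₗ g, h1.comp (isU_small hg), fun v => h2 _⟩

lemma SmallLift.add {ε η : Chain n →ₗ[ℂ] Chain n} (h : SmallLift hp ε) (h' : SmallLift hp η) :
    SmallLift hp (ε + η) := by
  intro V V' _ _ _ _ A B c φ hc hs hφ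
  obtain ⟨ψ, h1, h2⟩ := h V V' A B c φ hc hs hφ
  obtain ⟨ψ', h1', h2'⟩ := h' V V' A B c φ hc hs hφ
  exact ⟨ψ + ψ', ⟨fun v => by simp [h1.E, h1'.E], fun v => by simp [h1.F, h1'.F],
    fun v => by simp [h1.K, h1'.K]⟩, fun v => by simp [h2, h2']⟩

lemma SmallLift.zero : SmallLift hp (0 : Chain n →ₗ[ℂ] Chain n) := by
  intro V V' _ _ _ _ A B c φ hc hs hφ
  exact ⟨0, ⟨fun v => by simp, fun v => by simp, fun v => by simp⟩, fun v => by simp⟩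

lemma SmallLift.up {ε : Chain n →ₗ[ℂ] Chain n} (h : SmallLift hp ε) : SmallLift hp (up ε) := by
  intro V V' _ _ _ _ A B g φ hg hs hφ
  have hq := q_ne p
  let inl : Chain n →ₗ[ℂ] Chain (n + 1) := inPl
  let inr : Chain n →ₗ[ℂ] Chain (n + 1) := inMi
  have hadd : ∀ u d : Chain n, φ (mk u d) = φ (inl u) + φ (inr d) := by
    intro u d
    rw [← map_add]
    exact congrArg φ (show mk u d = mk u 0 + mk 0 d by rw [mk_add, add_zero, zero_add])
  have hE : ∀ v, φ (mk _ _) = _ := fun v => (congrArg φ (chainSmall_succ_E v)).symm.trans (hφ.E v)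
  have hF : ∀ v, φ (mk _ _) = _ := fun v => (congrArg φ (chainSmall_succ_F v)).symm.trans (hφ.F v)
  have hK : ∀ v, φ (mk _ _) = _ := fun v => (congrArg φ (chainSmall_succ_K v)).symm.trans (hφ.K v)
  have eil : ∀ u, inl u = mk u 0 := fun _ => rfl
  have eir : ∀ u, inr u = mk 0 u := fun _ => rfl
  have E1 : ∀ u, B.E (φ (inl u)) = q p • φ (inl ((chainSmall hp n).E u)) := by
    intro u
    rw [eil u, ← hE, hadd]; simp
  have E2 : ∀ u, B.E (φ (inr u)) = φ (inl u) + (q p)⁻¹ • φ (inr ((chainSmall hp n).E u)) := by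
    intro u
    rw [eir u, ← hE, hadd]; simp
  have F1 : ∀ u, B.F (φ (inl u)) = φ (inl ((chainSmall hp n).F u)) + φ (inr ((chainSmall hp n).L u)) := by
    intro u
    rw [eil u, ← hF, hadd]; simp
  have F2 : ∀ u, B.F (φ (inr u)) = φ (inr ((chainSmall hp n).F u)) := by
    intro u
    rw [eir u, ← hF, hadd]; simp
  have K1 : ∀ u, B.K (φ (inl u)) = q p • φ (inl ((chainSmall hp n).K u)) := by
    intro u
    rw [eil u, ← hK, hadd]; simp
  have K2 : ∀ u, B.K (φ (inr u)) = (q p)⁻¹ • φ (inr ((chainSmall hp n).K u)) := by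
    intro u
    rw [eir u, ← hK, hadd]; simp
  have L1 : ∀ u, B.L (φ (inl u)) = (q p)⁻¹ • φ (inl ((chainSmall hp n).L u)) := by
    intro u
    have := congrArg B.L (K1 ((chainSmall hp n).L u))
    rw [B.LK, (chainSmall hp n).KL, map_smul] at this
    rw [this, smul_smul, inv_mul_cancel₀ hq, one_smul]
  have L2 : ∀ u, B.L (φ (inr u)) = q p • φ (inr ((chainSmall hp n).L u)) := by
    intro u
    have := congrArg B.L (K2 ((chainSmall hp n).L u))
    rw [B.LK, (chainSmall hp n).KL, map_smul] at this
    rw [this, smul_smul, mul_inv_cancel₀ hq, one_smul]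
  have hTg : SmallHom (A.T hp) (B.T hp) (LinearMap.prodMap g g : V × V →ₗ[ℂ] V' × V') := by
    refine ⟨fun v => Prod.ext ?_ ?_, fun v => Prod.ext ?_ ?_, fun v => Prod.ext ?_ ?_⟩
    all_goals
      simp [Small.T, Small.tE_apply, Small.tF_apply, Small.tK_apply, hg.E, hg.F, hg.K, hg.L]
  obtain ⟨ψ, h1, h2⟩ := h (V × V) (V' × V') (A.T hp) (B.T hp) (LinearMap.prodMap g g)
    (LinearMap.prod (φ ∘ₗ inr) (-q p • φ ∘ₗ inl)) hTg
    (fun y => by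
      obtain ⟨a, ha⟩ := hs y.1
      obtain ⟨b, hb⟩ := hs y.2
      exact ⟨(a, b), Prod.ext ha hb⟩)
    ⟨fun u => by
      change (φ (inr _), -q p • φ (inl _)) = B.tE (φ (inr u), -q p • φ (inl u))
      rw [B.tE_apply]
      refine Prod.ext ?_ ?_
      · simp only [E2]
        match_scalars <;> field_simp; simp
      · simp only [map_smul, E1]
        match_scalars; field_simp,
    fun u => by
      change (φ (inr _), -q p • φ (inl _)) = B.tF (φ (inr u), -q p • φ (inl u))
      rw [B.tF_apply]
      refine Prod.ext (F2 u).symm ?_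
      simp only [map_smul, F1, L2]
      match_scalars <;> field_simp; simp,
    fun u => by
      change (φ (inr _), -q p • φ (inl _)) = B.tK (φ (inr u), -q p • φ (inl u))
      rw [B.tK_apply]
      refine Prod.ext ?_ ?_
      · simp only [K2]
        match_scalars; field_simp
      · simp only [map_smul, K1]
        match_scalars; field_simp⟩
  have hE' : ∀ u, ψ ((chainSmall hp n).E u) = _ := fun u => h1.E u
  have hF' : ∀ u, ψ ((chainSmall hp n).F u) = _ := fun u => h1.F u
  have hK' : ∀ u, ψ ((chainSmall hp n).K u) = _ := fun u => h1.K u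
  have hL' : ∀ u, ψ ((chainSmall hp n).L u) = _ := fun u => h1.L u
  refine ⟨LinearMap.fst ℂ V V ∘ₗ ψ ∘ₗ mi - (q p)⁻¹ • LinearMap.snd ℂ V V ∘ₗ ψ ∘ₗ pl,
    ⟨fun v => ?_, fun v => ?_, fun v => ?_⟩, fun v => ?_⟩
  · rw [chainSmall_succ_E]
    simp only [lin_sub, lin_smul, comp_apply, pl_mk, mi_mk,
      LinearMap.fst_apply, LinearMap.snd_apply, map_add, map_smul, hE', map_sub]
    change (q p)⁻¹ • (A.tE (ψ (mi v))).1 - (q p)⁻¹ • (q p • (A.tE (ψ (pl v))).2 + _) = _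
    rw [A.tE_apply, A.tE_apply]
    match_scalars <;> field_simp; simp
  · rw [chainSmall_succ_F]
    simp only [lin_sub, lin_smul, comp_apply, pl_mk, mi_mk,
      LinearMap.fst_apply, LinearMap.snd_apply, map_add, map_smul, hF', hL', map_sub]
    change (q p)⁻¹ • A.L (ψ (pl v)).1 + (A.tF (ψ (mi v))).1 - (q p)⁻¹ • (A.tF (ψ (pl v))).2 = _
    rw [A.tF_apply, A.tF_apply]
    match_scalars <;> ring
  · rw [chainSmall_succ_K]
    simp only [lin_sub, lin_smul, comp_apply, pl_mk, mi_mk,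
      LinearMap.fst_apply, LinearMap.snd_apply, map_smul, hK', map_sub]
    change (q p)⁻¹ • (A.tK (ψ (mi v))).1 - (q p)⁻¹ • (q p • (A.tK (ψ (pl v))).2) = _
    rw [A.tK_apply, A.tK_apply]
    match_scalars <;> field_simp
  · have a1 := congrArg Prod.fst (h2 (mi v))
    have a2 := congrArg Prod.snd (h2 (pl v))
    change g (ψ (mi v)).1 = φ (inr (ε (mi v))) at a1
    change g (ψ (pl v)).2 = -q p • φ (inl (ε (pl v))) at a2
    have : XXZ.up ε v = mk (ε (pl v)) (ε (mi v)) := rfl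
    rw [this, hadd]
    simp only [lin_sub, lin_smul, comp_apply,
      LinearMap.fst_apply, LinearMap.snd_apply, map_sub, map_smul, a1, a2]
    match_scalars <;> field_simp

end smallLift

/-! ### The top component of the spin chain -/

section top

variable {p n m : ℕ} {hp : 2 ≤ p}

/-- The vector `+ + ⋯ +`. -/
def top : (n : ℕ) → Chain n
  | 0 => show Chain 0 from (1 : ℂ)
  | n + 1 => mk (top n) 0

lemma top_weight (n : ℕ) (φ : ℤ → ℂ) : chainDiag n φ (top n) = φ n • top n := by
  induction n generalizing φ with
  | zero => rw [diag_zero_apply]; rfl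
  | succ n ih =>
    refine chain_ext ?_ ?_
    · rw [pl_D]
      refine (ih _).trans ?_
      push_cast; rfl
    · rw [mi_D]
      refine (map_zero _).trans (smul_zero _).symm

lemma top_E (n : ℕ) {a : ℤ} (ha : a ≠ 0) : chainE p n a (top n) = 0 := by
  induction n with
  | zero => rw [chainE, if_neg ha]; rfl
  | succ n ih =>
    refine chain_ext ?_ ?_
    · rw [pl_E]
      change q p ^ a • chainE p n a (top n) + chainE p n (a - 1) (0 : Chain n) = 0
      rw [ih, map_zero, smul_zero, add_zero]
    · rw [mi_E]
      change q p ^ (-a) • chainE p n a (0 : Chain n) = 0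
      rw [map_zero, smul_zero]

lemma weight_bound {w : ℤ} {v : Chain n} (h : ∀ φ, chainDiag n φ v = φ w • v)
    (hw : w < -n ∨ (n : ℤ) < w) : v = 0 := by
  have h1 := h fun x => if x = w then 1 else 0
  rw [if_pos rfl, one_smul] at h1
  rw [← h1, diag_congr n (ψ := fun x => (0 : ℂ) * (1 : ℂ)) (fun x hx => by
    rw [Finset.mem_Icc] at hx
    rw [if_neg (by omega), zero_mul]), ← diag_smul, zero_smul]
  rfl

lemma F_weight {w : ℤ} {v : Chain n} (h : ∀ φ, chainDiag n φ v = φ w • v) (a : ℤ) (φ : ℤ → ℂ) :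
    chainDiag n φ (chainF p n a v) = φ (w - 2 * a) • chainF p n a v := by
  have := lin_congr (diag_F (p := p) n φ a) v
  rw [mul_apply, mul_apply, h, map_smul] at this
  exact this

lemma top_F {a : ℤ} (ha : n < a) : chainF p n a (top n) = 0 :=
  weight_bound (F_weight (top_weight n) a) (by omega)

lemma diag_top (v : Chain n) : ∃ c : ℂ, chainDiag n (fun x => if x = n then 1 else 0) v = c • top n := by
  induction n with
  | zero =>
    refine ⟨show ℂ from v, ?_⟩
    rw [diag_zero_apply]
    change (if (0 : ℤ) = ((0 : ℕ) : ℤ) then (1 : ℂ) else 0) • v = _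
    rw [Nat.cast_zero, if_pos rfl, one_smul]
    exact (mul_one (show ℂ from v)).symm
  | succ n ih =>
    obtain ⟨c, hc⟩ := ih (pl v)
    refine ⟨c, chain_ext ?_ ?_⟩
    · rw [pl_D]
      refine Eq.trans ?_ hc
      congr 2; funext x
      push_cast
      simp
    · rw [mi_D, diag_congr n (ψ := fun x => (0 : ℂ) * (1 : ℂ)) (fun x hx => by
        rw [Finset.mem_Icc] at hx
        rw [if_neg (by push_cast; omega), zero_mul]), ← diag_smul, zero_smul]
      exact (smul_zero c).symm

lemma coHW_top_ext {l l' : Chain n →ₗ[ℂ] ℂ} (h : IsCoHW p n l) (h' : IsCoHW p n l')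
    (he : l (top n) = l' (top n)) : l = l' := by
  refine ext fun v => ?_
  obtain ⟨c, hc⟩ := diag_top v
  have h1 := h.D (fun x => if x = n then 1 else 0) v
  have h2 := h'.D (fun x => if x = n then 1 else 0) v
  rw [hc, if_pos rfl, one_mul] at h1 h2
  rw [← h1, ← h2, map_smul, map_smul, he]

lemma exists_coHW_top (hp : 2 ≤ p) (n : ℕ) : ∃ l : Chain n →ₗ[ℂ] ℂ, IsCoHW p n l ∧ l (top n) = 1 := by
  let l0 : LinkState n n := ⟨id, fun _ => rfl, fun x y h1 h2 => absurd h1 h2.not_gt, by simp⟩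
  have h1 := isCoHW_lam hp l0
  have h2 : lam p l0 ≠ 0 := (linearIndependent_lam n n).ne_zero l0
  have h3 : lam p l0 (top n) ≠ 0 := fun h => h2 (coHW_top_ext h1 (coHW p n n).zero_mem h)
  exact ⟨(lam p l0 (top n))⁻¹ • lam p l0, (coHW p n n).smul_mem _ h1, inv_mul_cancel₀ h3⟩

def topv (hp : 2 ≤ p) (n : ℕ) : HC hp n := (RepSpace.out (chainRep hp n)).symm (top n)

variable (hm : m + 1 ≤ p)

lemma simple_hom_ext {s r : ℕ} {hs : s ≤ p} {Y : Type} [AddCommGroup Y] [Module (U p) Y]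
    {f g : SX hp hs r →ₗ[U p] Y} (h : f (sv hp hs r 0 0) = g (sv hp hs r 0 0)) : f = g := by
  have h1 := sx_span (W := LinearMap.eqLocus f g) h
  refine ext fun x => ?_
  have : x ∈ LinearMap.eqLocus f g := by rw [h1]; trivial
  exact this

lemma exists_incl : ∃ ι : SX hp hm 1 →ₗ[U p] HC hp m, ι (sv hp hm 1 0 0) = topv hp m := by
  have hF : ∀ x : Chain m, chainF p m p x = 0 → ∀ y : HC hp m, y = (RepSpace.out _).symm x →
      U.gen p .f • y = 0 := by
    intro x hx y hy
    rw [hy, hc_smul]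
    change (RepSpace.out _).symm ((-1 : ℂ) ^ p • chainF p m p x) = 0
    rw [hx, smul_zero, map_zero]
  have he : U.gen p .e • topv hp m = 0 := by
    rw [hc_smul]
    change (RepSpace.out _).symm ((chainDiag m (fun x => q p ^ x) ^ p) (chainE p m p (top m))) = 0
    rw [top_E _ (by omega), map_zero, map_zero]
  have hf : U.gen p .f • topv hp m = 0 := hF _ (top_F (by omega)) _ rfl
  obtain ⟨φ, hφ⟩ := exists_simple_hom hp hm (by omega) le_rfl (topv hp m)
    (by
      rw [hc_smul]
      change (RepSpace.out _).symm (chainDiag m (fun x => q p ^ x) (top m)) = _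
      rw [top_weight, map_smul]; simp; rfl)
    (by
      rw [hc_smul]
      change (RepSpace.out _).symm (chainE p m 1 (top m)) = 0
      rw [top_E _ one_ne_zero, map_zero])
    he
    (by
      rw [h_eq, smul_assoc, sub_smul, mul_smul, mul_smul, he, hf]; simp)
    (by
      have : ∀ j : ℕ, ∀ x : Chain m, U.gen p .F ^ j • (RepSpace.out (chainRep hp m)).symm x =
          (RepSpace.out (chainRep hp m)).symm ((chainF p m 1 ^ j) x) := by
        intro j
        induction j with
        | zero => intro x; simp
        | succ j ih => intro x; rw [pow_succ, mul_smul, hc_smul, pow_succ]; exact ih _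
      rw [topv, this, F_pow hp, lin_smul, top_F (by push_cast; omega), smul_zero, map_zero])
    (by rw [pow_one, hf])
  refine ⟨φ, ?_⟩
  have h2 : φ (vec 0 0 : Fin (m + 1) × Fin 1 → ℂ) = topv hp m := by
    simpa using hφ 0 0 (by omega) (by omega)
  exact h2

/-- The embedding of `X_{m+1,1}` into the spin chain of length `m`. -/
def incl : SX hp hm 1 →ₗ[U p] HC hp m := (exists_incl (hp := hp) hm).choose

lemma incl_sv : incl hm (sv hp hm 1 0 0) = topv hp m := (exists_incl (hp := hp) hm).choose_spec

lemma top_ne (n : ℕ) : top n ≠ 0 := by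
  induction n with
  | zero => exact one_ne_zero (α := ℂ)
  | succ n ih => exact fun h => ih (congrArg pl h)

lemma incl_injective : Injective (incl (hp := hp) hm) :=
  simple_hom_injective hm (by omega) le_rfl _ fun h => top_ne m (by
    have := incl_sv (hp := hp) hm
    rw [h] at this
    exact this.symm)

/-- The isomorphism of `X_{m+1,1}` with a contragredient Weyl module. -/
def simpleCo : SX hp hm 1 ≃ₗ[U p] CW hp m :=
  LinearEquiv.ofBijective _ (socCoweyl_bijective hm (by omega) (show m + 1 = (1 - 1) * p + (m + 1) by omega))

lemma hom_top_ext {f g : HC hp m →ₗ[U p] SX hp hm 1} (h : f (topv hp m) = g (topv hp m)) : f = g := by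
  have h1 : (simpleCo (hp := hp) hm).toLinearMap.comp f = (simpleCo hm).toLinearMap.comp g := by
    refine coHead_injective (coHW_top_ext (isCoHW_coHead _) (isCoHW_coHead _) ?_)
    change evw (simpleCo hm (f (topv hp m))) _ = evw (simpleCo hm (g (topv hp m))) _
    rw [h]
  refine ext fun v => (simpleCo (hp := hp) hm).injective (lin_congr h1 v)

lemma exists_proj : ∃ π : HC hp m →ₗ[U p] SX hp hm 1, π (topv hp m) = sv hp hm 1 0 0 := by
  obtain ⟨l, hl, hl1⟩ := exists_coHW_top hp m
  refine ⟨(simpleCo hm).symm.toLinearMap.comp (xiHom hl), ?_⟩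
  refine (simpleCo (hp := hp) hm).injective ?_
  refine ((simpleCo hm).apply_symm_apply _).trans ?_
  have : simpleCo hm (sv hp hm 1 0 0) = cd hp m 0 := socCoweyl_sv hm (by omega) le_rfl (by omega)
  rw [this]
  refine cd_ext fun i hi => ?_
  rw [ev_xiHom]
  refine Eq.trans ?_ (ev_cd 0 hi).symm
  change l (chainE p m i (top m)) = _
  by_cases h : i = 0
  · subst h
    rw [Nat.cast_zero, if_pos rfl, (E_zero m).1]; exact hl1
  · rw [if_neg (by omega), top_E _ (by omega), map_zero]

/-- The projection of the spin chain of length `m` onto `X_{m+1,1}`. -/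
def proj : HC hp m →ₗ[U p] SX hp hm 1 := (exists_proj (hp := hp) hm).choose

lemma proj_top : proj hm (topv hp m) = sv hp hm 1 0 0 := (exists_proj (hp := hp) hm).choose_spec

lemma proj_comp_incl : (proj (hp := hp) hm).comp (incl hm) = LinearMap.id :=
  simple_hom_ext (by rw [comp_apply, incl_sv, proj_top]; rfl)

lemma proj_incl (x : SX hp hm 1) : proj hm (incl hm x) = x := lin_congr (proj_comp_incl hm) x

/-- The projector onto the top component of the spin chain. -/
def tp (hp : 2 ≤ p) (hm : m + 1 ≤ p) : Chain m →ₗ[ℂ] Chain m := under ((incl (hp := hp) hm).comp (proj hm))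

lemma isU_tp : IsU p (tp hp hm) := isU_under _

/-- The map of modules given by adding a site in front. -/
def upHom {n : ℕ} (f : HC hp m →ₗ[U p] HC hp n) : HC hp (m + 1) →ₗ[U p] HC hp (n + 1) :=
  (isU_under f).up.hom hp

lemma upHom_topv (f : HC hp m →ₗ[U p] HC hp m) (h : f (topv hp m) = topv hp m) :
    upHom f (topv hp (m + 1)) = topv hp (m + 1) := by
  change (mk (under f (top m)) (under f 0) : Chain (m + 1)) = mk (top m) 0
  rw [map_zero]
  exact congrArg (fun x => mk x 0) h

lemma tpHom_topv : ((incl (hp := hp) hm).comp (proj hm)) (topv hp m) = topv hp m := by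
  rw [comp_apply, proj_top, incl_sv]

lemma tp_zero (h0 : 0 + 1 ≤ p) : tp hp h0 = LinearMap.id := by
  refine ext fun v => ?_
  have h1 : v = (show ℂ from v) • top 0 := (mul_one (show ℂ from v)).symm
  have h2 : tp hp h0 (top 0) = top 0 := tpHom_topv _
  rw [LinearMap.id_apply, h1, map_smul, h2]

end top

/-! ### Decomposition of the spin chain -/

section fusion

variable {p m : ℕ} {hp : 2 ≤ p}

/-- `1 ⊗ X_{m+2,1}` is the sum of `X_{m+3,1}` and `X_{m+1,1}`, in terms of projectors. -/
lemma exists_fusion (hm : m + 1 + 1 + 1 ≤ p) : ∃ f : Chain m →ₗ[ℂ] Chain (m + 2),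
    ∃ g : Chain (m + 2) →ₗ[ℂ] Chain m, IsU p f ∧ IsU p g ∧
      up (tp hp (m := m + 1) (by omega)) = tp hp (m := m + 2) hm +
        f ∘ₗ tp hp (m := m) (by omega) ∘ₗ g := by
  have hm1 : m + 1 + 1 ≤ p := by omega
  have hm0 : m + 1 ≤ p := by omega
  set Q1 : HC hp (m + 1) →ₗ[U p] HC hp (m + 1) := (incl (hp := hp) hm1).comp (proj hm1) with hQ1
  set P : HC hp (m + 2) →ₗ[U p] HC hp (m + 2) := upHom Q1 with hP
  set Q2 : HC hp (m + 2) →ₗ[U p] HC hp (m + 2) := (incl (hp := hp) hm).comp (proj hm) with hQ2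
  have hPP : ∀ v, P (P v) = P v := by
    intro v
    have : ∀ x, Q1 (Q1 x) = Q1 x := fun x => congrArg (incl hm1) (proj_incl hm1 _)
    exact chain_ext (this _) (this _)
  have hPi : ∀ x, P (incl hm x) = incl hm x := by
    have : P.comp (incl hm) = incl hm := simple_hom_ext (by
      rw [comp_apply, incl_sv, hP, upHom_topv _ (tpHom_topv hm1)])
    exact fun x => lin_congr this x
  have hQP : ∀ v, Q2 (P v) = Q2 v := by
    have : (proj hm).comp P = proj hm := hom_top_ext hm (by
      rw [comp_apply, hP, upHom_topv _ (tpHom_topv hm1)])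
    exact fun v => congrArg (incl hm) (lin_congr this v)
  let cu : HC hp m →ₗ[U p] HC hp (m + 2) := (isU_cup (p := p) (n := m)).hom hp
  let G : SX hp hm0 1 →ₗ[U p] HC hp (m + 2) := P.comp (cu.comp (incl hm0))
  have hPG : ∀ x, P (G x) = G x := fun x => hPP _
  have hG0 : G ≠ 0 := by
    intro h
    have h1 : P (cu (incl hm0 (sv hp hm0 1 0 0))) = 0 := lin_congr h _
    rw [incl_sv] at h1
    have e : mk (-(q p) • top m) 0 = -(q p) • mk (top m) 0 := by rw [mk_smul, smul_zero]
    have h2 : Q1 ((-(q p)) • topv hp (m + 1)) = 0 :=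
      (congrArg (fun x : Chain (m + 1) => Q1 (show HC hp (m + 1) from x)) e.symm).trans (congrArg mi h1)
    rw [hom_smul, hQ1, tpHom_topv] at h2
    exact top_ne (m + 1) ((smul_eq_zero.1 h2).resolve_left (neg_ne_zero.2 (q_ne p)))
  have hGi : Injective G := simple_hom_injective hm0 (by omega) le_rfl _ hG0
  have hpG : ∀ x, proj hm (G x) = 0 := by
    have : (proj hm).comp G = 0 := by
      by_contra h
      have h1 := simple_hom_injective hm0 (by omega) le_rfl _ h
      have h2 := simple_hom_surjective hm (by omega) le_rfl _ h
      have h3 := (LinearEquiv.ofBijective (toC ((proj hm).comp G)) ⟨h1, h2⟩).finrank_eq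
      rw [finrank_SX, finrank_SX] at h3
      omega
    exact fun x => lin_congr this x
  let J : SX hp hm 1 × SX hp hm0 1 →ₗ[ℂ] HC hp (m + 2) :=
    LinearMap.coprod (toC (incl hm)) (toC G)
  have hJ : ∀ x y, J (x, y) = incl hm x + G y := fun _ _ => rfl
  have hJi : Injective J := by
    rw [← LinearMap.ker_eq_bot, eq_bot_iff]
    rintro ⟨x, y⟩ h
    rw [mem_ker, hJ] at h
    have h1 := congrArg (proj hm) h
    rw [map_add, proj_incl, hpG, add_zero, map_zero] at h1
    rw [h1, map_zero, zero_add] at h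
    have h2 : y = 0 := hGi (by rw [h, map_zero])
    rw [h1, h2]; rfl
  have fdS : ∀ {s : ℕ} (hs : s ≤ p), FiniteDimensional ℂ (SX hp hs 1) := fun {s} hs =>
    inferInstanceAs (FiniteDimensional ℂ (Fin s × Fin 1 → ℂ))
  have := fdS hm
  have := fdS hm0
  have := fdS hm1
  let under1 : ∀ h : m + 1 + 1 ≤ p, SX hp h 1 →ₗ[ℂ] Chain (m + 1) := fun h =>
    show SX hp h 1 →ₗ[ℂ] HC hp (m + 1) from toC (incl h)
  let I : SX hp hm1 1 × SX hp hm1 1 →ₗ[ℂ] HC hp (m + 2) :=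
    show _ →ₗ[ℂ] Chain (m + 1) × Chain (m + 1) from LinearMap.prodMap (under1 hm1) (under1 hm1)
  have hle : range J ≤ range I := by
    rintro _ ⟨⟨x, y⟩, rfl⟩
    have h1 : J (x, y) = P (J (x, y)) := by rw [hJ, map_add, hPi, hPG]
    rw [h1]
    exact ⟨(proj hm1 (pl (J (x, y) : HC hp (m + 2))), proj hm1 (mi (J (x, y) : HC hp (m + 2)))), rfl⟩
  have heq : range J = range I := by
    refine Submodule.eq_of_le_of_finrank_le hle ((LinearMap.finrank_range_le I).trans ?_)
    rw [LinearMap.finrank_range_of_inj hJi, Module.finrank_prod, Module.finrank_prod, finrank_SX,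
      finrank_SX, finrank_SX]
    omega
  have hR : ∀ v, (P - Q2) v ∈ range G := by
    intro v
    have h1 : P v ∈ range J := by
      rw [heq]
      exact ⟨(proj hm1 (pl (v : HC hp (m + 2))), proj hm1 (mi (v : HC hp (m + 2)))), rfl⟩
    obtain ⟨⟨x, y⟩, h2⟩ := h1
    refine ⟨y, ?_⟩
    rw [lin_sub, ← hQP, ← h2, hJ, hQ2, map_add]
    change G y = _ - (incl hm (proj hm _) + incl hm (proj hm _))
    rw [proj_incl, hpG, map_zero, add_zero, add_sub_cancel_left]
  let π' : HC hp (m + 2) →ₗ[U p] SX hp hm0 1 :=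
    (LinearEquiv.ofInjective G hGi).symm.toLinearMap.comp ((P - Q2).codRestrict _ hR)
  have hπ' : ∀ v, G (π' v) = P v - Q2 v := by
    intro v
    have := (LinearEquiv.ofInjective G hGi).apply_symm_apply ⟨(P - Q2) v, hR v⟩
    exact congrArg Subtype.val this
  refine ⟨under (G.comp (proj hm0)), under ((incl hm0).comp π'), isU_under _, isU_under _, ?_⟩
  refine ext fun v => ?_
  have e2 : G (proj hm0 (incl hm0 (proj hm0 (incl hm0 (π' v))))) = P v - Q2 v := by
    rw [proj_incl, proj_incl]; exact hπ' v
  exact (add_sub_cancel (Q2 v) (P v)).symm.trans (congrArg (Q2 v + ·) e2.symm)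

lemma up_tp_zero (h1 : 0 + 1 ≤ p) (h2 : 1 + 1 ≤ p) : up (tp hp h1) = tp hp h2 := by
  rw [tp_zero]
  have hs : Surjective (toC (incl (hp := hp) h2)) := by
    have fd1 : FiniteDimensional ℂ (SX hp h2 1) :=
      inferInstanceAs (FiniteDimensional ℂ (Fin (1 + 1) × Fin 1 → ℂ))
    have fd2 : FiniteDimensional ℂ (HC hp 1) := inferInstanceAs (FiniteDimensional ℂ (ℂ × ℂ))
    refine (LinearMap.injective_iff_surjective_of_finrank_eq_finrank ?_).1 (incl_injective h2)
    rw [finrank_SX]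
    have : finrank ℂ (ℂ × ℂ) = 2 := by simp
    exact this.symm
  refine ext fun v => ?_
  obtain ⟨x, hx⟩ := hs v
  have h3 : (incl (hp := hp) h2).comp (proj h2) (incl h2 x) = incl h2 x :=
    congrArg (incl h2) (proj_incl h2 x)
  have h4 : incl h2 x = v := hx
  rw [h4] at h3
  exact h3.symm

end fusion

section lift

variable {p m n : ℕ} {hp : 2 ≤ p}

lemma qInt_key (hp : 2 ≤ p) (s n : ℤ) :
    qInt p (n + 1) * qInt p (s - (n + 1)) = qInt p n * qInt p (s - n) +
      (q p - (q p)⁻¹)⁻¹ * (q p ^ (s - 1 - 2 * n) - q p ^ (-(s - 1 - 2 * n))) := by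
  have hq := q_ne p
  have hq' := q_sub_ne hp
  simp only [qInt]
  have e1 : s - (n + 1) = s - n - 1 := by ring
  have e2 : s - 1 - 2 * n = s - n - n - 1 := by ring
  rw [e1, e2]
  simp only [zpow_add₀ hq, zpow_sub₀ hq, zpow_neg, zpow_one]
  have := zpow_ne_zero n hq
  have := zpow_ne_zero s hq
  have hq2 : q p ^ 2 - 1 ≠ 0 := fun h => hq' (by field_simp; linear_combination h)
  field_simp
  ring

variable {V : Type} [AddCommGroup V] [Module ℂ V] (A : Small p V)

lemma Small.K_E_pow {z : V} {w : ℤ} (hK : A.K z = q p ^ w • z) (n : ℕ) :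
    A.K ((A.E ^ n) z) = q p ^ (w + 2 * n) • (A.E ^ n) z := by
  induction n with
  | zero => simpa using hK
  | succ n ih =>
    rw [pow_succ_apply', A.KE, ih, map_smul, smul_smul, ← zpow_add₀ (q_ne p)]
    congr 2; push_cast; ring

lemma Small.K_F_pow {z : V} {w : ℤ} (hK : A.K z = q p ^ w • z) (n : ℕ) :
    A.K ((A.F ^ n) z) = q p ^ (w - 2 * n) • (A.F ^ n) z := by
  induction n with
  | zero => simpa using hK
  | succ n ih =>
    rw [pow_succ_apply', A.KF, ih, map_smul, smul_smul, ← zpow_add₀ (q_ne p)]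
    congr 2; push_cast; ring

lemma Small.L_of_K {z : V} {w : ℤ} (hK : A.K z = q p ^ w • z) : A.L z = q p ^ (-w) • z := by
  have h := congrArg A.L hK
  rw [A.LK, map_smul] at h
  conv_rhs => rw [h]
  rw [smul_smul, ← zpow_add₀ (q_ne p)]; simp

lemma Small.E_F_pow (hp : 2 ≤ p) {z : V} {s : ℤ} (hK : A.K z = q p ^ (s - 1) • z) (hE : A.E z = 0)
    (n : ℕ) : A.E ((A.F ^ (n + 1)) z) =
      (qInt p (n + 1) * qInt p (s - (n + 1))) • (A.F ^ n) z := by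
  induction n with
  | zero =>
    have h := qInt_key hp s 0
    rw [qInt_zero, zero_mul, zero_add ((q p - (q p)⁻¹)⁻¹ * _)] at h
    rw [zero_add, pow_one, A.EF, hE, map_zero, zero_add, hK, A.L_of_K hK, ← sub_smul, smul_smul,
      pow_zero, one_apply, Nat.cast_zero, h]
    simp
  | succ n ih =>
    have h := A.K_F_pow hK (n + 1)
    rw [pow_succ_apply', A.EF, ih, map_smul, ← pow_succ_apply', h, A.L_of_K h, ← sub_smul, smul_smul,
      ← add_smul]
    have h2 := qInt_key hp s (n + 1)
    push_cast
    rw [h2]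

lemma Small.E_pow_F_pow (hp : 2 ≤ p) {z : V} {s : ℕ} (hs : s ≤ p)
    (hK : A.K z = q p ^ ((s : ℤ) - 1) • z) (hE : A.E z = 0) (n : ℕ) (hn : n < s) :
    ∃ c : ℂ, c ≠ 0 ∧ (A.E ^ n) ((A.F ^ n) z) = c • z := by
  induction n with
  | zero => exact ⟨1, one_ne_zero, by simp⟩
  | succ n ih =>
    obtain ⟨c, hc, h⟩ := ih (by omega)
    refine ⟨qInt p (n + 1) * qInt p (s - (n + 1)) * c, mul_ne_zero (mul_ne_zero ?_ ?_) hc, ?_⟩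
    · rw [Ne, qInt_eq_zero_iff hp]
      intro h; have := Int.le_of_dvd (by omega) h; omega
    · rw [Ne, qInt_eq_zero_iff hp]
      intro h; have := Int.le_of_dvd (by omega) h; omega
    · rw [pow_succ, mul_apply, A.E_F_pow hp hK hE, map_smul, h, smul_smul]

/-- The average of a vector over the powers of `K` is a weight vector. -/
lemma Small.K_average (w : ℤ) (z : V) (hp : 2 ≤ p) :
    A.K (∑ i ∈ Finset.range (2 * p), q p ^ (-(w * i)) • (A.K ^ i) z) =
      q p ^ w • ∑ i ∈ Finset.range (2 * p), q p ^ (-(w * i)) • (A.K ^ i) z := by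
  have h : ∀ i : ℕ, A.K (q p ^ (-(w * i)) • (A.K ^ i) z) =
      q p ^ w • (q p ^ (-(w * ((i + 1 : ℕ) : ℤ))) • (A.K ^ (i + 1)) z) := by
    intro i
    rw [map_smul, smul_smul, ← zpow_add₀ (q_ne p), pow_succ_apply']
    congr 2; push_cast; ring
  rw [map_sum, Finset.sum_congr rfl fun i _ => h i, ← Finset.smul_sum]
  congr 1
  have h1 := Finset.sum_range_succ (fun i : ℕ => q p ^ (-(w * i)) • (A.K ^ i) z) (2 * p)
  have h2 := Finset.sum_range_succ' (fun i : ℕ => q p ^ (-(w * i)) • (A.K ^ i) z) (2 * p)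
  rw [h1] at h2
  have h3 : q p ^ (-(w * ((2 * p : ℕ) : ℤ))) • (A.K ^ (2 * p)) z = z := by
    rw [A.Kpow, show (-(w * ((2 * p : ℕ) : ℤ))) = ((2 * p : ℕ) : ℤ) * (-w) by ring, zpow_mul,
      zpow_natCast, q_pow_two_mul hp, one_zpow, one_smul]
  rw [h3] at h2
  simp only [Nat.cast_zero, mul_zero, neg_zero, zpow_zero, pow_zero, one_apply,
    one_smul] at h2
  exact (add_right_cancel h2).symm

/-- The Steinberg-type projector has the lifting property. -/
lemma smallLift_tp (hm : m + 1 = p) : SmallLift hp (tp hp hm.le) := by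
  intro V V' _ _ _ _ A B g φ hg hs hφ
  have hKm : ∀ f : Module.End ℂ V, ∀ f' : Module.End ℂ V', (∀ v, g (f v) = f' (g v)) →
      ∀ n v, g ((f ^ n) v) = (f' ^ n) (g v) := by
    intro f f' h n v
    induction n with
    | zero => rfl
    | succ n ih => rw [pow_succ_apply', h, ih, pow_succ_apply']
  obtain ⟨y1, hy1⟩ := hs (φ (top m))
  set y0 := φ (top m)
  have hK0 : B.K y0 = q p ^ ((p : ℤ) - 1) • y0 := by
    rw [← hφ.K]
    change φ (chainDiag m (fun x => q p ^ x) (top m)) = _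
    rw [top_weight, map_smul]
    congr 2; omega
  have hE0 : B.E y0 = 0 := by
    rw [← hφ.E]
    change φ (chainE p m 1 (top m)) = 0
    rw [top_E _ one_ne_zero, map_zero]
  set w : ℤ := (p : ℤ) - 1
  obtain ⟨y2, hy2, hK2⟩ : ∃ y2, g y2 = y0 ∧ A.K y2 = q p ^ w • y2 := by
    have hp0 : ((2 * p : ℕ) : ℂ) ≠ 0 := by exact_mod_cast (by omega : 2 * p ≠ 0)
    refine ⟨((2 * p : ℕ) : ℂ)⁻¹ • ∑ i ∈ Finset.range (2 * p), q p ^ (-(w * i)) • (A.K ^ i) y1, ?_, ?_⟩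
    · have h : ∀ i : ℕ, g (q p ^ (-(w * i)) • (A.K ^ i) y1) = y0 := by
        intro i
        rw [map_smul, hKm _ _ hg.K, hy1]
        induction i with
        | zero => simp
        | succ i ih =>
          rw [pow_succ, mul_apply, hK0, map_smul, smul_smul, ← zpow_add₀ (q_ne p)]
          refine Eq.trans ?_ ih
          congr 2; push_cast; ring
      rw [map_smul, map_sum, Finset.sum_congr rfl fun i _ => h i, Finset.sum_const,
        Finset.card_range, ← Nat.cast_smul_eq_nsmul ℂ, smul_smul, inv_mul_cancel₀ hp0, one_smul]
    · rw [map_smul, A.K_average w y1 hp, smul_comm]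
  obtain ⟨c, hc, hc2⟩ := B.E_pow_F_pow hp le_rfl hK0 hE0 m (by omega)
  set y : V := c⁻¹ • (A.E ^ m) ((A.F ^ m) y2)
  have hy : g y = y0 := by
    rw [map_smul, hKm _ _ hg.E, hKm _ _ hg.F, hy2, hc2, smul_smul, inv_mul_cancel₀ hc, one_smul]
  have hKy : A.K y = q p ^ ((p : ℤ) - 1) • y := by
    have := A.K_E_pow (A.K_F_pow hK2 m) m
    rw [sub_add_cancel] at this
    rw [map_smul, this, smul_comm]
  have hEy : A.E y = 0 := by
    rw [map_smul, ← pow_succ_apply', hm, A.Epow, smul_zero]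
  let S : (Fin (m + 1) × Fin 1 → ℂ) →ₗ[ℂ] V := Fintype.linearCombination ℂ
    fun j : Fin (m + 1) × Fin 1 => (A.F ^ (j.1 : ℕ)) y
  have hS : ∀ n : ℕ, n ≤ m + 1 → S (vec n 0) = (A.F ^ n) y := by
    intro n hn
    by_cases h : n < m + 1
    · have := vec_eq_single (⟨n, h⟩ : Fin (m + 1)) (0 : Fin 1)
      simp only [Fin.val_zero, Nat.cast_zero] at this
      rw [this, Fintype.linearCombination_apply_single, one_smul]
    · rw [vec_zero (by push_cast; omega), map_zero, show n = p by omega, A.Fpow]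
  let X : Small p (Fin (m + 1) × Fin 1 → ℂ) := Small.ofIsUq _ (simple_isUq (r := 1) hp hm.le)
  have hXE : ∀ n : ℤ, X.E (vec n 0) = (qInt p n * qInt p ((m + 1 : ℕ) - n)) • vec (n - 1) 0 := by
    intro n
    have := (sv_gen (hp := hp) (hs := hm.le) (r := 1) .E n 0).symm.trans (sv_E n 0)
    rw [Nat.sub_self, pow_zero, one_mul] at this
    exact this
  have hXF : ∀ n : ℤ, n ≠ -1 → X.F (vec n 0) = vec (n + 1) 0 := by
    intro n hn
    exact (sv_gen (hp := hp) (hs := hm.le) (r := 1) .F n 0).symm.trans (sv_F hn 0)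
  have hXK : ∀ n : ℤ, X.K (vec n 0) = q p ^ (((m + 1 : ℕ) : ℤ) - 1 - 2 * n) • vec n 0 := by
    intro n
    have := (sv_gen (hp := hp) (hs := hm.le) (r := 1) .K n 0).symm.trans (sv_K n 0)
    rw [Nat.sub_self, pow_zero, one_mul] at this
    exact this
  have ext : ∀ {Z : Type} [AddCommGroup Z] [Module ℂ Z] {S T : (Fin (m + 1) × Fin 1 → ℂ) →ₗ[ℂ] Z},
      (∀ n : ℕ, n < m + 1 → S (vec n 0) = T (vec n 0)) → ∀ v, S v = T v := by
    intro Z _ _ S T h v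
    refine lin_congr (simple_ext fun n k hn hk => ?_) v
    obtain rfl : k = 0 := by omega
    exact h n hn
  have hSh : SmallHom X A S := by
    refine ⟨ext (S := S ∘ₗ X.E) (T := A.E ∘ₗ S) fun n hn => ?_,
      ext (S := S ∘ₗ X.F) (T := A.F ∘ₗ S) fun n hn => ?_,
      ext (S := S ∘ₗ X.K) (T := A.K ∘ₗ S) fun n hn => ?_⟩
    · rw [comp_apply, comp_apply, hXE, hS n hn.le]
      cases n with
      | zero => rw [Nat.cast_zero, qInt_zero, zero_mul, zero_smul, map_zero, pow_zero]; exact hEy.symm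
      | succ n =>
        rw [A.E_F_pow hp hKy hEy, map_smul, show ((n + 1 : ℕ) : ℤ) - 1 = n by push_cast; ring,
          hS n (by omega), hm]
        push_cast; rfl
    · rw [comp_apply, comp_apply, hXF _ (by omega), hS n hn.le, ← pow_succ_apply']
      exact hS (n + 1) (by omega)
    · rw [comp_apply, comp_apply, hXK, hS n hn.le, A.K_F_pow hKy, map_smul,
        hS n hn.le, hm]
  let pr : HC hp m →ₗ[U p] SX hp hm.le 1 := proj hm.le
  let pr' : Chain m →ₗ[ℂ] (Fin (m + 1) × Fin 1 → ℂ) := show HC hp m →ₗ[ℂ] SX hp hm.le 1 from toC pr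
  have hπ : SmallHom (chainSmall hp m) X pr' := by
    have key : ∀ x (v : Chain m), pr' (chainGen p m x v) = simpleGen p (m + 1) 1 x (pr' v) := by
      intro x v
      have h1 := map_smul pr (U.gen p x) ((RepSpace.out (chainRep hp m)).symm v)
      rw [hc_smul] at h1
      exact h1.trans (gen_smul_lift _ _ _ _)
    exact ⟨key .E, key .F, key .K⟩
  let ic : SX hp hm.le 1 →ₗ[U p] HC hp m := incl hm.le
  let ic' : (Fin (m + 1) × Fin 1 → ℂ) →ₗ[ℂ] Chain m := show SX hp hm.le 1 →ₗ[ℂ] HC hp m from toC ic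
  refine ⟨S ∘ₗ pr', hSh.comp hπ, fun v => ?_⟩
  have h1 : ∀ x : Fin (m + 1) × Fin 1 → ℂ, g (S x) = φ (ic' x) := by
    refine ext (S := g ∘ₗ S) (T := φ ∘ₗ ic') fun n hn => ?_
    rw [comp_apply, comp_apply, hS n hn.le, hKm _ _ hg.F, hy]
    have h2 : ∀ j : ℕ, φ ((chainF p m 1 ^ j) (top m)) = (B.F ^ j) y0 := by
      intro j
      induction j with
      | zero => rfl
      | succ j ih =>
        rw [pow_succ_apply', pow_succ_apply', ← ih]
        exact hφ.F _
    rw [← h2]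
    congr 1
    have h3 : ∀ j : ℕ, U.gen p .F ^ j • topv hp m =
        (RepSpace.out (chainRep hp m)).symm ((chainF p m 1 ^ j) (top m)) := by
      intro j
      induction j with
      | zero => rw [pow_zero, one_smul]; rfl
      | succ j ih => rw [pow_succ', mul_smul, ih, hc_smul, pow_succ_apply']; rfl
    have h4 : incl hm.le (sv hp hm.le 1 n 0) = U.gen p .F ^ n • topv hp m := by
      rw [← incl_sv hm.le, ← map_smul, sv_F_pow n le_rfl]; simp
    exact (h4.trans (h3 n)).symm
  exact h1 _

end lift

section decomposition

variable {p n : ℕ} {hp : 2 ≤ p}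

/-- The endomorphisms of the spin chain that factor through a shorter chain on which `e` and `f`
act by zero. -/
def IsShort (hp : 2 ≤ p) {n : ℕ} (χ : Chain n →ₗ[ℂ] Chain n) : Prop :=
  ∃ (m : ℕ) (hm : m + 2 ≤ p) (f : Chain m →ₗ[ℂ] Chain n) (g : Chain n →ₗ[ℂ] Chain m),
    IsU p f ∧ IsU p g ∧ χ = f ∘ₗ tp hp (show m + 1 ≤ p by omega) ∘ₗ g

lemma up_short {χ : Chain n →ₗ[ℂ] Chain n} (h : IsShort hp χ) : ∃ ε κ : Chain (n + 1) →ₗ[ℂ] Chain (n + 1),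
    up χ = ε + κ ∧ SmallLift hp ε ∧ κ ∈ AddSubmonoid.closure {κ | IsShort hp κ} := by
  obtain ⟨m, hm, f, g, hf, hg, rfl⟩ := h
  have hm1 : m + 1 + 1 ≤ p := hm
  have h1 : up (f ∘ₗ tp hp (show m + 1 ≤ p by omega) ∘ₗ g) =
      up f ∘ₗ up (tp hp (show m + 1 ≤ p by omega)) ∘ₗ up g := rfl
  have h2 : ∃ ε κ : Chain (n + 1) →ₗ[ℂ] Chain (n + 1),
      up f ∘ₗ tp hp hm1 ∘ₗ up g = ε + κ ∧ SmallLift hp ε ∧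
        κ ∈ AddSubmonoid.closure {κ | IsShort hp κ} := by
    by_cases h : m + 1 + 1 = p
    · exact ⟨_, 0, (add_zero _).symm, (smallLift_tp h).conj hf.up hg.up, AddSubmonoid.zero_mem _⟩
    · exact ⟨0, _, (zero_add _).symm, SmallLift.zero, AddSubmonoid.subset_closure
        ⟨m + 1, by omega, up f, up g, hf.up, hg.up, rfl⟩⟩
  obtain ⟨ε, κ, h3, h4, h5⟩ := h2
  rw [h1]
  cases m with
  | zero =>
    rw [up_tp_zero _ hm1]
    exact ⟨ε, κ, h3, h4, h5⟩
  | succ m =>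
    obtain ⟨f', g', hf', hg', h6⟩ := exists_fusion (hp := hp) hm1
    rw [h6, LinearMap.add_comp, comp_add, h3]
    refine ⟨ε, κ + _, add_assoc _ _ _, h4, add_mem h5 (AddSubmonoid.subset_closure ?_)⟩
    exact ⟨m, by omega, up f ∘ₗ f', g' ∘ₗ up g, hf.up.comp hf', hg'.comp hg.up, rfl⟩

lemma exists_small_decomp (hp : 2 ≤ p) (n : ℕ) : ∃ ε κ : Chain n →ₗ[ℂ] Chain n,
    LinearMap.id = ε + κ ∧ SmallLift hp ε ∧ κ ∈ AddSubmonoid.closure {κ | IsShort hp κ} := by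
  induction n with
  | zero =>
    refine ⟨0, LinearMap.id, (zero_add _).symm, SmallLift.zero, AddSubmonoid.subset_closure
      ⟨0, by omega, LinearMap.id, LinearMap.id, IsU.id, IsU.id, ?_⟩⟩
    rw [tp_zero]; rfl
  | succ n ih =>
    obtain ⟨ε, κ, h1, h2, h3⟩ := ih
    have h4 : ∀ κ ∈ AddSubmonoid.closure {κ : Chain n →ₗ[ℂ] Chain n | IsShort hp κ},
        ∃ ε κ' : Chain (n + 1) →ₗ[ℂ] Chain (n + 1), up κ = ε + κ' ∧ SmallLift hp ε ∧
          κ' ∈ AddSubmonoid.closure {κ | IsShort hp κ} := by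
      intro κ hκ
      induction hκ using AddSubmonoid.closure_induction with
      | mem χ hχ => exact up_short hχ
      | zero => exact ⟨0, 0, by rw [add_zero]; exact ext fun _ => rfl, SmallLift.zero,
          AddSubmonoid.zero_mem _⟩
      | add a b _ _ ha hb =>
        obtain ⟨ε1, κ1, a1, a2, a3⟩ := ha
        obtain ⟨ε2, κ2, b1, b2, b3⟩ := hb
        refine ⟨ε1 + ε2, κ1 + κ2, ?_, a2.add b2, add_mem a3 b3⟩
        have : up (a + b) = up a + up b := rfl
        rw [this, a1, b1]; abel
    obtain ⟨ε', κ', h5, h6, h7⟩ := h4 κ h3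
    refine ⟨up ε + ε', κ', ?_, h2.up.add h6, h7⟩
    rw [add_assoc, ← h5]
    have : (LinearMap.id : Chain (n + 1) →ₗ[ℂ] Chain (n + 1)) = up LinearMap.id := rfl
    rw [this, h1]; rfl

lemma short_isU {κ : Chain n →ₗ[ℂ] Chain n} (h : κ ∈ AddSubmonoid.closure {κ | IsShort hp κ}) :
    IsU p κ := by
  induction h using AddSubmonoid.closure_induction with
  | mem χ hχ =>
    obtain ⟨m, hm, f, g, hf, hg, rfl⟩ := hχ
    exact hf.comp (isU_tp _ |>.comp hg)
  | zero => exact IsU.zero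
  | add a b _ _ ha hb => exact ha.add hb

lemma chainE_large {m : ℕ} {a : ℤ} (ha : m < a) : chainE p m a = 0 := by
  induction m generalizing a with
  | zero => rw [chainE, if_neg (by omega)]
  | succ m ih =>
    refine ext fun v => chain_ext ?_ ?_
    · rw [pl_E, ih (by push_cast at ha; omega), ih (by push_cast at ha; omega)]; simp
    · rw [mi_E, ih (by push_cast at ha; omega)]; simp

lemma chainF_large {m : ℕ} {a : ℤ} (ha : m < a) : chainF p m a = 0 := by
  induction m generalizing a with
  | zero => rw [chainF, if_neg (by omega)]
  | succ m ih =>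
    refine ext fun v => chain_ext ?_ ?_
    · rw [pl_F, ih (by push_cast at ha; omega)]; simp
    · rw [mi_F, ih (by push_cast at ha; omega), ih (by push_cast at ha; omega)]; simp

lemma short_E {κ : Chain n →ₗ[ℂ] Chain n} (h : κ ∈ AddSubmonoid.closure {κ | IsShort hp κ})
    (v : Chain n) : chainE p n p (κ v) = 0 ∧ chainF p n p (κ v) = 0 := by
  induction h using AddSubmonoid.closure_induction with
  | mem χ hχ =>
    obtain ⟨m, hm, f, g, hf, hg, rfl⟩ := hχ
    simp only [comp_apply]
    rw [← hf.E, ← hf.F, chainE_large (by omega), chainF_large (by omega)]; simp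
  | zero => simp
  | add a b _ _ ha hb => simp [ha, hb]

/-! ### Lifting for the quantum group -/

section ad

variable {H Y : Type} [AddCommGroup H] [Module ℂ H] [Module (U p) H] [IsScalarTower ℂ (U p) H]
  [AddCommGroup Y] [Module ℂ Y] [Module (U p) Y] [IsScalarTower ℂ (U p) Y]

def op (Y : Type) [AddCommGroup Y] [Module ℂ Y] [Module (U p) Y] [IsScalarTower ℂ (U p) Y] :
    U p →ₐ[ℂ] Module.End ℂ Y := Algebra.lsmul ℂ ℂ Y

lemma op_isUq : IsUq p fun x => op Y (U.gen p x) := by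
  have H := U.isUq p
  have e : ∀ {a b : U p}, a = b → op Y a = op Y b := fun h => congrArg _ h
  constructor
  · simpa using e H.K_Kinv
  · simpa using e H.Kinv_K
  · simpa using e H.K_E
  · simpa using e H.K_F
  · simpa using e H.E_F
  · simpa using e H.E_pow
  · simpa using e H.F_pow
  · simpa using e H.K_pow
  · simpa using e H.h_e
  · simpa using e H.h_f
  · simpa using e H.e_f
  · simpa using e H.K_e
  · simpa using e H.K_f
  · simpa using e H.E_e
  · simpa using e H.F_f
  · simpa [kBr] using e H.F_e
  · simpa [kBr] using e H.E_f

/-- The adjoint action on linear maps. -/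
def ad (H Y : Type) [AddCommGroup H] [Module ℂ H] [Module (U p) H] [IsScalarTower ℂ (U p) H]
    [AddCommGroup Y] [Module ℂ Y] [Module (U p) Y] [IsScalarTower ℂ (U p) Y] (u : U p) :
    Module.End ℂ (H →ₗ[ℂ] Y) :=
  LinearMap.llcomp ℂ H Y Y (op Y u) - LinearMap.lcomp ℂ Y (op H u)

lemma ad_apply (u : U p) (ψ : H →ₗ[ℂ] Y) (v : H) : ad H Y u ψ v = u • ψ v - ψ (u • v) := rfl

lemma ad_comm (a b : U p) : ad H Y a * ad H Y b - ad H Y b * ad H Y a = ad H Y (a * b - b * a) := by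
  refine ext fun ψ => ext fun v => ?_
  rw [lin_sub, lin_sub, mul_apply, mul_apply]
  simp only [ad_apply, map_sub, smul_sub, sub_smul, mul_smul]
  abel

lemma ad_smul (c : ℂ) (a : U p) : ad H Y (c • a) = c • ad H Y a := by
  refine ext fun ψ => ext fun v => ?_
  rw [lin_smul, lin_smul, ad_apply, ad_apply, smul_assoc, smul_assoc, map_smul,
    smul_sub]

lemma ad_neg (a : U p) : ad H Y (-a) = -ad H Y a := by
  refine ext fun ψ => ext fun v => ?_
  rw [LinearMap.neg_apply, LinearMap.neg_apply, ad_apply, ad_apply, neg_smul, neg_smul, map_neg]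
  abel

variable (p) in
/-- The small quantum group as a subalgebra. -/
def smallU : Subalgebra ℂ (U p) := Algebra.adjoin ℂ {U.gen p .E, U.gen p .F, U.gen p .K, U.gen p .Kinv}

/-- The linear maps that commute with the small quantum group. -/
def smallMaps (H Y : Type) [AddCommGroup H] [Module ℂ H] [Module (U p) H]
    [AddCommGroup Y] [Module ℂ Y] [Module (U p) Y] [IsScalarTower ℂ (U p) Y] :
    Submodule ℂ (H →ₗ[ℂ] Y) where
  carrier := {ψ | ∀ u ∈ smallU p, ∀ v, ψ (u • v) = u • ψ v}
  add_mem' {a b} ha hb u hu v := by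
    rw [lin_add, lin_add, ha u hu, hb u hu, smul_add]
  zero_mem' u hu v := by simp
  smul_mem' c a ha u hu v := by
    rw [lin_smul, lin_smul, ha u hu, smul_comm_U]

lemma mem_smallMaps {ψ : H →ₗ[ℂ] Y} (hE : ∀ v, ψ (U.gen p .E • v) = U.gen p .E • ψ v)
    (hF : ∀ v, ψ (U.gen p .F • v) = U.gen p .F • ψ v)
    (hK : ∀ v, ψ (U.gen p .K • v) = U.gen p .K • ψ v) : ψ ∈ smallMaps (p := p) H Y := by
  intro u hu
  induction hu using Algebra.adjoin_induction with
  | mem x hx =>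
    rcases hx with rfl | rfl | rfl | rfl
    · exact hE
    · exact hF
    · exact hK
    · intro v
      rw [← act_Kinv_K (p := p) (ψ (U.gen p .Kinv • v)), ← hK, act_K_Kinv]
  | algebraMap c => intro v; rw [algebraMap_smul, algebraMap_smul, map_smul]
  | add a b _ _ ha hb => intro v; rw [add_smul, add_smul, map_add, ha, hb]
  | mul a b _ _ ha hb => intro v; rw [mul_smul, mul_smul, ha, hb]

lemma smallU_gen {x : Gen} (hx : x = .E ∨ x = .F ∨ x = .K ∨ x = .Kinv) : U.gen p x ∈ smallU p := by
  refine Algebra.subset_adjoin ?_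
  rcases hx with rfl | rfl | rfl | rfl <;> simp

lemma ad_mem {x : U p} (hx : ∀ y, y = Gen.E ∨ y = Gen.F ∨ y = Gen.K →
    U.gen p y * x - x * U.gen p y ∈ smallU p) {ψ : H →ₗ[ℂ] Y} (hψ : ψ ∈ smallMaps (p := p) H Y) :
    ad H Y x ψ ∈ smallMaps (p := p) H Y := by
  have key : ∀ y, y = Gen.E ∨ y = Gen.F ∨ y = Gen.K → ∀ v,
      ad H Y x ψ (U.gen p y • v) = U.gen p y • ad H Y x ψ v := by
    intro y hy v
    have h1 : U.gen p y ∈ smallU p := smallU_gen (by tauto)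
    have h2 := hψ _ (hx y hy) v
    simp only [sub_smul, mul_smul, map_sub] at h2
    rw [hψ _ h1] at h2
    rw [ad_apply, ad_apply, hψ _ h1, smul_sub]
    rw [← sub_eq_zero] at h2 ⊢
    rw [← h2]; abel
  exact mem_smallMaps (key .E (by simp)) (key .F (by simp)) (key .K (by simp))

lemma smallU_e (y : Gen) (hy : y = Gen.E ∨ y = Gen.F ∨ y = Gen.K) :
    U.gen p y * U.gen p .e - U.gen p .e * U.gen p y ∈ smallU p := by
  have H := U.isUq p
  rcases hy with rfl | rfl | rfl
  · rw [H.E_e, sub_self]; exact zero_mem _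
  · rw [H.F_e, kBr]
    refine Subalgebra.smul_mem _ (mul_mem (mul_mem (pow_mem (smallU_gen (by simp)) _)
      (Subalgebra.smul_mem _ (sub_mem (Subalgebra.smul_mem _ (smallU_gen (by simp)) _)
      (Subalgebra.smul_mem _ (smallU_gen (by simp)) _)) _)) (pow_mem (smallU_gen (by simp)) _)) _
  · rw [H.K_e, sub_self]; exact zero_mem _

lemma smallU_f (y : Gen) (hy : y = Gen.E ∨ y = Gen.F ∨ y = Gen.K) :
    U.gen p y * U.gen p .f - U.gen p .f * U.gen p y ∈ smallU p := by
  have H := U.isUq p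
  rcases hy with rfl | rfl | rfl
  · rw [H.E_f, kBr]
    refine Subalgebra.smul_mem _ (mul_mem (pow_mem (smallU_gen (by simp)) _)
      (Subalgebra.smul_mem _ (sub_mem (Subalgebra.smul_mem _ (smallU_gen (by simp)) _)
      (Subalgebra.smul_mem _ (smallU_gen (by simp)) _)) _)) _
  · rw [H.F_f, sub_self]; exact zero_mem _
  · rw [H.K_f, sub_self]; exact zero_mem _

end ad

/-- The lifting property of an endomorphism of the spin chain for the quantum group. -/
def HasLift {hp : 2 ≤ p} (ε : HC hp n →ₗ[U p] HC hp n) : Prop :=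
  ∀ (M M' : Type) [AddCommGroup M] [Module ℂ M] [Module (U p) M] [IsScalarTower ℂ (U p) M]
    [AddCommGroup M'] [Module ℂ M'] [Module (U p) M'] [IsScalarTower ℂ (U p) M']
    [FiniteDimensional ℂ M] (g : M →ₗ[U p] M') (φ : HC hp n →ₗ[U p] M'), Surjective g →
    ∃ ψ : HC hp n →ₗ[U p] M, g.comp ψ = φ.comp ε

instance chainFinite (n : ℕ) : FiniteDimensional ℂ (Chain n) := by
  induction n with
  | zero => exact inferInstanceAs (FiniteDimensional ℂ ℂ)
  | succ n ih => exact inferInstanceAs (FiniteDimensional ℂ (Chain n × Chain n))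

instance (n : ℕ) : FiniteDimensional ℂ (HC hp n) := chainFinite n

lemma SmallLift.hasLift {ε : Chain n →ₗ[ℂ] Chain n} (h : SmallLift hp ε) (hε : IsU p ε) :
    HasLift (hε.hom hp) := by
  intro M M' _ _ _ _ _ _ _ _ _ g φ hg
  let g' : M →ₗ[ℂ] M' := toC g
  let φ' : Chain n →ₗ[ℂ] M' := show HC hp n →ₗ[ℂ] M' from toC φ
  have hφ' : ∀ x (v : Chain n), φ' (chainGen p n x v) = U.gen p x • φ' v := by
    intro x v
    have := map_smul φ (U.gen p x) ((RepSpace.out (chainRep hp n)).symm v)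
    rw [hc_smul] at this
    exact this
  obtain ⟨ψ, h1, h2⟩ := h M M' (Small.ofIsUq _ (op_isUq (p := p) (Y := M)))
    (Small.ofIsUq _ (op_isUq (p := p) (Y := M'))) g' φ'
    ⟨map_smul g _, map_smul g _, map_smul g _⟩ hg ⟨hφ' .E, hφ' .F, hφ' .K⟩
  let H := HC hp n
  let ψ' : H →ₗ[ℂ] M := ψ
  have hψ' : ψ' ∈ smallMaps (p := p) H M := mem_smallMaps
    (fun v => (congrArg ψ' (hc_smul .E v)).trans (h1.E v))
    (fun v => (congrArg ψ' (hc_smul .F v)).trans (h1.F v))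
    (fun v => (congrArg ψ' (hc_smul .K v)).trans (h1.K v))
  let S := smallMaps (p := p) H M
  have me : ∀ ψ ∈ S, ad H M (U.gen p .e) ψ ∈ S := fun ψ hψ => ad_mem smallU_e hψ
  have mf : ∀ ψ ∈ S, ad H M (U.gen p .f) ψ ∈ S := fun ψ hψ => ad_mem smallU_f hψ
  have eh : ∀ Y : Type, ∀ [AddCommGroup Y] [Module ℂ Y] [Module (U p) Y] [IsScalarTower ℂ (U p) Y],
      ad H Y (U.gen p .e) * ad H Y (U.gen p .f) - ad H Y (U.gen p .f) * ad H Y (U.gen p .e) =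
        (2 : ℂ) • ad H Y (U.gen p .h) := by
    intro Y _ _ _ _
    rw [ad_comm, (U.isUq p).e_f, ad_smul]
  have mh : ∀ ψ ∈ S, ad H M (U.gen p .h) ψ ∈ S := by
    intro ψ hψ
    have := lin_congr (eh M) ψ
    rw [lin_smul, ← inv_smul_eq_iff₀ two_ne_zero] at this
    rw [← this]
    exact S.smul_mem _ (S.sub_mem (me _ (mf _ hψ)) (mf _ (me _ hψ)))
  let L : S →ₗ[ℂ] (H →ₗ[ℂ] M') := (LinearMap.llcomp ℂ H M M' g') ∘ₗ S.subtype
  have hL : ∀ x (ψ : H →ₗ[ℂ] M), g' ∘ₗ ad H M (U.gen p x) ψ = ad H M' (U.gen p x) (g' ∘ₗ ψ) := by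
    intro x ψ
    refine ext fun v => ?_
    rw [comp_apply, ad_apply, ad_apply, map_sub]
    congr 1
    exact map_smul g _ _
  have hLψ : g' ∘ₗ ψ' = toC (φ.comp (hε.hom hp)) := ext fun v => h2 v
  have hinv : ∀ x, ad H M' (U.gen p x) (g' ∘ₗ ψ') = 0 := by
    intro x
    rw [hLψ]
    refine ext fun v => ?_
    rw [ad_apply]
    exact sub_eq_zero.2 (map_smul (φ.comp (hε.hom hp)) _ _).symm
  have fdS : FiniteDimensional ℂ S := inferInstance
  obtain ⟨ψ0, a1, a2, a3, a4⟩ := sl2_invariant_lift (V := S) (V' := H →ₗ[ℂ] M')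
    (e := (ad H M (U.gen p .e)).restrict me) (f := (ad H M (U.gen p .f)).restrict mf)
    (h := (ad H M (U.gen p .h)).restrict mh)
    (by
      refine ext fun ψ => Subtype.ext ?_
      have := ad_comm (H := H) (Y := M) (U.gen p .h) (U.gen p .e)
      rw [(U.isUq p).h_e] at this
      exact lin_congr this ψ)
    (by
      refine ext fun ψ => Subtype.ext ?_
      have := ad_comm (H := H) (Y := M) (U.gen p .h) (U.gen p .f)
      rw [(U.isUq p).h_f, ad_neg] at this
      exact lin_congr this ψ)
    (by
      refine ext fun ψ => Subtype.ext ?_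
      exact lin_congr (eh M) ψ)
    (e' := ad H M' (U.gen p .e)) (f' := ad H M' (U.gen p .f)) (h' := ad H M' (U.gen p .h)) L
    (fun ψ => hL .e ψ) (fun ψ => hL .f ψ) (fun ψ => hL .h ψ) (v := ⟨ψ', hψ'⟩) (hinv .e) (hinv .h)
  have b1 : ∀ y, y ∈ smallU p → ∀ v : H, ψ0.1 (y • v) = y • ψ0.1 v := ψ0.2
  have b2 : ∀ v : H, ψ0.1 (U.gen p .e • v) = U.gen p .e • ψ0.1 v := fun v =>
    (sub_eq_zero.1 (lin_congr (congrArg Subtype.val a2) v)).symm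
  have b3 : ∀ v : H, ψ0.1 (U.gen p .f • v) = U.gen p .f • ψ0.1 v := fun v =>
    (sub_eq_zero.1 (lin_congr (congrArg Subtype.val a3) v)).symm
  refine ⟨mkHom ψ0.1 (b1 _ (smallU_gen (by simp))) (b1 _ (smallU_gen (by simp)))
    (b1 _ (smallU_gen (by simp))) b2 b3, ext fun v => ?_⟩
  have c1 : g' ∘ₗ ψ0.1 = g' ∘ₗ ψ' := a1
  exact lin_congr (c1.trans hLψ) v

/-- The identity of the spin chain is the sum of an endomorphism with the lifting property and one
that is killed by `e`, `f` and by all maps that vanish on the images of the `X_{s,1}` with `s < p`. -/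
theorem exists_decomp (hp : 2 ≤ p) (n : ℕ) : ∃ ε κ : HC hp n →ₗ[U p] HC hp n,
    (∀ v, ε v + κ v = v) ∧ HasLift ε ∧ (∀ v, U.gen p .e • κ v = 0 ∧ U.gen p .f • κ v = 0) ∧
    ∀ (Y : Type) [AddCommGroup Y] [Module (U p) Y] (θ : HC hp n →ₗ[U p] Y),
      (∀ m (hm : m + 2 ≤ p) (α : SX hp (show m + 1 ≤ p by omega) 1 →ₗ[U p] HC hp n),
        θ.comp α = 0) → θ.comp κ = 0 := by
  obtain ⟨ε, κ, h1, h2, h3⟩ := exists_small_decomp hp n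
  have hκ := short_isU h3
  have hε : IsU p ε := by
    rw [← add_sub_cancel_right ε κ, ← h1]; exact IsU.id.sub hκ
  refine ⟨hε.hom hp, hκ.hom hp, fun v => (lin_congr h1 v).symm, h2.hasLift hε, fun v => ?_,
    fun Y _ _ θ hθ => ext fun v => ?_⟩
  · obtain ⟨h4, h5⟩ := short_E h3 v
    constructor
    · rw [hc_smul]
      change (RepSpace.out (chainRep hp n)).symm
        ((chainDiag n (fun x => q p ^ x) ^ p) (chainE p n p (κ v))) = 0
      rw [h4, map_zero, map_zero]
    · rw [hc_smul]
      change (RepSpace.out (chainRep hp n)).symm ((-1 : ℂ) ^ p • chainF p n p (κ v)) = 0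
      rw [h5, smul_zero, map_zero]
  · change θ (κ v : Chain n) = 0
    clear h1 hκ
    induction h3 using AddSubmonoid.closure_induction with
    | mem χ hχ =>
      obtain ⟨m, hm, f, g, hf, hg, rfl⟩ := hχ
      exact lin_congr (hθ m hm ((hf.hom hp).comp (incl (show m + 1 ≤ p by omega))))
        (proj _ (hg.hom hp v))
    | zero => exact map_zero θ
    | add a b _ _ ha hb =>
      exact (map_add θ (a v : HC hp n) (b v : HC hp n)).trans
        ((congrArg₂ (· + ·) ha hb).trans (add_zero 0))

/-- The part of the identity of the spin chain that has the lifting property. -/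
def eps (hp : 2 ≤ p) (n : ℕ) : HC hp n →ₗ[U p] HC hp n := (exists_decomp hp n).choose

/-- The part of the identity of the spin chain that factors through the `X_{s,1}` with `s < p`. -/
def kap (hp : 2 ≤ p) (n : ℕ) : HC hp n →ₗ[U p] HC hp n := (exists_decomp hp n).choose_spec.choose

section

variable {Y Y' : Type} [AddCommGroup Y] [Module (U p) Y] [AddCommGroup Y'] [Module (U p) Y']
  {hp : 2 ≤ p} {n : ℕ}

lemma eps_add_kap (v : HC hp n) : eps hp n v + kap hp n v = v :=
  (exists_decomp hp n).choose_spec.choose_spec.1 v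

lemma eps_lift : HasLift (eps hp n) := (exists_decomp hp n).choose_spec.choose_spec.2.1

lemma kap_e (v : HC hp n) : U.gen p .e • kap hp n v = 0 :=
  ((exists_decomp hp n).choose_spec.choose_spec.2.2.1 v).1

lemma kap_f (v : HC hp n) : U.gen p .f • kap hp n v = 0 :=
  ((exists_decomp hp n).choose_spec.choose_spec.2.2.1 v).2

lemma comp_kap {θ : HC hp n →ₗ[U p] Y}
    (h : ∀ m (hm : m + 2 ≤ p) (α : SX hp (show m + 1 ≤ p by omega) 1 →ₗ[U p] HC hp n),
      θ.comp α = 0) : θ.comp (kap hp n) = 0 :=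
  (exists_decomp hp n).choose_spec.choose_spec.2.2.2 Y θ h

lemma comp_eps {θ : HC hp n →ₗ[U p] Y} (h : θ.comp (kap hp n) = 0) : θ.comp (eps hp n) = θ := by
  refine ext fun v => ?_
  conv_rhs => rw [← eps_add_kap v, map_add]
  exact (add_zero _).symm.trans (congrArg _ (lin_congr h v).symm)

lemma comp_kap_of_no_invariant
    (hY : ∀ y : Y, U.gen p .e • y = 0 → U.gen p .f • y = 0 → y = 0) (θ : HC hp n →ₗ[U p] Y) :
    θ.comp (kap hp n) = 0 := ext fun v => hY _
  (by rw [comp_apply, ← map_smul, kap_e, map_zero])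
  (by rw [comp_apply, ← map_smul, kap_f, map_zero])

lemma exists_lift [Module ℂ Y] [IsScalarTower ℂ (U p) Y] [Module ℂ Y'] [IsScalarTower ℂ (U p) Y']
    [FiniteDimensional ℂ Y] (g : Y →ₗ[U p] Y') (hg : Surjective g)
    {θ : HC hp n →ₗ[U p] Y'} (h : θ.comp (kap hp n) = 0) : ∃ ψ : HC hp n →ₗ[U p] Y, g.comp ψ = θ := by
  obtain ⟨ψ, hψ⟩ := eps_lift (hp := hp) (n := n) Y Y' g θ hg
  exact ⟨ψ, hψ.trans (comp_eps h)⟩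

end

end decomposition

/-! ### A normal form in the Temperley–Lieb algebra -/

section normalForm

variable {p n : ℕ}

/-- The generator acting on the two outermost sites. -/
def g0 (p n : ℕ) : TL p (n + 2) := TL.gen p (n + 2) (0 : Fin (n + 1))

lemma emb_isTL (p n : ℕ) : IsTL p (n + 1) fun i : Fin n => TL.gen p (n + 2) (i.succ : Fin (n + 1)) := by
  have H := TL.isTL p (n + 2)
  refine ⟨fun i => H.sq _, fun i j h => H.braid _ _ ?_, fun i j h => H.comm _ _ ?_⟩
  · simpa using h
  · simpa [add_right_comm] using h

/-- The embedding of the Temperley–Lieb algebra on the inner sites. -/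
def emb (p n : ℕ) : TL p (n + 1) →ₐ[ℂ] TL p (n + 2) := TL.lift _ (emb_isTL p n)

lemma emb_gen (i : Fin n) : emb p n (TL.gen p (n + 1) i) = TL.gen p (n + 2) (i.succ : Fin (n + 1)) :=
  TL.lift_gen _ _ _

lemma g0_comm (x : TL p (n + 1)) : g0 p (n + 1) * emb p (n + 1) (emb p n x) =
    emb p (n + 1) (emb p n x) * g0 p (n + 1) := by
  induction x using TL.induction with
  | hc c => rw [AlgHom.commutes, AlgHom.commutes]; exact (Algebra.commutes c _).symm
  | hg i =>
    rw [emb_gen (n := n) i, emb_gen (n := n + 1) _]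
    exact (TL.isTL p (n + 3)).comm _ _ (by left; simp)
  | hm a b h1 h2 => rw [map_mul, map_mul, ← mul_assoc, h1, mul_assoc, h2, mul_assoc]
  | ha a b h1 h2 => rw [map_add, map_add, mul_add, h1, h2, add_mul]

lemma g0_braid : g0 p (n + 1) * emb p (n + 1) (g0 p n) * g0 p (n + 1) = g0 p (n + 1) := by
  rw [g0, g0, emb_gen (n := n + 1) _]
  exact (TL.isTL p (n + 3)).braid _ _ (by left; simp)

lemma g0_braid' : emb p (n + 1) (g0 p n) * g0 p (n + 1) * emb p (n + 1) (g0 p n) =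
    emb p (n + 1) (g0 p n) := by
  rw [g0, g0, emb_gen (n := n + 1) _]
  exact (TL.isTL p (n + 3)).braid _ _ (by right; simp)

/-- The descending product of the generators `g_{n-1} ⋯ g_k`. -/
def desc (p : ℕ) : (n : ℕ) → ℕ → TL p (n + 1)
  | 0, _ => 1
  | n + 1, k => if k ≤ n then g0 p n * emb p n (desc p n k) else 1

lemma desc_of_le {k : ℕ} (h : k ≤ n) : desc p (n + 1) k = g0 p n * emb p n (desc p n k) := if_pos h

lemma desc_of_ge {k : ℕ} (h : n ≤ k) : desc p n k = 1 := by
  cases n with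
  | zero => rfl
  | succ n => exact if_neg (by omega)

/-- The map `x ↦ x g_n ⋯ g_k`. -/
def embMul (p n k : ℕ) : TL p (n + 1) →ₗ[ℂ] TL p (n + 2) :=
  LinearMap.mulRight ℂ (desc p (n + 1) k) ∘ₗ (emb p n).toLinearMap

lemma embMul_apply (k : ℕ) (x : TL p (n + 1)) : embMul p n k x = emb p n x * desc p (n + 1) k := rfl

/-- The span of the products `x g_n ⋯ g_{k'}` with `k < k'`. -/
def above (p n k : ℕ) : Submodule ℂ (TL p (n + 2)) :=
  ⨆ k' : {k' // k < k'}, range (embMul p n k')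

lemma mem_above {k k' : ℕ} (h : k < k') (x : TL p (n + 1)) :
    emb p n x * desc p (n + 1) k' ∈ above p n k :=
  Submodule.mem_iSup_of_mem (⟨k', h⟩ : {k' // k < k'}) ⟨x, rfl⟩

lemma above_induction {k : ℕ} {W : Submodule ℂ (TL p (n + 2))}
    (h : ∀ k' x, k < k' → emb p n x * desc p (n + 1) k' ∈ W) : above p n k ≤ W := by
  refine iSup_le fun k' => ?_
  rintro _ ⟨x, rfl⟩
  exact h _ x k'.2

lemma g0_above {k : ℕ} (hk : k ≤ n) {y : TL p (n + 2)} (hy : y ∈ above p n k) :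
    g0 p (n + 1) * emb p (n + 1) y ∈ above p (n + 1) k := by
  have : above p n k ≤ (above p (n + 1) k).comap
      (LinearMap.mulLeft ℂ (g0 p (n + 1)) ∘ₗ (emb p (n + 1)).toLinearMap) := by
    refine above_induction fun k' x hk' => ?_
    change g0 p (n + 1) * emb p (n + 1) (emb p n x * desc p (n + 1) k') ∈ above p (n + 1) k
    rw [map_mul, ← mul_assoc, g0_comm, mul_assoc]
    by_cases h : k' ≤ n + 1
    · rw [← desc_of_le h]; exact mem_above hk' _
    · rw [desc_of_ge (by omega), map_one, mul_one, ← mul_one (g0 p (n + 1)), ← map_one (emb p (n + 1)),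
        ← desc_of_ge (p := p) (le_refl (n + 1)), ← desc_of_le le_rfl]
      exact mem_above (by omega) _
  exact this hy

lemma emb_mul_above {k : ℕ} (x : TL p (n + 1)) {y : TL p (n + 2)} (hy : y ∈ above p n k) :
    emb p n x * y ∈ above p n k := by
  have : above p n k ≤ (above p n k).comap (LinearMap.mulLeft ℂ (emb p n x)) := by
    refine above_induction fun k' z hk' => ?_
    change emb p n x * (emb p n z * desc p (n + 1) k') ∈ above p n k
    rw [← mul_assoc, ← map_mul]; exact mem_above hk' _
  exact this hy

lemma desc_mul_desc {k k' : ℕ} (h : k ≤ k') (h' : k' < n) :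
    emb p n (desc p n k') * desc p (n + 1) k ∈ above p n k := by
  induction n with
  | zero => omega
  | succ n ih =>
    rw [desc_of_le (show k' ≤ n by omega), desc_of_le (show k ≤ n + 1 by omega), map_mul, mul_assoc,
      ← mul_assoc (emb p (n + 1) (emb p n _)), ← g0_comm, mul_assoc, ← map_mul]
    by_cases hk : k' = n
    · rw [desc_of_ge hk.ge, map_one, one_mul, desc_of_le (show k ≤ n by omega), map_mul, ← mul_assoc,
        ← mul_assoc, g0_braid', ← map_mul, ← mul_one (emb p (n + 1) _),
        ← desc_of_ge (p := p) (le_refl (n + 1 + 1))]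
      exact mem_above (by omega) _
    · exact emb_mul_above _ (g0_above (by omega) (ih (by omega)))

def nfSum (p n : ℕ) (G : ℕ → Submodule ℂ (TL p (n + 1))) : ℕ → Submodule ℂ (TL p (n + 2))
  | 0 => ⊥
  | k + 1 => nfSum p n G k ⊔ if k ≤ n then (G k).map (embMul p n k) else ⊥

/-- The span of the normal forms in which the last generators of the descending products are
less than `k`. -/
def nf (p : ℕ) : (n : ℕ) → ℕ → Submodule ℂ (TL p (n + 1))
  | 0, _ => Submodule.span ℂ {1}
  | n + 1, k => (nf p n k).map (emb p n).toLinearMap ⊔ nfSum p n (nf p n) k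

lemma nfSum_mono {G : ℕ → Submodule ℂ (TL p (n + 1))} {k k' : ℕ} (h : k ≤ k') :
    nfSum p n G k ≤ nfSum p n G k' := by
  induction h with
  | refl => exact le_rfl
  | step _ ih => exact ih.trans le_sup_left

lemma nf_mono {k k' : ℕ} (h : k ≤ k') : nf p n k ≤ nf p n k' := by
  induction n with
  | zero => exact le_rfl
  | succ n ih => exact sup_le_sup (Submodule.map_mono ih) (nfSum_mono h)

lemma mem_nf_of_desc {k k' : ℕ} (h : k < k') (hk : k ≤ n) {x : TL p (n + 1)} (hx : x ∈ nf p n k) :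
    emb p n x * desc p (n + 1) k ∈ nf p (n + 1) k' := by
  refine (le_sup_right : _ ≤ nf p (n + 1) k') (nfSum_mono (show k + 1 ≤ k' from h) ?_)
  refine (le_sup_right : _ ≤ nfSum p n (nf p n) (k + 1)) ?_
  rw [if_pos hk]
  exact ⟨x, hx, rfl⟩

/-- The elements whose product with `g_n ⋯ g_k` can be rewritten with larger `k`. -/
def reducible (p n k : ℕ) : Submodule ℂ (TL p (n + 1)) := (above p n k).comap (embMul p n k)

lemma nf_le_reducible (k K : ℕ) (hk : k ≤ n) : nf p n K ≤ nf p n k ⊔ reducible p n k := by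
  induction n generalizing K with
  | zero => exact le_sup_left
  | succ n ih =>
    have hsum : ∀ K, nfSum p n (nf p n) K ≤ nf p (n + 1) k ⊔ reducible p (n + 1) k := by
      intro K
      induction K with
      | zero => exact bot_le
      | succ j ihj =>
        refine sup_le ihj ?_
        split_ifs with hj
        · by_cases hjk : j < k
          · refine le_trans ?_ le_sup_left
            rintro _ ⟨x, hx, rfl⟩
            exact mem_nf_of_desc hjk hj hx
          · refine le_trans ?_ le_sup_right
            rintro _ ⟨x, hx, rfl⟩
            change emb p (n + 1) (emb p n x * desc p (n + 1) j) * desc p (n + 1 + 1) k ∈ above p (n + 1) k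
            rw [map_mul, mul_assoc]
            exact emb_mul_above _ (desc_mul_desc (by omega) (by omega))
        · exact bot_le
    refine sup_le ?_ (hsum K)
    by_cases hkn : k ≤ n
    · refine (Submodule.map_mono (ih K hkn)).trans ?_
      rw [Submodule.map_sup]
      refine sup_le_sup le_sup_left ?_
      rintro _ ⟨x, hx, rfl⟩
      have hx' : emb p n x * desc p (n + 1) k ∈ above p n k := hx
      change emb p (n + 1) (emb p n x) * desc p (n + 1 + 1) k ∈ above p (n + 1) k
      rw [desc_of_le (by omega), ← mul_assoc, ← g0_comm, mul_assoc, ← map_mul]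
      exact g0_above hkn hx'
    · obtain rfl : k = n + 1 := by omega
      refine le_trans ?_ le_sup_left
      refine le_trans ?_ (le_sup_left : _ ≤ nf p (n + 1) (n + 1))
      refine Submodule.map_mono ?_
      have : ∀ m K, m ≤ K → nf p m K ≤ nf p m m := by
        intro m
        induction m with
        | zero => exact fun _ _ => le_rfl
        | succ m ihm =>
          intro K hK
          have : ∀ j, nfSum p m (nf p m) j ≤ nfSum p m (nf p m) (m + 1) := by
            intro j
            induction j with
            | zero => exact bot_le
            | succ j ihj =>
              by_cases hj : j ≤ m
              · exact nfSum_mono (by omega)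
              · exact sup_le ihj (by rw [if_neg hj]; exact bot_le)
          exact sup_le_sup (Submodule.map_mono ((ihm K (by omega)).trans (nf_mono (by omega)))) (this K)
      rcases le_total K n with h | h
      · exact nf_mono (by omega)
      · exact (this n K h).trans (nf_mono (by omega))

/-- The span of all products `x g_n ⋯ g_k`. -/
def spanDesc (p n : ℕ) : Submodule ℂ (TL p (n + 2)) := ⨆ j, range (embMul p n j)

lemma mem_spanDesc (k : ℕ) (x : TL p (n + 1)) : emb p n x * desc p (n + 1) k ∈ spanDesc p n :=
  Submodule.mem_iSup_of_mem k ⟨x, rfl⟩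

lemma spanDesc_induction {W : Submodule ℂ (TL p (n + 2))}
    (h : ∀ k x, emb p n x * desc p (n + 1) k ∈ W) : spanDesc p n ≤ W := by
  refine iSup_le fun k => ?_
  rintro _ ⟨x, rfl⟩
  exact h _ x

lemma desc_self : desc p (n + 1) n = g0 p n := by
  rw [desc_of_le le_rfl, desc_of_ge le_rfl, map_one, mul_one]

lemma emb_mem_spanDesc (x : TL p (n + 1)) : emb p n x ∈ spanDesc p n := by
  have := mem_spanDesc (n + 1) x
  rwa [desc_of_ge le_rfl, mul_one] at this

lemma emb_mul_g0_mem_spanDesc (x : TL p (n + 1)) : emb p n x * g0 p n ∈ spanDesc p n := by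
  rw [← desc_self]; exact mem_spanDesc n x

lemma emb_mul_spanDesc (x : TL p (n + 1)) {y : TL p (n + 2)} (hy : y ∈ spanDesc p n) :
    emb p n x * y ∈ spanDesc p n := by
  have : spanDesc p n ≤ (spanDesc p n).comap (LinearMap.mulLeft ℂ (emb p n x)) := by
    refine spanDesc_induction fun k' z => ?_
    change emb p n x * (emb p n z * desc p (n + 1) k') ∈ spanDesc p n
    rw [← mul_assoc, ← map_mul]; exact mem_spanDesc _ _
  exact this hy

lemma g0_spanDesc {y : TL p (n + 2)} (hy : y ∈ spanDesc p n) :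
    g0 p (n + 1) * emb p (n + 1) y ∈ spanDesc p (n + 1) := by
  have : spanDesc p n ≤ (spanDesc p (n + 1)).comap
      (LinearMap.mulLeft ℂ (g0 p (n + 1)) ∘ₗ (emb p (n + 1)).toLinearMap) := by
    refine spanDesc_induction fun k' x => ?_
    change g0 p (n + 1) * emb p (n + 1) (emb p n x * desc p (n + 1) k') ∈ spanDesc p (n + 1)
    rw [map_mul, ← mul_assoc, g0_comm, mul_assoc]
    by_cases h : k' ≤ n + 1
    · rw [← desc_of_le h]; exact mem_spanDesc _ _
    · rw [desc_of_ge (by omega), map_one, mul_one]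
      exact emb_mul_g0_mem_spanDesc _
  exact this hy

lemma desc_mul_gen (k : ℕ) (j : Fin (n + 1)) :
    desc p (n + 1) k * TL.gen p (n + 2) j ∈ spanDesc p n := by
  induction n with
  | zero =>
    obtain rfl : j = 0 := Fin.ext (by omega)
    change _ * g0 p 0 ∈ _
    by_cases hk : k ≤ 0
    · obtain rfl : k = 0 := by omega
      rw [desc_self, g0, (TL.isTL p 2).sq]
      exact Submodule.smul_mem _ _ (by rw [← one_mul (TL.gen p _ _), ← map_one (emb p 0)]; exact emb_mul_g0_mem_spanDesc _)
    · rw [desc_of_ge (by omega), ← map_one (emb p 0)]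
      exact emb_mul_g0_mem_spanDesc _
  | succ n ih =>
    induction j using Fin.cases with
    | zero =>
      change _ * g0 p (n + 1) ∈ _
      by_cases hk : k ≤ n
      · rw [desc_of_le (by omega), desc_of_le hk, map_mul, mul_assoc, mul_assoc, ← g0_comm, ← mul_assoc,
          ← mul_assoc, g0_braid, g0_comm]
        exact emb_mul_g0_mem_spanDesc _
      by_cases hk : k ≤ n + 1
      · obtain rfl : k = n + 1 := by omega
        rw [desc_self, g0, (TL.isTL p (n + 1 + 2)).sq]
        exact Submodule.smul_mem _ _ (by
          rw [← one_mul (TL.gen p _ _), ← map_one (emb p (n + 1))]; exact emb_mul_g0_mem_spanDesc _)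
      · rw [desc_of_ge (by omega), ← map_one (emb p (n + 1))]
        exact emb_mul_g0_mem_spanDesc _
    | succ i =>
      rw [← emb_gen i]
      by_cases hk : k ≤ n + 1
      · rw [desc_of_le hk, mul_assoc, ← map_mul]
        exact g0_spanDesc (ih i)
      · rw [desc_of_ge (by omega), one_mul]
        exact emb_mem_spanDesc _

lemma spanDesc_eq_top : spanDesc p n = ⊤ := by
  have key : ∀ x : TL p (n + 2), ∀ z ∈ spanDesc p n, z * x ∈ spanDesc p n := by
    intro x
    induction x using TL.induction with
    | hc c => intro z hz; rw [← Algebra.commutes, ← Algebra.smul_def]; exact Submodule.smul_mem _ _ hz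
    | hg i =>
      intro z hz
      have : spanDesc p n ≤ (spanDesc p n).comap (LinearMap.mulRight ℂ (TL.gen p (n + 2) i)) := by
        refine spanDesc_induction fun k y => ?_
        change emb p n y * desc p (n + 1) k * TL.gen p (n + 2) i ∈ spanDesc p n
        rw [mul_assoc]
        exact emb_mul_spanDesc _ (desc_mul_gen k i)
      exact this hz
    | hm a b h1 h2 => intro z hz; rw [← mul_assoc]; exact h2 _ (h1 _ hz)
    | ha a b h1 h2 => intro z hz; rw [mul_add]; exact Submodule.add_mem _ (h1 _ hz) (h2 _ hz)
  rw [eq_top_iff]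
  rintro x -
  rw [← one_mul x]
  exact key x 1 (by rw [← map_one (emb p n)]; exact emb_mem_spanDesc _)

/-- The normal forms span the algebra. -/
theorem nf_eq_top (n k : ℕ) (hk : n ≤ k) : nf p n k = ⊤ := by
  induction n generalizing k with
  | zero =>
    rw [eq_top_iff]
    rintro x -
    induction x using TL.induction with
    | hc c => exact Submodule.mem_span_singleton.2 ⟨c, (Algebra.algebraMap_eq_smul_one c).symm⟩
    | hg i => exact i.elim0
    | hm a b h1 h2 =>
      obtain ⟨c, rfl⟩ := Submodule.mem_span_singleton.1 h1
      rw [smul_mul_assoc, one_mul]; exact Submodule.smul_mem _ _ h2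
    | ha a b h1 h2 => exact Submodule.add_mem _ h1 h2
  | succ n ih =>
    have h1 : ∀ d k, k + d = n + 1 → ∀ y, emb p n y * desc p (n + 1) k ∈ nf p (n + 1) (n + 1) := by
      intro d
      induction d using Nat.strong_induction_on with
      | _ d ihd =>
        intro j hj y
        by_cases hjn : j = n + 1
        · rw [desc_of_ge hjn.ge, mul_one]
          exact (le_sup_left : _ ≤ nf p (n + 1) (n + 1)) ⟨y, by rw [ih _ (by omega)]; trivial, rfl⟩
        · have hy : y ∈ nf p n n := by rw [ih n le_rfl]; trivial
          obtain ⟨a, ha, b, hb, rfl⟩ := Submodule.mem_sup.1 (nf_le_reducible j n (by omega) hy)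
          rw [map_add, add_mul]
          refine Submodule.add_mem _ (mem_nf_of_desc (by omega) (by omega) ha) ?_
          have hb' : emb p n b * desc p (n + 1) j ∈ above p n j := hb
          refine above_induction (fun k' x hk' => ?_) hb'
          by_cases hk2 : k' ≤ n + 1
          · exact ihd (n + 1 - k') (by omega) k' (by omega) x
          · rw [desc_of_ge (by omega), ← desc_of_ge (p := p) (le_refl (n + 1))]
            exact ihd 0 (by omega) (n + 1) (by omega) x
    have h2 : nf p (n + 1) (n + 1) = ⊤ := by
      rw [eq_top_iff, ← spanDesc_eq_top]
      refine spanDesc_induction fun j x => ?_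
      by_cases hj : j ≤ n + 1
      · exact h1 (n + 1 - j) j (by omega) x
      · rw [desc_of_ge (by omega), ← desc_of_ge (p := p) (le_refl (n + 1))]
        exact h1 0 (n + 1) rfl x
    rw [eq_top_iff, ← h2]
    exact nf_mono hk

end normalForm

/-! ### The Temperley–Lieb algebra as the commutant of the quantum group -/

section faithful

variable {p n : ℕ}

lemma xxzRep_emb (a : TL p (n + 1)) (v : Chain (n + 2)) : xxzRep p (n + 2) (emb p n a) v =
    mk (xxzRep p (n + 1) a (pl v)) (xxzRep p (n + 1) a (mi v)) := by
  induction a using TL.induction generalizing v with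
  | hc c => rw [AlgHom.commutes, AlgHom.commutes, AlgHom.commutes]; rfl
  | hg i =>
    rw [emb_gen, xxzRep, xxzRep, TL.lift_gen, TL.lift_gen]
    exact chain_ext (pl_xxz _ v) (mi_xxz _ v)
  | hm a b h1 h2 =>
    rw [map_mul, map_mul, map_mul, mul_apply, mul_apply, mul_apply,
      h2, h1]; rfl
  | ha a b h1 h2 =>
    rw [map_add, map_add, map_add, lin_add, h1, h2]; rfl

lemma xxzRep_g0 (v : Chain (n + 2)) : xxzRep p (n + 2) (g0 p n) v =
    mk (mk 0 (cap p n v)) (mk (-(q p) • cap p n v) 0) := by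
  rw [g0, xxzRep, TL.lift_gen]
  exact chain_ext (pl_xxz_zero v) (mi_xxz_zero v)

/-- The chains whose outer sites, up to the last `k`, are in the state `v_+`. -/
def outerPlus : (m k : ℕ) → Submodule ℂ (Chain m)
  | 0, _ => ⊤
  | m + 1, k => if m < k then ⊤ else (outerPlus m k).map inPl

lemma outerPlus_of_lt {m k : ℕ} (h : m < k) : outerPlus (m + 1) k = ⊤ := if_pos h

lemma outerPlus_of_le {m k : ℕ} (h : k ≤ m) : outerPlus (m + 1) k = (outerPlus m k).map inPl :=
  if_neg (by omega)

lemma mk_mem_outerPlus {m k : ℕ} {v : Chain m} (hv : v ∈ outerPlus m k) :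
    mk v 0 ∈ outerPlus (m + 1) k := by
  by_cases h : m < k
  · rw [outerPlus_of_lt h]; trivial
  · rw [outerPlus_of_le (by omega)]; exact ⟨v, hv, rfl⟩

lemma exists_of_mem_outerPlus {m k : ℕ} (h : k ≤ m) {w : Chain (m + 1)} (hw : w ∈ outerPlus (m + 1) k) :
    ∃ v ∈ outerPlus m k, mk v 0 = w := by
  rwa [outerPlus_of_le h] at hw

lemma outerPlus_mono {m k k' : ℕ} (h : k ≤ k') : outerPlus m k ≤ outerPlus m k' := by
  induction m with
  | zero => exact le_rfl
  | succ m ih =>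
    by_cases hm : m < k
    · rw [outerPlus_of_lt (show m < k' by omega)]; exact le_top
    · rw [outerPlus_of_le (by omega)]
      rintro _ ⟨v, hv, rfl⟩
      exact mk_mem_outerPlus (ih hv)

lemma cap_mk_zero (w : Chain (n + 1)) : cap p n (mk w 0) = (q p)⁻¹ • mi w := by
  rw [cap_apply, pl_mk, mi_mk, map_zero, sub_zero]

lemma desc_outerPlus {k : ℕ} (hk : k ≤ n) {w : Chain (n + 2)} (hw : w ∈ outerPlus (n + 2) k) :
    xxzRep p (n + 2) (desc p (n + 1) k) w = 0 := by
  have key : ∀ w' : Chain (n + 1), mi w' = 0 → xxzRep p (n + 2) (g0 p n) (mk w' 0) = 0 := by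
    intro w' h
    rw [xxzRep_g0, cap_mk_zero, h, smul_zero, smul_zero]; rfl
  induction n with
  | zero =>
    obtain ⟨w', hw', rfl⟩ := exists_of_mem_outerPlus (by omega) hw
    obtain ⟨w2, -, rfl⟩ := exists_of_mem_outerPlus hk hw'
    obtain rfl : k = 0 := by omega
    rw [desc_self]
    exact key _ rfl
  | succ n ih =>
    obtain ⟨w', hw', rfl⟩ := exists_of_mem_outerPlus (by omega) hw
    rw [desc_of_le hk, map_mul, mul_apply, xxzRep_emb, mi_mk, map_zero, pl_mk]
    by_cases h : k ≤ n
    · rw [ih h hw']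
      · exact key 0 (map_zero _)
      · intro w' h
        rw [xxzRep_g0, cap_mk_zero, h, smul_zero, smul_zero]; rfl
    · rw [desc_of_ge (by omega), map_one]
      obtain ⟨w2, -, rfl⟩ := exists_of_mem_outerPlus hk hw'
      exact key _ rfl

lemma exists_mi_desc {k : ℕ} (hk : k ≤ n) {v : Chain (n + 1)} (hv : v ∈ outerPlus (n + 1) k) :
    ∃ w ∈ outerPlus (n + 2) (k + 1), mi (xxzRep p (n + 2) (desc p (n + 1) k) w) = v := by
  induction n with
  | zero =>
    obtain rfl : k = 0 := by omega
    obtain ⟨v', -, rfl⟩ := exists_of_mem_outerPlus le_rfl hv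
    refine ⟨mk (-(mk 0 v')) 0, mk_mem_outerPlus
      ((outerPlus_of_lt (m := 0) (k := 0 + 1) one_pos).ge trivial), ?_⟩
    rw [desc_self, xxzRep_g0, cap_mk_zero, mi_mk, smul_smul, map_neg, mi_mk, neg_mul,
      mul_inv_cancel₀ (q_ne p), neg_smul, one_smul, neg_neg]
  | succ n ih =>
    obtain ⟨v', hv', rfl⟩ := exists_of_mem_outerPlus hk hv
    obtain ⟨w, hw, h⟩ : ∃ w ∈ outerPlus (n + 2) (k + 1),
        mi (xxzRep p (n + 2) (desc p (n + 1) k) w) = v' := by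
      by_cases h : k ≤ n
      · exact ih h hv'
      · refine ⟨mk 0 v', by rw [outerPlus_of_lt (by omega)]; trivial, ?_⟩
        rw [desc_of_ge (by omega), map_one, one_apply, mi_mk]
    refine ⟨mk (-w) 0, mk_mem_outerPlus (neg_mem hw), ?_⟩
    rw [desc_of_le hk, map_mul, mul_apply, xxzRep_emb, mi_mk, map_zero, pl_mk, xxzRep_g0,
      cap_mk_zero, mi_mk, smul_smul, map_neg, map_neg, h, neg_mul,
      mul_inv_cancel₀ (q_ne p), neg_smul, one_smul, neg_neg]

lemma xxzRep_embMul (k : ℕ) (x : TL p (n + 1)) (w : Chain (n + 2)) :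
    mi (xxzRep p (n + 2) (embMul p n k x) w) =
      xxzRep p (n + 1) x (mi (xxzRep p (n + 2) (desc p (n + 1) k) w)) := by
  rw [embMul_apply, map_mul, mul_apply, xxzRep_emb, mi_mk]

lemma nfSum_succ_indep {k : ℕ} (hk : k ≤ n)
    (hI : ∀ x ∈ nf p n k, (∀ v ∈ outerPlus (n + 1) k, xxzRep p (n + 1) x v = 0) → x = 0)
    (hD : ∀ y ∈ nfSum p n (nf p n) k,
      (∀ w ∈ outerPlus (n + 2) k, mi (xxzRep p (n + 2) y w) = 0) → y = 0)
    {x : TL p (n + 1)} (hx : x ∈ nf p n k) {y : TL p (n + 2)} (hy : y ∈ nfSum p n (nf p n) k)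
    (h : ∀ w ∈ outerPlus (n + 2) (k + 1), mi (xxzRep p (n + 2) (y + embMul p n k x) w) = 0) :
    y = 0 ∧ x = 0 := by
  have hy0 : y = 0 := by
    refine hD y hy fun w hw => ?_
    have h1 := h w (outerPlus_mono (Nat.le_succ k) hw)
    rwa [map_add, lin_add, map_add, xxzRep_embMul, desc_outerPlus hk hw, map_zero, map_zero,
      add_zero] at h1
  refine ⟨hy0, hI x hx fun v hv => ?_⟩
  obtain ⟨w, hw, rfl⟩ := exists_mi_desc (p := p) hk hv
  rw [← xxzRep_embMul, ← h w hw, hy0, zero_add]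

lemma nfSum_indep (hI : ∀ k, ∀ x ∈ nf p n k,
      (∀ v ∈ outerPlus (n + 1) k, xxzRep p (n + 1) x v = 0) → x = 0) (k : ℕ) (hk : k ≤ n + 1) :
    ∀ y ∈ nfSum p n (nf p n) k,
      (∀ w ∈ outerPlus (n + 2) k, mi (xxzRep p (n + 2) y w) = 0) → y = 0 := by
  induction k with
  | zero => exact fun y hy _ => hy
  | succ k ih =>
    intro y hy h
    rw [nfSum, if_pos (by omega)] at hy
    obtain ⟨y', hy', _, ⟨x, hx, rfl⟩, rfl⟩ := Submodule.mem_sup.1 hy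
    obtain ⟨h1, h2⟩ := nfSum_succ_indep (by omega) (hI k) (ih (by omega)) hx hy' h
    rw [h1, h2, map_zero, add_zero]

lemma nfSum_eq_min (k : ℕ) (G : ℕ → Submodule ℂ (TL p (n + 1))) :
    nfSum p n G k = nfSum p n G (min k (n + 1)) := by
  induction k with
  | zero => rfl
  | succ k ih =>
    by_cases hk : k ≤ n
    · rw [min_eq_left (by omega)]
    · rw [nfSum, if_neg hk, sup_bot_eq, ih, min_eq_right (by omega), min_eq_right (by omega)]

lemma nf_succ_indep (hI : ∀ k, ∀ x ∈ nf p n k,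
      (∀ v ∈ outerPlus (n + 1) k, xxzRep p (n + 1) x v = 0) → x = 0) (k : ℕ)
    {x : TL p (n + 1)} (hx : x ∈ nf p n k) {y : TL p (n + 2)} (hy : y ∈ nfSum p n (nf p n) k)
    (h : ∀ w ∈ outerPlus (n + 2) k, xxzRep p (n + 2) (emb p n x + y) w = 0) : x = 0 ∧ y = 0 := by
  have hy0 : y = 0 := by
    rw [nfSum_eq_min] at hy
    refine nfSum_indep hI _ (min_le_right _ _) y hy fun w hw => ?_
    have h1 := congrArg mi (h w (outerPlus_mono (min_le_left _ _) hw))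
    obtain ⟨w', -, rfl⟩ := exists_of_mem_outerPlus (min_le_right _ _) hw
    rwa [map_add, lin_add, map_add, xxzRep_emb, mi_mk, mi_mk, map_zero, map_zero,
      zero_add] at h1
  refine ⟨hI k x hx fun v hv => ?_, hy0⟩
  have h1 := congrArg pl (h _ (mk_mem_outerPlus hv))
  rwa [hy0, add_zero, xxzRep_emb, pl_mk, pl_mk, map_zero] at h1

/-- The normal forms act independently. -/
lemma nf_indep (n : ℕ) : ∀ k, ∀ x ∈ nf p n k,
    (∀ v ∈ outerPlus (n + 1) k, xxzRep p (n + 1) x v = 0) → x = 0 := by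
  induction n with
  | zero =>
    intro k x hx h
    obtain ⟨c, rfl⟩ := Submodule.mem_span_singleton.1 hx
    have h1 := congrArg pl (h (mk (1 : ℂ) (0 : ℂ)) (mk_mem_outerPlus trivial))
    rw [map_smul, map_one] at h1
    have h2 : c * 1 = (0 : ℂ) := h1
    rw [mul_one] at h2
    rw [h2, zero_smul]
  | succ n ih =>
    intro k x hx h
    obtain ⟨_, ⟨a, ha, rfl⟩, y, hy, rfl⟩ := Submodule.mem_sup.1 hx
    obtain ⟨rfl, rfl⟩ := nf_succ_indep ih k ha hy h
    rw [map_zero, add_zero]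

lemma xxzRep_injective (p n : ℕ) : Injective (xxzRep p (n + 1)) := by
  rw [injective_iff_map_eq_zero]
  intro a ha
  refine nf_indep n n a (by rw [nf_eq_top n n le_rfl]; trivial) fun v _ => ?_
  rw [ha, lin_zero]

instance tlFinite (p n : ℕ) : FiniteDimensional ℂ (TL p (n + 1)) :=
  FiniteDimensional.of_injective (xxzRep p (n + 1)).toLinearMap (xxzRep_injective p n)

lemma finrank_nfSum_succ {k : ℕ} (hk : k ≤ n) :
    finrank ℂ (nfSum p n (nf p n) k) + finrank ℂ (nf p n k) ≤
      finrank ℂ (nfSum p n (nf p n) (k + 1)) := by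
  rw [← Module.finrank_prod]
  let f : (nfSum p n (nf p n) k × nf p n k) →ₗ[ℂ] TL p (n + 2) :=
    LinearMap.coprod (Submodule.subtype _) ((embMul p n k).comp (Submodule.subtype _))
  have hf : ∀ z, f z ∈ nfSum p n (nf p n) (k + 1) := fun z => by
    rw [nfSum, if_pos hk]
    exact Submodule.add_mem_sup z.1.2 ⟨_, z.2.2, rfl⟩
  refine LinearMap.finrank_le_finrank_of_injective (f := f.codRestrict _ hf) ?_
  rw [injective_iff_map_eq_zero]
  rintro ⟨y, x⟩ h
  have h1 : (y : TL p (n + 2)) + embMul p n k x = 0 := congrArg Subtype.val h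
  obtain ⟨h2, h3⟩ := nfSum_succ_indep hk (nf_indep n k) (nfSum_indep (nf_indep n) k (by omega)) x.2 y.2
    (fun w _ => by rw [h1, map_zero, lin_zero, map_zero])
  exact Prod.ext (Subtype.ext h2) (Subtype.ext h3)

lemma finrank_nf_succ (k : ℕ) : finrank ℂ (nf p (n + 1) k) =
    finrank ℂ (nf p n k) + finrank ℂ (nfSum p n (nf p n) k) := by
  refine le_antisymm ((Submodule.finrank_add_le_finrank_add_finrank _ _).trans
    (Nat.add_le_add_right (Submodule.finrank_map_le _ _) _)) ?_
  rw [← Module.finrank_prod]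
  let f : (nf p n k × nfSum p n (nf p n) k) →ₗ[ℂ] TL p (n + 2) :=
    LinearMap.coprod ((emb p n).toLinearMap.comp (Submodule.subtype _)) (Submodule.subtype _)
  have hf : ∀ z, f z ∈ nf p (n + 1) k := fun z => Submodule.add_mem_sup ⟨_, z.1.2, rfl⟩ z.2.2
  refine LinearMap.finrank_le_finrank_of_injective (f := f.codRestrict _ hf) ?_
  rw [injective_iff_map_eq_zero]
  rintro ⟨x, y⟩ h
  have h1 : emb p n x + (y : TL p (n + 2)) = 0 := congrArg Subtype.val h
  obtain ⟨h2, h3⟩ := nf_succ_indep (nf_indep n) k x.2 y.2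
    (fun w _ => by rw [h1, map_zero, lin_zero])
  exact Prod.ext (Subtype.ext h2) (Subtype.ext h3)

lemma finrank_nf_ge {k : ℕ} (hk : k ≤ n) :
    finrank ℂ (nf p n (k + 1)) + finrank ℂ (nf p (n + 1) k) ≤
      finrank ℂ (nf p (n + 1) (k + 1)) := by
  have := finrank_nfSum_succ (p := p) hk
  rw [finrank_nf_succ, finrank_nf_succ]
  omega

lemma finrank_nf_pos (n k : ℕ) : 1 ≤ finrank ℂ (nf p n k) := by
  induction n with
  | zero =>
    refine Submodule.one_le_finrank_iff.2 fun h => ?_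
    have h1 : (1 : TL p 1) = 0 := (Submodule.mem_bot ℂ).1 (h ▸ Submodule.mem_span_singleton_self _)
    have h2 := congrArg (fun a => pl (xxzRep p 1 a (mk (1 : ℂ) (0 : ℂ)))) h1
    simp only [map_one, map_zero] at h2
    exact one_ne_zero (α := ℂ) h2
  | succ n ih => rw [finrank_nf_succ]; omega

end faithful

section dimensions

variable {p n : ℕ}

lemma coHW_eq_bot {n : ℕ} {k : ℤ} (h : (n : ℤ) < k) : coHW p n k = ⊥ := by
  rw [eq_bot_iff]
  intro l hl
  refine ext fun v => ?_
  have h1 := (mem_coHW.1 hl).D (fun x => if x = k then 1 else 0) v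
  have h2 := diag_congr n (φ := fun x => if x = k then 1 else 0) (ψ := fun x => 0 * x) fun x hx => by
    rw [Finset.mem_Icc] at hx
    rw [if_neg (by omega), zero_mul]
  have h3 : chainDiag n (fun x => (0 : ℂ) * x) = 0 :=
    (diag_smul n 0 fun x => (x : ℂ)).symm.trans (zero_smul ℂ (chainDiag n fun x => (x : ℂ)))
  rw [h2, h3, if_pos rfl, one_mul, lin_zero, map_zero] at h1
  exact h1.symm

lemma finrank_coHW_succ (n : ℕ) {a b k : ℤ} (ha : a = k + 1) (hb : b = k - 1) :
    finrank ℂ (coHW p (n + 1) k) ≤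
      finrank ℂ (coHW p n a) + finrank ℂ (coHW p n b) := by
  subst ha hb
  let f : coHW p (n + 1) k →ₗ[ℂ] Chain n →ₗ[ℂ] ℂ :=
    (LinearMap.lcomp ℂ ℂ (inMi (n := n))).comp (Submodule.subtype _)
  rw [← LinearMap.finrank_range_add_finrank_ker f]
  refine Nat.add_le_add (Submodule.finrank_mono ?_) ?_
  · rintro _ ⟨l, rfl⟩
    exact (mem_coHW.1 l.2).comp_mi
  · let g : ker f →ₗ[ℂ] Chain n →ₗ[ℂ] ℂ :=
      (LinearMap.lcomp ℂ ℂ (inPl (n := n))).comp ((Submodule.subtype _).comp (Submodule.subtype _))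
    have hg : ∀ l : ker f, ∀ v, l.1.1 v = g l (pl v) := fun l v => by
      have h1 : l.1.1 (mk 0 (mi v)) = 0 := lin_congr l.2 (mi v)
      have e : v = mk (pl v) 0 + mk 0 (mi v) := by rw [mk_add, add_zero, zero_add, mk_pl_mi]
      conv_lhs => rw [e, map_add, h1, add_zero]
      rfl
    have hg2 : ∀ l, g l ∈ coHW p n (k - 1) := fun l => by
      refine IsCoHW.of_pl (l := g l) ?_
      have : g l ∘ₗ pl = l.1.1 := ext fun v => (hg l v).symm
      rw [this]
      exact l.1.2
    refine LinearMap.finrank_le_finrank_of_injective (f := g.codRestrict _ hg2) ?_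
    rw [injective_iff_map_eq_zero]
    intro l h
    refine Subtype.ext (Subtype.ext (ext fun v => ?_))
    rw [hg, show g l = 0 from congrArg Subtype.val h]; rfl

lemma finrank_coHW_zero (hp : 2 ≤ p) (n : ℕ) : finrank ℂ (coHW p (n + 1) 0) ≤
    finrank ℂ (coHW p n 1) := by
  have h := finrank_coHW_succ (p := p) n (zero_add 1).symm (zero_sub (1 : ℤ)).symm
  have h1 : coHW p n (-1) = ⊥ := by
    rw [eq_bot_iff]; exact fun l hl => (mem_coHW.1 hl).eq_zero hp (by norm_num)
  rwa [h1, finrank_bot, add_zero] at h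

lemma finrank_coHW_self (n : ℕ) : finrank ℂ (coHW p n n) ≤ 1 := by
  induction n with
  | zero =>
    refine (Submodule.finrank_le _).trans (le_of_eq ?_)
    rw [Module.finrank_linearMap_self]
    exact Module.finrank_self ℂ
  | succ n ih =>
    have h := finrank_coHW_succ (p := p) n (a := n + 2) (b := n) (k := (n + 1 : ℕ)) (by push_cast; ring)
      (by push_cast; ring)
    rw [coHW_eq_bot (k := (n : ℤ) + 2) (by omega), finrank_bot, zero_add] at h
    exact h.trans ih

lemma finrank_coHW_le_nf (hp : 2 ≤ p) (k : ℕ) : ∀ j n, n + 1 = k + j →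
    finrank ℂ (coHW p (2 * k + j) j) ≤ finrank ℂ (nf p n k) := by
  induction k with
  | zero =>
    intro j n _
    rw [mul_zero, zero_add]
    exact (finrank_coHW_self j).trans (finrank_nf_pos n 0)
  | succ k ih =>
    intro j
    induction j with
    | zero =>
      intro n hn
      obtain rfl : n = k := by omega
      exact (finrank_coHW_zero hp (2 * n + 1)).trans ((ih 1 n rfl).trans
        (Submodule.finrank_mono (nf_mono (Nat.le_succ _))))
    | succ j ihj =>
      intro n hn
      obtain ⟨m, rfl⟩ : ∃ m, n = m + 1 := ⟨n - 1, by omega⟩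
      have h1 := finrank_coHW_succ (p := p) (2 * (k + 1) + j) (a := (j + 2 : ℕ)) (b := j)
        (k := (j + 1 : ℕ)) (by push_cast; ring) (by push_cast; ring)
      have h2 := ihj m (by omega)
      have h3 := ih (j + 2) (m + 1) (by omega)
      have h4 := finrank_nf_ge (p := p) (n := m) (k := k) (by omega)
      rw [show 2 * k + (j + 2) = 2 * (k + 1) + j by ring] at h3
      exact h1.trans (by omega)

/-- The space of the maps between spin chains that commute with the quantum group. -/
def homU (p m n : ℕ) : Submodule ℂ (Chain m →ₗ[ℂ] Chain n) where
  carrier := {f | IsU p f}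
  add_mem' ha hb := ha.add hb
  zero_mem' := IsU.zero
  smul_mem' c _ ha := ha.smul c

lemma finrank_homU_bend (a b : ℕ) : finrank ℂ (homU p a (b + 1)) ≤
    finrank ℂ (homU p (a + 1) b) := by
  let f : homU p a (b + 1) →ₗ[ℂ] Chain (a + 1) →ₗ[ℂ] Chain b :=
    { toFun := fun y => cap p b ∘ₗ up y.1
      map_add' := fun y z => by rw [← comp_add]; rfl
      map_smul' := fun c y => by rw [RingHom.id_apply, ← LinearMap.comp_smul]; rfl }
  refine LinearMap.finrank_le_finrank_of_injective
    (f := f.codRestrict (homU p (a + 1) b) fun y => isU_cap.comp (IsU.up y.2)) ?_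
  rw [injective_iff_map_eq_zero]
  intro y h
  have h1 : ∀ w, cap p b (up y.1 w) = 0 := fun w => lin_congr (congrArg Subtype.val h) w
  refine Subtype.ext (ext fun v => chain_ext ?_ ?_)
  · have h2 : (q p)⁻¹ • mi (y.1 0) - pl (y.1 v) = 0 := h1 (mk 0 v)
    rw [map_zero, map_zero, smul_zero, zero_sub, neg_eq_zero] at h2
    rw [h2]; rfl
  · have h2 : (q p)⁻¹ • mi (y.1 v) - pl (y.1 0) = 0 := h1 (mk v 0)
    rw [map_zero, map_zero, sub_zero] at h2
    exact (smul_eq_zero.1 h2).resolve_left (inv_ne_zero (q_ne p))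

lemma finrank_homU_le (hp : 2 ≤ p) (a b : ℕ) : finrank ℂ (homU p a b) ≤
    finrank ℂ (coHW p (a + b) 0) := by
  induction b generalizing a with
  | zero =>
    refine Submodule.finrank_mono (t := coHW p a 0) fun f hf => ?_
    have hU : IsU p (n := 0) f := hf
    have hF : ∀ b : ℤ, b ≠ 0 → ∀ v, f (chainF p a b v) = 0 := fun b hb v => by
      have h := hU.F b v
      rw [chainF, if_neg hb] at h
      exact h
    exact ⟨fun φ v => hU.D φ v, hF 1 one_ne_zero, hF p (by omega)⟩
  | succ b ih =>
    rw [show a + (b + 1) = (a + 1) + b by ring]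
    exact (finrank_homU_bend a b).trans (ih (a + 1))

/-- Every endomorphism of the spin chain that commutes with the quantum group comes from the
Temperley–Lieb algebra. -/
lemma exists_xxzRep (hp : 2 ≤ p) {f : Chain (n + 1) →ₗ[ℂ] Chain (n + 1)} (hf : IsU p f) :
    ∃ a, xxzRep p (n + 1) a = f := by
  let g : TL p (n + 1) →ₗ[ℂ] homU p (n + 1) (n + 1) :=
    (xxzRep p (n + 1)).toLinearMap.codRestrict _ (IsU.of_xxzRep (n + 1))
  have hg : Injective g := fun a b h => xxzRep_injective p n (congrArg Subtype.val h)
  have h1 := finrank_homU_le hp (n + 1) (n + 1)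
  have h2 := finrank_coHW_le_nf hp (n + 1) 0 n rfl
  rw [nf_eq_top n (n + 1) (Nat.le_succ n), finrank_top, add_zero, two_mul] at h2
  have h3 := LinearMap.finrank_le_finrank_of_injective hg
  obtain ⟨a, ha⟩ := (LinearMap.injective_iff_surjective_of_finrank_eq_finrank
    (le_antisymm h3 (h1.trans h2))).1 hg ⟨f, hf⟩
  exact ⟨a, congrArg Subtype.val ha⟩

lemma exists_tlHom {hp : 2 ≤ p} {N : ℕ} (hN : 1 ≤ N) (f : HC hp N →ₗ[U p] HC hp N) :
    ∃ a, tlHom hp a = f := by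
  obtain ⟨n, rfl⟩ : ∃ n, N = n + 1 := ⟨N - 1, by omega⟩
  obtain ⟨a, ha⟩ := exists_xxzRep hp (isU_under f)
  refine ⟨a, ext fun v => ?_⟩
  exact lin_congr ha v

end dimensions

/-! ### Homomorphisms to contragredient Weyl modules and irreducible modules -/

section heads

variable {p N k s r : ℕ} {hp : 2 ≤ p}

lemma comp_kap_coweyl (hk : p ≤ k + 1) (θ : HC hp N →ₗ[U p] CW hp k) : θ.comp (kap hp N) = 0 := by
  refine comp_kap fun m hm α => ?_
  by_contra h
  have := hom_simple_coweyl _ (by omega) le_rfl _ h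
  omega

/-- The embedding of chains that adds pairs of sites in the `q`-antisymmetric state. -/
def cups (p n : ℕ) : (d : ℕ) → Chain n →ₗ[ℂ] Chain (n + 2 * d)
  | 0 => LinearMap.id
  | d + 1 => cup p (n + 2 * d) ∘ₗ cups p n d

/-- The contraction of pairs of sites. -/
def caps (p n : ℕ) : (d : ℕ) → Chain (n + 2 * d) →ₗ[ℂ] Chain n
  | 0 => LinearMap.id
  | d + 1 => caps p n d ∘ₗ cap p (n + 2 * d)

lemma isU_cups (n d : ℕ) : IsU p (cups p n d) := by
  induction d with
  | zero => exact IsU.id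
  | succ d ih => exact isU_cup.comp ih

lemma isU_caps (n d : ℕ) : IsU p (caps p n d) := by
  induction d with
  | zero => exact IsU.id
  | succ d ih => exact ih.comp isU_cap

lemma caps_surjective (n d : ℕ) : Surjective (caps p n d) := by
  induction d with
  | zero => exact Function.surjective_id
  | succ d ih => exact ih.comp cap_surjective

lemma caps_cups (n d : ℕ) (v : Chain n) : caps p n d (cups p n d v) = (q p + (q p)⁻¹) ^ d • v := by
  induction d with
  | zero => rw [pow_zero, one_smul]; rfl
  | succ d ih =>
    have h1 : ∀ w, cap p (n + 2 * d) (cup p (n + 2 * d) w) = (q p + (q p)⁻¹) • w := fun w => by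
      rw [cap_apply, cup_apply, pl_mk, mi_mk, mi_mk, pl_mk, neg_smul, sub_neg_eq_add, ← add_smul,
        add_comm (q p)⁻¹]
    change caps p n d (cap p (n + 2 * d) (cup p (n + 2 * d) (cups p n d v))) = _
    rw [h1, map_smul, ih, smul_smul, pow_succ']

/-- The functional that reads off the coefficient of `+ + ⋯ +`. -/
def topCoeff : (n : ℕ) → Chain n →ₗ[ℂ] ℂ
  | 0 => (LinearMap.id : ℂ →ₗ[ℂ] ℂ)
  | n + 1 => topCoeff n ∘ₗ pl

lemma topCoeff_top (n : ℕ) : topCoeff n (top n) = 1 := by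
  induction n with
  | zero => rfl
  | succ n ih => exact ih

lemma isCoHW_topCoeff (hp : 2 ≤ p) (n : ℕ) : IsCoHW p n (topCoeff n) := by
  obtain ⟨l, h1, h2⟩ := exists_coHW_top hp n
  have h3 : topCoeff n = l := by
    have ht := topCoeff_top n
    have hD : ∀ φ v, topCoeff n (chainDiag n φ v) = φ n * topCoeff n v := by
      clear h1 h2 l ht
      induction n with
      | zero => intro φ v; rfl
      | succ n ih =>
        intro φ v
        change topCoeff n (pl (chainDiag (n + 1) φ v)) = _
        rw [pl_D, ih]; push_cast; rfl
    refine ext fun v => ?_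
    obtain ⟨c, hc⟩ := diag_top v
    have a1 := hD (fun x => if x = n then 1 else 0) v
    have a2 := h1.D (fun x => if x = n then 1 else 0) v
    rw [hc, if_pos rfl, one_mul] at a1 a2
    rw [← a1, ← a2, map_smul, map_smul, ht, h2]
  rw [h3]; exact h1

lemma exists_topCoeff_E {n j : ℕ} (hj : j ≤ n) : ∃ v, topCoeff n (chainE p n j v) ≠ 0 := by
  induction n generalizing j with
  | zero =>
    obtain rfl : j = 0 := by omega
    refine ⟨(1 : ℂ), ?_⟩
    rw [Nat.cast_zero, (E_zero 0).1]
    exact one_ne_zero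
  | succ n ih =>
    obtain rfl | ⟨i, rfl⟩ : j = 0 ∨ ∃ i, j = i + 1 := by
      cases j with
      | zero => exact .inl rfl
      | succ i => exact .inr ⟨i, rfl⟩
    · obtain ⟨v, hv⟩ := ih (Nat.zero_le n)
      refine ⟨mk v 0, ?_⟩
      rw [Nat.cast_zero, (E_zero _).1] at hv ⊢
      exact hv
    · obtain ⟨v, hv⟩ := ih (show i ≤ n by omega)
      refine ⟨mk 0 v, ?_⟩
      change topCoeff n (pl (chainE p (n + 1) ((i + 1 : ℕ) : ℤ) (mk 0 v))) ≠ 0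
      rw [pl_E, pl_mk, mi_mk, map_zero, smul_zero, zero_add]
      push_cast
      rwa [add_sub_cancel_right]

/-- The surjection from the chain of length `k` onto the contragredient Weyl module. -/
def topHom (hp : 2 ≤ p) (k : ℕ) : HC hp k →ₗ[U p] CW hp k := xiHom (isCoHW_topCoeff hp k)

lemma exists_chain_surjective (hkN : k ≤ N) (hpar : Even (k + N)) :
    ∃ ρ : HC hp N →ₗ[U p] HC hp k, Surjective ρ := by
  obtain ⟨d, rfl⟩ : ∃ d, N = k + 2 * d := by
    obtain ⟨c, hc⟩ := hpar; exact ⟨c - k, by omega⟩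
  exact ⟨(isU_caps k d).hom hp, caps_surjective k d⟩

variable (hs : s ≤ p) (hs1 : 1 ≤ s) (hr : 1 ≤ r) (hk : k + 1 + s = (r + 1) * p)

include hs hr hk in
lemma p_le_of_eq : p ≤ k + 1 := by nlinarith

lemma headCoweyl_topHom : (headCoweyl hs hs1 hr hk).comp (topHom hp k) ≠ 0 := by
  intro h
  have hb : p - s ≤ k := by have := p_le_of_eq hs hr hk; omega
  obtain ⟨v, hv⟩ := exists_topCoeff_E (p := p) hb
  have h1 := (headCoweyl_eq_zero hs hs1 hr hk _).1
    (lin_congr h ((RepSpace.out (chainRep hp k)).symm v)) (sv hp hs r 0 0)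
  rw [socWeyl_sv] at h1
  refine hv ?_
  have h2 := ev_xiHom (isCoHW_topCoeff hp k) ((RepSpace.out (chainRep hp k)).symm v) ((p - s : ℕ) : ℤ)
  push_cast [Nat.cast_sub hs] at h2 ⊢
  exact h2.symm.trans h1

lemma hom_coweyl_surjective {Y : Type} [AddCommGroup Y] [Module (U p) Y] {φ : Y →ₗ[U p] CW hp k}
    (h : (headCoweyl hs hs1 hr hk).comp φ ≠ 0) : Surjective φ := by
  refine range_eq_top.1 (coweyl_eq_top hs hs1 hr hk _ fun h1 => h ?_)
  exact ext fun v => h1 ⟨v, rfl⟩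

/-- Every homomorphism to the contragredient Weyl module is obtained from a given one that is not
killed by the projection to the head. -/
lemma exists_smul_coweyl (hN : 1 ≤ N) {φ : HC hp N →ₗ[U p] CW hp k}
    (h : (headCoweyl hs hs1 hr hk).comp φ ≠ 0) (θ : HC hp N →ₗ[U p] CW hp k) :
    ∃ a : TL p N, θ = φ.comp (tlHom hp a) := by
  obtain ⟨ψ, hψ⟩ := exists_lift φ (hom_coweyl_surjective hs hs1 hr hk h)
    (comp_kap_coweyl (p_le_of_eq hs hr hk) θ)
  obtain ⟨a, rfl⟩ := exists_tlHom hN ψ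
  exact ⟨a, hψ.symm⟩

lemma submodule_eq_top_of {M : Type} [AddCommGroup M] [Module (U p) M] {φ : HC hp N →ₗ[U p] M}
    (h : ∀ θ : HC hp N →ₗ[U p] M, ∃ a : TL p N, θ = φ.comp (tlHom hp a))
    {W : Submodule (TL p N) (HomSpace hp N M)} (hφ : toHS φ ∈ W) : W = ⊤ := by
  rw [eq_top_iff]
  rintro θ -
  obtain ⟨a, ha⟩ := h (ofHS θ)
  change toHS (ofHS θ) ∈ W
  rw [ha, anti_smul]
  exact W.smul_mem _ hφ

/-- The map of Hom spaces induced by the projection to the head. -/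
def headHS (hp : 2 ≤ p) (N : ℕ) {k s r : ℕ} (hs : s ≤ p) (hs1 : 1 ≤ s) (hr : 1 ≤ r)
    (hk : k + 1 + s = (r + 1) * p) : HomSpace hp N (CW hp k) →ₗ[TL p N] HomSpace hp N (SX hp hs r) :=
  hsMap hp N (headCoweyl hs hs1 hr hk)

lemma ker_headHS_ne_top (hkN : k ≤ N) (hpar : Even (k + N)) :
    ker (headHS hp N hs hs1 hr hk) ≠ ⊤ := by
  intro h
  obtain ⟨ρ, hρ⟩ := exists_chain_surjective (hp := hp) hkN hpar
  refine headCoweyl_topHom (hp := hp) hs hs1 hr hk (ext fun v => ?_)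
  obtain ⟨w, rfl⟩ := hρ v
  have h1 : toHS ((topHom hp k).comp ρ) ∈ ker (headHS hp N hs hs1 hr hk) := by
    rw [h]; trivial
  exact lin_congr (show (headCoweyl hs hs1 hr hk).comp ((topHom hp k).comp ρ) = 0 from h1) w

lemma eq_top_of_not_le_ker (hN : 1 ≤ N) {W : Submodule (TL p N) (HomSpace hp N (CW hp k))}
    (h : ¬ W ≤ ker (headHS hp N hs hs1 hr hk)) : W = ⊤ := by
  obtain ⟨φ, hφ, h1⟩ := SetLike.not_le_iff_exists.1 h
  exact submodule_eq_top_of (exists_smul_coweyl hs hs1 hr hk hN h1) hφ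

lemma subsingleton_st (h : N < k) : Subsingleton (RepSpace (stRep p N k)) :=
  have : IsEmpty (LinkState N k) := ⟨fun l => by
    have := l.card_fixed.symm.le.trans (Finset.card_le_univ _)
    rw [Fintype.card_fin] at this; omega⟩
  inferInstanceAs (Subsingleton (LinkState N k →₀ ℂ))

lemma sSup_ne_top_eq_ker {R M H X : Type} [Ring R] [AddCommGroup M] [Module R M] [AddCommGroup H]
    [Module R H] [AddCommGroup X] [Module R X] (e : M ≃ₗ[R] H) (g : H →ₗ[R] X) (h1 : ker g ≠ ⊤)
    (h2 : ∀ W : Submodule R H, ¬ W ≤ ker g → W = ⊤) :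
    sSup {W : Submodule R M | W ≠ ⊤} = ker (g ∘ₗ e.toLinearMap) := by
  refine le_antisymm (sSup_le fun W hW => by_contra fun h => hW ?_) (le_sSup fun h => h1 ?_)
  · have h3 := h2 (W.map e.toLinearMap) fun h4 => h ?_
    · rw [← Submodule.comap_map_eq_of_injective e.injective W]
      exact (congrArg (Submodule.comap e.toLinearMap) h3).trans (Submodule.comap_top _)
    · rw [LinearMap.ker_comp]; exact Submodule.map_le_iff_le_comap.1 h4
  · rw [eq_top_iff]
    rintro x -
    have h3 : e.symm x ∈ ker (g ∘ₗ e.toLinearMap) := by rw [h]; trivial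
    rw [mem_ker, comp_apply] at h3
    simpa using h3

def maxSt (p N k : ℕ) : Submodule (TL p N) (RepSpace (stRep p N k)) := maxSub p N k

def irrIso (p N k : ℕ) : irrMod p N k ≃ₗ[TL p N] (RepSpace (stRep p N k) ⧸ maxSt p N k) :=
  LinearEquiv.refl _ _

/-- The maximal proper submodule of the standard module, in terms of homomorphisms. -/
lemma maxSt_eq (hN : 1 ≤ N) (hpar : Even (k + N)) : maxSt p N k =
    ker ((headHS hp N hs hs1 hr hk).comp (stEquiv hp N k).toLinearMap) := by
  by_cases hkN : k ≤ N
  · refine Eq.trans (if_neg ?_) (sSup_ne_top_eq_ker _ _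
      (ker_headHS_ne_top (hp := hp) hs hs1 hr hk hkN hpar) fun W => eq_top_of_not_le_ker hs hs1 hr hk hN)
    have := p_le_of_eq hs hr hk
    omega
  · have := subsingleton_st (p := p) (not_le.1 hkN)
    exact Subsingleton.elim _ _

def irrEquivRange (hN : 1 ≤ N) (hpar : Even (k + N)) :
    irrMod p N k ≃ₗ[TL p N] range (headHS hp N hs hs1 hr hk) :=
  (irrIso p N k).trans ((Submodule.quotEquivOfEq _ _ (maxSt_eq (hp := hp) hs hs1 hr hk hN hpar)).trans
    ((LinearMap.quotKerEquivRange _).trans (LinearEquiv.ofEq _ _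
      (LinearMap.range_comp_of_range_eq_top _ (stEquiv hp N k).range))))

lemma comp_kap_simple (hr1 : 1 < r) (θ : HC hp N →ₗ[U p] SX hp hs r) : θ.comp (kap hp N) = 0 :=
  comp_kap_of_no_invariant (sx_no_invariant hr1) θ

lemma headHS_surjective (hr1 : 1 < r) :
    Surjective (headHS hp N hs hs1 hr hk) := fun θ =>
  exists_lift _ (headCoweyl_surjective hs hs1 hr hk) (comp_kap_simple hs hr1 θ)

/-- The irreducible module as the module of homomorphisms to an irreducible module. -/
def irrEquiv (hN : 1 ≤ N) (hpar : Even (k + N)) (hr1 : 1 < r) :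
    irrMod p N k ≃ₗ[TL p N] HomSpace hp N (SX hp hs r) :=
  (irrEquivRange hs hs1 hr hk hN hpar).trans
    (LinearEquiv.ofTop _ (range_eq_top.2 (headHS_surjective hs hs1 hr hk hr1)))

end heads

/-! ### Projective covers -/

section bridge

open CategoryTheory

variable {A : Type} [Ring A] [Algebra ℂ A]

/-- The lifting property of projective objects, for finite-dimensional modules. -/
def IsProj (A P : Type) [Ring A] [Algebra ℂ A] [AddCommGroup P] [Module A P] : Prop :=
  ∀ (M M' : Type) [AddCommGroup M] [Module ℂ M] [Module A M] [IsScalarTower ℂ A M]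
    [AddCommGroup M'] [Module ℂ M'] [Module A M'] [IsScalarTower ℂ A M']
    [FiniteDimensional ℂ M] [FiniteDimensional ℂ M'] (g : M →ₗ[A] M') (f : P →ₗ[A] M'),
    Surjective g → ∃ h : P →ₗ[A] M, g.comp h = f

lemma isFinDim_of (Y : Type) [AddCommGroup Y] [Module ℂ Y] [Module A Y] [IsScalarTower ℂ A Y]
    [FiniteDimensional ℂ Y] : IsFinDim (ModuleCat.of A Y) := by
  let e : Y ≃ₗ[ℂ] (ModuleCat.restrictScalars (algebraMap ℂ A)).obj (ModuleCat.of A Y) :=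
    { AddEquiv.refl Y with map_smul' := fun c y => (algebraMap_smul A c y).symm }
  exact Module.Finite.equiv e

lemma isScalarTower_compHom (Y : Type) [AddCommGroup Y] [Module A Y] :
    letI := Module.compHom Y (algebraMap ℂ A); IsScalarTower ℂ A Y :=
  letI := Module.compHom Y (algebraMap ℂ A)
  ⟨fun c a y => by rw [Algebra.smul_def, mul_smul]; rfl⟩

lemma isProjectiveCover_ofHom {P X : Type} [AddCommGroup P] [Module ℂ P] [Module A P]
    [IsScalarTower ℂ A P] [FiniteDimensional ℂ P] [AddCommGroup X] [Module A X] (π : P →ₗ[A] X)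
    (h : IsProj A P) (hs : Surjective π)
    (hsup : ∀ W : Submodule A P, W ⊔ ker π = ⊤ → W = ⊤) :
    IsProjectiveCover (ModuleCat.ofHom π) where
  finDim := isFinDim_of P
  lifts M M' hM hM' g f hg := by
    let := Module.compHom M (algebraMap ℂ A)
    let := Module.compHom M' (algebraMap ℂ A)
    have := isScalarTower_compHom (A := A) M
    have := isScalarTower_compHom (A := A) M'
    have : FiniteDimensional ℂ M := hM
    have : FiniteDimensional ℂ M' := hM'
    obtain ⟨l, hl⟩ := h M M' g.hom f.hom hg
    exact ⟨ModuleCat.ofHom l, ModuleCat.hom_ext hl⟩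
  surjective := hs
  superfluous := hsup

lemma IsProjectiveCover.isProj {P X : ModuleCat.{0} A} {π : P ⟶ X} (h : IsProjectiveCover π) :
    IsProj A P := by
  intro M M' _ _ _ _ _ _ _ _ _ _ g f hg
  obtain ⟨l, hl⟩ := h.lifts (ModuleCat.of A M) (ModuleCat.of A M') (isFinDim_of M) (isFinDim_of M')
    (ModuleCat.ofHom g) (ModuleCat.ofHom f) hg
  exact ⟨l.hom, congrArg ModuleCat.Hom.hom hl⟩

end bridge

section covers

variable {p N k s r : ℕ} {hp : 2 ≤ p}

instance homSpaceModule (M : Type) [AddCommGroup M] [Module (U p) M] : Module ℂ (HomSpace hp N M) :=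
  Module.compHom _ (algebraMap ℂ (TL p N))

instance homSpaceTower (M : Type) [AddCommGroup M] [Module (U p) M] :
    IsScalarTower ℂ (TL p N) (HomSpace hp N M) := isScalarTower_compHom _

instance submoduleFinite {Y : Type} [AddCommGroup Y] [Module ℂ Y] [Module (U p) Y]
    [IsScalarTower ℂ (U p) Y] [FiniteDimensional ℂ Y] (W : Submodule (U p) Y) :
    FiniteDimensional ℂ W :=
  FiniteDimensional.of_injective (toC W.subtype) Subtype.val_injective

lemma finrank_lt {Y : Type} [AddCommGroup Y] [Module ℂ Y] [Module (U p) Y]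
    [IsScalarTower ℂ (U p) Y] [FiniteDimensional ℂ Y] {W W' : Submodule (U p) Y} (h : W ≤ W')
    (hf : finrank ℂ W' ≤ finrank ℂ W) : W = W' := by
  have h1 := Submodule.eq_of_le_of_finrank_le (S₁ := W.restrictScalars ℂ) (S₂ := W'.restrictScalars ℂ)
    (fun x hx => h hx) hf
  exact SetLike.ext fun x => by
    rw [← Submodule.restrictScalars_mem ℂ W, h1, Submodule.restrictScalars_mem]

/-- The projective cover of a simple quotient of the spin chain, as a submodule of the spin chain. -/
lemma exists_cover {X : Type} [AddCommGroup X] [Module (U p) X] [Module ℂ X] [IsScalarTower ℂ (U p) X]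
    (π : HC hp N →ₗ[U p] X) (hπ : π.comp (eps hp N) = π) (hs : Surjective π) :
    ∃ Q : Submodule (U p) (HC hp N), IsProj (U p) Q ∧ Surjective (π.comp Q.subtype) ∧
      ∀ W : Submodule (U p) Q, W ⊔ ker (π.comp Q.subtype) = ⊤ → W = ⊤ := by
  obtain ⟨u, ⟨hu1, hu2⟩, hmin⟩ := (measure fun u : HC hp N →ₗ[U p] HC hp N =>
    finrank ℂ (range u)).wf.has_min {u | HasLift u ∧ π.comp u = π} ⟨_, eps_lift, hπ⟩
  replace hmin : ∀ v : HC hp N →ₗ[U p] HC hp N, π.comp v = π →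
      finrank ℂ (range u) ≤ finrank ℂ (range (v.comp u)) := by
    intro v hv
    refine not_lt.1 (hmin (v.comp u) ⟨fun M M' _ _ _ _ _ _ _ _ _ g φ hg => ?_, ?_⟩)
    · obtain ⟨ψ, hψ⟩ := hu1 M M' g (φ.comp v) hg
      exact ⟨ψ, by rw [hψ, comp_assoc]⟩
    · rw [← comp_assoc, hv, hu2]
  set Q := range u with hQ
  let u' : HC hp N →ₗ[U p] Q := u.rangeRestrict
  have hsub : Surjective (π.comp Q.subtype) := fun x => by
    obtain ⟨v, rfl⟩ := hs x
    exact ⟨u' v, lin_congr hu2 v⟩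
  have hv : Function.Bijective (toC (u'.comp Q.subtype)) := by
    rw [Function.Bijective, LinearMap.injective_iff_surjective, and_self]
    have h1 : range (u.comp u) = Q := finrank_lt (LinearMap.range_comp_le_range _ _) (hmin u hu2)
    rintro ⟨y, hy⟩
    rw [← h1] at hy
    obtain ⟨x, rfl⟩ := hy
    exact ⟨u' x, rfl⟩
  let e : Q ≃ₗ[U p] Q := LinearEquiv.ofBijective (u'.comp Q.subtype) hv
  refine ⟨Q, fun M M' _ _ _ _ _ _ _ _ _ _ g f hg => ?_, hsub, fun W hW => ?_⟩
  · obtain ⟨ψ, hψ⟩ := hu1 M M' g (f.comp u') hg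
    refine ⟨(ψ.comp Q.subtype).comp (e.symm.toLinearMap.comp e.symm.toLinearMap),
      ext fun x => ?_⟩
    obtain ⟨y, rfl⟩ := e.surjective x
    obtain ⟨z, rfl⟩ := e.surjective y
    have h1 := lin_congr hψ z
    simp only [comp_apply, LinearEquiv.coe_coe, LinearEquiv.symm_apply_apply] at h1 ⊢
    exact h1
  · have hWs : Surjective ((π.comp Q.subtype).comp W.subtype) := fun x => by
      obtain ⟨y, rfl⟩ := hsub x
      obtain ⟨w, hw, z, hz, rfl⟩ := Submodule.mem_sup.1 (show y ∈ W ⊔ _ by rw [hW]; trivial)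
      exact ⟨⟨w, hw⟩, by
        rw [map_add, mem_ker.1 hz, add_zero]; rfl⟩
    obtain ⟨ψ, hψ⟩ := hu1 _ _ ((π.comp Q.subtype).comp W.subtype) π hWs
    have h1 := hmin ((Q.subtype.comp W.subtype).comp ψ) (hψ.trans hu2)
    have h2 : range (((Q.subtype.comp W.subtype).comp ψ).comp u) ≤ W.map Q.subtype := by
      rintro _ ⟨x, rfl⟩
      exact ⟨_, (ψ (u x)).2, rfl⟩
    have h3 := finrank_lt ((h2.trans (Submodule.map_subtype_le _ _))) h1
    rw [h3] at h2
    rw [eq_top_iff]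
    rintro x -
    obtain ⟨y, hy, hyx⟩ := h2 x.2
    rwa [← Subtype.ext hyx]

lemma finite_tl (hN : 1 ≤ N) : FiniteDimensional ℂ (TL p N) := by
  obtain ⟨n, rfl⟩ : ∃ n, N = n + 1 := ⟨N - 1, by omega⟩
  infer_instance

/-- The algebra as a module of homomorphisms. -/
def tlEquiv (hN : 1 ≤ N) : TL p N ≃ₗ[TL p N] HomSpace hp N (HC hp N) :=
  LinearEquiv.ofBijective (LinearMap.toSpanSingleton (TL p N) _ (toHS (LinearMap.id : HC hp N →ₗ[U p] HC hp N))) (by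
    constructor
    · rw [injective_iff_map_eq_zero]
      intro a ha
      obtain ⟨n, rfl⟩ : ∃ n, N = n + 1 := ⟨N - 1, by omega⟩
      have h1 : (tlAnti p (n + 1) a).unop = 0 := xxzRep_injective p n (by
        rw [map_zero]
        exact ext fun v => lin_congr (congrArg ofHS ha) v)
      rw [← tlAnti_tlAnti a, h1, map_zero, MulOpposite.unop_zero]
    · intro θ
      obtain ⟨a, ha⟩ := exists_tlHom hN (ofHS θ)
      refine ⟨(tlAnti p N a).unop, ?_⟩
      change (tlAnti p N a).unop • toHS LinearMap.id = θ
      rw [← anti_smul, ha]; rfl)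

lemma tlEquiv_apply (hN : 1 ≤ N) (a : TL p N) :
    tlEquiv (hp := hp) hN a = a • toHS (LinearMap.id : HC hp N →ₗ[U p] HC hp N) := rfl

variable (hs : s ≤ p) (hs1 : 1 ≤ s) (hr : 1 ≤ r) (hk : k + 1 + s = (r + 1) * p)

lemma exists_head (hkN : k ≤ N) (hpar : Even (k + N)) :
    ∃ φ : HC hp N →ₗ[U p] CW hp k, (headCoweyl hs hs1 hr hk).comp φ ≠ 0 := by
  by_contra! h
  exact ker_headHS_ne_top (hp := hp) hs hs1 hr hk hkN hpar (eq_top_iff.2 fun φ _ => h φ)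

include hs1 hr hk in
lemma exists_projectiveCover_simple (hkN : k ≤ N) (hpar : Even (k + N)) :
    ∃ (P : ModuleCat.{0} (U p)) (π : P ⟶ simpleMod hp r hs), IsProjectiveCover π := by
  obtain ⟨φ, hφ⟩ := exists_head (hp := hp) hs hs1 hr hk hkN hpar
  obtain ⟨Q, h1, h2, h3⟩ := exists_cover _ (show ((headCoweyl hs hs1 hr hk).comp φ).comp (eps hp N) = _ by
    rw [comp_assoc, comp_eps (comp_kap_coweyl (p_le_of_eq hs hr hk) φ)])
    (simple_hom_surjective hs hs1 hr _ hφ)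
  exact ⟨_, _, isProjectiveCover_ofHom _ h1 h2 h3⟩

include hs1 hr hk in
lemma exists_projectiveCover_irr (hN : 1 ≤ N) (hkN : k ≤ N) (hpar : Even (k + N)) {P : Type}
    [AddCommGroup P] [Module ℂ P] [Module (U p) P] [IsScalarTower ℂ (U p) P] [FiniteDimensional ℂ P]
    (hP : IsProj (U p) P) (π : P →ₗ[U p] SX hp hs r)
    (hπ : ∀ W : Submodule (U p) P, W ⊔ ker π = ⊤ → W = ⊤) (hπs : Surjective π) :
    ∃ π' : ModuleCat.of (TL p N) (HomSpace hp N P) ⟶ irrMod p N k, IsProjectiveCover π' := by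
  obtain ⟨φ0, hφ0⟩ := exists_head (hp := hp) hs hs1 hr hk hkN hpar
  have hsurj : ∀ φ : HC hp N →ₗ[U p] P, π.comp φ ≠ 0 → Surjective φ := fun φ hφ => by
    refine range_eq_top.1 (hπ _ (eq_top_iff.2 fun y _ => ?_))
    obtain ⟨v, hv⟩ := simple_hom_surjective hs hs1 hr _ hφ (π y)
    refine Submodule.mem_sup.2 ⟨φ v, ⟨v, rfl⟩, y - φ v, ?_, add_sub_cancel _ _⟩
    rw [mem_ker, map_sub, ← hv]
    exact sub_self _
  obtain ⟨ψ, hψ⟩ := exists_lift π hπs (θ := (headCoweyl hs hs1 hr hk).comp φ0) (by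
    rw [comp_assoc, comp_kap_coweyl (p_le_of_eq hs hr hk) φ0, comp_zero])
  rw [← hψ] at hφ0
  have key : ∀ φ : HC hp N →ₗ[U p] P, π.comp φ ≠ 0 → ∃ σ : P →ₗ[U p] HC hp N, φ.comp σ = LinearMap.id :=
    fun φ hφ => hP _ _ φ LinearMap.id (hsurj φ hφ)
  obtain ⟨σ, hσ⟩ := key ψ hφ0
  obtain ⟨π1, hπ1⟩ := hP _ _ (headCoweyl hs hs1 hr hk) π (headCoweyl_surjective hs hs1 hr hk)
  have hgen : ∀ θ : HomSpace hp N P,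
      (tlEquiv (hp := hp) hN).symm (hsMap hp N σ θ) • toHS ψ = θ := by
    intro θ
    have h1 := (tlEquiv (hp := hp) hN).apply_symm_apply (hsMap hp N σ θ)
    rw [tlEquiv_apply] at h1
    refine (congrArg (hsMap hp N ψ) h1).trans (ext fun v => ?_)
    exact lin_congr hσ (ofHS θ v)
  have hfd : FiniteDimensional ℂ (HomSpace hp N P) := by
    have := finite_tl (p := p) hN
    exact Module.Finite.of_surjective ((LinearMap.toSpanSingleton (TL p N) _ (toHS ψ)).restrictScalars ℂ)
      fun θ => ⟨_, hgen θ⟩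
  let π2 : HomSpace hp N P →ₗ[TL p N] range (headHS hp N hs hs1 hr hk) :=
    (headHS hp N hs hs1 hr hk).rangeRestrict.comp (hsMap hp N π1)
  have hker : ∀ φ : HomSpace hp N P, π2 φ = 0 ↔ π.comp (ofHS φ) = 0 := by
    intro φ
    rw [← hπ1]
    exact Subtype.ext_iff
  refine ⟨ModuleCat.ofHom ((irrEquivRange hs hs1 hr hk hN hpar).symm.toLinearMap.comp π2),
    isProjectiveCover_ofHom _ ?_ ?_ fun W hW => ?_⟩
  · intro M M' _ _ _ _ _ _ _ _ _ _ g f hg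
    obtain ⟨m, hm⟩ := hg (f (toHS ψ))
    refine ⟨(LinearMap.toSpanSingleton (TL p N) M m).comp
      ((tlEquiv (hp := hp) hN).symm.toLinearMap.comp (hsMap hp N σ)), ext fun θ => ?_⟩
    conv_rhs => rw [← hgen θ, map_smul, ← hm, ← map_smul]
    rfl
  · refine (irrEquivRange hs hs1 hr hk hN hpar).symm.surjective.comp
      ((LinearMap.surjective_rangeRestrict _).comp (range_eq_top.1 ?_))
    refine eq_top_of_not_le_ker hs hs1 hr hk hN fun h => hφ0 ((hker (toHS ψ)).1 (Subtype.ext ?_))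
    exact h ⟨toHS ψ, rfl⟩
  · obtain ⟨φ, hφ, h1⟩ : ∃ φ ∈ W, π2 φ ≠ 0 := by
      by_contra! h
      refine hφ0 ((hker (toHS ψ)).1 ?_)
      obtain ⟨w, hw, z, hz, hwz⟩ := Submodule.mem_sup.1 (hW.ge (trivial : toHS ψ ∈ ⊤))
      rw [← hwz, map_add, h w hw, zero_add]
      exact (irrEquivRange hs hs1 hr hk hN hpar).symm.injective
        ((mem_ker.1 hz).trans (map_zero (irrEquivRange hs hs1 hr hk hN hpar).symm).symm)
    obtain ⟨τ, hτ⟩ := key (ofHS φ) fun h => h1 ((hker φ).2 h)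
    refine submodule_eq_top_of (φ := ofHS φ) (fun θ => ?_) hφ
    obtain ⟨a, ha⟩ := exists_tlHom hN (τ.comp θ)
    exact ⟨a, by rw [ha, ← comp_assoc, hτ, LinearMap.id_comp]⟩

end covers

/-! ### The contravariant form on the spin chain -/

section form

variable {p m n : ℕ} {hp : 2 ≤ p}

/-- The bilinear form on the spin chain for which the words in `v_±` are orthonormal. -/
def stdForm : (n : ℕ) → Chain n →ₗ[ℂ] Chain n →ₗ[ℂ] ℂ
  | 0 => LinearMap.mul ℂ ℂ
  | n + 1 => (stdForm n).compl₁₂ pl pl + (stdForm n).compl₁₂ mi mi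

lemma stdForm_succ (x y : Chain (n + 1)) :
    stdForm (n + 1) x y = stdForm n (pl x) (pl y) + stdForm n (mi x) (mi y) := rfl

lemma stdForm_symm (x y : Chain n) : stdForm n x y = stdForm n y x := by
  induction n with
  | zero => exact mul_comm (show ℂ from x) y
  | succ n ih => rw [stdForm_succ, stdForm_succ, ih, ih (mi x)]

lemma stdForm_nondegenerate {x : Chain n} (h : ∀ y, stdForm n x y = 0) : x = 0 := by
  induction n with
  | zero => exact (mul_one (show ℂ from x)).symm.trans (h (1 : ℂ))
  | succ n ih =>
    refine chain_ext (ih fun y => ?_) (ih fun y => ?_)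
    · have := h (mk y 0)
      rwa [stdForm_succ, pl_mk, mi_mk, map_zero, add_zero] at this
    · have := h (mk 0 y)
      rwa [stdForm_succ, pl_mk, mi_mk, map_zero, zero_add] at this

lemma stdForm_D (φ : ℤ → ℂ) (x y : Chain n) :
    stdForm n (chainDiag n φ x) y = stdForm n x (chainDiag n φ y) := by
  induction n generalizing φ with
  | zero => rw [diag_zero_apply]; simp
  | succ n ih => simp only [stdForm_succ, pl_D, mi_D, ih]

lemma stdForm_E (a : ℤ) (x y : Chain n) : stdForm n (chainE p n a x) y =
    stdForm n x (chainF p n a (chainDiag n (fun w => q p ^ (a * (w - a))) y)) := by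
  induction n generalizing a with
  | zero =>
    rw [chainE, chainF]
    split_ifs with h
    · subst h
      have h1 : chainDiag 0 (fun w => q p ^ ((0 : ℤ) * (w - 0))) y = y := by
        rw [diag_zero_apply]; simp
      exact congrArg (stdForm 0 x) h1.symm
    · simp
  | succ n ih =>
    have hd : ∀ (c : ℂ) (φ ψ : ℤ → ℂ) (v : Chain n), (∀ w, ψ w = c * φ w) →
        chainDiag n ψ v = c • chainDiag n φ v := fun c φ ψ v h => by
      rw [show ψ = fun w => c * φ w from funext h, ← diag_smul]; rfl
    simp only [stdForm_succ, pl_E, mi_E, pl_F, mi_F, pl_D, mi_D, map_add, map_smul,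
      lin_add, lin_smul, ih]
    have h1 := lin_congr (diag_mul n (fun x => q p ^ (-x)) fun w => q p ^ (a * (w + 1 - a))) (pl y)
    rw [mul_apply] at h1
    rw [h1, hd (q p ^ (-(a - 1))) (fun w => q p ^ ((a - 1) * (w - (a - 1))))
      (fun x => q p ^ (-x) * q p ^ (a * (x + 1 - a))) (pl y)
      fun w => by rw [← zpow_add₀ (q_ne p), ← zpow_add₀ (q_ne p)]; congr 1; ring]
    rw [hd (q p ^ a) (fun w => q p ^ (a * (w - a))) (fun w => q p ^ (a * (w + 1 - a))) _
        fun w => by rw [← zpow_add₀ (q_ne p)]; congr 1; ring,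
      hd (q p ^ (-a)) (fun w => q p ^ (a * (w - a))) (fun w => q p ^ (a * (w - 1 - a))) _
        fun w => by rw [← zpow_add₀ (q_ne p)]; congr 1; ring]
    simp only [map_smul, smul_eq_mul]
    rw [← mul_assoc, ← zpow_add₀ (q_ne p), add_neg_cancel, zpow_zero, one_mul]
    ring

lemma stdForm_xxz (i : ℕ) (x y : Chain n) : stdForm n (xxz p n i x) y = stdForm n x (xxz p n i y) := by
  induction n generalizing i with
  | zero => rw [xxz]; simp
  | succ n ih =>
    cases n with
    | zero => rw [xxz]; simp
    | succ n =>
      cases i with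
      | zero =>
        simp only [stdForm_succ, pl_xxz_zero, mi_xxz_zero, pl_mk, mi_mk, map_zero, map_smul,
          lin_zero, lin_smul, cap_apply, map_sub, lin_sub, smul_eq_mul]
        have := q_ne p
        field_simp
        ring
      | succ i => simp only [stdForm_succ, pl_xxz, mi_xxz, ih]

/-- The twist of the standard form that makes it contravariant. -/
def twist (p n : ℕ) : Module.End ℂ (Chain n) :=
  chainDiag n fun w => Complex.exp (-(w : ℂ) ^ 2 / 4 * (Real.pi * Complex.I / p))

lemma twist_F (a : ℤ) (y : Chain n) : twist p n (chainF p n a y) =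
    chainF p n a (chainDiag n (fun w => q p ^ (a * (w - a))) (twist p n y)) := by
  have h1 := lin_congr (diag_F (p := p) n
    (fun w => Complex.exp (-(w : ℂ) ^ 2 / 4 * (Real.pi * Complex.I / p))) a) y
  have h2 := lin_congr (diag_mul n (fun w => q p ^ (a * (w - a)))
    (fun w => Complex.exp (-(w : ℂ) ^ 2 / 4 * (Real.pi * Complex.I / p)))) y
  rw [mul_apply] at h2
  refine h1.trans ?_
  rw [twist, h2]
  change chainF p n a _ = _
  congr 3
  funext w
  rw [q_zpow, ← Complex.exp_add]
  congr 1
  push_cast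
  ring

/-- The contravariant form on the spin chain. -/
def chainForm (p n : ℕ) : Chain n →ₗ[ℂ] Chain n →ₗ[ℂ] ℂ := (stdForm n).compl₂ (twist p n)

lemma chainForm_symm (x y : Chain n) : chainForm p n x y = chainForm p n y x :=
  (stdForm_D _ _ _).symm.trans (stdForm_symm _ _)

lemma chainForm_E (a : ℤ) (x y : Chain n) :
    chainForm p n (chainE p n a x) y = chainForm p n x (chainF p n a y) :=
  (stdForm_E _ _ _).trans (congrArg _ (twist_F a y).symm)

lemma chainForm_F (a : ℤ) (x y : Chain n) :
    chainForm p n (chainF p n a x) y = chainForm p n x (chainE p n a y) := by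
  rw [chainForm_symm, ← chainForm_E, chainForm_symm]

lemma chainForm_D (φ : ℤ → ℂ) (x y : Chain n) :
    chainForm p n (chainDiag n φ x) y = chainForm p n x (chainDiag n φ y) := by
  refine (stdForm_D _ _ _).trans (congrArg _ ?_)
  have h1 := lin_congr (diag_mul n φ
    (fun w => Complex.exp (-(w : ℂ) ^ 2 / 4 * (Real.pi * Complex.I / p)))) y
  have h2 := lin_congr (diag_mul n
    (fun w => Complex.exp (-(w : ℂ) ^ 2 / 4 * (Real.pi * Complex.I / p))) φ) y
  refine h1.trans (Eq.trans ?_ h2.symm)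
  simp only [mul_comm]

lemma chainForm_xxz (i : ℕ) (x y : Chain n) :
    chainForm p n (xxz p n i x) y = chainForm p n x (xxz p n i y) :=
  (stdForm_xxz _ _ _).trans (congrArg _ (lin_congr (xxz_diag n i _).eq y))

lemma chainForm_nondegenerate {x : Chain n} (h : ∀ y, chainForm p n x y = 0) : x = 0 := by
  refine stdForm_nondegenerate fun y => ?_
  have h1 := h (chainDiag n (fun w => Complex.exp (-(-(w : ℂ) ^ 2 / 4 * (Real.pi * Complex.I / p)))) y)
  rw [← h1]
  refine congrArg (stdForm n x) ?_
  have h2 := lin_congr (diag_mul n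
    (fun w => Complex.exp (-(w : ℂ) ^ 2 / 4 * (Real.pi * Complex.I / p)))
    (fun w => Complex.exp (-(-(w : ℂ) ^ 2 / 4 * (Real.pi * Complex.I / p))))) y
  refine Eq.trans ?_ h2.symm
  simp only [← Complex.exp_add, add_neg_cancel, Complex.exp_zero]
  rw [diag_one]; rfl

lemma K_pow_smul_chain (v : HC hp n) : U.gen p .K ^ p • v =
    (RepSpace.out (chainRep hp n)).symm (chainDiag n (fun x => (-1) ^ x) (RepSpace.out _ v)) := by
  rw [← kappa_eq hp, RepSpace.smul_def, map_pow]
  have h : chainRep hp n (U.gen p .K) = chainDiag n fun x => q p ^ x := U.lift_gen _ _ _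
  rw [h]; rfl

lemma chainForm_e (hp : 2 ≤ p) (x y : Chain n) :
    chainForm p n ((chainDiag n (fun x => q p ^ x) ^ p) (chainE p n p x)) y = (-1) ^ p *
      chainForm p n x (chainDiag n (fun x => (-1) ^ x) ((-1 : ℂ) ^ p • chainF p n p y)) := by
  rw [kappa_eq hp, chainForm_D, chainForm_E, map_smul, map_smul, smul_eq_mul, ← mul_assoc, sign_sq,
    one_mul]
  exact congrArg _ (lin_congr (kappa_F n p).eq y).symm

lemma chainForm_f (hp : 2 ≤ p) (x y : Chain n) :
    chainForm p n ((-1 : ℂ) ^ p • chainF p n p x) y = (-1) ^ p * chainForm p n x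
      (chainDiag n (fun x => (-1) ^ x) ((chainDiag n (fun x => q p ^ x) ^ p) (chainE p n p y))) := by
  rw [kappa_eq hp, ← mul_apply (chainDiag n _), kappa_sq, map_smul, lin_smul,
    chainForm_F]; rfl

def chainDualHom (hp : 2 ≤ p) (n : ℕ) : HC hp n →ₗ[U p] DualRep hp (chainRep hp n) :=
  mkHom (show HC hp n →ₗ[ℂ] DualRep hp (chainRep hp n) from chainForm p n)
    (fun x => ev_ext fun y => by
      rw [ev_E, hc_smul, hc_smul]; exact chainForm_E 1 _ _)
    (fun x => ev_ext fun y => by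
      rw [ev_F, hc_smul, hc_smul]; exact chainForm_F 1 _ _)
    (fun x => ev_ext fun y => by
      rw [ev_K, hc_smul, hc_smul]; exact chainForm_D _ _ _)
    (fun x => ev_ext fun y => by
      rw [ev_e, K_pow_smul_chain, hc_smul, hc_smul]
      exact chainForm_e hp _ _)
    (fun x => ev_ext fun y => by
      rw [ev_f, K_pow_smul_chain, hc_smul, hc_smul]
      exact chainForm_f hp _ _)

/-- The spin chain is isomorphic to its contragredient module. -/
def chainDual (hp : 2 ≤ p) (n : ℕ) : HC hp n ≃ₗ[U p] DualRep hp (chainRep hp n) :=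
  LinearEquiv.ofBijective (chainDualHom hp n) (by
    have hi : Injective (chainDualHom hp n) := by
      rw [injective_iff_map_eq_zero]
      intro x hx
      exact chainForm_nondegenerate (p := p) fun y => by
        exact congrArg (fun z => ev hp (chainRep hp n) z y) hx
    have hd : finrank ℂ (HC hp n) = finrank ℂ (DualRep hp (chainRep hp n)) :=
      (Subspace.dual_finrank_eq (K := ℂ) (V := Chain n)).symm
    exact ⟨hi, (LinearMap.injective_iff_surjective_of_finrank_eq_finrank
      (f := toC (chainDualHom hp n)) hd).1 hi⟩)

lemma chainDual_symm (x y : HC hp n) :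
    ev hp _ (chainDual hp n x) y = ev hp _ (chainDual hp n y) x := chainForm_symm _ _

/-- The adjoint of a homomorphism of chains for the contravariant forms. -/
def adj (f : HC hp m →ₗ[U p] HC hp n) : HC hp n →ₗ[U p] HC hp m :=
  (chainDual hp m).symm.toLinearMap.comp ((transp f).comp (chainDual hp n).toLinearMap)

lemma chainDual_adj (f : HC hp m →ₗ[U p] HC hp n) (y : HC hp n) (x : HC hp m) :
    ev hp _ (chainDual hp m (adj f y)) x = ev hp _ (chainDual hp n y) (f x) := by
  rw [adj, comp_apply, LinearEquiv.coe_coe, LinearEquiv.apply_symm_apply]; rfl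

lemma adj_eq {f : HC hp m →ₗ[U p] HC hp n} {g : HC hp n →ₗ[U p] HC hp m}
    (h : ∀ x y, ev hp _ (chainDual hp m (g y)) x = ev hp _ (chainDual hp n y) (f x)) : adj f = g :=
  ext fun y => (chainDual hp m).injective (ev_ext fun x => by rw [chainDual_adj, h])

lemma adj_adj (f : HC hp m →ₗ[U p] HC hp n) : adj (adj f) = f :=
  adj_eq fun x y => by rw [chainDual_symm, ← chainDual_adj, chainDual_symm]

lemma adj_comp {l : ℕ} (f : HC hp m →ₗ[U p] HC hp n) (g : HC hp l →ₗ[U p] HC hp m) :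
    adj (f.comp g) = (adj g).comp (adj f) :=
  adj_eq fun x y => by rw [comp_apply, chainDual_adj, chainDual_adj]; rfl

lemma adj_add (f g : HC hp m →ₗ[U p] HC hp n) : adj (f + g) = adj f + adj g :=
  adj_eq fun x y => by
    rw [lin_add, map_add, map_add, lin_add, chainDual_adj, chainDual_adj,
      lin_add, map_add]

lemma adj_gen (i : Fin (n - 1)) : adj (tlHom hp (TL.gen p n i)) = tlHom hp (TL.gen p n i) :=
  adj_eq fun x y => by
    have h : xxzRep p n (TL.gen p n i) = xxz p n i := TL.lift_gen _ _ _
    change chainForm p n (xxzRep p n (TL.gen p n i) y) x = chainForm p n y (xxzRep p n (TL.gen p n i) x)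
    rw [h]; exact chainForm_xxz _ _ _

lemma comp_adj_kap {Y : Type} [AddCommGroup Y] [Module (U p) Y]
    (hY : ∀ y : Y, U.gen p .e • y = 0 → U.gen p .f • y = 0 → y = 0) (φ : HC hp n →ₗ[U p] Y) :
    φ.comp (adj (kap hp n)) = 0 := by
  have h0 : ∀ v, (∀ x, ev hp _ (chainDual hp n v) (kap hp n x) = 0) → adj (kap hp n) v = 0 := fun v h =>
    (chainDual hp n).injective (ev_ext fun x => by rw [chainDual_adj, h, map_zero]; rfl)
  refine ext fun v => hY _ ?_ ?_
  · rw [comp_apply, ← map_smul, ← map_smul, h0 _ fun x => ?_, map_zero]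
    rw [map_smul, ev_e, kap_f, smul_zero, map_zero, mul_zero]
  · rw [comp_apply, ← map_smul, ← map_smul, h0 _ fun x => ?_, map_zero]
    rw [map_smul, ev_f, kap_e, smul_zero, map_zero, mul_zero]

end form

/-! ### Homomorphisms to the Weyl modules `N_{s,1}` -/

section zigzag

variable {p N k k' s : ℕ} {hp : 2 ≤ p} (hsp : s < p) (hs1 : 1 ≤ s)

lemma exists_factor {Y Y' Z : Type} [AddCommGroup Y] [Module (U p) Y] [AddCommGroup Y'] [Module (U p) Y']
    [AddCommGroup Z] [Module (U p) Z] {i : Y →ₗ[U p] Y'} (hi : Injective i) (φ : Z →ₗ[U p] Y')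
    (h : ∀ z, φ z ∈ range i) : ∃ ξ : Z →ₗ[U p] Y, i.comp ξ = φ :=
  ⟨(LinearEquiv.ofInjective i hi).symm.toLinearMap.comp (φ.codRestrict _ h), ext fun z =>
    congrArg Subtype.val ((LinearEquiv.ofInjective i hi).apply_symm_apply ⟨φ z, h z⟩)⟩

include hs1 in
lemma comp_simple_one (hk : p ≤ k) (δ : HC hp N →ₗ[U p] CW hp k) (α : SX hp hsp.le 1 →ₗ[U p] HC hp N) :
    δ.comp α = 0 := by
  by_contra h
  have := hom_simple_coweyl hsp.le hs1 le_rfl _ h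
  omega

/-- The homomorphisms that vanish on the images of `X_{s,1}` in the spin chain. -/
def vanishing (N : ℕ) (Y : Type) [AddCommGroup Y] [Module (U p) Y] (hs : s ≤ p) :
    Submodule (TL p N) (HomSpace hp N Y) where
  carrier := {φ | ∀ α : SX hp hs 1 →ₗ[U p] HC hp N, (ofHS φ).comp α = 0}
  add_mem' ha hb α := by rw [ofHS_add, LinearMap.add_comp, ha, hb, add_zero]
  zero_mem' α := zero_comp _
  smul_mem' a φ h α := by rw [ofHS_smul, comp_assoc, h]

variable (hk : k + 1 + s = (1 + 1) * p)

lemma range_headHS : range (headHS hp N hsp.le hs1 le_rfl hk) =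
    vanishing N (SX hp hsp.le 1) hsp.le := by
  refine le_antisymm ?_ fun ξ hξ => ?_
  · rintro _ ⟨δ, rfl⟩ α
    change (headCoweyl _ _ _ _).comp ((ofHS δ).comp α) = 0
    rw [comp_simple_one hsp hs1 (by omega) (ofHS δ) α, comp_zero]
  · refine exists_lift _ (headCoweyl_surjective _ _ _ _) (comp_kap (θ := ofHS ξ) fun m hm α => ?_)
    by_contra h
    have h1 : finrank ℂ (SX hp (show m + 1 ≤ p by omega) 1) = finrank ℂ (SX hp hsp.le 1) :=
      (LinearEquiv.ofBijective (toC ((ofHS ξ).comp α)) ⟨simple_hom_injective _ (by omega) le_rfl _ h,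
        simple_hom_surjective _ hs1 le_rfl _ h⟩).finrank_eq
    rw [finrank_SX, finrank_SX] at h1
    obtain rfl : s = m + 1 := by omega
    exact h (hξ α)

include hs1 in
lemma simple_eq_top_of_not_le (hN : 1 ≤ N) {W : Submodule (TL p N) (HomSpace hp N (SX hp hsp.le 1))}
    (h : ¬ W ≤ vanishing N (SX hp hsp.le 1) hsp.le) : W = ⊤ := by
  obtain ⟨ξ, hξ, h1⟩ := SetLike.not_le_iff_exists.1 h
  obtain ⟨α, hα⟩ := not_forall.1 h1
  let e := LinearEquiv.ofBijective _ ⟨simple_hom_injective _ hs1 le_rfl _ hα,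
    simple_hom_surjective _ hs1 le_rfl _ hα⟩
  refine submodule_eq_top_of (φ := ofHS ξ) (fun θ => ?_) hξ
  obtain ⟨a, ha⟩ := exists_tlHom hN ((α.comp e.symm.toLinearMap).comp θ)
  exact ⟨a, ext fun v => by rw [ha]; exact (e.apply_symm_apply (θ v)).symm⟩

lemma loop_ne_zero (hp3 : 3 ≤ p) : q p + (q p)⁻¹ ≠ 0 := by
  intro h
  have h1 : q p ^ (2 : ℤ) = q p ^ (-2 : ℤ) := by
    have h2 : q p * q p = -1 := by
      rw [← mul_inv_cancel₀ (q_ne p), ← mul_neg, ← eq_neg_of_add_eq_zero_left h]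
    rw [zpow_neg, zpow_two, h2]
    norm_num
  have := Int.le_of_dvd (by norm_num) ((q_zpow_eq_iff (by omega) 2).1 h1)
  omega

include hs1 in
lemma vanishing_ne_top (hp3 : 3 ≤ p) (hsN : s ≤ N + 1) (hpar : Even (s + 1 + N)) :
    vanishing (hp := hp) N (SX hp hsp.le 1) hsp.le ≠ ⊤ := by
  obtain ⟨m, rfl⟩ : ∃ m, s = m + 1 := ⟨s - 1, by omega⟩
  obtain ⟨d, rfl⟩ : ∃ d, N = m + 2 * d := by
    obtain ⟨c, hc⟩ := hpar; exact ⟨c - m - 1, by omega⟩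
  intro h
  have h1 : toHS ((proj hsp.le).comp ((isU_caps m d).hom hp)) ∈
      vanishing (m + 2 * d) (SX hp hsp.le 1) hsp.le := h ▸ trivial
  have h2 := lin_congr (h1 (((isU_cups m d).hom hp).comp (incl hsp.le)))
    (sv hp hsp.le 1 0 0)
  have h3 := (congrArg (proj (hp := hp) hsp.le) (caps_cups (p := p) m d
    (incl hsp.le (sv hp hsp.le 1 0 0)))).symm.trans h2
  have h4 := (hom_smul (proj hsp.le) _ (incl (hp := hp) hsp.le (sv hp hsp.le 1 0 0))).symm.trans h3
  rw [proj_incl] at h4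
  exact sv_ne (hp := hp) (hs := hsp.le) (r := 1) ⟨0, by omega⟩ ⟨0, by omega⟩
    ((smul_eq_zero.1 h4).resolve_left (pow_ne_zero _ (loop_ne_zero hp3)))

lemma vanishing_eq_top (hN : 1 ≤ N) (hs : 1 ≤ 2) :
    vanishing (hp := le_refl 2) N (SX (le_refl 2) hs 1) hs = ⊤ := by
  rw [eq_top_iff]
  rintro ξ - α
  obtain ⟨n, rfl⟩ : ∃ n, N = n + 1 := ⟨N - 1, by omega⟩
  refine simple_hom_ext ?_
  have hE : U.gen 2 .E • α (sv _ hs 1 0 0) = 0 := by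
    rw [← map_smul, sv_E]; simp [qInt_zero]
  have hX : ∀ z : SX (le_refl 2) hs 1, U.gen 2 .E • z = 0 := fun z => by
    have h1 : simpleGen 2 1 1 .E = 0 := simple_ext fun a b ha hb => by
      obtain rfl : a = 0 := by omega
      rw [sE]; simp [qInt_zero]
    exact (gen_smul_lift _ _ .E z).trans (by rw [h1]; rfl)
  set x : Chain (n + 1) := α (sv _ hs 1 0 0) with hx
  have h1 : chainE 2 (n + 1) 1 x = 0 := (hc_smul .E (x : HC (le_refl 2) (n + 1))).symm.trans hE
  have h2 : q 2 ^ (1 : ℤ) • chainE 2 n 1 (pl x) + chainE 2 n (1 - 1) (mi x) = 0 := congrArg pl h1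
  rw [sub_self, (E_zero n).1, zpow_one, one_apply] at h2
  have h3 : chainE 2 (n + 1) 1 (mk 0 (pl x)) = x := by
    refine chain_ext ?_ ?_
    · rw [pl_E, pl_mk, mi_mk, map_zero, smul_zero, zero_add, sub_self, (E_zero n).1]; rfl
    · have hq : (q 2)⁻¹ = -q 2 := by
        have := q_pow_p (le_refl 2)
        exact inv_eq_of_mul_eq_one_right (by
          rw [mul_neg, ← zpow_two]; exact neg_eq_iff_eq_neg.2 this)
      rw [mi_E, mi_mk, zpow_neg, zpow_one, hq, neg_smul]
      exact neg_eq_of_add_eq_zero_right h2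
  have h4 : U.gen 2 .E • (show HC (le_refl 2) (n + 1) from mk 0 (pl x)) = x := (hc_smul _ _).trans h3
  change ofHS ξ x = 0
  rw [← h4, map_smul, hX]

lemma maxSt_simple (hN : 1 ≤ N) (hpar : Even (s + 1 + N)) : maxSt p N (s - 1) =
    ker ((vanishing (hp := hp) N (SX hp hsp.le 1) hsp.le).mkQ.comp
      (stEquivSimple hp N hsp.le hs1).symm.toLinearMap) := by
  by_cases hp2 : p = 2
  · subst hp2
    obtain rfl : s = 1 := by omega
    refine Eq.trans (show maxSub 2 N (1 - 1) = ⊤ from if_pos ⟨rfl, rfl⟩) ?_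
    rw [LinearMap.ker_comp, Submodule.ker_mkQ]
    exact (congrArg (Submodule.comap _) (vanishing_eq_top hN hsp.le)).symm
  by_cases hsN : s ≤ N + 1
  · refine (if_neg (by omega)).trans (sSup_ne_top_eq_ker _ _ ?_ fun W hW => ?_)
    · rw [Submodule.ker_mkQ]; exact vanishing_ne_top hsp hs1 (by omega) hsN hpar
    · rw [Submodule.ker_mkQ] at hW; exact simple_eq_top_of_not_le hsp hs1 hN hW
  · have := subsingleton_st (p := p) (N := N) (k := s - 1) (by omega)
    exact Subsingleton.elim _ _

variable (hs' : p - s ≤ p) (hs1' : 1 ≤ p - s) (hr' : 1 ≤ 1 + 1)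
  (hk' : k + 1 = (1 + 1 - 1) * p + (p - s)) (hk2 : k' + 1 + (p - s) = (1 + 1 + 1) * p)

include hsp hs1 hk hs' hs1' hr' hk' hk2 in
lemma comp_eps_comp_eq_zero (φ : HC hp N →ₗ[U p] DW hp k) (α : SX hp hsp.le 1 →ₗ[U p] HC hp N) :
    φ.comp ((eps hp N).comp α) = 0 := by
  set β := (eps hp N).comp α with hβ
  let sd := selfDual (hp := hp) (r := 1) hsp.le hs1 le_rfl
  let dual (α' : SX hp hsp.le 1 →ₗ[U p] HC hp N) : HC hp N →ₗ[U p] SX hp hsp.le 1 :=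
    sd.symm.toLinearMap.comp ((transp α').comp (chainDual hp N).toLinearMap)
  have hdual : ∀ α' v, sd (dual α' v) = transp α' (chainDual hp N v) := fun α' v =>
    sd.apply_symm_apply _
  have h1 : ∀ ξ : HC hp N →ₗ[U p] SX hp hsp.le 1, ξ.comp β = 0 := fun ξ => by
    obtain ⟨ψ, hψ⟩ := eps_lift (hp := hp) (n := N) _ _ (headCoweyl hsp.le hs1 le_rfl hk) ξ
      (headCoweyl_surjective _ _ _ _)
    rw [hβ, ← comp_assoc, ← hψ, comp_assoc, comp_simple_one hsp hs1 (by omega) ψ α,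
      comp_zero]
  have h2 : toHS (dual β) ∈ vanishing N (SX hp hsp.le 1) hsp.le := fun α' => by
    refine ext fun x => sd.injective (ev_ext fun y => ?_)
    have h3 := congrArg (fun z => ev hp _ (sd z) x) (lin_congr (h1 (dual α')) y)
    change ev hp _ (sd (dual β (α' x))) y = _
    rw [hdual, ev_transp, chainDual_symm, ← ev_transp, ← hdual]
    refine h3.trans ?_
    simp
  rw [← range_headHS hsp hs1 hk] at h2
  obtain ⟨δ, hδ⟩ := h2
  let α' : DW hp k →ₗ[U p] HC hp N := (chainDual hp N).symm.toLinearMap.comp (flipHom (ofHS δ))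
  have h3 : ∀ x, α' (socWeyl hsp.le hs1 le_rfl hk x) = β x := fun x => by
    refine (LinearEquiv.symm_apply_eq _).2 (ev_ext fun v => ?_)
    rw [ev_flipHom, chainDual_symm, ← ev_transp β, ← hdual, ← ev_transp (socWeyl hsp.le hs1 le_rfl hk),
      ← selfDual_headCoweyl]
    exact congrArg (fun ξ => ev hp _ (sd (ofHS ξ v)) x) hδ
  obtain ⟨χ, hχ⟩ := exists_lift (headCoweyl hs' hs1' hr' hk2) (headCoweyl_surjective _ _ _ _)
    (comp_kap_simple hs' (by norm_num) ((headWeyl hs' hs1' hr' hk').comp φ))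
  by_contra h4
  have hinj : Injective (φ.comp α') := by
    rw [← LinearMap.ker_eq_bot]
    by_contra h5
    refine h4 (ext fun x => ?_)
    have h6 := range_socWeyl_le hsp.le hs1 le_rfl hk _ h5 ⟨x, rfl⟩
    rw [mem_ker, comp_apply, h3] at h6
    exact h6
  have hsurj : Surjective (φ.comp α') :=
    LinearMap.surjective_of_injective (f := toC (φ.comp α')) hinj
  have h7 : Surjective (χ.comp α') := hom_coweyl_surjective hs' hs1' hr' hk2 fun h => by
    rw [← comp_assoc, hχ, comp_assoc] at h
    have h8 : Surjective ((headWeyl (hp := hp) hs' hs1' hr' hk').comp (φ.comp α')) :=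
      (headWeyl_surjective hs' hs1' hr' hk').comp hsurj
    rw [h] at h8
    have h9 : Subsingleton (SX hp hs' (1 + 1)) :=
      ⟨fun a b => by obtain ⟨_, rfl⟩ := h8 a; obtain ⟨_, rfl⟩ := h8 b; rfl⟩
    have h10 := finrank_SX (hp := hp) (r := 1 + 1) hs'
    rw [Module.finrank_zero_of_subsingleton] at h10
    omega
  have h8 := LinearMap.finrank_le_finrank_of_surjective (f := toC (χ.comp α')) h7
  rw [finrank_CW, finrank_DW] at h8
  omega

lemma isZigZag_of {T : Type} [Ring T] {X D Y : Type} [AddCommGroup X] [Module T X] [AddCommGroup D]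
    [Module T D] [AddCommGroup Y] [Module T Y] {A S B : ModuleCat.{0} T} (i : X →ₗ[T] D) (h : D →ₗ[T] Y)
    (R : Submodule T X) (V : Submodule T D) (eA : A ≃ₗ[T] X ⧸ R) (eS : S ≃ₗ[T] R) (eB : B ≃ₗ[T] Y)
    (hi : Injective i) (hhi : ∀ ξ, h (i ξ) = 0) (hfac : ∀ φ, h φ = 0 → ∃ ξ, i ξ = φ)
    (hRV : ∀ ξ, i ξ ∈ V ↔ ξ ∈ R) (hV : ∀ φ, ∃ ξ, φ - i ξ ∈ V) (hB : ∀ y, ∃ φ ∈ V, h φ = y)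
    (hX : ∀ W : Submodule T X, ¬ W ≤ R → W = ⊤)
    (hD : ∀ φ, h φ ≠ 0 → ∀ ξ ∈ R, ∃ a : T, a • φ = i ξ) : IsZigZag (ModuleCat.of T D) A S B := by
  let c : X →ₗ[T] D ⧸ V := V.mkQ.comp i
  have hc : Surjective c := fun y => by
    obtain ⟨φ, rfl⟩ := V.mkQ_surjective y
    obtain ⟨ξ, hξ⟩ := hV φ
    exact ⟨ξ, ((Submodule.Quotient.eq V).2 hξ).symm⟩
  have hcker : R = ker c := Submodule.ext fun ξ => by
    rw [mem_ker, comp_apply, Submodule.mkQ_apply, Submodule.Quotient.mk_eq_zero, hRV]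
  let eA' : A ≃ₗ[T] D ⧸ V := eA.trans
    ((Submodule.quotEquivOfEq _ _ hcker).trans (LinearMap.quotKerEquivOfSurjective c hc))
  let ι : S →ₗ[T] D := i.comp (R.subtype.comp eS.toLinearMap)
  let π : D →ₗ[T] A × B := (eA'.symm.toLinearMap.comp V.mkQ).prod (eB.symm.toLinearMap.comp h)
  have hπ1 : ∀ φ, (π φ).1 = 0 ↔ φ ∈ V := fun φ => by
    refine (LinearEquiv.map_eq_zero_iff eA'.symm).trans ?_
    rw [Submodule.mkQ_apply, Submodule.Quotient.mk_eq_zero]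
  have hπ2 : ∀ φ, (π φ).2 = 0 ↔ h φ = 0 := fun φ => LinearEquiv.map_eq_zero_iff eB.symm
  have hιR : ∀ ξ ∈ R, ∃ x, ι x = i ξ := fun ξ hξ =>
    ⟨eS.symm ⟨ξ, hξ⟩, congrArg i (congrArg Subtype.val (eS.apply_symm_apply ⟨ξ, hξ⟩))⟩
  have hιinj : Injective ι := hi.comp (Subtype.val_injective.comp eS.injective)
  have hkerπ : ∀ φ, π φ = 0 ↔ ∃ x, ι x = φ := fun φ => by
    constructor
    · intro h
      obtain ⟨ξ, rfl⟩ := hfac φ ((hπ2 φ).1 (congrArg Prod.snd h))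
      exact hιR ξ ((hRV ξ).1 ((hπ1 _).1 (congrArg Prod.fst h)))
    · rintro ⟨x, rfl⟩
      exact Prod.ext ((hπ1 _).2 ((hRV _).2 (eS x).2)) ((hπ2 _).2 (hhi _))
  refine ⟨ι, π, hιinj, fun ⟨a, b⟩ => ?_, Submodule.ext fun φ => (hkerπ φ).symm, ?_, ?_⟩
  · obtain ⟨ξ, hξ⟩ := hc (eA' a)
    obtain ⟨χ, hχ, hχ'⟩ := hB (eB b)
    refine ⟨i ξ + χ, Prod.ext ?_ ?_⟩
    · rw [map_add, Prod.fst_add, (hπ1 _).2 hχ, add_zero]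
      exact (congrArg eA'.symm hξ).trans (eA'.symm_apply_apply a)
    · rw [map_add, Prod.snd_add, (hπ2 _).2 (hhi ξ), zero_add]
      exact (congrArg eB.symm hχ').trans (eB.symm_apply_apply b)
  · rintro _ _ ⟨σ, hσ⟩
    let σ' : A →ₗ[T] D := σ
    let W := (range σ').comap i
    have h1 : ∀ ξ, ∃ ξ' ∈ R, ξ - ξ' ∈ W := fun ξ => by
      let a := (π (i ξ)).1
      obtain ⟨x, hx⟩ := (hkerπ (i ξ - σ' a)).1 (by
        rw [map_sub, show π (σ' a) = (a, 0) from hσ a]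
        exact Prod.ext (sub_self _) ((sub_zero _).trans ((hπ2 _).2 (hhi ξ))))
      refine ⟨(eS x).1, (eS x).2, a, ?_⟩
      rw [map_sub, show i (eS x).1 = i ξ - σ' a from hx, sub_sub_cancel]
    have h2 : ∀ ξ ∈ R, ξ ∈ W → ξ = 0 := by
      rintro ξ hξ ⟨a, ha⟩
      have h3 : π (σ' a) = (a, 0) := hσ a
      rw [ha, (hkerπ _).2 (hιR ξ hξ)] at h3
      refine hi ?_
      rw [← ha, show a = 0 from (congrArg Prod.fst h3).symm, map_zero, map_zero]
    by_cases hW : W ≤ R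
    · have hR1 : R = ⊤ := eq_top_iff.2 fun ξ _ => by
        obtain ⟨ξ', h3, h4⟩ := h1 ξ
        have := R.add_mem (hW h4) h3
        rwa [sub_add_cancel] at this
      obtain ⟨a, ha⟩ := exists_ne (0 : A)
      obtain ⟨ξ, hξ⟩ := hc (eA' a)
      refine ha (eA'.injective ?_)
      rw [← hξ, map_zero, ← mem_ker, ← hcker, hR1]; trivial
    · have hW1 := hX W hW
      obtain ⟨x, hx⟩ := exists_ne (0 : S)
      refine hx (eS.injective (Subtype.ext ?_))
      rw [map_zero]
      exact h2 _ (eS x).2 (by rw [hW1]; trivial)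
  · rintro _ _ ⟨σ, hσ⟩
    let σ' : B →ₗ[T] D := σ
    obtain ⟨b, hb⟩ := exists_ne (0 : B)
    obtain ⟨x, hx⟩ := exists_ne (0 : S)
    obtain ⟨a, ha⟩ := hD (σ' b) (fun h3 => hb ((congrArg Prod.snd (hσ b)).symm.trans ((hπ2 _).2 h3)))
      (eS x) (eS x).2
    have h1 : σ' (a • b) = ι x := (map_smul σ' a b).trans ha
    have h2 : π (σ' (a • b)) = (0, a • b) := hσ (a • b)
    rw [h1, (hkerπ _).2 ⟨x, rfl⟩] at h2
    refine hx (hιinj ?_)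
    rw [← h1, show a • b = 0 from (congrArg Prod.snd h2).symm, map_zero, map_zero]

include hsp hs1 hk hs' hs1' hr' hk' hk2 in
/-- The homomorphisms to a Weyl module `N_{s,1}` form a zig-zag module. -/
theorem isZigZag_weyl (hN : 1 ≤ N) (hpar : Even (k + N)) :
    IsZigZag (ModuleCat.of (TL p N) (HomSpace hp N (DW hp k))) (irrMod p N (s - 1)) (irrMod p N k)
      (irrMod p N k') := by
  let i := socWeyl (hp := hp) hsp.le hs1 le_rfl hk
  let h' := headWeyl (hp := hp) hs' hs1' hr' hk'
  have hi : Injective i := socWeyl_injective _ _ _ _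
  have hker : ∀ y, h' y = 0 ↔ y ∈ range i := fun y => by
    rw [← ker_headWeyl (hp := hp) hsp.le hs1 le_rfl hk hsp hs' hs1' hr' hk', mem_ker]
  have hpar' : Even (s + 1 + N) := by obtain ⟨c, hc⟩ := hpar; exact ⟨c + s + 1 - p, by omega⟩
  have hpar2 : Even (k' + N) := by obtain ⟨c, hc⟩ := hpar; exact ⟨c + s, by omega⟩
  have heps : ∀ φ : HC hp N →ₗ[U p] DW hp k,
      toHS (φ.comp (eps hp N)) ∈ vanishing (hp := hp) N (DW hp k) hsp.le := fun φ α =>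
    comp_eps_comp_eq_zero hsp hs1 hk hs' hs1' hr' hk' hk2 φ α
  have hfac : ∀ φ : HC hp N →ₗ[U p] DW hp k, h'.comp φ = 0 →
      ∃ ξ : HC hp N →ₗ[U p] SX hp hsp.le 1, i.comp ξ = φ := fun φ h =>
    exists_factor hi φ fun z => (hker _).1 (lin_congr h z)
  refine isZigZag_of (hsMap hp N i) (hsMap hp N h') (vanishing (hp := hp) N (SX hp hsp.le 1) hsp.le)
    (vanishing (hp := hp) N (DW hp k) hsp.le)
    ((irrIso p N (s - 1)).trans ((Submodule.quotEquivOfEq _ _ (maxSt_simple (hp := hp) hsp hs1 hN hpar')).trans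
      ((LinearMap.quotKerEquivOfSurjective _ ((Submodule.mkQ_surjective _).comp
        (stEquivSimple hp N hsp.le hs1).symm.surjective)))))
    ((irrEquivRange (hp := hp) hsp.le hs1 le_rfl hk hN hpar).trans
      (LinearEquiv.ofEq _ _ (range_headHS (hp := hp) (N := N) hsp hs1 hk)))
    (irrEquiv (hp := hp) (k := k') hs' hs1' hr' hk2 hN hpar2 (by norm_num))
    (hsMap_injective i hi) (fun ξ => ext fun z => (hker _).2 ⟨_, rfl⟩) (fun φ h => hfac (ofHS φ) h)
    (fun ξ => ⟨fun h α => ext fun x => hi ?_, fun h α => ?_⟩) (fun φ => ?_) (fun y => ?_)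
    (fun W => simple_eq_top_of_not_le hsp hs1 hN) (fun φ hφ ξ hξ => ?_)
  · rw [lin_zero, map_zero]; exact lin_congr (h α) x
  · exact (comp_assoc _ _ _).trans ((congrArg _ (h α)).trans (comp_zero i))
  · obtain ⟨ξ, hξ⟩ := hfac ((ofHS φ).comp (kap hp N))
      (comp_kap_simple hs' (by norm_num) (h'.comp (ofHS φ)))
    refine ⟨toHS ξ, ?_⟩
    have h1 : φ - hsMap hp N i (toHS ξ) = toHS ((ofHS φ).comp (eps hp N)) :=
      ext fun v => by
        change ofHS φ v - i.comp ξ v = ofHS φ (eps hp N v)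
        rw [hξ, ← (map_add (ofHS φ) _ _).symm.trans (congrArg (ofHS φ) (eps_add_kap v))]
        exact add_sub_cancel_right _ _
    rw [h1]
    exact heps (ofHS φ)
  · obtain ⟨χ, hχ⟩ := exists_lift h' (headWeyl_surjective _ _ _ _)
      (comp_kap_simple hs' (by norm_num) (ofHS y))
    refine ⟨_, heps χ, ?_⟩
    change (h'.comp χ).comp (eps hp N) = _
    rw [hχ, comp_eps (comp_kap_simple hs' (by norm_num) _)]; rfl
  · have h1 : Surjective (ofHS φ) := by
      refine range_eq_top.1 (weyl_eq_top hsp.le hs1 le_rfl hk _ fun h => hφ ?_)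
      exact ext fun v => (hker _).2 (h ⟨v, rfl⟩)
    rw [← range_headHS hsp hs1 hk] at hξ
    obtain ⟨δ, rfl⟩ := hξ
    obtain ⟨ψ, hψ⟩ := exists_lift _ h1 (θ := i.comp ((headCoweyl hsp.le hs1 le_rfl hk).comp (ofHS δ))) (by
      rw [comp_assoc, comp_assoc, comp_kap_coweyl (by omega) (ofHS δ),
        comp_zero, comp_zero])
    obtain ⟨a, rfl⟩ := exists_tlHom hN ψ
    exact ⟨(tlAnti p N a).unop, (anti_smul a (ofHS φ)).symm.trans hψ⟩

end zigzag

/-! ### The kernel of the projection of the chain to the contragredient Weyl module -/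

section annih

variable {p n : ℕ}

lemma inPl_add_inMi (v : Chain (n + 1)) : inPl (pl v) + inMi (mi v) = v :=
  chain_ext (add_zero _) (zero_add _)

lemma xxz_inPl (i : ℕ) (v : Chain (n + 1)) :
    xxz p (n + 2) (i + 1) (inPl v) = inPl (xxz p (n + 1) i v) :=
  chain_ext (pl_xxz _ _) ((mi_xxz _ _).trans (map_zero _))

lemma xxz_inMi (i : ℕ) (v : Chain (n + 1)) :
    xxz p (n + 2) (i + 1) (inMi v) = inMi (xxz p (n + 1) i v) :=
  chain_ext ((pl_xxz _ _).trans (map_zero _)) (mi_xxz _ _)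

/-- The words in which all `+` precede all `-`, with `a` letters `+`. -/
def sortedWord : (n : ℕ) → ℕ → Chain n
  | 0, _ => show Chain 0 from (1 : ℂ)
  | n + 1, 0 => inMi (sortedWord n 0)
  | n + 1, a + 1 => inPl (sortedWord n a)

/-- The linear functionals that vanish on the images of the Temperley–Lieb generators. -/
def IsAnnih (p : ℕ) {n : ℕ} (l : Chain n →ₗ[ℂ] ℂ) : Prop := ∀ i, i + 1 < n → ∀ v, l (xxz p n i v) = 0

lemma IsAnnih.comp_inPl {l : Chain (n + 1) →ₗ[ℂ] ℂ} (h : IsAnnih p l) : IsAnnih p (l ∘ₗ inPl) := by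
  intro i hi v
  obtain ⟨n, rfl⟩ : ∃ m, n = m + 1 := ⟨n - 1, by omega⟩
  exact (congrArg l (xxz_inPl i v)).symm.trans (h (i + 1) (by omega) _)

lemma IsAnnih.comp_inMi {l : Chain (n + 1) →ₗ[ℂ] ℂ} (h : IsAnnih p l) : IsAnnih p (l ∘ₗ inMi) := by
  intro i hi v
  obtain ⟨n, rfl⟩ : ∃ m, n = m + 1 := ⟨n - 1, by omega⟩
  exact (congrArg l (xxz_inMi i v)).symm.trans (h (i + 1) (by omega) _)

lemma chain_zero_ext {l : Chain 0 →ₗ[ℂ] ℂ} (h : l (show Chain 0 from (1 : ℂ)) = 0) : l = 0 :=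
  LinearMap.ext_ring (R := ℂ) h

lemma IsAnnih.eq_zero_of_inPl {l : Chain (n + 1) →ₗ[ℂ] ℂ} (h : IsAnnih p l)
    (h0 : l (sortedWord (n + 1) 0) = 0) (h1 : l ∘ₗ inPl = 0) : l = 0 := by
  have h2 : l ∘ₗ inMi = 0 := by
    induction n with
    | zero => exact chain_zero_ext h0
    | succ n ih =>
      refine ext fun v => lin_congr (f := l ∘ₗ inMi) (g := 0) ?_ v
      have h3 : (l ∘ₗ inMi) ∘ₗ inPl = 0 := ext fun u => by
        obtain ⟨v, hv⟩ := cap_surjective (p := p) u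
        have h4 : inPl (mk 0 u) + -q p • inMi (inPl u) = xxz p (n + 2) 0 v := by
          rw [← cup_cap, hv]
          exact chain_ext (by rw [map_add, map_smul]; exact (congrArg _ (smul_zero _)).trans (add_zero _))
            (chain_ext (zero_add _) ((zero_add _).trans (smul_zero _)))
        have h5 := h 0 (by omega) v
        rw [← h4, map_add, map_smul] at h5
        have h6 := (congrArg (· + _) (lin_congr h1 (mk 0 u))).symm.trans h5
        exact (smul_eq_zero.1 ((zero_add _).symm.trans h6)).resolve_left (neg_ne_zero.2 (q_ne p))
      have h4 := ih h.comp_inMi h0 h3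
      refine ext fun v => ?_
      rw [← inPl_add_inMi v, map_add]
      exact (congrArg₂ (· + ·) (lin_congr h3 _) (lin_congr h4 _)).trans (add_zero 0)
  refine ext fun v => ?_
  rw [← inPl_add_inMi v, map_add]
  exact (congrArg₂ (· + ·) (lin_congr h1 _) (lin_congr h2 _)).trans (add_zero 0)

lemma IsAnnih.eq_zero {l : Chain n →ₗ[ℂ] ℂ} (h : IsAnnih p l) (h0 : ∀ a ≤ n, l (sortedWord n a) = 0) :
    l = 0 := by
  induction n with
  | zero => exact chain_zero_ext (h0 0 le_rfl)
  | succ n ih => exact h.eq_zero_of_inPl (h0 0 (by omega)) (ih h.comp_inPl fun a ha => h0 (a + 1) (by omega))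

lemma xxz_top (n i : ℕ) : xxz p n i (top n) = 0 := by
  induction n generalizing i with
  | zero => rfl
  | succ n ih =>
    rcases n with _ | n
    · rfl
    · rcases i with _ | i
      · rw [← cup_cap, show cap p n (top (n + 2)) = 0 from ?_, map_zero]
        rw [cap_apply]; exact (congrArg₂ (· - ·) (smul_zero _) rfl).trans (sub_zero 0)
      · exact (xxz_inPl i (top (n + 1))).trans ((congrArg _ (ih i)).trans (map_zero _))

end annih

section lower

variable {p k : ℕ} {hp : 2 ≤ p}

lemma topHom_gen (i : Fin (k - 1)) : (topHom hp k).comp (tlHom hp (TL.gen p k i)) = 0 := by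
  refine coHead_injective (coHW_top_ext (isCoHW_coHead _) (isCoHW_coHead _) ?_)
  have h : xxzRep p k (TL.gen p k i) = xxz p k i := TL.lift_gen _ _ _
  change coHead (topHom hp k) (xxzRep p k (TL.gen p k i) (top k)) = 0
  rw [h, xxz_top, map_zero]

/-- The sum of the generators, with image the sum of their images. -/
def lowerMap (hp : 2 ≤ p) (k : ℕ) : (Fin (k - 1) → HC hp k) →ₗ[U p] HC hp k :=
  ∑ i, (tlHom hp (TL.gen p k i)).comp (LinearMap.proj i)

lemma lowerMap_apply (x : Fin (k - 1) → HC hp k) :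
    lowerMap hp k x = ∑ i, tlHom hp (TL.gen p k i) (x i) := by
  rw [lowerMap, lin_sum]; rfl

lemma range_lowerMap (hπ : Surjective (topHom hp k)) :
    range (lowerMap hp k) = ker (topHom hp k) := by
  have hle : range (toC (lowerMap hp k)) ≤ ker (toC (topHom hp k)) := by
    rintro _ ⟨x, rfl⟩
    rw [mem_ker, toC_apply, toC_apply, lowerMap_apply, map_sum]
    exact Finset.sum_eq_zero fun i _ => lin_congr (topHom_gen i) _
  have h1 := LinearMap.finrank_range_add_finrank_ker (toC (topHom hp k))
  rw [(range_eq_top (f := toC (topHom hp k))).2 hπ, finrank_top, finrank_CW] at h1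
  have h2 := Subspace.finrank_add_finrank_dualAnnihilator_eq (range (toC (lowerMap hp k)))
  let ψ : (range (toC (lowerMap hp k))).dualAnnihilator →ₗ[ℂ] Fin (k + 1) → ℂ :=
    LinearMap.pi fun a => (Module.Dual.eval ℂ (HC hp k) ((RepSpace.out _).symm (sortedWord k a))).comp
      (Submodule.subtype _)
  have hψ : Injective ψ := by
    rw [injective_iff_map_eq_zero]
    intro l hl
    have h3 : IsAnnih p (show Chain k →ₗ[ℂ] ℂ from l.1) := fun i hi v => by
      let v' : HC hp k := (RepSpace.out _).symm v
      refine (Submodule.mem_dualAnnihilator _).1 l.2 _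
        ⟨Pi.single (M := fun _ => HC hp k) (⟨i, by omega⟩ : Fin (k - 1)) v', ?_⟩
      rw [toC_apply, lowerMap_apply, Finset.sum_eq_single (⟨i, by omega⟩ : Fin (k - 1))]
      · rw [Pi.single_eq_same]
        have h : xxzRep p k (TL.gen p k ⟨i, by omega⟩) = xxz p k i := TL.lift_gen _ _ _
        exact lin_congr h v
      · intro j _ hj; rw [Pi.single_eq_of_ne hj, map_zero]
      · exact fun h => (h (Finset.mem_univ _)).elim
    exact Subtype.ext (h3.eq_zero fun a ha => congrFun hl ⟨a, by omega⟩)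
  have h3 := LinearMap.finrank_le_finrank_of_injective hψ
  rw [Module.finrank_fin_fun] at h3
  have h4 := Submodule.eq_of_le_of_finrank_le hle (by omega)
  exact SetLike.coe_injective (show (_ : Set (HC hp k)) = _ from congrArg (fun W : Submodule ℂ (HC hp k) => (W : Set (HC hp k))) h4)

end lower

/-! ### The pairing of homomorphisms to a Weyl module and to its contragredient -/

section pairing

/-- The multiplication by a scalar on a chain. -/
def scal {p : ℕ} (hp : 2 ≤ p) (n : ℕ) (c : ℂ) : HC hp n →ₗ[U p] HC hp n := tlHom hp (algebraMap ℂ (TL p n) c)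

lemma scal_apply {p n : ℕ} {hp : 2 ≤ p} (c : ℂ) (v : HC hp n) : scal hp n c v = c • v :=
  congrArg (fun f : Module.End ℂ (Chain n) => (f v : Chain n)) ((xxzRep p n).commutes c)

lemma adj_scal {p n : ℕ} {hp : 2 ≤ p} (c : ℂ) : adj (scal hp n c) = scal hp n c :=
  adj_eq fun x y => by
    rw [scal_apply, scal_apply,
      show chainDual hp n (c • y) = c • chainDual hp n y from hom_smul (chainDual hp n).toLinearMap c y, map_smul, map_smul]
    rfl

variable {p N k s r : ℕ} {hp : 2 ≤ p} (hsp : s < p) (hs1 : 1 ≤ s) (hr1 : 1 < r)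
  (hk : k + 1 + s = (r + 1) * p)

/-- The homomorphism from the chain of length `k` onto the socle of the Weyl module. -/
def socHom : HC hp k →ₗ[U p] DW hp k :=
  (socWeyl hsp.le hs1 hr1.le hk).comp ((headCoweyl hsp.le hs1 hr1.le hk).comp (topHom hp k))

lemma socHom_ne : socHom (hp := hp) hsp hs1 hr1 hk ≠ 0 := fun h =>
  headCoweyl_topHom (hp := hp) hsp.le hs1 hr1.le hk (ext fun v =>
    socWeyl_injective hsp.le hs1 hr1.le hk ((lin_congr h v).trans (map_zero _).symm))

include hsp hs1 hr1 hk in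
lemma topHom_surjective : Surjective (topHom hp k) :=
  hom_coweyl_surjective hsp.le hs1 hr1.le hk (headCoweyl_topHom hsp.le hs1 hr1.le hk)

lemma hom_coweyl_eq_zero (h : N < k) (φ : HC hp N →ₗ[U p] CW hp k) : φ = 0 := by
  have := subsingleton_st (p := p) h
  exact (stEquiv hp N k).symm.injective (Subsingleton.elim (α := RepSpace (stRep p N k)) _ _)

lemma hom_weyl_eq_smul (f : HC hp k →ₗ[U p] DW hp k) : ∃ c : ℂ, ∀ v, f v = c • socHom hsp hs1 hr1 hk v := by
  have hs' : p - s ≤ p := Nat.sub_le _ _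
  have hs1' : 1 ≤ p - s := by omega
  have hr' : 1 ≤ r + 1 := by omega
  have hk' : k + 1 = (r + 1 - 1) * p + (p - s) := by rw [Nat.add_sub_cancel]; nlinarith [Nat.sub_add_cancel hsp.le]
  have hk2 : k + 2 * s + 1 + (p - s) = (r + 1 + 1) * p := by nlinarith [Nat.sub_add_cancel hsp.le]
  obtain ⟨χ, hχ⟩ := exists_lift (headCoweyl hs' hs1' hr' hk2) (headCoweyl_surjective _ _ _ _)
    (comp_kap_simple hs' (by omega) ((headWeyl hs' hs1' hr' hk').comp f))
  rw [hom_coweyl_eq_zero (by omega) χ, comp_zero] at hχ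
  obtain ⟨g, rfl⟩ := exists_factor (socWeyl_injective hsp.le hs1 hr1.le hk) f fun z => by
    rw [← ker_headWeyl (hp := hp) hsp.le hs1 hr1.le hk hsp hs' hs1' hr' hk']
    exact (lin_congr hχ z).symm
  obtain ⟨δ, rfl⟩ := exists_lift _ (headCoweyl_surjective hsp.le hs1 hr1.le hk) (comp_kap_simple hsp.le hr1 g)
  have h1 : δ = (topHom hp k).comp (scal hp k (coHead δ (top k))) := by
    refine coHead_injective (coHW_top_ext (isCoHW_coHead _) (isCoHW_coHead _) ?_)
    refine Eq.trans ?_ (congrArg (coHead (topHom hp k)) (scal_apply (coHead δ (top k)) (topv hp k))).symm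
    refine Eq.trans ?_ (map_smul (coHead (topHom hp k)) _ (top k)).symm
    rw [topHom, coHead_xiHom, topCoeff_top, smul_eq_mul, mul_one]
  refine ⟨coHead δ (top k), fun v => ?_⟩
  rw [comp_apply, comp_apply, lin_congr h1 v, comp_apply, scal_apply,
    hom_smul, hom_smul, hom_smul]
  rfl

include hsp hs1 hr1 hk in
lemma comp_adj_eq_zero (φ : HC hp N →ₗ[U p] DW hp k) {ρ : HC hp N →ₗ[U p] HC hp k}
    (h : (topHom hp k).comp ρ = 0) : φ.comp (adj ρ) = 0 := by
  have hρ : ∀ v, ρ v ∈ range (lowerMap hp k) := fun v => by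
    rw [range_lowerMap (topHom_surjective hsp hs1 hr1 hk)]
    exact lin_congr h v
  obtain ⟨ψ, hψ⟩ := eps_lift (hp := hp) (n := N) _ _ (lowerMap hp k).rangeRestrict
    (ρ.codRestrict _ hρ) (LinearMap.surjective_rangeRestrict _)
  have h1 : ρ = ∑ i, (tlHom hp (TL.gen p k i)).comp ((LinearMap.proj i).comp ψ) + ρ.comp (kap hp N) := by
    refine ext fun v => ?_
    rw [lin_add, lin_sum]
    refine Eq.trans ?_ (congrArg (· + ρ (kap hp N v)) ((congrArg Subtype.val
      (lin_congr hψ v)).symm.trans (lowerMap_apply _)))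
    refine Eq.trans ?_ (map_add ρ _ _)
    exact congrArg ρ (eps_add_kap v).symm
  have h2 : ∀ ρ' : HC hp N →ₗ[U p] HC hp k, ∀ i, φ.comp (adj ((tlHom hp (TL.gen p k i)).comp ρ')) = 0 := by
    intro ρ' i
    rw [adj_comp, adj_gen, ← comp_assoc]
    refine ext fun v => ?_
    obtain ⟨c, hc⟩ := hom_weyl_eq_smul hsp hs1 hr1 hk (φ.comp (adj ρ'))
    rw [comp_apply, hc]
    refine (congrArg (fun z => c • socWeyl hsp.le hs1 hr1.le hk (headCoweyl hsp.le hs1 hr1.le hk z))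
      (lin_congr (topHom_gen i) v)).trans ?_
    rw [lin_zero, map_zero, map_zero, smul_zero]; rfl
  rw [h1, adj_add, comp_add, adj_comp ρ, ← comp_assoc,
    comp_adj_kap (weyl_no_invariant hsp.le hs1 hk hsp hr1) φ, zero_comp, add_zero]
  have h3 := map_sum (AddMonoidHom.mk' (adj (hp := hp) (m := N) (n := k)) adj_add)
    (fun i => (tlHom hp (TL.gen p k i)).comp ((LinearMap.proj i).comp ψ)) Finset.univ
  refine (congrArg φ.comp h3).trans ?_
  refine ext fun v => ?_
  rw [comp_apply, lin_sum, map_sum]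
  exact Finset.sum_eq_zero fun i _ => lin_congr (h2 _ i) v

include hsp hs1 hr1 hk in
lemma exists_topHom_comp (δ : HC hp N →ₗ[U p] CW hp k)  :
    ∃ ρ : HC hp N →ₗ[U p] HC hp k, (topHom hp k).comp ρ = δ :=
  exists_lift _ (topHom_surjective hsp hs1 hr1 hk) (comp_kap_coweyl (p_le_of_eq hsp.le hr1.le hk) δ)

lemma exists_pair (φ : HC hp N →ₗ[U p] DW hp k) (δ : HC hp N →ₗ[U p] CW hp k) :
    ∃ c : ℂ, ∀ ρ, (topHom hp k).comp ρ = δ → ∀ v, φ (adj ρ v) = c • socHom hsp hs1 hr1 hk v := by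
  obtain ⟨ρ', hρ'⟩ := exists_topHom_comp hsp hs1 hr1 hk δ
  obtain ⟨c, hc⟩ := hom_weyl_eq_smul hsp hs1 hr1 hk (φ.comp (adj ρ'))
  refine ⟨c, fun ρ hρ v => ?_⟩
  have h1 := lin_congr (comp_adj_eq_zero hsp hs1 hr1 hk φ (ρ := ρ - ρ')
    (by rw [LinearMap.comp_sub, hρ, hρ', sub_self])) v
  rw [← hc v, ← sub_add_cancel ρ ρ', adj_add, lin_add, map_add]
  exact (congrArg (· + _) h1).trans (zero_add _)

/-- The pairing of the homomorphisms to a Weyl module and to its contragredient. -/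
def pair (φ : HC hp N →ₗ[U p] DW hp k) (δ : HC hp N →ₗ[U p] CW hp k) : ℂ :=
  (exists_pair hsp hs1 hr1 hk φ δ).choose

variable {hsp hs1 hr1 hk}

lemma pair_spec (φ : HC hp N →ₗ[U p] DW hp k) {δ : HC hp N →ₗ[U p] CW hp k} {ρ : HC hp N →ₗ[U p] HC hp k}
    (h : (topHom hp k).comp ρ = δ) (v : HC hp k) :
    φ (adj ρ v) = pair hsp hs1 hr1 hk φ δ • socHom hsp hs1 hr1 hk v :=
  (exists_pair hsp hs1 hr1 hk φ δ).choose_spec ρ h v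

lemma pair_eq {φ : HC hp N →ₗ[U p] DW hp k} {δ : HC hp N →ₗ[U p] CW hp k} {ρ : HC hp N →ₗ[U p] HC hp k}
    (h : (topHom hp k).comp ρ = δ) {c : ℂ} (hc : ∀ v, φ (adj ρ v) = c • socHom hsp hs1 hr1 hk v) :
    pair hsp hs1 hr1 hk φ δ = c := by
  obtain ⟨v, hv⟩ := DFunLike.ne_iff.1 (socHom_ne (hp := hp) hsp hs1 hr1 hk)
  exact smul_left_injective ℂ hv ((pair_spec φ h v).symm.trans (hc v))

lemma pair_add_left (φ φ' : HC hp N →ₗ[U p] DW hp k) (δ : HC hp N →ₗ[U p] CW hp k) :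
    pair hsp hs1 hr1 hk (φ + φ') δ = pair hsp hs1 hr1 hk φ δ + pair hsp hs1 hr1 hk φ' δ := by
  obtain ⟨ρ, hρ⟩ := exists_topHom_comp hsp hs1 hr1 hk δ
  exact pair_eq hρ fun v => by rw [lin_add, pair_spec φ hρ, pair_spec φ' hρ, add_smul]

lemma pair_add_right (φ : HC hp N →ₗ[U p] DW hp k) (δ δ' : HC hp N →ₗ[U p] CW hp k) :
    pair hsp hs1 hr1 hk φ (δ + δ') = pair hsp hs1 hr1 hk φ δ + pair hsp hs1 hr1 hk φ δ' := by
  obtain ⟨ρ, hρ⟩ := exists_topHom_comp hsp hs1 hr1 hk δ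
  obtain ⟨ρ', hρ'⟩ := exists_topHom_comp hsp hs1 hr1 hk δ'
  exact pair_eq (ρ := ρ + ρ') (by rw [comp_add, hρ, hρ']) fun v => by
    rw [adj_add, lin_add, map_add, pair_spec φ hρ, pair_spec φ hρ', add_smul]

lemma pair_comp (φ : HC hp N →ₗ[U p] DW hp k) (δ : HC hp N →ₗ[U p] CW hp k) (f : HC hp N →ₗ[U p] HC hp N) :
    pair hsp hs1 hr1 hk φ (δ.comp f) = pair hsp hs1 hr1 hk (φ.comp (adj f)) δ := by
  obtain ⟨ρ, hρ⟩ := exists_topHom_comp hsp hs1 hr1 hk δ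
  exact pair_eq (ρ := ρ.comp f) (by rw [← comp_assoc, hρ]) fun v => by
    rw [adj_comp, ← pair_spec _ hρ]; rfl

lemma pair_scal_left (φ : HC hp N →ₗ[U p] DW hp k) (δ : HC hp N →ₗ[U p] CW hp k) (c : ℂ) :
    pair hsp hs1 hr1 hk (φ.comp (scal hp N c)) δ = c * pair hsp hs1 hr1 hk φ δ := by
  obtain ⟨ρ, hρ⟩ := exists_topHom_comp hsp hs1 hr1 hk δ
  exact pair_eq hρ fun v => by
    rw [comp_apply, scal_apply, hom_smul, pair_spec φ hρ, smul_smul]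

lemma exists_pair_eq_one {φ : HC hp N →ₗ[U p] DW hp k} (h : φ ≠ 0) : ∃ δ, pair hsp hs1 hr1 hk φ δ = 1 := by
  have h1 : ∀ v, socHom hsp hs1 hr1 hk v ∈ range φ := fun v =>
    range_socWeyl_le hsp.le hs1 hr1.le hk _ (mt LinearMap.range_eq_bot.1 h) ⟨_, rfl⟩
  obtain ⟨ψ, hψ⟩ := exists_lift φ.rangeRestrict (LinearMap.surjective_rangeRestrict _)
    (θ := (socHom hsp hs1 hr1 hk).codRestrict _ h1) (ext fun v => Subtype.ext (
      (congrArg (fun z => socWeyl hsp.le hs1 hr1.le hk (headCoweyl hsp.le hs1 hr1.le hk z))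
        (lin_congr (comp_kap_coweyl (p_le_of_eq hsp.le hr1.le hk) (topHom hp k)) v)).trans (by
          rw [lin_zero, map_zero, map_zero]; rfl)))
  refine ⟨_, pair_eq (ρ := adj ψ) rfl fun v => ?_⟩
  rw [adj_adj, one_smul]
  exact congrArg Subtype.val (lin_congr hψ v)

end pairing

/-! ### The reversal of link states -/

section reversal

variable {p N k : ℕ}

/-- The mirror image of a link state. -/
def LinkState.rev (l : LinkState N k) : LinkState N k where
  m x := (l.m x.rev).rev
  invol x := by rw [Fin.rev_rev, l.invol, Fin.rev_rev]
  noncross x y h1 h2 := by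
    have h3 : l.m x.rev < y.rev := Fin.lt_rev_iff.1 h2 |> fun h => by simpa using h
    have h4 := l.noncross (l.m x.rev) y.rev h3 (by rw [l.invol]; exact Fin.rev_lt_rev.2 h1)
    rw [l.invol] at h4
    exact ⟨fun h => h4.1 (Fin.rev_injective (by rw [h, Fin.rev_rev])), Fin.lt_rev_iff.2 h4.2.2,
      Fin.rev_lt_rev.2 h4.2.1⟩
  card_fixed := by
    refine Eq.trans ?_ l.card_fixed
    refine Finset.card_bij (fun x _ => x.rev) (fun x hx => ?_) (fun x _ y _ h => Fin.rev_injective h)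
      fun y hy => ⟨y.rev, ?_, Fin.rev_rev y⟩
    · rw [Finset.mem_filter] at hx ⊢
      exact ⟨Finset.mem_univ _, Fin.rev_injective (by rw [hx.2, Fin.rev_rev])⟩
    · rw [Finset.mem_filter] at hy ⊢
      exact ⟨Finset.mem_univ _, by rw [Fin.rev_rev, hy.2]⟩

lemma rev_m (l : LinkState N k) (x : Fin N) : l.rev.m x = (l.m x.rev).rev := rfl

lemma LinkState.rev_rev (l : LinkState N k) : l.rev.rev = l := by
  ext x : 2
  rw [rev_m, rev_m, Fin.rev_rev, Fin.rev_rev]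

lemma siteL_rev (i : Fin (N - 1)) : siteL i.rev = (siteR i).rev := by
  ext; simp only [siteL, siteR, Fin.val_rev]; omega

lemma siteR_rev (i : Fin (N - 1)) : siteR i.rev = (siteL i).rev := by
  ext; simp only [siteL, siteR, Fin.val_rev]; omega

lemma rev_weight (i : Fin (N - 1)) (l : LinkState N k) : l.rev.weight p i.rev = l.weight p i := by
  have h1 := l.invol (siteL i)
  have h2 := l.invol (siteR i)
  simp only [LinkState.weight, rev_m, siteL_rev, siteR_rev, Fin.rev_rev, Fin.rev_inj]
  grind

lemma rev_join (i : Fin (N - 1)) (l : LinkState N k) : l.rev.join i.rev = (l.join i).rev := by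
  have hi := site_ne i
  ext x : 2
  obtain ⟨x, rfl⟩ : ∃ y : Fin N, x = y.rev := ⟨x.rev, (Fin.rev_rev x).symm⟩
  have h1 := l.invol x
  simp only [rev_m, join_m, joinFun, siteL_rev, siteR_rev, Fin.rev_rev, Fin.rev_inj]
  grind

/-- The reversal of link states, as a linear automorphism. -/
def stRev (N k : ℕ) : (LinkState N k →₀ ℂ) ≃ₗ[ℂ] (LinkState N k →₀ ℂ) :=
  Finsupp.domLCongr ⟨LinkState.rev, LinkState.rev, LinkState.rev_rev, LinkState.rev_rev⟩

lemma stRev_single (l : LinkState N k) (c : ℂ) :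
    stRev N k (Finsupp.single l c) = Finsupp.single l.rev c := Finsupp.domLCongr_single _ _ _

lemma stRev_gen (i : Fin (N - 1)) (v : LinkState N k →₀ ℂ) :
    stRev N k (stRep p N k (TL.gen p N i) v) = stRep p N k (TL.gen p N i.rev) (stRev N k v) := by
  have h : ∀ i, stRep p N k (TL.gen p N i) = stGen p N k i := fun i => TL.lift_gen _ _ _
  rw [h, h]
  refine lin_congr (f := (stRev N k).toLinearMap ∘ₗ stGen p N k i)
    (g := stGen p N k i.rev ∘ₗ (stRev N k).toLinearMap) (Finsupp.lhom_ext fun l c => ?_) v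
  simp only [comp_apply, LinearEquiv.coe_coe, stGen_single, stRev_single, rev_weight, rev_join]

end reversal

/-! ### The costandard modules -/

section costandard

variable {p N k s r : ℕ} {hp : 2 ≤ p} (hsp : s < p) (hs1 : 1 ≤ s) (hr1 : 1 < r)
  (hk : k + 1 + s = (r + 1) * p)

/-- The homomorphism to the contragredient Weyl module that belongs to a reversed vector. -/
def revHom (hp : 2 ≤ p) (N k : ℕ) (v : LinkState N k →₀ ℂ) : HC hp N →ₗ[U p] CW hp k :=
  ofHS (stHom hp N k ((RepSpace.out (stRep p N k)).symm (stRev N k v)))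

lemma tlHom_anti_scal (c : ℂ) :
    tlHom hp (tlAnti p N (algebraMap ℂ (TL p N) c)).unop = scal hp N c := by
  rw [AlgHom.commutes, MulOpposite.algebraMap_apply, MulOpposite.unop_op]; rfl

lemma revHom_add (v w : LinkState N k →₀ ℂ) : revHom hp N k (v + w) = revHom hp N k v + revHom hp N k w := by
  rw [revHom, map_add, map_add, map_add]; rfl

lemma revHom_smul (c : ℂ) (v : LinkState N k →₀ ℂ) :
    revHom hp N k (c • v) = (revHom hp N k v).comp (scal hp N c) := by
  rw [revHom, map_smul, map_smul, ← algebraMap_smul (TL p N) c, map_smul, ofHS_smul, tlHom_anti_scal]; rfl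

lemma revHom_gen (i : Fin (N - 1)) (v : LinkState N k →₀ ℂ) :
    revHom hp N k (stRep p N k (TL.gen p N i.rev) v) = (revHom hp N k v).comp (tlHom hp (TL.gen p N i.rev)) := by
  rw [revHom, stRev_gen, Fin.rev_rev]
  refine (congrArg ofHS (map_smul (stHom hp N k) (TL.gen p N i) _)).trans ?_
  rw [ofHS_smul, tlAnti_gen]; rfl

/-- The functional on the link states that belongs to a homomorphism to the Weyl module. -/
def costFun (φ : HC hp N →ₗ[U p] DW hp k) : Module.Dual ℂ (LinkState N k →₀ ℂ) where
  toFun v := pair hsp hs1 hr1 hk φ (revHom hp N k v)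
  map_add' v w := by rw [revHom_add, pair_add_right]
  map_smul' c v := by rw [revHom_smul, pair_comp, adj_scal, pair_scal_left]; rfl

/-- The map to the costandard module given by the pairing. -/
def costMap : HomSpace hp N (DW hp k) →ₗ[TL p N] RepSpace (contraRep (stRep p N k) (tlAnti p N)) where
  toFun φ := (RepSpace.out _).symm (costFun hsp hs1 hr1 hk (ofHS φ))
  map_add' φ ψ := congrArg (RepSpace.out _).symm (ext fun v => pair_add_left _ _ _)
  map_smul' a φ := by
    rw [RingHom.id_apply]
    induction a using TL.induction generalizing φ with
    | hc c =>
      refine ext fun v => ?_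
      change pair hsp hs1 hr1 hk (ofHS (algebraMap ℂ (TL p N) c • φ)) (revHom hp N k v) =
        costFun hsp hs1 hr1 hk (ofHS φ) (stRep p N k (tlAnti p N (algebraMap ℂ (TL p N) c)).unop v)
      rw [ofHS_smul, tlHom_anti_scal, pair_scal_left, AlgHom.commutes, MulOpposite.algebraMap_apply,
        MulOpposite.unop_op, AlgHom.commutes]
      exact (map_smul (costFun hsp hs1 hr1 hk (ofHS φ)) c v).symm
    | hg i =>
      refine ext fun v => ?_
      change pair hsp hs1 hr1 hk (ofHS (TL.gen p N i • φ)) (revHom hp N k v) =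
        pair hsp hs1 hr1 hk (ofHS φ) (revHom hp N k (stRep p N k (tlAnti p N (TL.gen p N i)).unop v))
      rw [ofHS_smul, tlAnti_gen, MulOpposite.unop_op, revHom_gen, pair_comp, adj_gen]
    | hm a b ha hb => rw [mul_smul, mul_smul, ha, hb]
    | ha a b ha hb =>
      rw [add_smul, add_smul, ← ha, ← hb]
      exact congrArg (RepSpace.out _).symm (ext fun v => pair_add_left _ _ _)

lemma costMap_injective : Injective (costMap (N := N) (hp := hp) hsp hs1 hr1 hk) := by
  rw [injective_iff_map_eq_zero]
  intro φ h
  by_contra h1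
  obtain ⟨δ, hδ⟩ := exists_pair_eq_one (hsp := hsp) (hs1 := hs1) (hr1 := hr1) (hk := hk) (φ := ofHS φ) h1
  obtain ⟨v, hv⟩ := (stEquiv hp N k).surjective (toHS δ)
  let w := (stRev N k).symm (RepSpace.out _ v)
  have h2 : pair hsp hs1 hr1 hk (ofHS φ) (revHom hp N k w) = 0 :=
    lin_congr (show costFun hsp hs1 hr1 hk (ofHS φ) = 0 from h) w
  have h3 : revHom hp N k w = δ :=
    (congrArg (fun z => ofHS (stHom hp N k ((RepSpace.out (stRep p N k)).symm z)))
      ((stRev N k).apply_symm_apply (RepSpace.out _ v))).trans hv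
  rw [h3, hδ] at h2
  exact one_ne_zero h2

lemma finrank_exact {T A B C : Type} [Ring T] [Algebra ℂ T] [AddCommGroup A] [Module T A] [Module ℂ A]
    [IsScalarTower ℂ T A] [AddCommGroup B] [Module T B] [Module ℂ B] [IsScalarTower ℂ T B] [AddCommGroup C]
    [Module T C] [Module ℂ C] [IsScalarTower ℂ T C] [FiniteDimensional ℂ B] (f : A →ₗ[T] B) (g : B →ₗ[T] C)
    (hf : Injective f) (hg : Surjective g) (h : ∀ b, g b = 0 ↔ b ∈ range f) :
    finrank ℂ B = finrank ℂ C + finrank ℂ A := by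
  rw [← LinearMap.finrank_range_add_finrank_ker (g.restrictScalars ℂ),
    (range_eq_top (f := g.restrictScalars ℂ)).2 hg, finrank_top,
    show ker (g.restrictScalars ℂ) = range (f.restrictScalars ℂ) from
      Submodule.ext fun b => h b, LinearMap.finrank_range_of_inj (f := f.restrictScalars ℂ) hf]

lemma hsMap_exact {X Y Z : Type} [AddCommGroup X] [Module (U p) X] [AddCommGroup Y] [Module (U p) Y]
    [AddCommGroup Z] [Module (U p) Z] {f : X →ₗ[U p] Y} {g : Y →ₗ[U p] Z} (hf : Injective f)
    (h : ker g = range f) (φ : HomSpace hp N Y) :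
    hsMap hp N g φ = 0 ↔ φ ∈ range (hsMap hp N f) := by
  constructor
  · intro h1
    refine exists_factor hf (ofHS φ) fun z => ?_
    rw [← h]; exact lin_congr h1 z
  · rintro ⟨ξ, rfl⟩
    exact ext fun z => (h.ge ⟨_, rfl⟩ : f (ofHS ξ z) ∈ ker g)

/-- The homomorphisms to a Weyl module `N_{s,r}` with `r > 1` form a costandard module. -/
def costEquiv : HomSpace hp N (DW hp k) ≃ₗ[TL p N] RepSpace (contraRep (stRep p N k) (tlAnti p N)) :=
  LinearEquiv.ofBijective (costMap hsp hs1 hr1 hk) (by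
    have hs' : p - s ≤ p := Nat.sub_le _ _
    have hs1' : 1 ≤ p - s := by omega
    have hr' : 1 ≤ r + 1 := by omega
    have hk' : k + 1 = (r + 1 - 1) * p + (p - s) := by
      rw [Nat.add_sub_cancel]; nlinarith [Nat.sub_add_cancel hsp.le]
    let Ψ := (costMap (N := N) (hp := hp) hsp hs1 hr1 hk).restrictScalars ℂ
    have hinj : Injective Ψ := costMap_injective hsp hs1 hr1 hk
    let e := (stEquiv hp N k).restrictScalars ℂ
    have : FiniteDimensional ℂ (RepSpace (stRep p N k)) :=
      inferInstanceAs (FiniteDimensional ℂ (LinkState N k →₀ ℂ))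
    have : FiniteDimensional ℂ (RepSpace (contraRep (stRep p N k) (tlAnti p N))) :=
      inferInstanceAs (FiniteDimensional ℂ (Module.Dual ℂ (LinkState N k →₀ ℂ)))
    have : FiniteDimensional ℂ (HomSpace hp N (CW hp k)) := e.finiteDimensional
    have : FiniteDimensional ℂ (HomSpace hp N (DW hp k)) := FiniteDimensional.of_injective Ψ hinj
    have h1 := finrank_exact (hsMap hp N (socCoweyl hs' hs1' hr' hk')) (headHS hp N hsp.le hs1 hr1.le hk)
      (hsMap_injective _ (socCoweyl_injective _ _ _ _)) (headHS_surjective hsp.le hs1 hr1.le hk hr1)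
      (hsMap_exact (socCoweyl_injective _ _ _ _) (ker_headCoweyl hsp.le hs1 hr1.le hk hsp hs' hs1' hr' hk'))
    have h2 := finrank_exact (hsMap hp N (socWeyl hsp.le hs1 hr1.le hk))
      (hsMap hp N (headWeyl hs' hs1' hr' hk')) (hsMap_injective _ (socWeyl_injective _ _ _ _))
      (fun θ => exists_lift _ (headWeyl_surjective hs' hs1' hr' hk') (comp_kap_simple hs' (by omega) θ))
      (hsMap_exact (socWeyl_injective _ _ _ _) (ker_headWeyl hsp.le hs1 hr1.le hk hsp hs' hs1' hr' hk'))
    have h3 : finrank ℂ (RepSpace (contraRep (stRep p N k) (tlAnti p N))) =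
        finrank ℂ (RepSpace (stRep p N k)) :=
      Subspace.dual_finrank_eq (K := ℂ) (V := LinkState N k →₀ ℂ)
    exact ⟨hinj, (LinearMap.injective_iff_surjective_of_finrank_eq_finrank (f := Ψ)
      (by rw [h3, e.finrank_eq, h1, h2, add_comm])).1 hinj⟩)

end costandard

end

end XXZ

theorem proposition3p1 (p N : ℕ) (hp : 2 ≤ p) (hN : 2 ≤ N) :
    (∀ (s : ℕ) (hs : s ≤ p), 1 ≤ s → Odd (2 * p + s + N) →
      Nonempty ((XXZ.homFunctor hp N).obj (XXZ.simpleMod hp 1 hs) ≅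
        XXZ.standardMod p N (s - 1))) ∧
    (∀ (s r : ℕ) (hs : s ≤ p), 1 ≤ s → 1 < r → Odd ((r + 1) * p + s + N) →
      Nonempty ((XXZ.homFunctor hp N).obj (XXZ.simpleMod hp r hs) ≅
        XXZ.irrMod p N ((r + 1) * p - s - 1))) ∧
    (∀ s r : ℕ, 1 ≤ s → s ≤ p - 1 → 1 ≤ r → Odd ((r + 1) * p + s + N) →
      Nonempty ((XXZ.homFunctor hp N).obj (XXZ.coweylMod hp s r) ≅
        XXZ.standardMod p N ((r + 1) * p - s - 1))) ∧
    (∀ s : ℕ, 1 ≤ s → s ≤ p - 1 → Odd (2 * p + s + N) →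
      XXZ.IsZigZag ((XXZ.homFunctor hp N).obj (XXZ.weylMod hp s 1))
        (XXZ.irrMod p N (s - 1)) (XXZ.irrMod p N (2 * p - s - 1))
        (XXZ.irrMod p N (2 * p + s - 1))) ∧
    (∀ s r : ℕ, 1 ≤ s → s ≤ p - 1 → 1 < r → Odd ((r + 1) * p + s + N) →
      Nonempty ((XXZ.homFunctor hp N).obj (XXZ.weylMod hp s r) ≅
        XXZ.costandardMod p N ((r + 1) * p - s - 1))) ∧
    (∀ (s r : ℕ) (hs : s ≤ p), 1 ≤ s → 1 ≤ r → Odd ((r + 1) * p + s + N) →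
      (r + 1) * p - s - 1 ≤ N →
      (∃ (P : ModuleCat.{0} (XXZ.U p)) (π : P ⟶ XXZ.simpleMod hp r hs),
        XXZ.IsProjectiveCover π) ∧
      ∀ (P : ModuleCat.{0} (XXZ.U p)) (π : P ⟶ XXZ.simpleMod hp r hs),
        XXZ.IsProjectiveCover π →
        ∃ π' : (XXZ.homFunctor hp N).obj P ⟶ XXZ.irrMod p N ((r + 1) * p - s - 1),
          XXZ.IsProjectiveCover π') := by
  have hle : ∀ {s r : ℕ}, s ≤ p → 1 ≤ r → (r + 1) * p - s - 1 + 1 + s = (r + 1) * p := fun {s r} hs hr => by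
    have := Nat.mul_le_mul_right p (show 2 ≤ r + 1 by omega)
    omega
  have hev : ∀ {s r : ℕ}, s ≤ p → 1 ≤ r → Odd ((r + 1) * p + s + N) → Even ((r + 1) * p - s - 1 + N) :=
    fun {s r} hs hr ⟨c, hc⟩ => ⟨c - s, by have := hle hs hr; omega⟩
  have hN1 : 1 ≤ N := by omega
  refine ⟨fun s hs hs1 _ => ⟨(XXZ.stEquivSimple hp N hs hs1).toModuleIso⟩,
    fun s r hs hs1 hr1 h => ⟨(XXZ.irrEquiv hs hs1 hr1.le (hle hs hr1.le) hN1 (hev hs hr1.le h) hr1).symm.toModuleIso⟩,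
    fun s r _ _ _ _ => ⟨(XXZ.stEquiv hp N _).symm.toModuleIso⟩, fun s hs1 hs h => ?_,
    fun s r hs1 hs hr1 _ => ⟨(XXZ.costEquiv (by omega) hs1 hr1 (hle (by omega) hr1.le)).toModuleIso⟩,
    fun s r hs hs1 hr h hkN => ⟨XXZ.exists_projectiveCover_simple hs hs1 hr (hle hs hr) hkN (hev hs hr h),
      fun P π hπ => ?_⟩⟩
  · have hsp : s < p := by omega
    exact XXZ.isZigZag_weyl (s := s) (k := (1 + 1) * p - s - 1) (k' := 2 * p + s - 1) hsp hs1 (hle hsp.le le_rfl)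
      (Nat.sub_le _ _) (by omega) (by norm_num) (by omega) (by omega) hN1 (hev hsp.le le_rfl h)
  · let := Module.compHom P (algebraMap ℂ (XXZ.U p))
    have := XXZ.isScalarTower_compHom (A := XXZ.U p) P
    have : FiniteDimensional ℂ P := hπ.finDim
    exact XXZ.exists_projectiveCover_irr hs hs1 hr (hle hs hr) hN1 hkN (hev hs hr h) hπ.isProj π.hom
      hπ.superfluous hπ.surjective
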